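/- **Setting.** Let $M$ be a compact manifold, possibly with boundary (or corners), $\Omega(M)$ its smooth complex differential forms, and $\Omega:=\Omega_{\mathbb T}(M\times\mathbb T)=\{\alpha+\vartheta\wedge\beta:\alpha,\beta\in\Omega(M)\}$ the $\mathbb T$-invariant forms on $M\times\mathbb T$ ($\vartheta$ the canonical $1$-form on the circle), with the wedge product, the grading in which $\alpha+\vartheta\wedge\beta$ has degree $j$ if $\alpha\in\Omega^j(M)$, $\beta\in\Omega^{j+1}(M)$, the differential $d_{\mathbb T}(\alpha+\vartheta\wedge\beta)=d\alpha+\beta-\vartheta\wedge d\beta$, and the $C^\infty$-topology. Put $\underline\Omega=\Omega/\mathbb C\cdot 1$ and $\mathscr C(\Omega)=\bigoplus_{n\ge0}\Omega\otimes\underline\Omega^{\otimes n}$ (algebraic tensor products); $\langle a\rangle$ denotes the chain with $a$ in slot $n$ and $0$ elsewhere. With $r_l=j_0+\dots+j_l-l$ (so $r_{-1}=1$), for $\omega_i$ of degree $j_i$ let $$b\langle\omega_0\otimes\cdots\otimes\omega_n\rangle=-\sum_{i=0}^n(-1)^{r_{i-1}}\langle\cdots\otimes d_{\mathbb T}\omega_i\otimes\cdots\rangle-\sum_{i=0}^{n-1}(-1)^{r_i}\langle\cdots\otimes\omega_i\omega_{i+1}\otimes\cdots\rangle+(-1)^{(j_n-1)r_{n-1}}\langle\omega_n\omega_0\otimes\omega_1\otimes\cdots\otimes\omega_{n-1}\rangle$$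 (for $n=0$ only the first sum is present), $$B\langle\omega_0\otimes\cdots\otimes\omega_n\rangle=\sum_{i=0}^n(-1)^{(r_{i-1}+1)(r_n-r_{i-1})}\langle1\otimes\omega_i\otimes\cdots\otimes\omega_n\otimes\omega_0\otimes\cdots\otimes\omega_{i-1}\rangle,$$ and $\Gamma\langle\omega_0\otimes\cdots\otimes\omega_n\rangle=(-1)^{j_0+\dots+j_n+n}\langle\omega_0\otimes\cdots\otimes\omega_n\rangle$. The space $\mathscr C_\epsilon$ of entire chains is the Hausdorff completion of $\mathscr C(\Omega)$ with respect to the seminorms $\kappa_\varepsilon(w)=\sum_n\varepsilon_n(w_n)/\sqrt{n!}$, where $\varepsilon$ runs through the continuous seminorms on $\Omega$ and $\varepsilon_n$ is the $\pi$-tensor seminorm induced by $\varepsilon$. The operators $b,B,\Gamma$ extend continuously to $\mathscr C_\epsilon$; put $\mathscr C_\epsilon^\pm=\{w\in\mathscr C_\epsilon:\Gamma w=\pm w\}$. Let $\mathscr D$ be the span of all chains $\langle\omega_0\otimes\cdots\otimes\omega_n\rangle$ with $\omega_r\in C^\infty(M)$ for some $r\ge1$, and of all chains $$\langle\cdots\otimes\omega_{r-1}f\otimes\omega_{r+1}\otimes\cdots\rangle+\langle\cdots\otimes\omega_{r-1}\otimes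 df\otimes\omega_{r+1}\otimes\cdots\rangle-\langle\cdots\otimes\omega_{r-1}\otimes f\omega_{r+1}\otimes\cdots\rangle$$ with $1\le r\le n$ and $f\in C^\infty(M)$, where for $r=n$ the last summand is read cyclically as $\langle f\omega_0\otimes\omega_1\otimes\cdots\otimes\omega_{n-1}\rangle$ (for $n=r=1$ the chain is $\langle\omega_0f\rangle+\langle\omega_0\otimes df\rangle-\langle f\omega_0\rangle$). Let $\mathscr D_\epsilon$ be the closure of $\mathscr D$ in $\mathscr C_\epsilon$, $\mathscr N_\epsilon=\mathscr C_\epsilon/\mathscr D_\epsilon$ (the Chen normalized complex), $\mathscr N^\pm_\epsilon$ the image of $\mathscr C^\pm_\epsilon$, and $\mathsf{HN}^-_\epsilon$ the homology at $\mathscr N^-_\epsilon$ of $\mathscr N^+_\epsilon\xrightarrow{b+B}\mathscr N^-_\epsilon\xrightarrow{b+B}\mathscr N^+_\epsilon$. Let $\mathsf K^{-1}(M)$ be the abelian group generated by the smooth maps $g:M\to U(l)$, $l\ge0$, with the relations $[g\oplus h]=[g]+[h]$, $[g_0]=[g_1]$ for smoothly homotopic $g_0,g_1$, and $[1]=0$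 for constant maps to the identity matrix. For smooth $g:M\to U(l)$ put $\omega=g^{-1}dg$, and let $R^s=s\,d\omega+s^2\,\omega\wedge\omega$ be the curvature of $d+s\omega$, $\mathcal A^s=s\omega-\vartheta\wedge R^s$ and $\mathcal B=-\vartheta\wedge\omega$. Define $$\mathrm{Ch}^-_n(g)=\mathrm{Tr}_n\Big[\int_0^1 1\otimes\sum_{k=1}^n(\mathcal A^s)^{\otimes(k-1)}\otimes\mathcal B\otimes(\mathcal A^s)^{\otimes(n-k)}\,ds\Big],\qquad \mathrm{Tr}_n[v^{(0)}\otimes\cdots\otimes v^{(n)}]=\sum_{i_0,\dots,i_n}v^{(0)}_{i_0i_1}\otimes\cdots\otimes v^{(n)}_{i_ni_0}.$$ **Theorem.** a) For every smooth $g:M\to U(l)$ the series $\mathrm{Ch}^-(g)=\sum_n\langle\mathrm{Ch}^-_n(g)\rangle$ converges in $\mathscr C_\epsilon$, its sum lies in $\mathscr C^-_\epsilon$, and $(b+B)\mathrm{Ch}^-(g)=0$ in $\mathscr N_\epsilon$; so $\mathrm{Ch}^-(g)$ defines a class in $\mathsf{HN}^-_\epsilon$. b) For all smooth $g:M\to U(l)$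 and $h:M\to U(m)$ one has $\mathrm{Ch}^-(g\oplus h)=\mathrm{Ch}^-(g)+\mathrm{Ch}^-(h)$; if $g_0,g_1:M\to U(l)$ are smoothly homotopic, then $\mathrm{Ch}^-(g_1)-\mathrm{Ch}^-(g_0)=(b+B)w$ in $\mathscr N_\epsilon$ for some $w\in\mathscr C_\epsilon^+$. The map $[g]\mapsto[\mathrm{Ch}^-(g)]$ is a well-defined group homomorphism $\mathsf K^{-1}(M)\to\mathsf{HN}^-_\epsilon$. -/

import Mathlib

open scoped Manifold ContDiff
set_option linter.unusedSectionVars false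

noncomputable section

namespace OddChern

/-! ### Smooth functions, vector fields and differential forms -/

section Manifold

variable {E : Type*} [NormedAddCommGroup E] [NormedSpace ℝ E] [FiniteDimensional ℝ E]
  {H : Type*} [TopologicalSpace H] (I : ModelWithCorners ℝ E H)
  (M : Type*) [TopologicalSpace M] [ChartedSpace H M]

instance contMDiffRingComplex : ContMDiffRing 𝓘(ℝ, ℂ) ∞ ℂ :=
  { instNormedSpaceLieAddGroup with
    contMDiff_mul := by
      have h : ContMDiff 𝓘(ℝ, ℂ × ℂ) 𝓘(ℝ, ℂ) ∞ (fun p : ℂ × ℂ => p.1 * p.2) :=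
        contDiff_mul.contMDiff
      rw [modelWithCornersSelf_prod, ← chartedSpaceSelf_prod] at h
      exact h }

/-- Smooth real functions on `M`. -/
abbrev RFun := C^∞⟮I, M; 𝓘(ℝ, ℝ), ℝ⟯

/-- Smooth complex functions on `M`. -/
abbrev CFun := C^∞⟮I, M; 𝓘(ℝ, ℂ), ℂ⟯

/-- The constant functions. -/
def constC : ℂ →+* CFun I M where
  toFun c := ⟨fun _ => c, contMDiff_const⟩
  map_one' := rfl
  map_mul' _ _ := rfl
  map_zero' := rfl
  map_add' _ _ := rfl

instance : Algebra ℂ (CFun I M) := (constC I M).toAlgebra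

variable {I M}

@[simp] lemma smulC_apply (c : ℂ) (f : CFun I M) (x : M) : (c • f) x = c * f x := by
  rw [Algebra.smul_def]; rfl

lemma smulR_apply (r : RFun I M) (f : CFun I M) (x : M) : (r • f) x = (r x : ℂ) * f x := by
  change r x • f x = _
  simp

instance : IsScalarTower (RFun I M) (CFun I M) (CFun I M) :=
  ⟨fun r f g => by ext x; simp [smulR_apply, mul_assoc]⟩
instance : SMulCommClass (RFun I M) (CFun I M) (CFun I M) :=
  ⟨fun r f g => by ext x; simp [smulR_apply, mul_left_comm]⟩
instance : SMulCommClass (RFun I M) ℂ (CFun I M) :=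
  ⟨fun r f g => by ext x; simp [smulR_apply, mul_left_comm]⟩
instance : SMulCommClass ℂ (RFun I M) (CFun I M) := SMulCommClass.symm _ _ _

variable [IsManifold I ∞ M]
variable (I M) in
/-- Smooth vector fields on `M`. -/
abbrev VField := Cₛ^∞⟮I; E, (fun x : M => TangentSpace I x)⟯

instance : SMul (RFun I M) (VField I M) :=
  ⟨fun f X => ⟨fun x => f x • X x, ContMDiff.smul_section f.contMDiff X.contMDiff⟩⟩

@[simp] lemma smulV_apply (r : RFun I M) (X : VField I M) (x : M) : (r • X) x = r x • X x := rfl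

instance : Module (RFun I M) (VField I M) where
  one_smul X := by ext x; simp
  mul_smul r s X := by ext x; simp [mul_smul]
  smul_zero r := by ext x; simp
  smul_add r X Y := by ext x; simp
  add_smul r s X := by ext x; simp [add_smul]
  zero_smul X := by ext x; simp

lemma contMDiff_dirDeriv {F : Type*} [NormedAddCommGroup F] [NormedSpace ℝ F]
    (f : C^∞⟮I, M; 𝓘(ℝ, F), F⟯) (X : VField I M) :
    ContMDiff I 𝓘(ℝ, F) ∞ (fun x => mvfderiv I f x (X x)) := by
  have h1 := (f.contMDiff.contMDiff_tangentMap (m := ∞) (by simp)).comp X.contMDiff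
  exact contMDiff_snd_tangentBundle_modelSpace F 𝓘(ℝ, F) |>.comp h1

/-- The directional derivative `X f` of a smooth complex function. -/
def lieD : VField I M →+ CFun I M →+ CFun I M :=
  AddMonoidHom.mk' (fun X => AddMonoidHom.mk' (fun f =>
      ⟨fun x => mvfderiv I f x (X x), contMDiff_dirDeriv f X⟩) (by
    intro f g
    ext x
    have := mvfderiv_add (I := I) (f.contMDiff.mdifferentiable (by simp) x)
      (g.contMDiff.mdifferentiable (by simp) x)
    exact congrArg (fun L => L (X x)) this)) (by
    intro X Y
    ext f x
    exact (mvfderiv I f x).map_add _ _)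

lemma lieD_apply (X : VField I M) (f : CFun I M) (x : M) :
    lieD X f x = mvfderiv I f x (X x) := rfl

/-- The directional derivative `X r` of a smooth real function. -/
def lieR (X : VField I M) (r : RFun I M) : RFun I M :=
  ⟨fun x => mvfderiv I r x (X x), contMDiff_dirDeriv r X⟩

lemma lieD_smul_left (r : RFun I M) (X : VField I M) (f : CFun I M) :
    lieD (r • X) f = r • lieD X f := by
  ext x
  exact map_smul (mvfderiv I f x) (r x) (X x)

lemma lieD_smul_right (r : RFun I M) (X : VField I M) (f : CFun I M) :
    lieD X (r • f) = r • lieD X f + lieR X r • f := by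
  ext x
  have := mvfderiv_smul (I := I) (r.contMDiff.mdifferentiable (by simp) x)
      (f.contMDiff.mdifferentiable (by simp) x)
  exact congrArg (fun L => L (X x)) this

lemma lieD_mul (X : VField I M) (f g : CFun I M) :
    lieD X (f * g) = lieD X f * g + f * lieD X g := by
  ext x
  have hf := (f.contMDiff.mdifferentiable (by simp) x : MDifferentiableAt I 𝓘(ℝ, ℂ) f x)
  have hg := (g.contMDiff.mdifferentiable (by simp) x : MDifferentiableAt I 𝓘(ℝ, ℂ) g x)
  have h := (hf.hasMFDerivAt.mul hg.hasMFDerivAt).mfderiv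
  have h2 := congrArg (fun L => L (X x)) h
  rw [add_comm]
  refine Eq.trans h2 ?_
  exact congrArg (fun z : ℂ => f x * mvfderiv I g x (X x) + z) (mul_comm _ _)

lemma lieD_const (X : VField I M) (c : ℂ) : lieD X (constC I M c) = 0 := by
  ext x
  exact congrArg (fun L => L (X x)) (mvfderiv_const (I := I) c)

lemma lieD_smulC (c : ℂ) (X : VField I M) (f : CFun I M) :
    lieD X (c • f) = c • lieD X f := by
  rw [Algebra.smul_def, Algebra.smul_def, lieD_mul]
  change lieD X (constC I M c) * f + _ = _
  rw [lieD_const, zero_mul, zero_add]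

/-- The Lie bracket of smooth vector fields. -/
def bracket : VField I M →+ VField I M →+ VField I M :=
  haveI : CompleteSpace E := FiniteDimensional.complete ℝ E
  haveI : IsManifold I (minSmoothness ℝ 2) M := by
    rw [minSmoothness_of_isRCLikeNormedField]; infer_instance
  haveI : IsManifold I (minSmoothness ℝ 3) M := by
    rw [minSmoothness_of_isRCLikeNormedField]; infer_instance
  AddMonoidHom.mk' (fun X => AddMonoidHom.mk' (fun Y => ⟨VectorField.mlieBracket I X Y, by
    intro x
    have : IsManifold I (((⊤ : ℕ∞) : WithTop ℕ∞) + 1) M := by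
      simpa using (inferInstance : IsManifold I ∞ M)
    have := ContMDiffAt.mlieBracket_vectorField (I := I) (m := ⊤) (n := ⊤) (U := X) (V := Y)
      (X.contMDiff x) (Y.contMDiff x) (by simp)
    exact this⟩) (by
    intro Y Z
    ext x
    exact VectorField.mlieBracket_add_right Y.mdifferentiableAt Z.mdifferentiableAt)) (by
    intro X Y
    ext Z x
    exact VectorField.mlieBracket_add_left X.mdifferentiableAt Y.mdifferentiableAt)

lemma bracket_apply (X Y : VField I M) (x : M) :
    bracket X Y x = VectorField.mlieBracket I X Y x := rfl

lemma bracket_smul_right (r : RFun I M) (X Y : VField I M) :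
    bracket X (r • Y) = r • bracket X Y + lieR X r • Y := by
  have : CompleteSpace E := FiniteDimensional.complete ℝ E
  ext x
  have := VectorField.mlieBracket_smul_right (I := I) (V := X) (W := Y)
    (r.contMDiff.mdifferentiable (by simp) x) Y.mdifferentiableAt
  rw [add_comm]
  exact this

lemma bracket_smul_left (r : RFun I M) (X Y : VField I M) :
    bracket (r • X) Y = r • bracket X Y - lieR Y r • X := by
  have : CompleteSpace E := FiniteDimensional.complete ℝ E
  ext x
  have := VectorField.mlieBracket_smul_left (I := I) (V := X) (W := Y)
    (r.contMDiff.mdifferentiable (by simp) x) X.mdifferentiableAt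
  rw [sub_eq_neg_add, ← neg_smul]
  exact this

variable (I M) in
/-- Smooth complex differential forms of degree `k`: alternating `C^∞(M)`-multilinear maps from
smooth vector fields to smooth complex functions. -/
abbrev Form (k : ℕ) := (VField I M) [⋀^Fin k]→ₗ[RFun I M] (CFun I M)

/-- The wedge product (sum over shuffles). -/
def wedge {p q m : ℕ} (h : p + q = m) (a : Form I M p) (b : Form I M q) : Form I M m :=
  ((LinearMap.mul' (RFun I M) (CFun I M)).compAlternatingMap (a.domCoprod b)).domDomCongr
    (finSumFinEquiv.trans (finCongr h))

lemma adSum_update {k : ℕ} (a : Form I M k) (X : VField I M) (Y : Fin k → VField I M)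
    (i : Fin k) (x : VField I M) :
    ∑ m, a (Function.update (Function.update Y i x) m
        (bracket X (Function.update Y i x m))) =
      a (Function.update Y i (bracket X x)) +
        ∑ m ∈ Finset.univ.erase i,
          a (Function.update (Function.update Y m (bracket X (Y m))) i x) := by
  rw [← Finset.add_sum_erase _ _ (Finset.mem_univ i)]
  congr 1
  · simp
  · refine Finset.sum_congr rfl fun m hm => ?_
    have hm' : m ≠ i := (Finset.mem_erase.mp hm).1
    rw [Function.update_of_ne hm', Function.update_comm hm']

lemma adSum_eq_zero {k : ℕ} (a : Form I M k) (X : VField I M) (Y : Fin k → VField I M)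
    {i j : Fin k} (h : Y i = Y j) (hij : i ≠ j) :
    ∑ m, a (Function.update Y m (bracket X (Y m))) = 0 := by
  have hz : ∀ m, m ≠ i → m ≠ j → a (Function.update Y m (bracket X (Y m))) = 0 := by
    intro m hi hj
    exact a.map_eq_zero_of_eq _ (by rw [Function.update_of_ne hi.symm, Function.update_of_ne hj.symm, h]) hij
  rw [Fintype.sum_eq_add i j hij (fun m hm => hz m hm.1 hm.2)]
  have h1 : Function.update Y j (bracket X (Y j)) =
      Function.update Y i (bracket X (Y i)) ∘ Equiv.swap i j := by
    funext m
    rcases eq_or_ne m i with rfl | hi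
    · simp [Function.update_of_ne hij, Function.update_of_ne hij.symm, h]
    · rcases eq_or_ne m j with rfl | hj
      · simp [h]
      · simp [Function.update_of_ne hi, Function.update_of_ne hj, Equiv.swap_apply_of_ne_of_ne hi hj]
  rw [h1, a.map_swap _ hij, add_neg_cancel]

/-- `(X, Y₁, …, Y_k) ↦ X (α(Y₁, …, Y_k)) - ½ ∑ₘ α(Y₁, …, [X, Y_m], …, Y_k)`, additive in `X` and
additive and alternating in the `Y`'s. -/
def preD {k : ℕ} (a : Form I M k) : VField I M →ₗ[ℤ] (VField I M) [⋀^Fin k]→ₗ[ℤ] (CFun I M) :=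
  AddMonoidHom.toIntLinearMap <| AddMonoidHom.mk' (fun X =>
    { toFun := fun Y => lieD X (a Y) -
        (1 / 2 : ℂ) • ∑ m, a (Function.update Y m (bracket X (Y m)))
      map_update_add' := by
        intro inst Y i x y
        obtain rfl : inst = instDecidableEqFin k := Subsingleton.elim _ _
        simp only [adSum_update, map_add, AlternatingMap.map_update_add, Finset.sum_add_distrib,
          smul_add]
        abel
      map_update_smul' := by
        intro inst Y i c x
        obtain rfl : inst = instDecidableEqFin k := Subsingleton.elim _ _
        have h : ∀ (Z : Fin k → VField I M) (x : VField I M),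
            a (Function.update Z i (c • x)) = c • a (Function.update Z i x) := fun Z x =>
          map_zsmul (a.toMultilinearMap.toLinearMap Z i) c x
        simp only [adSum_update, map_zsmul, h, ← Finset.smul_sum, ← smul_add, smul_sub]
        rw [smul_comm]
      map_eq_zero_of_eq' := by
        intro Y i j h hij
        rw [adSum_eq_zero a X Y h hij, a.map_eq_zero_of_eq Y h hij]
        simp }) (by
    intro X Z
    ext1 Y
    simp only [AlternatingMap.add_apply, AlternatingMap.coe_mk, MultilinearMap.coe_mk, map_add,
      AddMonoidHom.add_apply, AlternatingMap.map_update_add, Finset.sum_add_distrib, smul_add]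
    abel)

lemma preD_apply {k : ℕ} (a : Form I M k) (X : VField I M) (Y : Fin k → VField I M) :
    preD a X Y = lieD X (a Y) - (1 / 2 : ℂ) • ∑ m, a (Function.update Y m (bracket X (Y m))) := rfl

lemma preD_smul_left {k : ℕ} (a : Form I M k) (r : RFun I M) (X : VField I M)
    (Y : Fin k → VField I M) :
    preD a (r • X) Y = r • preD a X Y +
      (1 / 2 : ℂ) • ∑ m, lieR (Y m) r • a (Function.update Y m X) := by
  simp only [preD_apply, lieD_smul_left, bracket_smul_left, sub_eq_add_neg,
     AlternatingMap.map_update_smul, AlternatingMap.map_update_add, ← neg_smul,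
     Finset.sum_add_distrib, smul_add]
  simp only [neg_smul, Finset.sum_neg_distrib, smul_neg, ← Finset.smul_sum]
  rw [smul_comm r (1 / 2 : ℂ)]
  abel

lemma preD_cons_smul {k : ℕ} (a : Form I M (k + 1)) (r : RFun I M) (Z X : VField I M)
    (Y : Fin k → VField I M) :
    preD a Z (Fin.cons (r • X) Y) = r • preD a Z (Fin.cons X Y) +
      (1 / 2 : ℂ) • (lieR Z r • a (Fin.cons X Y)) := by
  have h0 : ∀ (r : RFun I M) (W : VField I M) (Y : Fin k → VField I M),
      a (Fin.cons (r • W) Y) = r • a (Fin.cons W Y) := by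
    intro r W Y
    have := a.map_update_smul (Fin.cons W Y) 0 r W
    simpa [Fin.update_cons_zero] using this
  have h1 : ∀ (W W' : VField I M) (Y : Fin k → VField I M),
      a (Fin.cons (W + W') Y) = a (Fin.cons W Y) + a (Fin.cons W' Y) := by
    intro W W' Y
    have := a.map_update_add (Fin.cons W Y) 0 W W'
    simpa [Fin.update_cons_zero] using this
  simp only [preD_apply, Fin.sum_univ_succ, Fin.cons_zero, Fin.cons_succ, Fin.update_cons_zero,
    ← Fin.cons_update, h0, bracket_smul_right, h1, lieD_smul_right]
  simp only [smul_add, smul_sub, ← Finset.smul_sum, smul_comm r (1 / 2 : ℂ)]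
  generalize lieR Z r • a (Fin.cons X Y) = z
  generalize r • lieD Z (a (Fin.cons X Y)) = p
  generalize r • a (Fin.cons (bracket Z X) Y) = q
  generalize r • ∑ m, a (Fin.cons X (Function.update Y m (bracket Z (Y m)))) = t
  module

lemma altPreD_cons_smul {k : ℕ} (a : Form I M k) (r : RFun I M) (X : VField I M)
    (Y : Fin k → VField I M) :
    AlternatingMap.alternatizeUncurryFin (preD a) (Fin.cons (r • X) Y) =
      r • AlternatingMap.alternatizeUncurryFin (preD a) (Fin.cons X Y) := by
  simp only [AlternatingMap.alternatizeUncurryFin_apply, Fin.sum_univ_succ, Fin.cons_zero,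
    Fin.cons_succ]
  cases k with
  | zero =>
    simp [preD_smul_left]
  | succ k =>
    have hr : ∀ (j : Fin (k + 1)) (W : VField I M),
        Fin.removeNth j.succ (Fin.cons W Y : Fin (k + 2) → VField I M) =
          (Fin.cons W (Fin.removeNth j Y) : Fin (k + 1) → VField I M) := by
      intro j W
      funext i
      refine Fin.cases ?_ (fun i => ?_) i <;> simp [Fin.removeNth]
    have h0 : ∀ W : VField I M, Fin.removeNth 0 (Fin.cons W Y : Fin (k + 2) → VField I M) = Y := by
      intro W; rfl
    have hu : ∀ j : Fin (k + 1), a (Function.update Y j X) =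
        (-1 : ℤ) ^ (j : ℕ) • a (Fin.cons X (Fin.removeNth j Y)) := by
      intro j
      have := a.map_insertNth j X (Fin.removeNth j Y)
      rw [Fin.insertNth_removeNth] at this
      rw [this, zsmul_eq_mul, zsmul_eq_mul]
      simp
      rfl
    simp only [hr, h0, preD_smul_left, preD_cons_smul, hu, smul_add, Finset.sum_add_distrib,
      Fin.val_succ, Fin.val_zero, pow_zero, one_smul, Finset.smul_sum]
    have e1 : ∀ j : Fin (k + 1), (-1 : ℤ) ^ ((j : ℕ) + 1) •
        (1 / 2 : ℂ) • lieR (Y j) r • a (Fin.cons X (Fin.removeNth j Y)) =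
        - ((1 / 2 : ℂ) • lieR (Y j) r • (-1 : ℤ) ^ (j : ℕ) • a (Fin.cons X (Fin.removeNth j Y))) := by
      intro j
      rw [pow_succ, mul_neg_one, neg_smul, smul_comm ((-1 : ℤ) ^ (j : ℕ)),
        smul_comm ((-1 : ℤ) ^ (j : ℕ)) (lieR (Y j) r)]
    simp only [e1, Finset.sum_neg_distrib]
    have e2 : ∀ j : Fin (k + 1), (-1 : ℤ) ^ ((j : ℕ) + 1) •
        r • preD a (Y j) (Fin.cons X (Fin.removeNth j Y)) =
        r • (-1 : ℤ) ^ ((j : ℕ) + 1) • preD a (Y j) (Fin.cons X (Fin.removeNth j Y)) := by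
      intro j
      rw [smul_comm]
    simp only [e2]
    abel

/-- The exterior derivative (Koszul formula): `dα(Y₀, …, Y_k)` is
`∑ᵢ (-1)ⁱ (Yᵢ (α(.., Ŷᵢ, ..)) - ½ ∑_{m ≠ i} α(.., Ŷᵢ, .., [Yᵢ, Y_m], ..))`, in which every unordered
pair `{i, m}` contributes twice, i.e.
`∑ᵢ (-1)ⁱ Yᵢ (α(.., Ŷᵢ, ..)) + ∑_{i<m} (-1)^{i+m} α([Yᵢ, Y_m], .., Ŷᵢ, .., Ŷ_m, ..)`. -/
def extD {k : ℕ} (a : Form I M k) : Form I M (k + 1) :=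
  let b := AlternatingMap.alternatizeUncurryFin (preD a)
  { toFun := b
    map_update_add' := b.map_update_add'
    map_update_smul' := by
      intro inst Y i r X
      obtain rfl : inst = instDecidableEqFin _ := Subsingleton.elim _ _
      change b _ = r • b _
      have h : ∀ W, Function.update Y i W = i.insertNth W (Fin.removeNth i Y) := by
        intro W; simp [Fin.insertNth_removeNth]
      rw [h, h, AlternatingMap.map_insertNth, AlternatingMap.map_insertNth, smul_comm r]
      congr 1
      exact altPreD_cons_smul a r X _
    map_eq_zero_of_eq' := b.map_eq_zero_of_eq' }

lemma wedge_summand {p q : ℕ} (a : Form I M p) (b : Form I M q)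
    (s : Equiv.Perm (Fin p ⊕ Fin q)) (v : Fin p ⊕ Fin q → VField I M) :
    LinearMap.mul' (RFun I M) (CFun I M)
        (AlternatingMap.domCoprod.summand a b (Quotient.mk'' s) v) =
      Equiv.Perm.sign s • (a (fun i => v (s (Sum.inl i))) * b (fun i => v (s (Sum.inr i)))) := by
  rw [AlternatingMap.domCoprod.summand_mk'']
  simp [MultilinearMap.domCoprod_apply]

lemma wedge_apply' {p q m : ℕ} (h : p + q = m) (a : Form I M p) (b : Form I M q)
    (Y : Fin m → VField I M) :
    wedge h a b Y = ∑ s : Equiv.Perm.ModSumCongr (Fin p) (Fin q),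
      LinearMap.mul' (RFun I M) (CFun I M) (AlternatingMap.domCoprod.summand a b s
        (Y ∘ finSumFinEquiv.trans (finCongr h))) := by
  simp only [wedge, AlternatingMap.domDomCongr_apply, LinearMap.compAlternatingMap_apply,
    AlternatingMap.domCoprod_apply, sum_apply, map_sum]

/-- The wedge product evaluated on vector fields, with chosen representatives of the shuffles. -/
lemma wedge_apply {p q m : ℕ} (h : p + q = m) (a : Form I M p) (b : Form I M q)
    (Y : Fin m → VField I M) :
    wedge h a b Y = ∑ s : Equiv.Perm.ModSumCongr (Fin p) (Fin q), Equiv.Perm.sign s.out •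
      (a (fun i => Y (finCongr h (finSumFinEquiv (s.out (Sum.inl i))))) *
        b (fun i => Y (finCongr h (finSumFinEquiv (s.out (Sum.inr i)))))) := by
  rw [wedge_apply']
  refine Finset.sum_congr rfl fun s _ => ?_
  conv_lhs => rw [← Quotient.out_eq' s]
  exact wedge_summand a b s.out _

lemma wedge_add_left {p q m : ℕ} (h : p + q = m) (a a' : Form I M p) (b : Form I M q) :
    wedge h (a + a') b = wedge h a b + wedge h a' b := by
  ext Y : 1
  simp [wedge_apply, add_mul, Finset.sum_add_distrib]

lemma wedge_add_right {p q m : ℕ} (h : p + q = m) (a : Form I M p) (b b' : Form I M q) :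
    wedge h a (b + b') = wedge h a b + wedge h a b' := by
  ext Y : 1
  simp [wedge_apply, mul_add, Finset.sum_add_distrib]

lemma wedge_smul_left {p q m : ℕ} (h : p + q = m) (c : ℂ) (a : Form I M p) (b : Form I M q) :
    wedge h (c • a) b = c • wedge h a b := by
  ext Y : 1
  simp [wedge_apply, Finset.smul_sum, smul_comm c]

lemma wedge_smul_right {p q m : ℕ} (h : p + q = m) (c : ℂ) (a : Form I M p) (b : Form I M q) :
    wedge h a (c • b) = c • wedge h a b := by
  ext Y : 1
  simp [wedge_apply, Finset.smul_sum, smul_comm c]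

lemma wedge_zero_left {q m : ℕ} (h : 0 + q = m) (f : CFun I M) (b : Form I M q)
    (Y : Fin m → VField I M) :
    wedge h (AlternatingMap.constOfIsEmpty (RFun I M) (VField I M) (Fin 0) f) b Y =
      f * b (fun i => Y (Fin.cast (by omega) i)) := by
  have hs : Subsingleton (Equiv.Perm.ModSumCongr (Fin 0) (Fin q)) := by
    refine ⟨fun s t => ?_⟩
    induction s using Quotient.inductionOn'
    induction t using Quotient.inductionOn'
    refine Quotient.sound' (QuotientGroup.leftRel_apply.mpr ?_)
    apply Equiv.Perm.mem_sumCongrHom_range_of_perm_mapsTo_inl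
    rintro _ ⟨i, rfl⟩
    exact i.elim0
  rw [wedge_apply']
  refine (Finset.sum_eq_single (Quotient.mk'' 1)
    (fun s _ hs' => absurd (Subsingleton.elim _ _) hs') (by simp)).trans ?_
  rw [wedge_summand]
  simp only [Equiv.Perm.sign_one, one_smul, AlternatingMap.constOfIsEmpty_apply,
    Equiv.Perm.coe_one, id_eq]
  refine congrArg (fun z => f * b z) ?_
  funext i
  refine congrArg Y ?_
  ext
  simp

lemma wedge_zero_right {p m : ℕ} (h : p + 0 = m) (f : CFun I M) (a : Form I M p)
    (Y : Fin m → VField I M) :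
    wedge h a (AlternatingMap.constOfIsEmpty (RFun I M) (VField I M) (Fin 0) f) Y =
      a (fun i => Y (Fin.cast (by omega) i)) * f := by
  have hs : Subsingleton (Equiv.Perm.ModSumCongr (Fin p) (Fin 0)) := by
    refine ⟨fun s t => ?_⟩
    induction s using Quotient.inductionOn'
    induction t using Quotient.inductionOn'
    refine Quotient.sound' (QuotientGroup.leftRel_apply.mpr ?_)
    apply Equiv.Perm.mem_sumCongrHom_range_of_perm_mapsTo_inl
    rintro _ ⟨i, rfl⟩
    generalize (_ : Equiv.Perm (Fin p ⊕ Fin 0)) (Sum.inl i) = z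
    rcases z with z | z
    · exact ⟨z, rfl⟩
    · exact z.elim0
  rw [wedge_apply']
  refine (Finset.sum_eq_single (Quotient.mk'' 1)
    (fun s _ hs' => absurd (Subsingleton.elim _ _) hs') (by simp)).trans ?_
  rw [wedge_summand]
  simp only [Equiv.Perm.sign_one, one_smul, AlternatingMap.constOfIsEmpty_apply,
    Equiv.Perm.coe_one, id_eq]
  refine congrArg (fun z => a z * f) ?_
  funext i
  exact congrArg Y (by ext; simp; rfl)

variable (I M) in
/-- Smooth complex differential forms on `M`, graded by degree. Forms of degree larger than `dim M`
vanish, so that this is the (finite) direct sum of the spaces of forms of fixed degree. -/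
abbrev Forms := (k : ℕ) → Form I M k

/-- The wedge product of inhomogeneous forms: the component of degree `m` of `α ∧ β` is
`∑_{p ≤ m} α_p ∧ β_{m-p}`. -/
def wedgeF : Forms I M →ₗ[ℂ] Forms I M →ₗ[ℂ] Forms I M :=
  LinearMap.mk₂ ℂ (fun a b m => ∑ p : Fin (m + 1),
      wedge (Nat.add_sub_of_le (Nat.lt_succ_iff.mp p.2)) (a p) (b (m - p)))
    (by intro a a' b; funext m; simp [wedge_add_left, Finset.sum_add_distrib])
    (by intro c a b; funext m; simp [wedge_smul_left, Finset.smul_sum])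
    (by intro a b b'; funext m; simp [wedge_add_right, Finset.sum_add_distrib])
    (by intro c a b; funext m; simp [wedge_smul_right, Finset.smul_sum])

lemma wedgeF_apply (a b : Forms I M) (m : ℕ) : wedgeF a b m = ∑ p : Fin (m + 1),
    wedge (Nat.add_sub_of_le (Nat.lt_succ_iff.mp p.2)) (a p) (b (m - p)) := rfl

lemma extD_apply {k : ℕ} (a : Form I M k) (Y : Fin (k + 1) → VField I M) :
    extD a Y = ∑ i : Fin (k + 1), (-1 : ℤ) ^ (i : ℕ) • (lieD (Y i) (a (i.removeNth Y)) -
      (1 / 2 : ℂ) • ∑ m, a (Function.update (i.removeNth Y) m (bracket (Y i) (i.removeNth Y m)))) :=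
  AlternatingMap.alternatizeUncurryFin_apply _ _

/-- The exterior derivative of inhomogeneous forms. -/
def extDF : Forms I M →ₗ[ℂ] Forms I M where
  toFun a := fun m => match m with
    | 0 => 0
    | k + 1 => extD (a k)
  map_add' a b := by
    funext m
    cases m with
    | zero => simp
    | succ k =>
      ext Y : 1
      simp only [Pi.add_apply, AlternatingMap.add_apply, extD_apply, map_add,
        Finset.sum_add_distrib, smul_sub, smul_add, Finset.sum_sub_distrib]
      abel
  map_smul' c a := by
    funext m
    cases m with
    | zero => simp
    | succ k =>
      ext Y : 1
      simp only [Pi.smul_apply, AlternatingMap.smul_apply, extD_apply, lieD_smulC,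
        ← Finset.smul_sum, RingHom.id_apply, smul_comm _ c, ← smul_sub]

/-- The grading involution `α ↦ (-1)^k α` for `α` of degree `k`. -/
def parF : Forms I M →ₗ[ℂ] Forms I M where
  toFun a := fun k => (-1 : ℂ) ^ k • a k
  map_add' a b := by funext k; simp
  map_smul' c a := by funext k; simp [smul_comm c]

variable (I M) in
/-- Smooth functions as forms of degree zero. -/
def ofFun : CFun I M →ₗ[ℂ] Forms I M where
  toFun f := Pi.single 0 (AlternatingMap.constOfIsEmpty (RFun I M) (VField I M) (Fin 0) f)
  map_add' f g := by
    rw [← Pi.single_add]; rfl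
  map_smul' c f := by
    rw [RingHom.id_apply, ← Pi.single_smul]; rfl

lemma ofFun_of_ne (f : CFun I M) {k : ℕ} (hk : k ≠ 0) : ofFun I M f k = 0 :=
  Pi.single_eq_of_ne hk _

lemma wedgeF_ofFun_left (f : CFun I M) (b : Forms I M) (m : ℕ) (Y : Fin m → VField I M) :
    wedgeF (ofFun I M f) b m Y = f * b m Y := by
  rw [wedgeF_apply, Fin.sum_univ_succ, Finset.sum_eq_zero, add_zero]
  · exact wedge_zero_left _ f (b m) Y
  · intro p _
    have : ofFun I M f (p.succ : Fin (m + 1)) = 0 := by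
      exact ofFun_of_ne f (by simp)
    rw [this]
    ext Y : 1
    simp [wedge_apply]

lemma wedgeF_ofFun_right (f : CFun I M) (a : Forms I M) (m : ℕ) (Y : Fin m → VField I M) :
    wedgeF a (ofFun I M f) m Y = a m Y * f := by
  have h : ∀ k : ℕ, k = 0 → ∀ (h : m + k = m), wedge h (a m) (ofFun I M f k) Y = a m Y * f := by
    rintro k rfl h
    exact wedge_zero_right h f (a m) Y
  rw [wedgeF_apply, Fin.sum_univ_castSucc, Finset.sum_eq_zero, zero_add]
  · exact h _ (by simp) _
  · intro p _
    have : ofFun I M f (m - (p.castSucc : Fin (m + 1))) = 0 := by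
      exact ofFun_of_ne f (by have := p.2; simp; omega)
    rw [this]
    ext Y : 1
    simp [wedge_apply]

variable (I M) in
/-- The `𝕋`-invariant forms on `M × 𝕋`: the pair `(α, β)` stands for `α + ϑ ∧ β`. -/
abbrev OmegaT := Forms I M × Forms I M

/-- `(α + ϑ ∧ β) ∧ (α' + ϑ ∧ β') = α ∧ α' + ϑ ∧ (β ∧ α' + (-1)^{deg α} α ∧ β')`. -/
def mulT : OmegaT I M →ₗ[ℂ] OmegaT I M →ₗ[ℂ] OmegaT I M :=
  LinearMap.mk₂ ℂ (fun x y => (wedgeF x.1 y.1, wedgeF x.2 y.1 + wedgeF (parF x.1) y.2))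
    (by intro x x' y; ext1 <;> simp [add_add_add_comm])
    (by intro c x y; ext1 <;> simp)
    (by intro x y y'; ext1 <;> simp [add_add_add_comm])
    (by intro c x y; ext1 <;> simp)

/-- `d_𝕋 (α + ϑ ∧ β) = dα + β - ϑ ∧ dβ`. -/
def dT : OmegaT I M →ₗ[ℂ] OmegaT I M where
  toFun x := (extDF x.1 + x.2, -extDF x.2)
  map_add' x y := by ext1 <;> simp <;> abel
  map_smul' c x := by ext1 <;> simp

/-- The grading involution of `Ω_𝕋(M × 𝕋)`: the form `α + ϑ ∧ β` has degree `j` if `α` has degree `j`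
and `β` has degree `j + 1`. -/
def parT : OmegaT I M →ₗ[ℂ] OmegaT I M where
  toFun x := (parF x.1, -parF x.2)
  map_add' x y := by ext1 <;> simp [add_comm]
  map_smul' c x := by ext1 <;> simp

variable (I M) in
/-- Smooth functions on `M` as elements of `Ω_𝕋(M × 𝕋)`. -/
def funT : CFun I M →ₗ[ℂ] OmegaT I M := LinearMap.inl ℂ _ _ ∘ₗ ofFun I M

/-! ### The topology of uniform convergence of all derivatives -/

/-- `X₁ (X₂ (⋯ (X_r f)))`. -/
def iterD (l : List (VField I M)) (f : CFun I M) : CFun I M :=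
  l.foldr (fun X h => lieD X h) f

/-- A smooth function as a continuous function. -/
def toC (f : CFun I M) : C(M, ℂ) := ⟨f, f.contMDiff.continuous⟩

/-- The `C^∞`-topology: the coarsest topology for which `f ↦ X₁ ⋯ X_r f` is continuous into the
continuous functions with the compact-open topology (for compact `M`: the sup norm), for all smooth
vector fields `X₁, …, X_r`. -/
instance : TopologicalSpace (CFun I M) :=
  TopologicalSpace.induced (fun f (l : List (VField I M)) => toC (iterD l f)) inferInstance

/-- The `C^∞`-topology on forms of degree `k`: the coarsest topology for which
`α ↦ α(Y₁, …, Y_k)` is continuous for all smooth vector fields `Y₁, …, Y_k`. -/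
instance (k : ℕ) : TopologicalSpace (Form I M k) :=
  TopologicalSpace.induced (fun a (Y : Fin k → VField I M) => a Y) inferInstance

lemma toC_lieD_continuous (X : VField I M) : Continuous (fun f : CFun I M => lieD X f) := by
  refine continuous_induced_rng.mpr (continuous_pi fun l => ?_)
  have h : Continuous (fun (f : CFun I M) (l : List (VField I M)) => toC (iterD l f)) :=
    continuous_induced_dom
  have h2 := (continuous_apply (l ++ [X])).comp h
  refine h2.congr fun f => ?_
  simp [iterD]

lemma continuous_toC_iterD (l : List (VField I M)) :
    Continuous (fun f : CFun I M => toC (iterD l f)) := by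
  have h : Continuous (fun (f : CFun I M) (l : List (VField I M)) => toC (iterD l f)) :=
    continuous_induced_dom
  exact (continuous_apply l).comp h

lemma iterD_append (l : List (VField I M)) (X : VField I M) (f : CFun I M) :
    iterD (l ++ [X]) f = iterD l (lieD X f) := by
  simp [iterD]

lemma iterD_add (l : List (VField I M)) (f g : CFun I M) :
    iterD l (f + g) = iterD l f + iterD l g := by
  induction l with
  | nil => rfl
  | cons X l ih =>
    change lieD X (iterD l (f + g)) = lieD X (iterD l f) + lieD X (iterD l g)
    rw [ih, map_add]

lemma iterD_smul (l : List (VField I M)) (c : ℂ) (f : CFun I M) :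
    iterD l (c • f) = c • iterD l f := by
  induction l with
  | nil => rfl
  | cons X l ih =>
    change lieD X (iterD l (c • f)) = c • lieD X (iterD l f)
    rw [ih, lieD_smulC]

variable (I M) in
/-- The linear map defining the topology of `C^∞(M)`. -/
def jetMap : CFun I M →ₗ[ℂ] (List (VField I M) → C(M, ℂ)) where
  toFun f := fun l => toC (iterD l f)
  map_add' f g := by
    funext l; ext x
    simp [toC, iterD_add]
  map_smul' c f := by
    funext l; ext x
    simp [toC, iterD_smul]

lemma isInducing_jetMap : Topology.IsInducing (jetMap I M) := ⟨rfl⟩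

instance : IsTopologicalAddGroup (CFun I M) :=
  topologicalAddGroup_induced (jetMap I M)

instance : ContinuousSMul ℂ (CFun I M) :=
  isInducing_jetMap.continuousSMul continuous_id (by intro c x; exact map_smul _ _ _)

lemma continuous_toC_mul :
    Continuous (fun p : CFun I M × CFun I M => toC (p.1 * p.2)) := by
  have : LocallyCompactSpace M := Manifold.locallyCompact_of_finiteDimensional I
  have h := continuous_toC_iterD (I := I) (M := M) []
  exact (h.comp continuous_fst).mul (h.comp continuous_snd)

lemma continuous_mul_aux (l : List (VField I M)) :
    Continuous (fun p : CFun I M × CFun I M => toC (iterD l (p.1 * p.2))) := by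
  induction l using List.reverseRecOn with
  | nil => exact continuous_toC_mul
  | append_singleton l X ih =>
    have h1 := ih.comp (((toC_lieD_continuous X).comp continuous_fst).prodMk continuous_snd)
    have h2 := ih.comp (continuous_fst.prodMk ((toC_lieD_continuous X).comp continuous_snd))
    refine (h1.add h2).congr fun p => ?_
    ext x
    simp [toC, iterD_append, lieD_mul, iterD_add]

instance : ContinuousMul (CFun I M) :=
  ⟨continuous_induced_rng.mpr (continuous_pi fun l => continuous_mul_aux l)⟩

/-- The linear map defining the topology of the space of forms of degree `k`. -/
def evalMap (k : ℕ) : Form I M k →ₗ[ℂ] ((Fin k → VField I M) → CFun I M) where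
  toFun a := fun Y => a Y
  map_add' _ _ := rfl
  map_smul' _ _ := rfl

lemma isInducing_evalMap (k : ℕ) : Topology.IsInducing (evalMap (I := I) (M := M) k) := ⟨rfl⟩

instance (k : ℕ) : IsTopologicalAddGroup (Form I M k) :=
  topologicalAddGroup_induced (evalMap k)

instance (k : ℕ) : ContinuousSMul ℂ (Form I M k) :=
  (isInducing_evalMap k).continuousSMul continuous_id (by intro c x; exact map_smul _ _ _)

lemma continuous_form_apply {k : ℕ} (Y : Fin k → VField I M) :
    Continuous (fun a : Form I M k => a Y) :=
  (continuous_apply Y).comp (isInducing_evalMap k).continuous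

lemma continuous_form_iff {Z : Type*} [TopologicalSpace Z] {k : ℕ} {f : Z → Form I M k} :
    Continuous f ↔ ∀ Y, Continuous (fun z => f z Y) := by
  rw [(isInducing_evalMap k).continuous_iff, continuous_pi_iff]
  rfl

lemma continuous_wedge {Z : Type*} [TopologicalSpace Z] {p q m : ℕ} (h : p + q = m)
    {f : Z → Form I M p} {g : Z → Form I M q} (hf : Continuous f) (hg : Continuous g) :
    Continuous (fun z => wedge h (f z) (g z)) := by
  refine continuous_form_iff.mpr fun Y => ?_
  simp only [wedge_apply]
  refine continuous_finsetSum _ fun s _ => ?_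
  have : Continuous (fun z =>
      f z (fun i => Y (finCongr h (finSumFinEquiv (s.out (Sum.inl i))))) *
        g z (fun i => Y (finCongr h (finSumFinEquiv (s.out (Sum.inr i)))))) :=
    ((continuous_form_apply _).comp hf).mul ((continuous_form_apply _).comp hg)
  rcases Int.units_eq_one_or (Equiv.Perm.sign s.out) with hs | hs <;> rw [hs]
  · simpa only [one_smul] using this
  · simp only [Units.neg_smul, one_smul]
    exact this.neg

lemma continuous_wedgeF {Z : Type*} [TopologicalSpace Z]
    {f g : Z → Forms I M} (hf : Continuous f) (hg : Continuous g) :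
    Continuous (fun z => wedgeF (f z) (g z)) := by
  refine continuous_pi_iff.mpr fun m => ?_
  simp only [wedgeF_apply]
  refine continuous_finsetSum _ fun p _ => ?_
  have h1 : Continuous (fun z => f z p) := (continuous_apply (p : ℕ)).comp hf
  have h2 : Continuous (fun z => g z (m - p)) := (continuous_apply (m - (p : ℕ))).comp hg
  exact continuous_wedge _ h1 h2

lemma continuous_extD {k : ℕ} : Continuous (fun a : Form I M k => extD a) := by
  refine continuous_form_iff.mpr fun Y => ?_
  simp only [extD_apply]
  refine continuous_finsetSum _ fun i _ => ?_
  have h1 : Continuous (fun a : Form I M k => lieD (Y i) (a (i.removeNth Y))) :=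
    (toC_lieD_continuous _).comp (continuous_form_apply _)
  have h2 : Continuous (fun a : Form I M k =>
      ∑ m, a (Function.update (i.removeNth Y) m (bracket (Y i) (i.removeNth Y m)))) := by
    refine continuous_finsetSum _ fun m _ => ?_
    exact continuous_form_apply
      (Function.update (i.removeNth Y) m (bracket (Y i) (i.removeNth Y m)))
  exact (h1.sub (h2.const_smul (1 / 2 : ℂ))).const_smul ((-1 : ℤ) ^ (i : ℕ))

lemma continuous_extDF : Continuous (extDF : Forms I M → Forms I M) := by
  refine continuous_pi_iff.mpr fun m => ?_
  cases m with
  | zero => exact continuous_const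
  | succ k => exact continuous_extD.comp (continuous_apply k)

lemma continuous_parF : Continuous (parF : Forms I M → Forms I M) :=
  continuous_pi_iff.mpr fun k => (continuous_apply k).const_smul ((-1 : ℂ) ^ k)

lemma continuous_mulT : Continuous (fun x : OmegaT I M × OmegaT I M => mulT x.1 x.2) := by
  have h11 : Continuous (fun x : OmegaT I M × OmegaT I M => x.1.1) := by fun_prop
  have h12 : Continuous (fun x : OmegaT I M × OmegaT I M => x.1.2) := by fun_prop
  have h21 : Continuous (fun x : OmegaT I M × OmegaT I M => x.2.1) := by fun_prop
  have h22 : Continuous (fun x : OmegaT I M × OmegaT I M => x.2.2) := by fun_prop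
  have h13 : Continuous (fun x : OmegaT I M × OmegaT I M => parF x.1.1) :=
    continuous_parF.comp h11
  exact (continuous_wedgeF h11 h21).prodMk
    ((continuous_wedgeF h12 h21).add (continuous_wedgeF h13 h22))

lemma continuous_dT : Continuous (dT : OmegaT I M → OmegaT I M) :=
  ((continuous_extDF.comp continuous_fst).add continuous_snd).prodMk
    (continuous_extDF.comp continuous_snd).neg

lemma continuous_parT : Continuous (parT : OmegaT I M → OmegaT I M) :=
  (continuous_parF.comp continuous_fst).prodMk (continuous_parF.comp continuous_snd).neg

lemma parF_apply (a : Forms I M) (k : ℕ) : parF a k = (-1 : ℂ) ^ k • a k := rfl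

lemma mulT_fst (x y : OmegaT I M) : (mulT x y).1 = wedgeF x.1 y.1 := rfl

lemma mulT_snd (x y : OmegaT I M) :
    (mulT x y).2 = wedgeF x.2 y.1 + wedgeF (parF x.1) y.2 := rfl

lemma parF_ofFun (f : CFun I M) : parF (ofFun I M f) = ofFun I M f := by
  funext k
  rw [parF_apply]
  rcases eq_or_ne k 0 with rfl | hk
  · simp
  · rw [ofFun_of_ne f hk, smul_zero]

lemma wedgeF_one_left (a : Forms I M) : wedgeF (ofFun I M 1) a = a := by
  funext m; ext Y : 1
  rw [wedgeF_ofFun_left, one_mul]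

lemma wedgeF_one_right (a : Forms I M) : wedgeF a (ofFun I M 1) = a := by
  funext m; ext Y : 1
  rw [wedgeF_ofFun_right, mul_one]

lemma funT_fst (f : CFun I M) : (funT I M f).1 = ofFun I M f := rfl

lemma funT_snd (f : CFun I M) : (funT I M f).2 = 0 := rfl

lemma one_mulT (x : OmegaT I M) : mulT (funT I M 1) x = x := by
  refine Prod.ext ?_ ?_
  · rw [mulT_fst, funT_fst, wedgeF_one_left]
  · rw [mulT_snd, funT_fst, funT_snd, parF_ofFun, wedgeF_one_left, map_zero,
      LinearMap.zero_apply, zero_add]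

lemma mulT_one (x : OmegaT I M) : mulT x (funT I M 1) = x := by
  refine Prod.ext ?_ ?_
  · rw [mulT_fst, funT_fst, wedgeF_one_right]
  · rw [mulT_snd, funT_fst, funT_snd, wedgeF_one_right, map_zero, add_zero]

lemma extDF_one : extDF (ofFun I M 1) = 0 := by
  funext m
  cases m with
  | zero => rfl
  | succ k =>
    change extD (ofFun I M 1 k) = 0
    ext Y : 1
    rw [extD_apply]
    rcases eq_or_ne k 0 with rfl | hk
    · have h : ∀ Z : Fin 0 → VField I M, ofFun I M 1 0 Z = constC I M 1 := fun Z => rfl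
      simp only [h, lieD_const, Finset.univ_eq_empty, Finset.sum_empty, smul_zero, sub_zero,
        Finset.sum_const_zero, AlternatingMap.zero_apply]
    · simp [ofFun_of_ne 1 hk]

lemma dT_one : dT (funT I M 1) = 0 := by
  refine Prod.ext ?_ ?_
  · change extDF (ofFun I M 1) + 0 = 0
    rw [extDF_one, add_zero]
  · change -extDF 0 = 0
    rw [map_zero, neg_zero]

lemma parT_funT (f : CFun I M) : parT (funT I M f) = funT I M f := by
  refine Prod.ext ?_ ?_
  · exact parF_ofFun f
  · change -parF 0 = 0
    rw [map_zero, neg_zero]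

variable [CompactSpace M]

lemma polynormable_pi_continuousMap (ι : Type*) : PolynormableSpace ℂ (ι → C(M, ℂ)) := by
  have : PolynormableSpace ℂ C(M, ℂ) := (norm_withSeminorms ℂ C(M, ℂ)).toPolynormableSpace
  infer_instance

instance : PolynormableSpace ℂ (CFun I M) :=
  have := polynormable_pi_continuousMap (M := M) (List (VField I M))
  isInducing_jetMap.polynormableSpace

instance (k : ℕ) : PolynormableSpace ℂ (Form I M k) := (isInducing_evalMap k).polynormableSpace

instance : PolynormableSpace ℂ (Forms I M) := instPolynormableSpaceForall

instance : PolynormableSpace ℂ (OmegaT I M) := instPolynormableSpaceProd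

end Manifold

/-! ### Cyclic chains -/

section Chains

open scoped TensorProduct NNReal

/-- The part of the structure of a locally convex unital differential graded algebra which enters
the definition of its cyclic chain complex: the unit, the product, the differential, and the
involution which is `(-1)^j` in degree `j`. -/
class DGData (Ω : Type*) [AddCommGroup Ω] [Module ℂ Ω] [TopologicalSpace Ω] where
  one : Ω
  mul : Ω →ₗ[ℂ] Ω →ₗ[ℂ] Ω
  d : Ω →ₗ[ℂ] Ω
  par : Ω →ₗ[ℂ] Ω
  one_mul : ∀ x, mul one x = x
  mul_one : ∀ x, mul x one = x
  d_one : d one = 0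
  par_one : par one = one
  continuous_mul : Continuous (fun x : Ω × Ω => mul x.1 x.2)
  continuous_d : Continuous d
  continuous_par : Continuous par

variable (Ω : Type*) [AddCommGroup Ω] [Module ℂ Ω] [TopologicalSpace Ω] [DGData Ω]

/-- `Ω / ℂ·1`. -/
abbrev Red := Ω ⧸ Submodule.span ℂ {(DGData.one : Ω)}

/-- `Ω ⊗ (Ω / ℂ·1)^{⊗ n}` (algebraic tensor product). -/
abbrev ChainN (n : ℕ) := Ω ⊗[ℂ] (⨂[ℂ] _ : Fin n, Red Ω)

/-- The space of cyclic chains `⨁ₙ Ω ⊗ (Ω / ℂ·1)^{⊗ n}`. -/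
def Chain := DirectSum ℕ (fun n => ChainN Ω n)

instance : AddCommGroup (Chain Ω) := inferInstanceAs (AddCommGroup (DirectSum ℕ _))
instance : Module ℂ (Chain Ω) := inferInstanceAs (Module ℂ (DirectSum ℕ _))

/-- The chain `⟨a⟩` with `a` in slot `n` and zero in all other slots. -/
def single (n : ℕ) : ChainN Ω n →ₗ[ℂ] Chain Ω := DirectSum.lof ℂ ℕ (fun n => ChainN Ω n) n

/-- The component of a chain in slot `n`. -/
def slot (n : ℕ) : Chain Ω →ₗ[ℂ] ChainN Ω n := DirectSum.component ℂ ℕ (fun n => ChainN Ω n) n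

variable {Ω}

lemma tens_aux {n : ℕ} (v : Fin (n + 1) → Ω) (i : Fin n) (x : Ω) :
    (fun k : Fin n => (Submodule.Quotient.mk (Function.update v i.succ x k.succ) : Red Ω)) =
      Function.update (fun k => Submodule.Quotient.mk (v k.succ)) i (Submodule.Quotient.mk x) := by
  funext k
  rcases eq_or_ne k i with rfl | h
  · simp
  · rw [Function.update_of_ne h, Function.update_of_ne (by simpa using h)]

/-- The elementary tensor `ω₀ ⊗ ω₁ ⊗ ⋯ ⊗ ωₙ`. -/
def tens (n : ℕ) : MultilinearMap ℂ (fun _ : Fin (n + 1) => Ω) (ChainN Ω n) where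
  toFun v := v 0 ⊗ₜ PiTensorProduct.tprod ℂ (fun i : Fin n => Submodule.Quotient.mk (v i.succ))
  map_update_add' := by
    intro inst v i x y
    obtain rfl : inst = instDecidableEqFin _ := Subsingleton.elim _ _
    refine Fin.cases ?_ (fun i => ?_) i
    · simp [TensorProduct.add_tmul, Function.update_of_ne]
    · simp only [tens_aux, Submodule.Quotient.mk_add, MultilinearMap.map_update_add,
        TensorProduct.tmul_add, Function.update_of_ne (Fin.succ_ne_zero i).symm]
  map_update_smul' := by
    intro inst v i c x
    obtain rfl : inst = instDecidableEqFin _ := Subsingleton.elim _ _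
    refine Fin.cases ?_ (fun i => ?_) i
    · simp [TensorProduct.smul_tmul', Function.update_of_ne]
    · simp only [tens_aux, Submodule.Quotient.mk_smul, MultilinearMap.map_update_smul,
        TensorProduct.tmul_smul, Function.update_of_ne (Fin.succ_ne_zero i).symm]

lemma tens_apply (n : ℕ) (v : Fin (n + 1) → Ω) :
    tens n v = v 0 ⊗ₜ PiTensorProduct.tprod ℂ (fun i : Fin n => Submodule.Quotient.mk (v i.succ)) :=
  rfl

/-- The chain `⟨ω₀ ⊗ ω₁ ⊗ ⋯ ⊗ ωₙ⟩`. -/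
def el (n : ℕ) : MultilinearMap ℂ (fun _ : Fin (n + 1) => Ω) (Chain Ω) :=
  (single Ω n).compMultilinearMap (tens n)

lemma tens_eq_zero {n : ℕ} (v : Fin (n + 1) → Ω) (i : Fin n) (h : v i.succ = DGData.one) :
    tens n v = 0 := by
  rw [tens_apply, MultilinearMap.map_coord_zero _ i, TensorProduct.tmul_zero]
  rw [h]
  exact (Submodule.Quotient.mk_eq_zero _).mpr (Submodule.mem_span_singleton_self _)

/-- A linear section of `Ω → Ω / ℂ·1`. -/
def redSection : Red Ω →ₗ[ℂ] Ω :=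
  ((Submodule.mkQ (Submodule.span ℂ {(DGData.one : Ω)})).exists_rightInverse_of_surjective
    (LinearMap.range_eq_top.mpr (Submodule.mkQ_surjective _))).choose

lemma mk_section (x : Red Ω) : Submodule.Quotient.mk (redSection x) = x :=
  LinearMap.congr_fun
    ((Submodule.mkQ (Submodule.span ℂ {(DGData.one : Ω)})).exists_rightInverse_of_surjective
      (LinearMap.range_eq_top.mpr (Submodule.mkQ_surjective _))).choose_spec x

/-- A multilinear map is reduced if it vanishes as soon as one of the entries `1, …, n` is `1`. -/
def IsReduced {W : Type*} [AddCommGroup W] [Module ℂ W] {n : ℕ}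
    (f : MultilinearMap ℂ (fun _ : Fin (n + 1) => Ω) W) : Prop :=
  ∀ (v : Fin (n + 1) → Ω) (i : Fin n), v i.succ = DGData.one → f v = 0

/-- The linear map on `Ω ⊗ (Ω / ℂ·1)^{⊗ n}` induced by a reduced multilinear map. -/
def descend {W : Type*} [AddCommGroup W] [Module ℂ W] {n : ℕ}
    (f : MultilinearMap ℂ (fun _ : Fin (n + 1) => Ω) W) (_ : IsReduced f) :
    ChainN Ω n →ₗ[ℂ] W :=
  TensorProduct.lift (PiTensorProduct.lift.toLinearMap ∘ₗ
    MultilinearMap.compLinearMapₗ (fun _ : Fin n => redSection) ∘ₗ f.curryLeft)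

lemma IsReduced.congr {W : Type*} [AddCommGroup W] [Module ℂ W] {n : ℕ}
    {f : MultilinearMap ℂ (fun _ : Fin (n + 1) => Ω) W} (hf : IsReduced f)
    {v w : Fin (n + 1) → Ω} (h0 : v 0 = w 0)
    (h : ∀ i : Fin n, (Submodule.Quotient.mk (v i.succ) : Red Ω) =
      Submodule.Quotient.mk (w i.succ)) :
    f v = f w := by
  have key : ∀ s : Finset (Fin n), f v =
      f (Fin.cons (v 0) (fun i => if i ∈ s then w i.succ else v i.succ)) := by
    intro s
    induction s using Finset.induction_on with
    | empty =>
      congr 1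
      funext i
      refine Fin.cases ?_ (fun i => ?_) i <;> simp
    | insert a s ha ih =>
      rw [ih]
      set u : Fin (n + 1) → Ω := Fin.cons (v 0) (fun i => if i ∈ s then w i.succ else v i.succ)
        with hu
      have h1 : (Fin.cons (v 0) (fun i => if i ∈ insert a s then w i.succ else v i.succ) :
          Fin (n + 1) → Ω) = Function.update u a.succ (w a.succ) := by
        funext i
        refine Fin.cases ?_ (fun i => ?_) i
        · simp [hu, Function.update_of_ne (Fin.succ_ne_zero a).symm]
        · rcases eq_or_ne i a with rfl | hi
          · simp
          · rw [Function.update_of_ne (by simpa using hi)]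
            simp [hu, hi]
      have h2 : u = Function.update u a.succ (v a.succ) := by
        rw [eq_comm, Function.update_eq_self_iff]
        simp [hu, ha]
      obtain ⟨c, hc⟩ := Submodule.mem_span_singleton.mp ((Submodule.Quotient.eq _).mp (h a))
      have h3 : v a.succ = w a.succ + c • (DGData.one : Ω) := by rw [hc]; abel
      rw [h1]
      conv_lhs => rw [h2, h3]
      rw [f.map_update_add, f.map_update_smul, hf (Function.update u a.succ DGData.one) a (by simp),
        smul_zero, add_zero]
  rw [key Finset.univ]
  congr 1
  funext i
  refine Fin.cases ?_ (fun i => ?_) i <;> simp [h0]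

lemma descend_tens {W : Type*} [AddCommGroup W] [Module ℂ W] {n : ℕ}
    (f : MultilinearMap ℂ (fun _ : Fin (n + 1) => Ω) W) (hf : IsReduced f)
    (v : Fin (n + 1) → Ω) : descend f hf (tens n v) = f v := by
  rw [tens_apply]
  simp only [descend, TensorProduct.lift.tmul, LinearMap.comp_apply]
  change PiTensorProduct.lift _ (PiTensorProduct.tprod ℂ _) = _
  rw [PiTensorProduct.lift.tprod]
  change f (Fin.cons (v 0) _) = _
  refine hf.congr (by simp) (fun i => ?_)
  simp [mk_section]

/-- The projection of `Ω` to the even (`p = 0`) or odd (`p = 1`) part. -/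
def prj (p : ZMod 2) : Ω →ₗ[ℂ] Ω :=
  (1 / 2 : ℂ) • (LinearMap.id + (if p = 0 then (1 : ℂ) else -1) • DGData.par)

/-- The sign `(-1)^a`. -/
def sgn (a : ZMod 2) : ℂ := if a = 0 then 1 else -1

/-- The multilinear map which is given by `F p` on entries which are homogeneous with parities
`p₀, …, pₙ`. -/
def homog {W : Type*} [AddCommGroup W] [Module ℂ W] {n : ℕ}
    (F : (Fin (n + 1) → ZMod 2) → MultilinearMap ℂ (fun _ : Fin (n + 1) => Ω) W) :
    MultilinearMap ℂ (fun _ : Fin (n + 1) => Ω) W :=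
  ∑ p, (F p).compLinearMap (fun i => prj (p i))

lemma prj_of_par {p q : ZMod 2} {x : Ω} (h : DGData.par x = sgn q • x) :
    prj p x = if p = q then x else 0 := by
  simp only [prj, LinearMap.smul_apply, LinearMap.add_apply, LinearMap.id_apply, h, sgn]
  have key : ∀ p : ZMod 2, p = 0 ∨ p = 1 := by decide
  rcases key p with rfl | rfl <;> rcases key q with rfl | rfl <;> simp <;> module

lemma homog_apply {W : Type*} [AddCommGroup W] [Module ℂ W] {n : ℕ}
    (F : (Fin (n + 1) → ZMod 2) → MultilinearMap ℂ (fun _ : Fin (n + 1) => Ω) W)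
    (v : Fin (n + 1) → Ω) : homog F v = ∑ p, F p (fun i => prj (p i) (v i)) := by
  simp [homog]

lemma homog_of_par {W : Type*} [AddCommGroup W] [Module ℂ W] {n : ℕ}
    (F : (Fin (n + 1) → ZMod 2) → MultilinearMap ℂ (fun _ : Fin (n + 1) => Ω) W)
    (q : Fin (n + 1) → ZMod 2) (v : Fin (n + 1) → Ω)
    (h : ∀ i, DGData.par (v i) = sgn (q i) • v i) : homog F v = F q v := by
  rw [homog_apply, Finset.sum_eq_single q]
  · congr 1; funext i; simp [prj_of_par (h i)]
  · intro p _ hp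
    obtain ⟨i, hi⟩ := Function.ne_iff.mp hp
    exact MultilinearMap.map_coord_zero _ i (by simp [prj_of_par (h i), hi])
  · simp

lemma homog_isReduced {W : Type*} [AddCommGroup W] [Module ℂ W] {n : ℕ}
    (F : (Fin (n + 1) → ZMod 2) → MultilinearMap ℂ (fun _ : Fin (n + 1) => Ω) W)
    (h : ∀ (p : Fin (n + 1) → ZMod 2) (v : Fin (n + 1) → Ω) (i : Fin n),
      p i.succ = 0 → v i.succ = DGData.one → F p v = 0) : IsReduced (homog F) := by
  intro v i hv
  rw [homog_apply]
  refine Finset.sum_eq_zero fun p _ => ?_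
  have h1 : DGData.par (v i.succ) = sgn 0 • v i.succ := by
    rw [hv, DGData.par_one]; simp [sgn]
  by_cases hp : p i.succ = 0
  · exact h p _ i hp (by rw [prj_of_par h1, if_pos hp, hv])
  · exact MultilinearMap.map_coord_zero _ i.succ (by rw [prj_of_par h1, if_neg hp])

/-! ### The Hochschild differential, the Connes operator, and the grading -/

/-- For degrees `j₀, …, jₙ` with parities `p₀, …, pₙ` this is the parity of
`r_{m-1} = j₀ + ⋯ + j_{m-1} - (m - 1)`. -/
def rr {n : ℕ} (p : Fin (n + 1) → ZMod 2) (m : ℕ) : ZMod 2 :=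
  (∑ k : Fin (n + 1) with k.val < m, p k) - ((m : ZMod 2) - 1)

/-- `⟨ω₀ ⊗ ⋯ ⊗ dωᵢ ⊗ ⋯ ⊗ ωₙ⟩`. -/
def dTerm {n : ℕ} (i : Fin (n + 1)) : MultilinearMap ℂ (fun _ : Fin (n + 1) => Ω) (Chain Ω) :=
  (el n).compLinearMap (Function.update (fun _ => LinearMap.id) i DGData.d)

/-- `(ω₀, …, ω_{j-1}, ω_j ω_{j+1}, ω_{j+2}, …)`. -/
def merge {n : ℕ} (j : Fin (n + 1)) (v : Fin (n + 2) → Ω) : Fin (n + 1) → Ω := fun k =>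
  if k < j then v k.castSucc
  else if k = j then DGData.mul (v j.castSucc) (v j.succ)
  else v k.succ

lemma merge_update {n : ℕ} (j : Fin (n + 1)) (v : Fin (n + 2) → Ω) (i : Fin (n + 2)) :
    ∃ (k : Fin (n + 1)) (L : Ω →ₗ[ℂ] Ω), ∀ x,
      merge j (Function.update v i x) = Function.update (merge j v) k (L x) := by
  rcases lt_or_ge i j.castSucc with h | h
  · refine ⟨⟨i, by have := Fin.lt_def.mp h; simp at this; omega⟩, LinearMap.id, fun x => ?_⟩
    funext k
    simp only [merge, Function.update_apply, Fin.ext_iff, Fin.lt_def, Fin.val_castSucc,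
      Fin.val_succ, LinearMap.id_apply] at h ⊢
    split_ifs <;> first | rfl | omega
  rcases eq_or_ne i j.castSucc with rfl | h1
  · refine ⟨j, DGData.mul.flip (v j.succ), fun x => ?_⟩
    funext k
    simp only [merge, Function.update_apply, Fin.ext_iff, Fin.lt_def, Fin.val_castSucc,
      Fin.val_succ, LinearMap.flip_apply]
    split_ifs <;> first | rfl | omega
  have hi : (i : ℕ) = i - 1 + 1 := by
    simp only [Fin.le_def, Fin.val_castSucc, ne_eq, Fin.ext_iff] at h h1
    omega
  rcases eq_or_ne i j.succ with rfl | h2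
  · refine ⟨j, DGData.mul (v j.castSucc), fun x => ?_⟩
    funext k
    simp only [merge, Function.update_apply, Fin.ext_iff, Fin.lt_def, Fin.val_castSucc,
      Fin.val_succ]
    split_ifs <;> first | rfl | omega
  · refine ⟨⟨i - 1, by omega⟩, LinearMap.id, fun x => ?_⟩
    funext k
    simp only [merge, Function.update_apply, Fin.ext_iff, Fin.lt_def, Fin.le_def, Fin.val_castSucc,
      Fin.val_succ, LinearMap.id_apply, ne_eq] at h h1 h2 ⊢
    split_ifs <;> first | rfl | omega

/-- `⟨ω₀ ⊗ ⋯ ⊗ ωⱼ ωⱼ₊₁ ⊗ ⋯ ⊗ ωₙ₊₁⟩`. -/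
def mulTerm {n : ℕ} (j : Fin (n + 1)) : MultilinearMap ℂ (fun _ : Fin (n + 2) => Ω) (Chain Ω) where
  toFun v := el n (merge j v)
  map_update_add' := by
    intro inst v i x y
    obtain rfl : inst = instDecidableEqFin _ := Subsingleton.elim _ _
    obtain ⟨k, L, h⟩ := merge_update j v i
    rw [h, h, h, map_add, MultilinearMap.map_update_add]
  map_update_smul' := by
    intro inst v i c x
    obtain rfl : inst = instDecidableEqFin _ := Subsingleton.elim _ _
    obtain ⟨k, L, h⟩ := merge_update j v i
    rw [h, h, map_smul, MultilinearMap.map_update_smul]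

/-- `⟨ωₙ₊₁ ω₀ ⊗ ω₁ ⊗ ⋯ ⊗ ωₙ⟩`. -/
def lastTerm (n : ℕ) : MultilinearMap ℂ (fun _ : Fin (n + 2) => Ω) (Chain Ω) :=
  (mulTerm 0).domDomCongr (finRotate (n + 2)).symm

/-- The part of the Hochschild differential involving `d`. -/
def dPart (n : ℕ) : MultilinearMap ℂ (fun _ : Fin (n + 1) => Ω) (Chain Ω) :=
  homog fun p => - ∑ i : Fin (n + 1), sgn (rr p i) • dTerm i

/-- The part of the Hochschild differential involving the product. -/
def mulPart : (n : ℕ) → MultilinearMap ℂ (fun _ : Fin (n + 1) => Ω) (Chain Ω)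
  | 0 => 0
  | n + 1 => homog fun p =>
      - (∑ i : Fin (n + 1), sgn (rr p (i + 1)) • mulTerm i) +
        sgn ((p (Fin.last (n + 1)) - 1) * rr p (n + 1)) • lastTerm n

/-- `⟨1 ⊗ ωᵢ ⊗ ⋯ ⊗ ωₙ ⊗ ω₀ ⊗ ⋯ ⊗ ωᵢ₋₁⟩`. -/
def rotTerm {n : ℕ} (i : Fin (n + 1)) : MultilinearMap ℂ (fun _ : Fin (n + 1) => Ω) (Chain Ω) :=
  ((el (n + 1)).curryLeft DGData.one).domDomCongr (Equiv.addRight i)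

/-- The Connes operator on elementary tensors. -/
def rotPart (n : ℕ) : MultilinearMap ℂ (fun _ : Fin (n + 1) => Ω) (Chain Ω) :=
  homog fun p => ∑ i : Fin (n + 1), sgn ((rr p i + 1) * (rr p (n + 1) - rr p i)) • rotTerm i

/-- The grading operator on elementary tensors: the sign is `(-1)^(j₀ + ⋯ + jₙ + n)`. -/
def parPart (n : ℕ) : MultilinearMap ℂ (fun _ : Fin (n + 1) => Ω) (Chain Ω) :=
  (-1 : ℂ) ^ n • (el n).compLinearMap (fun _ => DGData.par)

lemma el_eq_zero {n : ℕ} (v : Fin (n + 1) → Ω) (k : Fin (n + 1)) (hk : k ≠ 0)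
    (h : v k = DGData.one) : el n v = 0 := by
  obtain ⟨i, rfl⟩ := Fin.exists_succ_eq.mpr hk
  change single Ω n (tens n v) = 0
  rw [tens_eq_zero v i h, map_zero]

lemma dPart_isReduced (n : ℕ) : IsReduced (dPart (Ω := Ω) n) := by
  refine homog_isReduced _ fun p v i _ hv => ?_
  rw [neg_apply, sum_apply, neg_eq_zero]
  refine Finset.sum_eq_zero fun k _ => ?_
  rw [smul_apply, dTerm, MultilinearMap.compLinearMap_apply]
  rcases eq_or_ne i.succ k with rfl | hk
  · rw [MultilinearMap.map_coord_zero _ i.succ (by simp [hv, DGData.d_one]), smul_zero]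
  · rw [el_eq_zero _ i.succ (Fin.succ_ne_zero i) (by simp [Function.update_of_ne hk, hv]),
      smul_zero]

lemma rotPart_isReduced (n : ℕ) : IsReduced (rotPart (Ω := Ω) n) := by
  refine homog_isReduced _ fun p v i _ hv => ?_
  rw [sum_apply]
  refine Finset.sum_eq_zero fun k _ => ?_
  rw [smul_apply, rotTerm, MultilinearMap.domDomCongr_apply,
    MultilinearMap.curryLeft_apply,
    el_eq_zero _ (i.succ - k).succ (Fin.succ_ne_zero _) (by simp [hv]), smul_zero]

lemma parPart_isReduced (n : ℕ) : IsReduced (parPart (Ω := Ω) n) := by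
  intro v i hv
  rw [parPart, smul_apply, MultilinearMap.compLinearMap_apply,
    el_eq_zero _ i.succ (Fin.succ_ne_zero i) (by simp [hv, DGData.par_one]), smul_zero]

lemma lastTerm_apply (n : ℕ) (v : Fin (n + 2) → Ω) :
    lastTerm n v = el n (Fin.cons (DGData.mul (v (Fin.last (n + 1))) (v 0))
      (fun i : Fin n => v i.succ.castSucc)) := by
  have h0 : (finRotate (n + 2)).symm 0 = Fin.last (n + 1) := by
    rw [Equiv.symm_apply_eq, finRotate_last]
  have h1 : ∀ k : Fin (n + 1), (finRotate (n + 2)).symm k.succ = k.castSucc := by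
    intro k
    rw [Equiv.symm_apply_eq, finRotate_apply, Fin.coeSucc_eq_succ]
  rw [lastTerm, MultilinearMap.domDomCongr_apply]
  change el n (merge 0 _) = _
  congr 1
  funext k
  refine Fin.cases ?_ (fun k => ?_) k
  · have h2 := h1 0
    rw [Fin.castSucc_zero] at h2
    simp only [merge, lt_self_iff_false, if_false, if_true, Fin.cons_zero, Fin.castSucc_zero, h0, h2]
  · rw [merge, if_neg (Fin.not_lt_zero _), if_neg (Fin.succ_ne_zero _), h1, Fin.cons_succ]

lemma rr_succ {n : ℕ} (p : Fin (n + 1) → ZMod 2) (m : Fin (n + 1)) :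
    rr p (m + 1) = rr p m + p m - 1 := by
  have h : (Finset.univ.filter fun k : Fin (n + 1) => k.val < (m : ℕ) + 1) =
      insert m (Finset.univ.filter fun k : Fin (n + 1) => k.val < m) := by
    ext k
    simp only [Finset.mem_filter, Finset.mem_univ, true_and, Finset.mem_insert, Fin.ext_iff]
    omega
  rw [rr, rr, h, Finset.sum_insert (by simp)]
  push_cast
  ring

lemma sgn_sub_one (a : ZMod 2) : sgn (a - 1) = - sgn a := by
  have key : ∀ p : ZMod 2, p = 0 ∨ p = 1 := by decide
  rcases key a with rfl | rfl <;> simp [sgn]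

lemma mulPart_isReduced (n : ℕ) : IsReduced (mulPart (Ω := Ω) n) := by
  cases n with
  | zero => intro v i; exact i.elim0
  | succ n =>
    refine homog_isReduced _ fun p v i hp hv => ?_
    set R : Chain Ω := el n (i.succ.removeNth v) with hR
    have hi : mulTerm i v = R := by
      change el n _ = el n _
      congr 1
      funext k
      simp only [merge, Fin.removeNth]
      rcases lt_trichotomy k i with h | rfl | h
      · rw [if_pos h, Fin.succAbove_of_castSucc_lt _ _ ((Fin.castSucc_lt_castSucc_iff.mpr h).trans Fin.castSucc_lt_succ)]
      · rw [if_neg (lt_irrefl _), if_pos rfl, hv, DGData.mul_one,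
          Fin.succAbove_of_castSucc_lt _ _ Fin.castSucc_lt_succ]
      · rw [if_neg h.not_gt, if_neg h.ne', Fin.succAbove_of_le_castSucc _ _ (Fin.succ_le_castSucc_iff.mpr h)]
    have hne : ∀ j : Fin (n + 1), j ≠ i → (j : ℕ) ≠ i + 1 → mulTerm j v = 0 := by
      intro j h1 h2
      change el n _ = 0
      rcases lt_or_gt_of_ne h1 with h | h
      · refine el_eq_zero _ i (Fin.ne_zero_of_lt h) ?_
        rw [merge, if_neg h.not_gt, if_neg h.ne', hv]
      · have h3 : (i : ℕ) + 1 < j := by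
          have := Fin.lt_def.mp h; omega
        refine el_eq_zero _ ⟨i + 1, by omega⟩ (Fin.ne_of_val_ne (Nat.succ_ne_zero _)) ?_
        rw [merge, if_pos (Fin.lt_def.mpr h3)]
        exact hv
    rw [add_apply, neg_apply, sum_apply]
    simp only [smul_apply]
    rcases eq_or_ne i (Fin.last n) with rfl | hl
    · rw [Finset.sum_eq_single (Fin.last n) (fun j _ h => by
        rw [hne j h (by have := j.2; simp; omega), smul_zero]) (by simp), hi]
      have hlast : lastTerm n v = R := by
        rw [lastTerm_apply, hR]
        congr 1
        funext k
        rw [Fin.succ_last] at hv ⊢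
        rw [Fin.removeNth_last, hv, DGData.one_mul]
        refine Fin.cases ?_ (fun k => ?_) k <;> simp [Fin.init]
      rw [Fin.succ_last] at hp
      rw [hlast, hp, zero_sub, neg_one_mul, ZMod.neg_eq_self_mod_two, Fin.val_last, neg_add_cancel]
    · have hlt : (i : ℕ) + 1 < n + 1 := by
        have := Fin.val_lt_last hl; omega
      have hs : mulTerm ⟨i + 1, hlt⟩ v = R := by
        change el n _ = el n _
        congr 1
        funext k
        simp only [merge, Fin.removeNth]
        rcases lt_trichotomy k ⟨i + 1, hlt⟩ with h | rfl | h
        · rw [if_pos h, Fin.succAbove_of_castSucc_lt]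
          exact h
        · have hv' : v (Fin.castSucc ⟨i + 1, hlt⟩) = DGData.one := hv
          rw [if_neg (lt_irrefl _), if_pos rfl, hv', DGData.one_mul, Fin.succAbove_of_le_castSucc]
          exact le_refl ((i : ℕ) + 1)
        · rw [if_neg h.not_gt, if_neg h.ne', Fin.succAbove_of_le_castSucc]
          exact h.le
      have hlast : lastTerm n v = 0 := by
        rw [lastTerm_apply]
        refine el_eq_zero _ ⟨i + 1, hlt⟩ (Fin.ne_of_val_ne (Nat.succ_ne_zero _)) ?_
        have : (⟨i + 1, hlt⟩ : Fin (n + 1)) = Fin.succ ⟨i, by omega⟩ := rfl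
        rw [this, Fin.cons_succ]
        exact hv
      rw [hlast, smul_zero, add_zero, Fintype.sum_eq_add i ⟨i + 1, hlt⟩
        (Fin.ne_of_val_ne (Nat.succ_ne_self _).symm) (fun j hj => by
          rw [hne j hj.1 (fun h => hj.2 (Fin.ext h)), smul_zero]), hi, hs]
      have h4 := rr_succ p i.succ
      rw [hp, add_zero, Fin.val_succ] at h4
      rw [h4, sgn_sub_one, neg_smul, add_neg_cancel, neg_zero]

/-- The part of the Hochschild differential involving `d`. -/
def dOp : Chain Ω →ₗ[ℂ] Chain Ω :=
  DirectSum.toModule ℂ ℕ _ fun n => descend (dPart n) (dPart_isReduced n)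

/-- The part of the Hochschild differential involving the product. -/
def mulOp : Chain Ω →ₗ[ℂ] Chain Ω :=
  DirectSum.toModule ℂ ℕ _ fun n => descend (mulPart n) (mulPart_isReduced n)

/-- The Hochschild differential `b`. -/
def bOp : Chain Ω →ₗ[ℂ] Chain Ω := dOp + mulOp

/-- The Connes operator `B`. -/
def BOp : Chain Ω →ₗ[ℂ] Chain Ω :=
  DirectSum.toModule ℂ ℕ _ fun n => descend (rotPart n) (rotPart_isReduced n)

/-- The grading operator `Γ`. -/
def gammaOp : Chain Ω →ₗ[ℂ] Chain Ω :=
  DirectSum.toModule ℂ ℕ _ fun n => descend (parPart n) (parPart_isReduced n)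

lemma toModule_el {W : Type*} [AddCommGroup W] [Module ℂ W]
    (T : (n : ℕ) → ChainN Ω n →ₗ[ℂ] W) (n : ℕ) (v : Fin (n + 1) → Ω) :
    DirectSum.toModule ℂ ℕ W T (el n v) = T n (tens n v) :=
  DirectSum.toModule_lof ℂ n _

lemma dOp_el (n : ℕ) (v : Fin (n + 1) → Ω) : dOp (el n v) = dPart n v :=
  (toModule_el _ n v).trans (descend_tens _ _ v)

lemma mulOp_el (n : ℕ) (v : Fin (n + 1) → Ω) : mulOp (el n v) = mulPart n v :=
  (toModule_el _ n v).trans (descend_tens _ _ v)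

lemma BOp_el (n : ℕ) (v : Fin (n + 1) → Ω) : BOp (el n v) = rotPart n v :=
  (toModule_el _ n v).trans (descend_tens _ _ v)

lemma gammaOp_el (n : ℕ) (v : Fin (n + 1) → Ω) : gammaOp (el n v) = parPart n v :=
  (toModule_el _ n v).trans (descend_tens _ _ v)

/-! ### The generalized trace and integrals over the unit interval -/

/-- The generalized trace
`∑ v⁽⁰⁾_{i₀ i₁} ⊗ v⁽¹⁾_{i₁ i₂} ⊗ ⋯ ⊗ v⁽ⁿ⁾_{iₙ i₀}` of matrices with entries in `Ω`. -/
def trN {l n : ℕ} (V : Fin (n + 1) → Matrix (Fin l) (Fin l) Ω) : ChainN Ω n :=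
  ∑ i : Fin (n + 1) → Fin l, tens n (fun j => V j (i j) (i (j + 1)))

/-- `a` is the integral of `c` over `[0, 1]`: this holds after application of every linear
functional. (Such an `a` is unique, since linear functionals separate the points.) -/
def IsIntegral01 {V : Type*} [AddCommGroup V] [Module ℂ V] (c : ℝ → V) (a : V) : Prop :=
  ∀ φ : Module.Dual ℂ V, Continuous (fun s => φ (c s)) ∧ φ a = ∫ s in (0 : ℝ)..1, φ (c s)

/-- Continuous curves in a finite dimensional subspace. -/
def FinCurve {V : Type*} [AddCommGroup V] [Module ℂ V] (c : ℝ → V) : Prop :=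
  ∃ (ι : Type) (_ : Fintype ι) (f : ι → ℝ → ℂ) (a : ι → V),
    (∀ k, Continuous (f k)) ∧ ∀ s, c s = ∑ k, f k s • a k

lemma FinCurve.exists_integral {V : Type*} [AddCommGroup V] [Module ℂ V] {c : ℝ → V}
    (h : FinCurve c) : ∃ a, IsIntegral01 c a := by
  obtain ⟨ι, _, f, a, hf, hc⟩ := h
  refine ⟨∑ k, (∫ s in (0 : ℝ)..1, f k s) • a k, fun φ => ?_⟩
  have h1 : (fun s => φ (c s)) = fun s => ∑ k, f k s * φ (a k) := by
    funext s; simp [hc]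
  rw [h1]
  refine ⟨continuous_finsetSum _ fun k _ => (hf k).mul continuous_const, ?_⟩
  have h2 : ∀ k ∈ (Finset.univ : Finset ι),
      IntervalIntegrable (fun s => f k s * φ (a k)) MeasureTheory.volume 0 1 := fun k _ =>
    ((hf k).mul continuous_const).intervalIntegrable _ _
  rw [intervalIntegral.integral_finsetSum h2]
  simp [intervalIntegral.integral_mul_const]

lemma FinCurve.const {V : Type*} [AddCommGroup V] [Module ℂ V] (a : V) :
    FinCurve (fun _ => a) :=
  ⟨Unit, inferInstance, fun _ _ => 1, fun _ => a, fun _ => continuous_const, by simp⟩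

lemma FinCurve.smul {V : Type*} [AddCommGroup V] [Module ℂ V] {f : ℝ → ℂ} (hf : Continuous f)
    (a : V) : FinCurve (fun s => f s • a) :=
  ⟨Unit, inferInstance, fun _ => f, fun _ => a, fun _ => hf, by simp⟩

lemma FinCurve.sum {V : Type*} [AddCommGroup V] [Module ℂ V] {κ : Type} [Fintype κ]
    {c : κ → ℝ → V} (h : ∀ k, FinCurve (c k)) : FinCurve (fun s => ∑ k, c k s) := by
  choose ι hι f a hf hc using h
  refine ⟨Σ k, ι k, inferInstance, fun k => f k.1 k.2, fun k => a k.1 k.2,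
    fun k => hf k.1 k.2, fun s => ?_⟩
  rw [Fintype.sum_sigma]
  exact Finset.sum_congr rfl fun k _ => hc k s

lemma FinCurve.multilinear {V W : Type*} [AddCommGroup V] [Module ℂ V] [AddCommGroup W]
    [Module ℂ W] {n : ℕ} (T : MultilinearMap ℂ (fun _ : Fin n => V) W) {c : Fin n → ℝ → V}
    (h : ∀ i, FinCurve (c i)) : FinCurve (fun s => T (fun i => c i s)) := by
  choose ι hι f a hf hc using h
  refine ⟨(i : Fin n) → ι i, inferInstance, fun r s => ∏ i, f i (r i) s,
    fun r => T (fun i => a i (r i)), fun r => continuous_finsetProd _ fun i _ => hf i (r i),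
    fun s => ?_⟩
  simp only [hc]
  rw [MultilinearMap.map_sum]
  exact Finset.sum_congr rfl fun r _ => MultilinearMap.map_smul_univ _ _ _

lemma FinCurve.trN {l n : ℕ} {V : ℝ → Fin (n + 1) → Matrix (Fin l) (Fin l) Ω}
    (h : ∀ j p q, FinCurve (fun s => V s j p q)) : FinCurve (fun s => trN (V s)) :=
  FinCurve.sum fun i => FinCurve.multilinear (tens n) fun j => h j (i j) (i (j + 1))

/-! ### The seminorms and the space of entire chains -/

lemma exists_rep {n : ℕ} (w : ChainN Ω n) :
    ∃ l : List (Fin (n + 1) → Ω), (l.map (tens n)).sum = w := by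
  induction w using TensorProduct.induction_on with
  | zero => exact ⟨[], rfl⟩
  | add x y hx hy =>
    obtain ⟨l, rfl⟩ := hx
    obtain ⟨l', rfl⟩ := hy
    exact ⟨l ++ l', by simp⟩
  | tmul x t =>
    induction t using PiTensorProduct.induction_on with
    | smul_tprod r f =>
      refine ⟨[Fin.cons (r • x) (fun i => redSection (f i))], ?_⟩
      simp only [List.map_cons, List.map_nil, List.sum_cons, List.sum_nil, add_zero, tens_apply,
        Fin.cons_zero, Fin.cons_succ, mk_section]
      rw [TensorProduct.smul_tmul]
    | add s t hs ht =>
      obtain ⟨l, hl⟩ := hs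
      obtain ⟨l', hl'⟩ := ht
      exact ⟨l ++ l', by simp [hl, hl', TensorProduct.tmul_add]⟩

/-- The sums `∑_α ε(ω₀^α) ⋯ ε(ωₙ^α)` over all representations `w = ∑_α ω₀^α ⊗ ⋯ ⊗ ωₙ^α`. -/
def repSet (ε : Seminorm ℂ Ω) (n : ℕ) (w : ChainN Ω n) : Set ℝ :=
  {x | ∃ l : List (Fin (n + 1) → Ω), (l.map (tens n)).sum = w ∧
    (l.map fun v => ∏ i, ε (v i)).sum = x}

lemma repSet_nonempty (ε : Seminorm ℂ Ω) (n : ℕ) (w : ChainN Ω n) : (repSet ε n w).Nonempty := by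
  obtain ⟨l, hl⟩ := exists_rep w
  exact ⟨_, l, hl, rfl⟩

lemma repSet_nonneg (ε : Seminorm ℂ Ω) (n : ℕ) (w : ChainN Ω n) : ∀ x ∈ repSet ε n w, 0 ≤ x := by
  rintro _ ⟨l, -, rfl⟩
  refine List.sum_nonneg fun x hx => ?_
  obtain ⟨v, -, rfl⟩ := List.mem_map.mp hx
  exact Finset.prod_nonneg fun i _ => apply_nonneg ε _

lemma repSet_bddBelow (ε : Seminorm ℂ Ω) (n : ℕ) (w : ChainN Ω n) : BddBelow (repSet ε n w) :=
  ⟨0, repSet_nonneg ε n w⟩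

lemma sInf_repSet_smul_le (ε : Seminorm ℂ Ω) (n : ℕ) (c : ℂ) (w : ChainN Ω n) :
    sInf (repSet ε n (c • w)) ≤ ‖c‖ * sInf (repSet ε n w) := by
  have h : ∀ x ∈ repSet ε n w, ‖c‖ * x ∈ repSet ε n (c • w) := by
    rintro _ ⟨l, rfl, rfl⟩
    refine ⟨l.map fun v => Function.update v 0 (c • v 0), ?_, ?_⟩
    · rw [List.smul_sum, List.map_map, List.map_map]
      refine congrArg List.sum (List.map_congr_left fun v _ => ?_)
      simp only [Function.comp_apply, MultilinearMap.map_update_smul, Function.update_eq_self]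
    · rw [← List.sum_map_mul_left, List.map_map]
      refine congrArg List.sum (List.map_congr_left fun v _ => ?_)
      simp only [Function.comp_apply, Fin.prod_univ_succ, Function.update_self, map_smul_eq_mul,
        Function.update_of_ne (Fin.succ_ne_zero _), mul_assoc]
  rw [← smul_eq_mul, ← Real.sInf_smul_of_nonneg (norm_nonneg c)]
  refine le_csInf (repSet_nonempty ε n w).smul_set ?_
  rintro _ ⟨x, hx, rfl⟩
  exact csInf_le (repSet_bddBelow _ _ _) (h x hx)

/-- The `π`-tensor seminorm `εₙ` on `Ω ⊗ (Ω / ℂ·1)^{⊗ n}`. -/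
def tensorSeminorm (ε : Seminorm ℂ Ω) (n : ℕ) : Seminorm ℂ (ChainN Ω n) :=
  Seminorm.ofSMulLE (fun w => sInf (repSet ε n w))
    (le_antisymm (csInf_le (repSet_bddBelow _ _ _) ⟨[], by simp⟩)
      (le_csInf (repSet_nonempty _ _ _) (repSet_nonneg _ _ _)))
    (fun w w' => by
      rw [← csInf_add (repSet_nonempty _ _ _) (repSet_bddBelow _ _ _) (repSet_nonempty _ _ _)
        (repSet_bddBelow _ _ _)]
      refine le_csInf ((repSet_nonempty _ _ _).add (repSet_nonempty _ _ _)) ?_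
      rintro _ ⟨_, ⟨l, hl, rfl⟩, _, ⟨l', hl', rfl⟩, rfl⟩
      exact csInf_le (repSet_bddBelow _ _ _) ⟨l ++ l', by simp [hl, hl'], by simp⟩)
    (sInf_repSet_smul_le ε n)

lemma tensorSeminorm_apply (ε : Seminorm ℂ Ω) (n : ℕ) (w : ChainN Ω n) :
    tensorSeminorm ε n w = sInf (repSet ε n w) := rfl

lemma tensorSeminorm_tens_le (ε : Seminorm ℂ Ω) (n : ℕ) (v : Fin (n + 1) → Ω) :
    tensorSeminorm ε n (tens n v) ≤ ∏ i, ε (v i) :=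
  csInf_le (repSet_bddBelow _ _ _) ⟨[v], by simp, by simp⟩

lemma slot_single_self (n : ℕ) (a : ChainN Ω n) : slot Ω n (single Ω n a) = a :=
  DirectSum.component.lof_self ℂ n a

lemma slot_single_ne {m n : ℕ} (h : n ≠ m) (a : ChainN Ω n) : slot Ω m (single Ω n a) = 0 := by
  exact DFinsupp.single_eq_of_ne h.symm

lemma finite_slot (w : Chain Ω) : {n | slot Ω n w ≠ 0}.Finite :=
  DFinsupp.finite_support w

lemma summable_kappa (ε : Seminorm ℂ Ω) (w : Chain Ω) :
    Summable (fun n => tensorSeminorm ε n (slot Ω n w) / √(n.factorial : ℝ)) := by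
  refine summable_of_hasFiniteSupport ((finite_slot w).subset fun n hn h => hn ?_)
  simp [h]

/-- The seminorm `κ_ε(w) = ∑ₙ εₙ(wₙ) / √(n!)`. -/
def kappa (ε : Seminorm ℂ Ω) : Seminorm ℂ (Chain Ω) :=
  Seminorm.of (fun w => ∑' n : ℕ, tensorSeminorm ε n (slot Ω n w) / √(n.factorial : ℝ))
    (fun w w' => by
      rw [← (summable_kappa ε w).tsum_add (summable_kappa ε w')]
      refine (summable_kappa ε (w + w')).tsum_le_tsum (fun n => ?_)
        ((summable_kappa ε w).add (summable_kappa ε w'))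
      rw [← add_div, map_add]
      gcongr
      exact map_add_le_add _ _ _)
    (fun c w => by
      rw [← tsum_mul_left]
      refine tsum_congr fun n => ?_
      rw [map_smul, map_smul_eq_mul, mul_div_assoc])

lemma kappa_apply (ε : Seminorm ℂ Ω) (w : Chain Ω) :
    kappa ε w = ∑' n : ℕ, tensorSeminorm ε n (slot Ω n w) / √(n.factorial : ℝ) := rfl

lemma kappa_single (ε : Seminorm ℂ Ω) (n : ℕ) (a : ChainN Ω n) :
    kappa ε (single Ω n a) = tensorSeminorm ε n a / √(n.factorial : ℝ) := by
  rw [kappa_apply, tsum_eq_single n (fun m hm => by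
    rw [slot_single_ne hm.symm, map_zero, zero_div]), slot_single_self]

lemma kappa_el_le (ε : Seminorm ℂ Ω) (n : ℕ) (v : Fin (n + 1) → Ω) :
    kappa ε (el n v) ≤ (∏ i, ε (v i)) / √(n.factorial : ℝ) := by
  refine (kappa_single ε n (tens n v)).trans_le ?_
  gcongr
  exact tensorSeminorm_tens_le ε n v

lemma sum_single (w : Chain Ω) :
    w = ∑ n ∈ (finite_slot w).toFinset, single Ω n (slot Ω n w) := by
  refine DirectSum.ext_component ℂ fun m => ?_
  change slot Ω m w = slot Ω m _
  rw [map_sum]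
  by_cases hm : slot Ω m w = 0
  · rw [hm, Finset.sum_eq_zero]
    intro n _
    rcases eq_or_ne n m with rfl | h
    · rw [slot_single_self, hm]
    · exact slot_single_ne h _
  · rw [Finset.sum_eq_single m (fun n _ h => slot_single_ne h _) (fun h => by simp [hm] at h),
      slot_single_self]

/-- To bound a seminorm by `κ_ε` it suffices to do so on elementary tensors. -/
lemma le_kappa (q : Seminorm ℂ (Chain Ω)) (ε : Seminorm ℂ Ω)
    (h : ∀ n (v : Fin (n + 1) → Ω), q (el n v) ≤ (∏ i, ε (v i)) / √(n.factorial : ℝ))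
    (w : Chain Ω) : q w ≤ kappa ε w := by
  have h1 : ∀ n (a : ChainN Ω n), q (single Ω n a) ≤ tensorSeminorm ε n a / √(n.factorial : ℝ) := by
    intro n a
    have hpos : 0 < √(n.factorial : ℝ) := Real.sqrt_pos.mpr (by positivity)
    rw [le_div_iff₀ hpos, tensorSeminorm_apply]
    refine le_csInf (repSet_nonempty _ _ _) ?_
    rintro _ ⟨l, rfl, rfl⟩
    rw [← le_div_iff₀ hpos]
    induction l with
    | nil => simp
    | cons v l ih =>
      simp only [List.map_cons, List.sum_cons, map_add, add_div]
      exact (map_add_le_add _ _ _).trans (add_le_add (h n v) ih)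
  conv_lhs => rw [sum_single w]
  refine (Finset.le_sum_of_subadditive q (map_zero q).le (map_add_le_add q) _ _).trans ?_
  refine (Finset.sum_le_sum fun n _ => h1 n _).trans ?_
  exact (summable_kappa ε w).sum_le_tsum _ (fun n _ => by positivity)

variable (Ω) in
/-- The seminorms `κ_ε`, where `ε` runs through the continuous seminorms of `Ω`. -/
def chainSeminorms : SeminormFamily ℂ (Chain Ω) {ε : Seminorm ℂ Ω // Continuous ε} :=
  fun ε => kappa ε.1

instance : Nonempty {ε : Seminorm ℂ Ω // Continuous ε} := ⟨⟨0, continuous_const⟩⟩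

/-- The locally convex topology on the space of cyclic chains defined by the seminorms `κ_ε`. -/
instance : TopologicalSpace (Chain Ω) := (chainSeminorms Ω).moduleFilterBasis.topology

lemma withSeminorms_chain : WithSeminorms (chainSeminorms Ω) := ⟨rfl⟩

instance : IsTopologicalAddGroup (Chain Ω) := withSeminorms_chain.topologicalAddGroup

instance : ContinuousSMul ℂ (Chain Ω) := withSeminorms_chain.continuousSMul

instance : UniformSpace (Chain Ω) := IsTopologicalAddGroup.rightUniformSpace (Chain Ω)

instance : IsUniformAddGroup (Chain Ω) := isUniformAddGroup_of_addCommGroup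

instance : UniformContinuousConstSMul ℂ (Chain Ω) :=
  uniformContinuousConstSMul_of_continuousConstSMul ℂ _

lemma continuous_of_le (T : Chain Ω →ₗ[ℂ] Chain Ω)
    (h : ∀ ε : Seminorm ℂ Ω, Continuous ε → ∃ ε' : Seminorm ℂ Ω, Continuous ε' ∧
      ∀ n (v : Fin (n + 1) → Ω),
        kappa ε (T (el n v)) ≤ (∏ i, ε' (v i)) / √(n.factorial : ℝ)) : Continuous T := by
  refine WithSeminorms.continuous_of_isBounded withSeminorms_chain withSeminorms_chain T ?_
  rintro ⟨ε, hε⟩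
  obtain ⟨ε', hε', hb⟩ := h ε hε
  refine ⟨{⟨ε', hε'⟩}, 1, fun w => ?_⟩
  rw [Finset.sup_singleton, one_smul]
  exact le_kappa ((kappa ε).comp T) ε' hb w

variable [PolynormableSpace ℂ Ω]

lemma continuous_prj (p : ZMod 2) : Continuous (prj p : Ω → Ω) := by
  have hw := PolynormableSpace.withSeminorms ℂ Ω
  have := hw.topologicalAddGroup
  have := hw.continuousSMul
  have h : Continuous fun x : Ω => (if p = 0 then (1 : ℂ) else -1) • DGData.par x :=
    DGData.continuous_par.const_smul _
  exact (continuous_id.add h).const_smul (1 / 2 : ℂ)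

lemma norm_sgn (a : ZMod 2) : ‖sgn a‖ = 1 := by
  rw [sgn]; split_ifs <;> simp

lemma continuous_of_homog (T : Chain Ω →ₗ[ℂ] Chain Ω)
    (F : (n : ℕ) → (Fin (n + 1) → ZMod 2) →
      MultilinearMap ℂ (fun _ : Fin (n + 1) => Ω) (Chain Ω))
    (hT : ∀ n v, T (el n v) = homog (F n) v)
    (h : ∀ ε : Seminorm ℂ Ω, Continuous ε → ∃ ε' : Seminorm ℂ Ω, Continuous ε' ∧
      ∀ n (p : Fin (n + 1) → ZMod 2) (v : Fin (n + 1) → Ω),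
        kappa ε (F n p v) ≤ (∏ i, ε' (v i)) / √(n.factorial : ℝ)) : Continuous T := by
  refine continuous_of_le T fun ε hε => ?_
  obtain ⟨δ, hδ, hb⟩ := h ε hε
  refine ⟨(2 : ℝ≥0) • (δ.comp (prj 0) + δ.comp (prj 1)), ?_, fun n v => ?_⟩
  · have h1 : Continuous fun x => (2 : ℝ) * (δ (prj 0 x) + δ (prj 1 x)) :=
      continuous_const.mul ((hδ.comp (continuous_prj 0)).add (hδ.comp (continuous_prj 1)))
    exact h1
  have hp : ∀ (p : ZMod 2) (x : Ω), δ (prj p x) ≤ δ (prj 0 x) + δ (prj 1 x) := by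
    intro p x
    have key : ∀ p : ZMod 2, p = 0 ∨ p = 1 := by decide
    rcases key p with rfl | rfl
    · exact le_add_of_nonneg_right (apply_nonneg _ _)
    · exact le_add_of_nonneg_left (apply_nonneg _ _)
  rw [hT, homog_apply]
  refine (Finset.le_sum_of_subadditive _ (map_zero _).le (map_add_le_add _) _ _).trans ?_
  have h2 : ∀ p ∈ (Finset.univ : Finset (Fin (n + 1) → ZMod 2)),
      kappa ε (F n p fun i => prj (p i) (v i)) ≤
        (∏ i, (δ (prj 0 (v i)) + δ (prj 1 (v i)))) / √(n.factorial : ℝ) := fun p _ =>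
    (hb n p _).trans (by
      gcongr with i
      exact hp _ _)
  refine (Finset.sum_le_card_nsmul _ _ _ h2).trans_eq ?_
  have h3 : ∀ x, ((2 : ℝ≥0) • (δ.comp (prj 0) + δ.comp (prj 1))) x =
      2 * (δ (prj 0 x) + δ (prj 1 x)) := fun x => rfl
  simp only [h3, Finset.prod_mul_distrib, Finset.prod_const, Finset.card_univ, Fintype.card_pi,
    ZMod.card, Fintype.card_fin, nsmul_eq_mul, Nat.cast_pow, Nat.cast_ofNat]
  ring

lemma exists_mul_bound (ε : Seminorm ℂ Ω) (hε : Continuous ε) :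
    ∃ δ : Seminorm ℂ Ω, Continuous δ ∧ ∀ x y, ε (DGData.mul x y) ≤ δ x * δ y := by
  have h1 : Continuous fun x : Ω × Ω => ε (DGData.mul x.1 x.2) :=
    hε.comp DGData.continuous_mul
  have h2 : {x : Ω × Ω | ε (DGData.mul x.1 x.2) < 1} ∈ nhds ((0 : Ω), (0 : Ω)) :=
    (isOpen_lt h1 continuous_const).mem_nhds (by simp)
  obtain ⟨U, hU, V, hV, hUV⟩ := mem_nhds_prod_iff.mp h2
  have hw := PolynormableSpace.withSeminorms ℂ Ω
  obtain ⟨s, r, hr, hs⟩ := (hw.mem_nhds_iff 0 (U ∩ V)).mp (Filter.inter_mem hU hV)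
  set q : Seminorm ℂ Ω := s.sup (fun p : {p : Seminorm ℂ Ω // Continuous p} => p.1) with hq
  have := hw.topologicalAddGroup
  have hqc : Continuous q := Seminorm.continuous_finsetSup fun i _ => i.2
  have hr2 : 0 < 2 / r := by positivity
  have key : ∀ x y, ε (DGData.mul x y) ≤ (2 / r * q x) * (2 / r * q y) := by
    have h3 : ∀ t > 0, ∀ s > 0, ∀ x y, q x < t * r → q y < s * r →
        ε (DGData.mul x y) ≤ t * s := by
      intro t ht s hs' x y hx hy
      have h4 : ∀ (t : ℝ) (x : Ω), 0 < t → q x < t * r → (t⁻¹ : ℂ) • x ∈ U ∩ V := by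
        intro t x ht hx
        refine hs ?_
        rw [Seminorm.mem_ball_zero, map_smul_eq_mul, norm_inv, Complex.norm_real,
          Real.norm_of_nonneg ht.le, inv_mul_lt_iff₀ ht]
        exact hx
      have h5 : ε (DGData.mul ((t⁻¹ : ℂ) • x) ((s⁻¹ : ℂ) • y)) < 1 :=
        hUV (Set.mk_mem_prod (h4 t x ht hx).1 (h4 s y hs' hy).2)
      rw [map_smul, LinearMap.map_smul₂, map_smul_eq_mul, map_smul_eq_mul, norm_inv,
        norm_inv, Complex.norm_real, Complex.norm_real, Real.norm_of_nonneg ht.le,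
        Real.norm_of_nonneg hs'.le, inv_mul_lt_iff₀ hs', inv_mul_lt_iff₀ ht] at h5
      linarith
    intro x y
    refine le_of_forall_pos_le_add fun e he => ?_
    have h6 : Filter.Tendsto (fun c : ℝ => (2 / r * q x + c) * (2 / r * q y + c))
        (nhdsWithin 0 (Set.Ioi 0)) (nhds ((2 / r * q x + 0) * (2 / r * q y + 0))) := by
      refine Filter.Tendsto.mono_left ?_ nhdsWithin_le_nhds
      exact Continuous.tendsto (by fun_prop) 0
    rw [add_zero, add_zero] at h6
    have h7 := (h6.eventually (gt_mem_nhds (lt_add_of_pos_right _ he))).and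
      self_mem_nhdsWithin
    obtain ⟨c, hc, hc0⟩ := h7.exists
    have hc0 : 0 < c := hc0
    have h8 : ∀ x, q x < (2 / r * q x + c) * r := by
      intro x
      have h9 : (2 / r * q x + c) * r = 2 * q x + c * r := by field_simp
      have := apply_nonneg q x
      have := mul_pos hc0 hr
      rw [h9]
      linarith
    have h9 : ∀ x, 0 < 2 / r * q x + c := fun x => by
      have := apply_nonneg q x
      positivity
    exact (h3 _ (h9 x) _ (h9 y) x y (h8 x) (h8 y)).trans hc.le
  refine ⟨Real.toNNReal (2 / r) • q, ?_, fun x y => ?_⟩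
  swap
  · have h3 : ∀ x, (Real.toNNReal (2 / r) • q) x = 2 / r * q x := fun x => by
      rw [smul_apply, NNReal.smul_def, Real.coe_toNNReal _ hr2.le, smul_eq_mul]
    rw [h3, h3]
    exact key x y
  have : Continuous fun x => (Real.toNNReal (2 / r) : ℝ) * q x := continuous_const.mul hqc
  exact this

lemma sum_bound {ι : Type*} (s : Finset ι) (q : Seminorm ℂ (Chain Ω)) (f : ι → Chain Ω) (c : ℝ)
    (h : ∀ i ∈ s, q (f i) ≤ c) (a : ι → ZMod 2) : q (∑ i ∈ s, sgn (a i) • f i) ≤ s.card * c := by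
  refine (Finset.le_sum_of_subadditive _ (map_zero _).le (map_add_le_add _) _ _).trans ?_
  rw [← nsmul_eq_mul]
  refine Finset.sum_le_card_nsmul _ _ _ fun i hi => ?_
  rw [map_smul_eq_mul, norm_sgn, one_mul]
  exact h i hi

lemma natCast_le_two_pow (n : ℕ) : (n : ℝ) ≤ 2 ^ n := by
  exact_mod_cast Nat.lt_two_pow_self.le

lemma continuous_dOp : Continuous (dOp : Chain Ω →ₗ[ℂ] Chain Ω) := by
  refine continuous_of_homog dOp _ dOp_el fun ε hε => ?_
  refine ⟨(2 : ℝ≥0) • (ε + ε.comp DGData.d), ?_, fun n p v => ?_⟩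
  · have h1 : Continuous fun x => (2 : ℝ) * (ε x + ε (DGData.d x)) :=
      continuous_const.mul (hε.add (hε.comp DGData.continuous_d))
    exact h1
  have h3 : ∀ x, ((2 : ℝ≥0) • (ε + ε.comp DGData.d)) x = 2 * (ε x + ε (DGData.d x)) :=
    fun x => rfl
  simp only [h3, Finset.prod_mul_distrib, Finset.prod_const, Finset.card_univ, Fintype.card_fin]
  rw [neg_apply, map_neg_eq_map, sum_apply]
  simp only [smul_apply]
  refine (sum_bound _ _ _ ((∏ i, (ε (v i) + ε (DGData.d (v i)))) / √(n.factorial : ℝ))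
    (fun i _ => ?_) _).trans ?_
  · rw [dTerm, MultilinearMap.compLinearMap_apply]
    refine (kappa_el_le _ _ _).trans ?_
    gcongr with k
    rcases eq_or_ne k i with rfl | hk
    · rw [Function.update_self]
      exact le_add_of_nonneg_left (apply_nonneg _ _)
    · rw [Function.update_of_ne hk]
      exact le_add_of_nonneg_right (apply_nonneg _ _)
  · rw [Finset.card_univ, Fintype.card_fin, mul_div_assoc]
    gcongr
    exact natCast_le_two_pow _

lemma prod_merge_le {n : ℕ} (ε δ : Seminorm ℂ Ω) (h1 : ∀ x, ε x ≤ δ x)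
    (h2 : ∀ x y, ε (DGData.mul x y) ≤ δ x * δ y) (j : Fin (n + 1)) (v : Fin (n + 2) → Ω) :
    ∏ k, ε (merge j v k) ≤ ∏ k, δ (v k) := by
  rw [Fin.prod_univ_succAbove _ j.succ, Fin.prod_univ_succAbove _ j,
    Fin.prod_univ_succAbove (fun k => δ (v (j.succ.succAbove k))) j, ← mul_assoc]
  have hj : j.succ.succAbove j = j.castSucc :=
    Fin.succAbove_of_castSucc_lt _ _ Fin.castSucc_lt_succ
  refine mul_le_mul ?_ (Finset.prod_le_prod (fun _ _ => apply_nonneg _ _) fun k _ => ?_)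
    (Finset.prod_nonneg fun _ _ => apply_nonneg _ _)
    (mul_nonneg (apply_nonneg _ _) (apply_nonneg _ _))
  · rw [hj, mul_comm, merge, if_neg (lt_irrefl _), if_pos rfl]
    exact h2 _ _
  · refine le_of_eq_of_le ?_ (h1 _)
    have hk := Fin.succAbove_ne j k
    rcases lt_or_gt_of_ne hk with h | h
    · rw [merge, if_pos h, Fin.succAbove_of_castSucc_lt _ _
        ((Fin.castSucc_lt_castSucc_iff.mpr h).trans Fin.castSucc_lt_succ)]
    · rw [merge, if_neg h.not_gt, if_neg h.ne', Fin.succAbove_of_le_castSucc j.succ _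
        (Fin.succ_le_castSucc_iff.mpr h)]

lemma continuous_mulOp :
    Continuous (mulOp : Chain Ω →ₗ[ℂ] Chain Ω) := by
  refine continuous_of_homog mulOp (fun n => match n with
    | 0 => 0
    | n + 1 => fun p => - (∑ i : Fin (n + 1), sgn (rr p (i + 1)) • mulTerm i) +
        sgn ((p (Fin.last (n + 1)) - 1) * rr p (n + 1)) • lastTerm n) ?_ fun ε hε => ?_
  · intro n v
    rw [mulOp_el]
    cases n with
    | zero => simp [mulPart, homog]
    | succ n => rfl
  obtain ⟨δ, hδ, hm⟩ := exists_mul_bound ε hε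
  refine ⟨(4 : ℝ≥0) • (ε + δ), ?_, fun n p v => ?_⟩
  · have h1 : Continuous fun x => (4 : ℝ) * (ε x + δ x) := continuous_const.mul (hε.add hδ)
    exact h1
  have h3 : ∀ x, ((4 : ℝ≥0) • (ε + δ)) x = 4 * (ε + δ) x := fun x => rfl
  have h4 : ∀ x, ε x ≤ (ε + δ) x := fun x => le_add_of_nonneg_right (apply_nonneg _ _)
  have h5 : ∀ x y, ε (DGData.mul x y) ≤ (ε + δ) x * (ε + δ) y := fun x y =>
    (hm x y).trans (mul_le_mul (le_add_of_nonneg_left (apply_nonneg ε x))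
      (le_add_of_nonneg_left (apply_nonneg ε y)) (apply_nonneg δ y) (apply_nonneg (ε + δ) x))
  cases n with
  | zero =>
    rw [show kappa ε ((0 : (Fin (0 + 1) → ZMod 2) →
      MultilinearMap ℂ (fun _ : Fin (0 + 1) => Ω) (Chain Ω)) p v) = 0 from map_zero (kappa ε)]
    exact div_nonneg (Finset.prod_nonneg fun _ _ => apply_nonneg _ _) (Real.sqrt_nonneg _)
  | succ n =>
    set Q := ∏ k, (ε + δ) (v k) with hQ
    have hQ0 : 0 ≤ Q := Finset.prod_nonneg fun _ _ => apply_nonneg _ _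
    have h6 : ∀ i : Fin (n + 1), kappa ε (mulTerm i v) ≤ Q / √(n.factorial : ℝ) := fun i =>
      (kappa_el_le _ _ _).trans (by gcongr; exact prod_merge_le ε (ε + δ) h4 h5 i v)
    have h7 : kappa ε (lastTerm n v) ≤ Q / √(n.factorial : ℝ) := by
      refine (kappa_el_le _ _ _).trans ?_
      gcongr
      refine (prod_merge_le ε (ε + δ) h4 h5 0 _).trans_eq ?_
      exact Equiv.prod_comp (finRotate (n + 2)).symm (fun k => (ε + δ) (v k))
    rw [add_apply, neg_apply, sum_apply, smul_apply]
    simp only [FunLike.coe_smul, Pi.smul_apply]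
    refine (map_add_le_add _ _ _).trans ?_
    rw [map_neg_eq_map, map_smul_eq_mul, norm_sgn, one_mul]
    refine (add_le_add (sum_bound _ _ _ _ (fun i _ => h6 i) _) h7).trans ?_
    have h13 : ∏ i, ((4 : ℝ≥0) • (ε + δ)) (v i) = 4 ^ (n + 1 + 1) * Q := by
      rw [Finset.prod_congr rfl fun i _ => h3 (v i), Finset.prod_mul_distrib, Finset.prod_const,
        Finset.card_univ, Fintype.card_fin]
    refine le_of_le_of_eq ?_
      (congrArg (fun z => z / √((n + 1).factorial : ℝ)) h13.symm)
    rw [Finset.card_univ, Fintype.card_fin, ← add_one_mul, Nat.factorial_succ, Nat.cast_mul, Real.sqrt_mul (by positivity)]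
    have h8 : (0 : ℝ) < √(n.factorial : ℝ) := Real.sqrt_pos.mpr (by positivity)
    have h9 : (0 : ℝ) < √((n + 1 : ℕ) : ℝ) := Real.sqrt_pos.mpr (by positivity)
    have h10 : √((n + 1 : ℕ) : ℝ) ≤ 2 ^ (n + 2) := by
      have h := natCast_le_two_pow (n + 2)
      rw [Real.sqrt_le_iff]
      have h1 : (1 : ℝ) ≤ 2 ^ (n + 2) := one_le_pow₀ (by norm_num)
      push_cast at h ⊢
      exact ⟨by positivity, by nlinarith⟩
    have h11 : ((n + 1 : ℕ) : ℝ) + 1 ≤ 2 ^ (n + 2) := by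
      have := natCast_le_two_pow (n + 2)
      push_cast at this ⊢
      linarith
    rw [mul_div_assoc', div_le_div_iff₀ h8 (by positivity)]
    have h12 : (((n + 1 : ℕ) : ℝ) + 1) * √((n + 1 : ℕ) : ℝ) ≤ 4 ^ (n + 1 + 1) := by
      calc _ ≤ (2 : ℝ) ^ (n + 2) * 2 ^ (n + 2) := by gcongr
        _ = 4 ^ (n + 1 + 1) := by rw [← mul_pow]; norm_num
    calc _ = ((((n + 1 : ℕ) : ℝ) + 1) * √((n + 1 : ℕ) : ℝ)) * (Q * √(n.factorial : ℝ)) := by ring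
      _ ≤ 4 ^ (n + 1 + 1) * (Q * √(n.factorial : ℝ)) := by gcongr
      _ = _ := by ring

lemma continuous_BOp : Continuous (BOp : Chain Ω →ₗ[ℂ] Chain Ω) := by
  refine continuous_of_homog BOp _ BOp_el fun ε hε => ?_
  set c : ℝ≥0 := 2 * (1 + ⟨ε DGData.one, apply_nonneg _ _⟩) with hc
  refine ⟨c • ε, ?_, fun n p v => ?_⟩
  · have h1 : Continuous fun x => (c : ℝ) * ε x := continuous_const.mul hε
    exact h1
  have h3 : ∀ x, (c • ε) x = c * ε x := fun x => rfl
  simp only [h3, Finset.prod_mul_distrib, Finset.prod_const, Finset.card_univ, Fintype.card_fin]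
  rw [sum_apply]
  simp only [smul_apply]
  have he : 0 ≤ ε (DGData.one : Ω) := apply_nonneg _ _
  refine (sum_bound _ _ _ (ε DGData.one * ((∏ i, ε (v i)) / √(n.factorial : ℝ)))
    (fun i _ => ?_) _).trans ?_
  · rw [rotTerm, MultilinearMap.domDomCongr_apply, MultilinearMap.curryLeft_apply]
    refine (kappa_el_le _ _ _).trans ?_
    rw [Fin.prod_univ_succ, ← mul_div_assoc]
    simp only [Fin.cons_zero, Fin.cons_succ]
    rw [Equiv.prod_comp (Equiv.addRight i) (fun k => ε (v k))]
    have : 0 ≤ ∏ i, ε (v i) := Finset.prod_nonneg fun _ _ => apply_nonneg _ _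
    have h8 : (0 : ℝ) < √(n.factorial : ℝ) := Real.sqrt_pos.mpr (by positivity)
    gcongr
    omega
  · rw [Finset.card_univ, Fintype.card_fin, ← mul_assoc, mul_div_assoc]
    have : 0 ≤ ∏ i, ε (v i) := Finset.prod_nonneg fun _ _ => apply_nonneg _ _
    gcongr
    rw [hc]
    push_cast
    rw [mul_pow]
    gcongr
    · exact_mod_cast natCast_le_two_pow (n + 1)
    · have h4 : (1 : ℝ) ≤ 1 + ε DGData.one := by linarith
      exact (le_add_of_nonneg_left zero_le_one).trans (le_self_pow₀ h4 (by simp))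

lemma continuous_gammaOp : Continuous (gammaOp : Chain Ω →ₗ[ℂ] Chain Ω) := by
  refine continuous_of_le gammaOp fun ε hε => ⟨ε.comp DGData.par,
    hε.comp DGData.continuous_par, fun n v => ?_⟩
  rw [gammaOp_el, parPart, smul_apply, map_smul_eq_mul, norm_pow, norm_neg, norm_one, one_pow,
    one_mul, MultilinearMap.compLinearMap_apply]
  exact kappa_el_le _ _ _

/-! ### Entire chains, the Chen normalization, and its homology -/

variable (Ω) in
/-- The space of entire cyclic chains: the Hausdorff completion of the space of cyclic chains with
respect to the seminorms `κ_ε`. -/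
abbrev EChain := UniformSpace.Completion (Chain Ω)

/-- The inclusion of the cyclic chains into the entire cyclic chains. -/
def incl : Chain Ω →ₗ[ℂ] EChain Ω where
  toFun w := (w : EChain Ω)
  map_add' := UniformSpace.Completion.coe_add
  map_smul' c w := UniformSpace.Completion.coe_smul c w

variable (Ω) in
/-- The operator `b + B` on entire cyclic chains. -/
def bB : EChain Ω →L[ℂ] EChain Ω :=
  (⟨bOp + BOp, (continuous_dOp.add continuous_mulOp).add continuous_BOp⟩ :
    Chain Ω →L[ℂ] Chain Ω).completion

variable (Ω) in
/-- The grading operator on entire cyclic chains. -/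
def gammaE : EChain Ω →L[ℂ] EChain Ω :=
  (⟨gammaOp, continuous_gammaOp⟩ : Chain Ω →L[ℂ] Chain Ω).completion

variable (Ω) in
/-- The even entire cyclic chains. -/
def evenChains : Submodule ℂ (EChain Ω) where
  carrier := {w | gammaE Ω w = w}
  add_mem' h h' := by
    simp only [Set.mem_ofPred_eq] at *
    rw [map_add, h, h']
  zero_mem' := map_zero _
  smul_mem' c w h := by
    simp only [Set.mem_ofPred_eq] at *
    rw [map_smul, h]

variable (Ω) in
/-- The odd entire cyclic chains. -/
def oddChains : Submodule ℂ (EChain Ω) where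
  carrier := {w | gammaE Ω w = -w}
  add_mem' h h' := by
    simp only [Set.mem_ofPred_eq] at *
    rw [map_add, h, h', neg_add]
  zero_mem' := by simp
  smul_mem' c w h := by
    simp only [Set.mem_ofPred_eq] at *
    rw [map_smul, h, smul_neg]

/-- The Chen subspace of the cyclic chains, for a space `F` of elements of degree `0`. It is spanned
by the chains `⟨ω₀ ⊗ ⋯ ⊗ ωₙ⟩` with `ω_r ∈ F` for some `r ≥ 1`, and by the chains
`⟨⋯ ⊗ ω_j f ⊗ ω_{j+1} ⊗ ⋯⟩ + ⟨⋯ ⊗ ω_j ⊗ df ⊗ ω_{j+1} ⊗ ⋯⟩ - ⟨⋯ ⊗ ω_j ⊗ f ω_{j+1} ⊗ ⋯⟩`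
with `f ∈ F`. In the second relation the index `j + 1` is read cyclically: if `df` stands in the
last slot, then the last summand is `⟨f ω₀ ⊗ ω₁ ⊗ ⋯⟩`. -/
def chenSubspace (F : Submodule ℂ Ω) : Submodule ℂ (Chain Ω) :=
  Submodule.span ℂ
    ({w | ∃ (n : ℕ) (v : Fin (n + 1) → Ω) (r : Fin (n + 1)), r ≠ 0 ∧ v r ∈ F ∧ w = el n v} ∪
     {w | ∃ (n : ℕ) (v : Fin (n + 1) → Ω) (j : Fin (n + 1)) (f : Ω), f ∈ F ∧
        w = el n (Function.update v j (DGData.mul (v j) f)) +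
          el (n + 1) (j.succ.insertNth (DGData.d f) v) -
          el n (Function.update v (j + 1) (DGData.mul f (v (j + 1))))})

/-- The closure of the Chen subspace in the entire cyclic chains. -/
def chenClosure (F : Submodule ℂ Ω) : Submodule ℂ (EChain Ω) :=
  ((chenSubspace F).map incl).topologicalClosure

/-- The Chen normalized entire cyclic chains. -/
abbrev NChain (F : Submodule ℂ Ω) := EChain Ω ⧸ chenClosure F

/-- The class in the Chen normalized complex of `(b + B) w`. -/
def bBN (F : Submodule ℂ Ω) : EChain Ω →ₗ[ℂ] NChain F :=
  (chenClosure F).mkQ ∘ₗ (bB Ω : EChain Ω →ₗ[ℂ] EChain Ω)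

/-- The odd cycles of the Chen normalized complex: the classes of all odd entire chains `w` such that
`(b + B) w` vanishes in the Chen normalized complex. -/
def oddCycles (F : Submodule ℂ Ω) : Submodule ℂ (NChain F) :=
  (oddChains Ω ⊓ LinearMap.ker (bBN F)).map (chenClosure F).mkQ

/-- The boundaries `(b + B) w` in the Chen normalized complex, where `w` is an even entire chain. -/
def oddBoundaries (F : Submodule ℂ Ω) : Submodule ℂ (NChain F) :=
  (evenChains Ω).map (bBN F)

/-- The odd homology of the Chen normalized entire cyclic complex. -/
abbrev HNOdd (F : Submodule ℂ Ω) :=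
  oddCycles F ⧸ (oddBoundaries F).comap (oddCycles F).subtype

end Chains

section Manifold

variable {E : Type*} [NormedAddCommGroup E] [NormedSpace ℝ E] [FiniteDimensional ℝ E]
  {H : Type*} [TopologicalSpace H] {I : ModelWithCorners ℝ E H}
  {M : Type*} [TopologicalSpace M] [ChartedSpace H M] [IsManifold I ∞ M]

instance : DGData (OmegaT I M) where
  one := funT I M 1
  mul := mulT
  d := dT
  par := parT
  one_mul := one_mulT
  mul_one := mulT_one
  d_one := dT_one
  par_one := parT_funT 1
  continuous_mul := continuous_mulT
  continuous_d := continuous_dT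
  continuous_par := continuous_parT

/-! ### Smooth maps to the unitary groups -/

variable (I M) in
/-- Smooth maps `M → U(l)`, given by their matrix entries. -/
structure SmoothU (l : ℕ) where
  entry : Matrix (Fin l) (Fin l) (CFun I M)
  unitary : ∀ x : M, (Matrix.of fun i j => entry i j x) ∈ Matrix.unitaryGroup (Fin l) ℂ

/-- The unitary matrix `g(x)`. -/
def SmoothU.eval {l : ℕ} (g : SmoothU I M l) (x : M) : Matrix (Fin l) (Fin l) ℂ :=
  Matrix.of fun i j => g.entry i j x

variable (I M) in
/-- The constant map with value the identity matrix. -/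
def SmoothU.one (l : ℕ) : SmoothU I M l where
  entry := 1
  unitary x := by
    have h : (Matrix.of fun i j => (1 : Matrix (Fin l) (Fin l) (CFun I M)) i j x) = 1 := by
      ext i j
      rcases eq_or_ne i j with rfl | h
      · simp
      · simp [Matrix.one_apply_ne h]
    rw [h]
    exact one_mem _

/-- The direct sum `g ⊕ h` (block diagonal matrix). -/
def SmoothU.directSum {l m : ℕ} (g : SmoothU I M l) (h : SmoothU I M m) : SmoothU I M (l + m) where
  entry := (Matrix.fromBlocks g.entry 0 0 h.entry).reindex finSumFinEquiv finSumFinEquiv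
  unitary x := by
    have e : (Matrix.of fun i j => ((Matrix.fromBlocks g.entry 0 0 h.entry).reindex
        finSumFinEquiv finSumFinEquiv) i j x) =
        (Matrix.fromBlocks (g.eval x) 0 0 (h.eval x)).reindex finSumFinEquiv finSumFinEquiv := by
      ext i j
      simp only [Matrix.of_apply, Matrix.reindex_apply, Matrix.submatrix_apply]
      rcases finSumFinEquiv.symm i with i | i <;> rcases finSumFinEquiv.symm j with j | j <;> rfl
    have hg := Matrix.mem_unitaryGroup_iff.mp (g.unitary x)
    have hh := Matrix.mem_unitaryGroup_iff.mp (h.unitary x)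
    rw [Matrix.star_eq_conjTranspose] at hg hh
    change g.eval x * (g.eval x).conjTranspose = 1 at hg
    change h.eval x * (h.eval x).conjTranspose = 1 at hh
    rw [e, Matrix.mem_unitaryGroup_iff, Matrix.star_eq_conjTranspose]
    simp only [Matrix.reindex_apply, Matrix.conjTranspose_submatrix, Matrix.submatrix_mul_equiv,
      Matrix.fromBlocks_conjTranspose, Matrix.fromBlocks_multiply, Matrix.conjTranspose_zero,
      Matrix.mul_zero, Matrix.zero_mul, add_zero, zero_add, hg, hh, Matrix.fromBlocks_one,
      Matrix.submatrix_one_equiv]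

/-- Smooth homotopy of smooth maps `M → U(l)`. -/
def SmoothU.Homotopic {l : ℕ} (g₀ g₁ : SmoothU I M l) : Prop :=
  ∃ G : SmoothU (I.prod (𝓡∂ 1)) (M × unitInterval) l,
    ∀ x : M, G.eval (x, 0) = g₀.eval x ∧ G.eval (x, 1) = g₁.eval x

variable (I M) in
/-- The relations defining `K⁻¹(M)`. -/
def kRel : Set (FreeAbelianGroup (Σ l, SmoothU I M l)) :=
  {z | ∃ (l m : ℕ) (g : SmoothU I M l) (h : SmoothU I M m),
      z = .of ⟨l + m, g.directSum h⟩ - .of ⟨l, g⟩ - .of ⟨m, h⟩} ∪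
  {z | ∃ (l : ℕ) (g₀ g₁ : SmoothU I M l), g₀.Homotopic g₁ ∧ z = .of ⟨l, g₁⟩ - .of ⟨l, g₀⟩} ∪
  {z | ∃ l : ℕ, z = .of ⟨l, SmoothU.one I M l⟩}

variable (I M) in
/-- `K⁻¹(M)`: the abelian group generated by the smooth maps `g : M → U(l)`, `l = 0, 1, 2, …`, with
the relations `[g ⊕ h] = [g] + [h]`, `[g₀] = [g₁]` if `g₀`, `g₁` are smoothly homotopic, and
`[1] = 0` for the constant maps with value the identity matrix. -/
abbrev KMinusOne := FreeAbelianGroup (Σ l, SmoothU I M l) ⧸ AddSubgroup.closure (kRel I M)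

/-- The class `[g]` in `K⁻¹(M)`. -/
def SmoothU.kClass {l : ℕ} (g : SmoothU I M l) : KMinusOne I M :=
  QuotientAddGroup.mk (FreeAbelianGroup.of ⟨l, g⟩)

/-! ### The odd Chern character -/

/-- The complex conjugate of a smooth function. -/
def conjC (f : CFun I M) : CFun I M :=
  ⟨fun x => (starRingEnd ℂ) (f x), Complex.conjCLE.contDiff.comp_contMDiff f.contMDiff⟩

/-- The pull-back `ω = g⁻¹ dg` of the Maurer-Cartan form, `ω_{ij} = ∑ₖ conj(g_{ki}) dg_{kj}`. -/
def SmoothU.mc {l : ℕ} (g : SmoothU I M l) : Matrix (Fin l) (Fin l) (Forms I M) :=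
  fun i j => ∑ k, wedgeF (ofFun I M (conjC (g.entry k i))) (extDF (ofFun I M (g.entry k j)))

/-- The curvature `R^s = s dω + (s ω) ∧ (s ω)` of the connection `d + s ω`. -/
def SmoothU.curv {l : ℕ} (g : SmoothU I M l) (s : ℝ) : Matrix (Fin l) (Fin l) (Forms I M) :=
  fun i j => (s : ℂ) • extDF (g.mc i j) +
    ∑ k, wedgeF ((s : ℂ) • g.mc i k) ((s : ℂ) • g.mc k j)

/-- `𝒜^s = s ω - ϑ ∧ R^s`. -/
def SmoothU.calA {l : ℕ} (g : SmoothU I M l) (s : ℝ) : Matrix (Fin l) (Fin l) (OmegaT I M) :=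
  fun i j => ((s : ℂ) • g.mc i j, -g.curv s i j)

/-- `ℬ = -ϑ ∧ ω`. -/
def SmoothU.calB {l : ℕ} (g : SmoothU I M l) : Matrix (Fin l) (Fin l) (OmegaT I M) :=
  fun i j => (0, -g.mc i j)

/-- The factors of `1 ⊗ (𝒜^s)^{⊗ (k-1)} ⊗ ℬ ⊗ (𝒜^s)^{⊗ (n-k)}`; the index `k` runs through
`1, …, n` and is represented by `k - 1` in `Fin n`. -/
def SmoothU.factors {l : ℕ} (g : SmoothU I M l) (n : ℕ) (k : Fin n) (s : ℝ) :
    Fin (n + 1) → Matrix (Fin l) (Fin l) (OmegaT I M) :=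
  Fin.cons (fun i j => if i = j then DGData.one else 0)
    (fun j => if j = k then g.calB else g.calA s)

/-- `Tr_n [1 ⊗ ∑_{k=1}^n (𝒜^s)^{⊗ (k-1)} ⊗ ℬ ⊗ (𝒜^s)^{⊗ (n-k)}]`. -/
def SmoothU.integrand {l : ℕ} (g : SmoothU I M l) (n : ℕ) (s : ℝ) : ChainN (OmegaT I M) n :=
  ∑ k : Fin n, trN (g.factors n k s)

lemma SmoothU.finCurve_calA {l : ℕ} (g : SmoothU I M l) (i j : Fin l) :
    FinCurve (fun s => g.calA s i j) := by
  refine ⟨Fin 2, inferInstance, ![fun s => (s : ℂ), fun s => (s : ℂ) ^ 2],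
    ![(g.mc i j, -extDF (g.mc i j)), (0, -∑ k, wedgeF (g.mc i k) (g.mc k j))], ?_, fun s => ?_⟩
  · intro k
    fin_cases k
    · exact Complex.continuous_ofReal
    · exact Complex.continuous_ofReal.pow 2
  · rw [Fin.sum_univ_two]
    refine Prod.ext ?_ ?_
    · simp [SmoothU.calA, -Complex.coe_smul]
    · simp only [SmoothU.calA, SmoothU.curv, map_smul, LinearMap.smul_apply, ← Finset.smul_sum,
        smul_smul, ← pow_two]
      simp [add_comm, -Complex.coe_smul]

lemma SmoothU.finCurve_integrand {l : ℕ} (g : SmoothU I M l) (n : ℕ) :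
    FinCurve (g.integrand n) := by
  refine FinCurve.sum fun k => FinCurve.trN fun j p q => ?_
  refine Fin.cases ?_ (fun j => ?_) j
  · exact FinCurve.const _
  · change FinCurve (fun s => (if j = k then g.calB else g.calA s) p q)
    by_cases h : j = k
    · simp only [if_pos h]
      exact FinCurve.const _
    · simp only [if_neg h]
      exact g.finCurve_calA p q

/-- The component `Ch_n(g)` of the odd Chern character: the integral of
`Tr_n [1 ⊗ ∑_{k=1}^n (𝒜^s)^{⊗ (k-1)} ⊗ ℬ ⊗ (𝒜^s)^{⊗ (n-k)}]` over `0 ≤ s ≤ 1`. -/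
def SmoothU.chN {l : ℕ} (g : SmoothU I M l) (n : ℕ) : ChainN (OmegaT I M) n :=
  (g.finCurve_integrand n).exists_integral.choose

lemma SmoothU.isIntegral_chN {l : ℕ} (g : SmoothU I M l) (n : ℕ) :
    IsIntegral01 (g.integrand n) (g.chN n) :=
  (g.finCurve_integrand n).exists_integral.choose_spec

variable [CompactSpace M]

/-- The element `⟨Ch_n(g)⟩` of the space of entire chains. -/
def SmoothU.chTerm {l : ℕ} (g : SmoothU I M l) (n : ℕ) : EChain (OmegaT I M) :=
  incl (single (OmegaT I M) n (g.chN n))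

/-- The odd Chern character `Ch(g) = ∑ₙ ⟨Ch_n(g)⟩`. -/
def SmoothU.ch {l : ℕ} (g : SmoothU I M l) : EChain (OmegaT I M) := ∑' n, g.chTerm n

variable (I M) in
/-- Smooth functions on `M`, as a subspace of `Ω_𝕋(M × 𝕋)`. -/
def smoothFun : Submodule ℂ (OmegaT I M) := LinearMap.range (funT I M)

end Manifold

end OddChern

end

open OddChern

noncomputable section

namespace OddChern

section Manifold

variable {E : Type*} [NormedAddCommGroup E] [NormedSpace ℝ E] [FiniteDimensional ℝ E]
  {H : Type*} [TopologicalSpace H] {I : ModelWithCorners ℝ E H}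
  {M : Type*} [TopologicalSpace M] [ChartedSpace H M] [IsManifold I ∞ M]

lemma fderivWithin_mpullbackWithin_extChartAt (V : Π x : M, TangentSpace I x) (f : CFun I M) (x : M)
    {y : E} (hy : y ∈ (extChartAt I x).target) :
    fderivWithin ℝ (f ∘ (extChartAt I x).symm) (Set.range I) y
      (VectorField.mpullbackWithin 𝓘(ℝ, E) I (extChartAt I x).symm V (Set.range I) y) =
    mvfderiv I f ((extChartAt I x).symm y) (V ((extChartAt I x).symm y)) := by
  have hU : UniqueMDiffWithinAt 𝓘(ℝ, E) (Set.range I) y :=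
    I.uniqueMDiffOn _ (extChartAt_target_subset_range x hy)
  have hf : MDifferentiableAt I 𝓘(ℝ, ℂ) f ((extChartAt I x).symm y) :=
    f.contMDiff.mdifferentiable (by simp) _
  have hs : MDifferentiableWithinAt 𝓘(ℝ, E) I (extChartAt I x).symm (Set.range I) y :=
    ((contMDiffWithinAt_extChartAt_symm_range (I := I) (n := 1) x hy).mdifferentiableWithinAt (by simp))
  have h1 := mfderiv_comp_mfderivWithin y hf hs hU
  obtain ⟨e, he⟩ := isInvertible_mfderivWithin_extChartAt_symm (I := I) hy
  have h2 : (mfderivWithin 𝓘(ℝ, E) I (extChartAt I x).symm (Set.range I) y)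
      (VectorField.mpullbackWithin 𝓘(ℝ, E) I (extChartAt I x).symm V (Set.range I) y) =
      V ((extChartAt I x).symm y) := by
    rw [VectorField.mpullbackWithin_apply, ← he, ContinuousLinearMap.inverse_equiv]
    exact e.apply_symm_apply _
  rw [← mfderivWithin_eq_fderivWithin]
  have h3 := congrArg (fun L => L (VectorField.mpullbackWithin 𝓘(ℝ, E) I (extChartAt I x).symm V (Set.range I) y)) h1
  refine h3.trans ?_
  refine Eq.trans ?_ (congrArg (fun v => mfderiv I 𝓘(ℝ, ℂ) f ((extChartAt I x).symm y) v) h2)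
  rfl

lemma mpullbackWithin_extChartAt_self (V : Π x : M, TangentSpace I x) (x : M) :
    VectorField.mpullbackWithin 𝓘(ℝ, E) I (extChartAt I x).symm V (Set.range I)
      (extChartAt I x x) = V x := by
  rw [VectorField.mpullbackWithin_apply]
  refine (mfderivWithin_extChartAt_symm_inverse_apply (I := I) (x := x) _).trans ?_
  rw [extChartAt_to_inv]

lemma fderivWithin_extChartAt_self (f : CFun I M) (x : M) (v : TangentSpace I x) :
    fderivWithin ℝ (f ∘ (extChartAt I x).symm) (Set.range I) (extChartAt I x x) v =
      mvfderiv I f x v := by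
  classical
  have h := fderivWithin_mpullbackWithin_extChartAt
    (Function.update (fun z => (0 : TangentSpace I z)) x v) f x (mem_extChartAt_target (I := I) x)
  rw [mpullbackWithin_extChartAt_self, extChartAt_to_inv, Function.update_self] at h
  exact h

lemma lieD_bracket (X Y : VField I M) (f : CFun I M) :
    lieD (bracket X Y) f = lieD X (lieD Y f) - lieD Y (lieD X f) := by
  have : CompleteSpace E := FiniteDimensional.complete ℝ E
  ext x
  change mvfderiv I f x (VectorField.mlieBracket I X Y x) =
    mvfderiv I (lieD Y f) x (X x) - mvfderiv I (lieD X f) x (Y x)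
  have hx := mem_extChartAt_target (I := I) x
  have hD : ∀ (Z W : VField I M), mvfderiv I (lieD Z f) x (W x) =
      fderivWithin ℝ (fun y => fderivWithin ℝ (f ∘ (extChartAt I x).symm) (Set.range I) y
        (VectorField.mpullbackWithin 𝓘(ℝ, E) I (extChartAt I x).symm Z (Set.range I) y))
        (Set.range I) (extChartAt I x x)
        (VectorField.mpullbackWithin 𝓘(ℝ, E) I (extChartAt I x).symm W (Set.range I)
          (extChartAt I x x)) := by
    intro Z W
    rw [← fderivWithin_extChartAt_self, mpullbackWithin_extChartAt_self]
    refine congrArg (fun L : E →L[ℝ] ℂ => L (W x)) (Filter.EventuallyEq.fderivWithin_eq ?_ ?_)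
    · filter_upwards [extChartAt_target_mem_nhdsWithin (I := I) x] with y hy
      rw [fderivWithin_mpullbackWithin_extChartAt _ f x hy]
      rfl
    · rw [fderivWithin_mpullbackWithin_extChartAt _ f x hx]
      rfl
  have hd : ∀ Z : VField I M, DifferentiableWithinAt ℝ
      (VectorField.mpullbackWithin 𝓘(ℝ, E) I (extChartAt I x).symm Z (Set.range I))
      (Set.range I) (extChartAt I x x) := by
    intro Z
    have : IsManifold I 2 M := inferInstance
    have := ((Z.contMDiff.mdifferentiable (by simp) x).mdifferentiableWithinAt
      (s := Set.univ)).differentiableWithinAt_mpullbackWithin_vectorField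
    rwa [Set.preimage_univ, Set.univ_inter] at this
  have hf : ContDiffWithinAt ℝ ∞ (f ∘ (extChartAt I x).symm) (Set.range I) (extChartAt I x x) := by
    exact ((f.contMDiff _).comp_contMDiffWithinAt _
      (contMDiffWithinAt_extChartAt_symm_range (I := I) x hx)).contDiffWithinAt
  have h2 : minSmoothness ℝ 2 ≤ ∞ := by
    rw [minSmoothness_of_isRCLikeNormedField]
    exact WithTop.coe_le_coe.mpr le_top
  rw [hD, hD, ← VectorField.fderivWithin_apply_lieBracket hf h2 I.uniqueDiffOn
    (I.range_subset_closure_interior (Set.mem_range_self _)) (Set.mem_range_self _) (hd Y) (hd X),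
    ← VectorField.mlieBracketWithin_univ, VectorField.mlieBracketWithin_apply, Set.preimage_univ,
    Set.univ_inter, mfderiv_extChartAt_self]
  refine Eq.trans ?_ (fderivWithin_extChartAt_self f x _).symm
  exact congrArg (mvfderiv I f x) (congrArg (fun L : E →L[ℝ] E => L _)
    (ContinuousLinearMap.inverse_id (R := ℝ) (M := E)))

open Equiv in
/-- A product of antisymmetrizations is the antisymmetrization of the product. -/
lemma mul'_domCoprod_alternatization {p q : Type*} [Fintype p] [Fintype q]
    [DecidableEq p] [DecidableEq q]
    (a : MultilinearMap (RFun I M) (fun _ : p => VField I M) (CFun I M))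
    (b : MultilinearMap (RFun I M) (fun _ : q => VField I M) (CFun I M))
    (Y : p ⊕ q → VField I M) :
    (LinearMap.mul' (RFun I M) (CFun I M))
      (((MultilinearMap.alternatization a).domCoprod (MultilinearMap.alternatization b)) Y) =
     ∑ σ : Perm (p ⊕ q), Perm.sign σ • (a (fun i => Y (σ (.inl i))) * b (fun i => Y (σ (.inr i)))) := by
  rw [← MultilinearMap.domCoprod_alternization, MultilinearMap.alternatization_apply, map_sum]
  refine Finset.sum_congr rfl fun σ _ => ?_
  simp [MultilinearMap.domCoprod_apply]

/-- Every form is an antisymmetrization. -/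
lemma exists_alternatization {k : ℕ} (a : Form I M k) :
    ∃ m : MultilinearMap (RFun I M) (fun _ : Fin k => VField I M) (CFun I M),
      MultilinearMap.alternatization m = a := by
  refine ⟨((k.factorial : ℂ)⁻¹ • a : Form I M k).toMultilinearMap, ?_⟩
  have h := AlternatingMap.coe_alternatization ((k.factorial : ℂ)⁻¹ • a : Form I M k)
  refine h.trans ?_
  rw [Fintype.card_fin, ← Nat.cast_smul_eq_nsmul ℂ, smul_smul, mul_inv_cancel₀ (Nat.cast_ne_zero.mpr k.factorial_ne_zero), one_smul]

open Equiv in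
/-- Product of multilinear maps, with arguments indexed by `Fin`. -/
def mprod {p q m : ℕ} (h : p + q = m)
    (a : MultilinearMap (RFun I M) (fun _ : Fin p => VField I M) (CFun I M))
    (b : MultilinearMap (RFun I M) (fun _ : Fin q => VField I M) (CFun I M)) :
    MultilinearMap (RFun I M) (fun _ : Fin m => VField I M) (CFun I M) :=
  ((LinearMap.mul' (RFun I M) (CFun I M)).compMultilinearMap (a.domCoprod b)).domDomCongr
    (finSumFinEquiv.trans (finCongr h))

lemma mprod_apply {p q m : ℕ} (h : p + q = m)
    (a : MultilinearMap (RFun I M) (fun _ : Fin p => VField I M) (CFun I M))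
    (b : MultilinearMap (RFun I M) (fun _ : Fin q => VField I M) (CFun I M)) (Y : Fin m → VField I M) :
    mprod h a b Y = a (fun i => Y (Fin.cast h (Fin.castAdd q i))) * b (fun i => Y (Fin.cast h (Fin.natAdd p i))) := by
  simp [mprod, MultilinearMap.domCoprod_apply]

lemma wedge_alternatization {p q m : ℕ} (h : p + q = m)
    (a : MultilinearMap (RFun I M) (fun _ : Fin p => VField I M) (CFun I M))
    (b : MultilinearMap (RFun I M) (fun _ : Fin q => VField I M) (CFun I M)) :
    wedge h (MultilinearMap.alternatization a) (MultilinearMap.alternatization b) =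
      MultilinearMap.alternatization (mprod h a b) := by
  ext Y : 1
  rw [wedge, AlternatingMap.domDomCongr_apply]
  refine (mul'_domCoprod_alternatization a b _).trans ?_
  rw [MultilinearMap.alternatization_apply]
  refine Fintype.sum_equiv ((finSumFinEquiv.trans (finCongr h)).permCongr) _ _ fun σ => ?_
  rw [Equiv.Perm.sign_permCongr, MultilinearMap.domDomCongr_apply, mprod_apply]
  congr 3
  · ext i : 1; simp [Equiv.permCongr_apply]
  · ext i : 1; simp [Equiv.permCongr_apply]

lemma wedge_assoc {p q r m s t : ℕ} (h1 : p + q = s) (h2 : s + r = m) (h3 : q + r = t) (h4 : p + t = m)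
    (a : Form I M p) (b : Form I M q) (c : Form I M r) :
    wedge h2 (wedge h1 a b) c = wedge h4 a (wedge h3 b c) := by
  obtain ⟨a, rfl⟩ := exists_alternatization a
  obtain ⟨b, rfl⟩ := exists_alternatization b
  obtain ⟨c, rfl⟩ := exists_alternatization c
  rw [wedge_alternatization, wedge_alternatization, wedge_alternatization, wedge_alternatization]
  congr 1
  ext Y : 1
  simp only [mprod_apply, mul_assoc]
  subst h1 h2 h3
  congr 1
  congr 1
  congr 1; ext i : 1; congr 1; ext; simp [add_assoc]

open Equiv in
lemma sum_perm_two {A : Type*} [AddCommMonoid A] (f : Perm (Fin 2) → A) :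
    ∑ σ, f σ = f 1 + f (swap 0 1) := by
  have h : (Finset.univ : Finset (Perm (Fin 2))) = {1, swap 0 1} := by decide
  rw [h, Finset.sum_insert (by decide), Finset.sum_singleton]

open Equiv in
lemma sum_perm_three {A : Type*} [AddCommMonoid A] (f : Perm (Fin 3) → A) :
    ∑ σ, f σ = f 1 + (f (swap 0 1) + (f (swap 0 2) + (f (swap 1 2) +
      (f (swap 0 1 * swap 1 2) + f (swap 1 2 * swap 0 1))))) := by
  have h : (Finset.univ : Finset (Perm (Fin 3))) =
    {1, swap 0 1, swap 0 2, swap 1 2, swap 0 1 * swap 1 2, swap 1 2 * swap 0 1} := by decide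
  rw [h, Finset.sum_insert (by decide), Finset.sum_insert (by decide), Finset.sum_insert (by decide),
    Finset.sum_insert (by decide), Finset.sum_insert (by decide), Finset.sum_singleton]

lemma alternatization_one (a : Form I M 1) :
    MultilinearMap.alternatization a.toMultilinearMap = a := by
  simpa using AlternatingMap.coe_alternatization a

lemma alternatization_two (a : Form I M 2) :
    MultilinearMap.alternatization ((1 / 2 : ℂ) • a).toMultilinearMap = a := by
  refine (AlternatingMap.coe_alternatization ((1 / 2 : ℂ) • a)).trans ?_
  rw [Fintype.card_fin, ← Nat.cast_smul_eq_nsmul ℂ, smul_smul]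
  norm_num [Nat.factorial]

lemma vec_one {A : Type*} (Z : Fin 1 → A) : Z = ![Z 0] := by
  funext i; fin_cases i; rfl

lemma vec_two {A : Type*} (Z : Fin 2 → A) : Z = ![Z 0, Z 1] := by
  funext i; fin_cases i <;> rfl

lemma mprod_one_one (a b : Form I M 1) (Y : Fin 2 → VField I M) :
    mprod (m := 2) rfl a.toMultilinearMap b.toMultilinearMap Y = a ![Y 0] * b ![Y 1] := by
  rw [mprod_apply]
  exact congrArg₂ _ (congrArg a (vec_one _)) (congrArg b (vec_one _))

lemma mprod_two_one (a : Form I M 2) (b : Form I M 1) (Y : Fin 3 → VField I M) :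
    mprod (m := 3) rfl a.toMultilinearMap b.toMultilinearMap Y = a ![Y 0, Y 1] * b ![Y 2] := by
  rw [mprod_apply]
  exact congrArg₂ _ (congrArg a (vec_two _)) (congrArg b (vec_one _))

lemma mprod_one_two (a : Form I M 1) (b : Form I M 2) (Y : Fin 3 → VField I M) :
    mprod (m := 3) rfl a.toMultilinearMap b.toMultilinearMap Y = a ![Y 0] * b ![Y 1, Y 2] := by
  rw [mprod_apply]
  exact congrArg₂ _ (congrArg a (vec_one _)) (congrArg b (vec_two _))

lemma wedge_one_one (a b : Form I M 1) (Y : Fin 2 → VField I M) :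
    wedge (m := 2) rfl a b Y = a ![Y 0] * b ![Y 1] - a ![Y 1] * b ![Y 0] := by
  conv_lhs => rw [← alternatization_one a, ← alternatization_one b, wedge_alternatization,
    MultilinearMap.alternatization_apply]
  simp only [MultilinearMap.domDomCongr_apply, mprod_one_one, sum_perm_two]
  simp [sub_eq_add_neg]

lemma form_two_swap (a : Form I M 2) (X Y : VField I M) : a ![Y, X] = - a ![X, Y] := by
  have := a.map_swap ![X, Y] (i := 0) (j := 1) (by decide)
  rw [← this]
  congr 1; funext i; fin_cases i <;> rfl

lemma wedge_two_one (a : Form I M 2) (b : Form I M 1) (Y : Fin 3 → VField I M) :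
    wedge (m := 3) rfl a b Y = a ![Y 0, Y 1] * b ![Y 2] - a ![Y 0, Y 2] * b ![Y 1] +
      a ![Y 1, Y 2] * b ![Y 0] := by
  conv_lhs => rw [← alternatization_two a, ← alternatization_one b, wedge_alternatization,
    MultilinearMap.alternatization_apply]
  simp only [MultilinearMap.domDomCongr_apply, mprod_two_one, sum_perm_three]
  have h1 : Equiv.Perm.sign (Equiv.swap (0 : Fin 3) 1) = -1 := by decide
  have h2 : Equiv.Perm.sign (Equiv.swap (0 : Fin 3) 2) = -1 := by decide
  have h3 : Equiv.Perm.sign (Equiv.swap (1 : Fin 3) 2) = -1 := by decide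
  simp [Equiv.swap_apply_def, h1, h2, h3]
  rw [form_two_swap a (Y 0) (Y 1), form_two_swap a (Y 1) (Y 2), form_two_swap a (Y 0) (Y 2)]
  simp only [neg_mul, smul_neg, neg_neg, smul_mul_assoc]
  module

lemma wedge_one_two (a : Form I M 1) (b : Form I M 2) (Y : Fin 3 → VField I M) :
    wedge (m := 3) rfl a b Y = a ![Y 0] * b ![Y 1, Y 2] - a ![Y 1] * b ![Y 0, Y 2] +
      a ![Y 2] * b ![Y 0, Y 1] := by
  conv_lhs => rw [← alternatization_one a, ← alternatization_two b, wedge_alternatization,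
    MultilinearMap.alternatization_apply]
  simp only [MultilinearMap.domDomCongr_apply, mprod_one_two, sum_perm_three]
  have h1 : Equiv.Perm.sign (Equiv.swap (0 : Fin 3) 1) = -1 := by decide
  have h2 : Equiv.Perm.sign (Equiv.swap (0 : Fin 3) 2) = -1 := by decide
  have h3 : Equiv.Perm.sign (Equiv.swap (1 : Fin 3) 2) = -1 := by decide
  simp [Equiv.swap_apply_def, h1, h2, h3]
  rw [form_two_swap b (Y 0) (Y 1), form_two_swap b (Y 1) (Y 2), form_two_swap b (Y 0) (Y 2)]
  simp only [mul_neg, smul_neg, neg_neg, mul_smul_comm]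
  module

lemma extD_zero_form (a : Form I M 0) (Y : Fin 1 → VField I M) :
    extD a Y = lieD (Y 0) (a ![]) := by
  rw [extD_apply]
  simp only [Finset.univ_eq_empty, Finset.sum_empty]
  simp
  congr 2
  exact Subsingleton.elim _ _

lemma extD_one_form (a : Form I M 1) (Y : Fin 2 → VField I M) :
    extD a Y = lieD (Y 0) (a ![Y 1]) - (1 / 2 : ℂ) • a ![bracket (Y 0) (Y 1)] -
      (lieD (Y 1) (a ![Y 0]) - (1 / 2 : ℂ) • a ![bracket (Y 1) (Y 0)]) := by
  have e0 : (0 : Fin 2).removeNth Y = ![Y 1] := by funext i; fin_cases i; rfl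
  have e1 : (1 : Fin 2).removeNth Y = ![Y 0] := by funext i; fin_cases i; rfl
  have u : ∀ X Z : VField I M, Function.update ![X] 0 Z = ![Z] := by
    intro X Z; funext i; fin_cases i; rfl
  rw [extD_apply, Fin.sum_univ_two, e0, e1]
  simp [u, sub_eq_add_neg]
  abel

lemma extD_two_form (a : Form I M 2) (Y : Fin 3 → VField I M) :
    extD a Y = lieD (Y 0) (a ![Y 1, Y 2]) -
        (1 / 2 : ℂ) • (a ![bracket (Y 0) (Y 1), Y 2] + a ![Y 1, bracket (Y 0) (Y 2)]) -
      (lieD (Y 1) (a ![Y 0, Y 2]) -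
        (1 / 2 : ℂ) • (a ![bracket (Y 1) (Y 0), Y 2] + a ![Y 0, bracket (Y 1) (Y 2)])) +
      (lieD (Y 2) (a ![Y 0, Y 1]) -
        (1 / 2 : ℂ) • (a ![bracket (Y 2) (Y 0), Y 1] + a ![Y 0, bracket (Y 2) (Y 1)])) := by
  have e0 : (0 : Fin 3).removeNth Y = ![Y 1, Y 2] := by funext i; fin_cases i <;> rfl
  have e1 : (1 : Fin 3).removeNth Y = ![Y 0, Y 2] := by funext i; fin_cases i <;> rfl
  have e2 : (2 : Fin 3).removeNth Y = ![Y 0, Y 1] := by funext i; fin_cases i <;> rfl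
  have u0 : ∀ X Z W : VField I M, Function.update ![X, W] 0 Z = ![Z, W] := by
    intro X Z W; funext i; fin_cases i <;> rfl
  have u1 : ∀ X Z W : VField I M, Function.update ![X, W] 1 Z = ![X, Z] := by
    intro X Z W; funext i; fin_cases i <;> rfl
  rw [extD_apply, Fin.sum_univ_three, e0, e1, e2]
  simp only [Fin.sum_univ_two, u0, u1]
  simp [sub_eq_add_neg]
  abel

/-- The Leibniz rule for one-forms. -/
lemma extD_wedge_one_one (a b : Form I M 1) :
    extD (wedge (m := 2) rfl a b) =
      wedge (m := 3) rfl (extD a) b - wedge (m := 3) rfl a (extD b) := by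
  ext Y : 1
  rw [AlternatingMap.sub_apply, extD_two_form, wedge_two_one, wedge_one_two]
  simp only [wedge_one_one, extD_one_form, Matrix.cons_val_zero, Matrix.cons_val_one, map_sub, lieD_mul]
  ext x
  simp
  ring

end Manifold

section Words

variable {Ω : Type*} [AddCommGroup Ω] [Module ℂ Ω] [TopologicalSpace Ω] [DGData Ω]

/-! ### Closed formulas for the Hochschild differential -/

/-- The operator which is `-(-1)^j` in degree `j`. -/
def sg : Ω →ₗ[ℂ] Ω := -DGData.par

lemma prj_add_prj (x : Ω) : prj 0 x + prj 1 x = x := by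
  simp only [prj, LinearMap.smul_apply, LinearMap.add_apply, LinearMap.id_apply]
  simp
  module

lemma sum_sgn_prj (x : Ω) : ∑ q : ZMod 2, (-sgn q) • prj q x = sg x := by
  have : (Finset.univ : Finset (ZMod 2)) = {0, 1} := by decide
  rw [this, Finset.sum_insert (by decide), Finset.sum_singleton]
  simp only [prj, sgn, sg, LinearMap.smul_apply, LinearMap.add_apply, LinearMap.id_apply]
  simp
  module

lemma sum_prj (x : Ω) : ∑ q : ZMod 2, (1 : ℂ) • prj q x = x := by
  have : (Finset.univ : Finset (ZMod 2)) = {0, 1} := by decide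
  rw [this, Finset.sum_insert (by decide), Finset.sum_singleton, one_smul, one_smul, prj_add_prj]

lemma sgn_add (a b : ZMod 2) : sgn (a + b) = sgn a * sgn b := by
  have key : ∀ p : ZMod 2, p = 0 ∨ p = 1 := by decide
  rcases key a with rfl | rfl <;> rcases key b with rfl | rfl <;> simp [sgn]
  decide

lemma sgn_rr {n : ℕ} (p : Fin (n + 1) → ZMod 2) (m : ℕ) (hm : m ≤ n + 1) :
    sgn (rr p m) = - ∏ k : Fin (n + 1), if k.val < m then - sgn (p k) else 1 := by
  induction m with
  | zero => simp [rr, sgn]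
  | succ m ih =>
    have h : rr p (m + 1) = rr p m + p ⟨m, hm⟩ - 1 := rr_succ p ⟨m, hm⟩
    rw [h, sgn_sub_one, sgn_add, ih (by omega), Fintype.prod_eq_mul_prod_compl (⟨m, hm⟩ : Fin (n + 1)),
      Fintype.prod_eq_mul_prod_compl (⟨m, hm⟩ : Fin (n + 1))]
    have : ∏ i ∈ {(⟨m, hm⟩ : Fin (n + 1))}ᶜ, (if (i : ℕ) < m then -sgn (p i) else 1) =
        ∏ i ∈ {(⟨m, hm⟩ : Fin (n + 1))}ᶜ, (if (i : ℕ) < m + 1 then -sgn (p i) else 1) := by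
      refine Finset.prod_congr rfl fun i hi => ?_
      have : (i : ℕ) ≠ m := fun h => by simp [Fin.ext_iff, h] at hi
      congr 1
      simp only [eq_iff_iff]
      omega
    rw [this]
    simp
    ring

lemma sum_prod_smul_prj {W : Type*} [AddCommGroup W] [Module ℂ W] {n : ℕ}
    (T : MultilinearMap ℂ (fun _ : Fin n => Ω) W) (c : Fin n → ZMod 2 → ℂ) (v : Fin n → Ω) :
    ∑ p : Fin n → ZMod 2, (∏ k, c k (p k)) • T (fun k => prj (p k) (v k)) =
      T (fun k => ∑ q, c k q • prj q (v k)) := by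
  rw [MultilinearMap.map_sum]
  exact Finset.sum_congr rfl fun p _ => (T.map_smul_univ _ _).symm

/-- `-(-1)^j` is applied to the first `m` entries. -/
def sgUpTo {n : ℕ} (m : ℕ) (v : Fin n → Ω) : Fin n → Ω := fun k => if k.val < m then sg (v k) else v k

lemma sum_sgn_rr {W : Type*} [AddCommGroup W] [Module ℂ W] {n : ℕ}
    (T : MultilinearMap ℂ (fun _ : Fin (n + 1) => Ω) W) (m : ℕ) (hm : m ≤ n + 1) (v : Fin (n + 1) → Ω) :
    ∑ p : Fin (n + 1) → ZMod 2, sgn (rr p m) • T (fun k => prj (p k) (v k)) = - T (sgUpTo m v) := by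
  have h := sum_prod_smul_prj T (fun k q => if k.val < m then - sgn q else 1) v
  simp only [sgn_rr _ m hm, neg_smul, Finset.sum_neg_distrib, h]
  congr 2
  funext k
  simp only [sgUpTo]
  split_ifs
  · exact sum_sgn_prj _
  · exact sum_prj _

lemma dPart_apply (n : ℕ) (v : Fin (n + 1) → Ω) :
    dPart n v = ∑ i : Fin (n + 1), el n (Function.update (sgUpTo i v) i (DGData.d (v i))) := by
  rw [dPart, homog_apply]
  simp only [neg_apply, sum_apply, smul_apply, Finset.sum_neg_distrib]
  rw [Finset.sum_comm, ← Finset.sum_neg_distrib]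
  refine Finset.sum_congr rfl fun i _ => ?_
  rw [sum_sgn_rr _ _ i.2.le, neg_neg, dTerm, MultilinearMap.compLinearMap_apply]
  congr 1
  funext k
  rcases eq_or_ne k i with rfl | h
  · simp [sgUpTo]
  · simp [h]

lemma mulPart_apply (n : ℕ) (v : Fin (n + 2) → Ω) :
    mulPart (n + 1) v = ∑ i : Fin (n + 1), el n (merge i (sgUpTo (i + 1) v)) +
      (lastTerm n (Function.update v (Fin.last (n + 1)) (prj 1 (v (Fin.last (n + 1))))) -
        lastTerm n (Function.update (sgUpTo (n + 1) v) (Fin.last (n + 1))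
          (prj 0 (v (Fin.last (n + 1)))))) := by
  change homog _ v = _
  rw [homog_apply]
  simp only [add_apply, neg_apply, sum_apply, smul_apply, Finset.sum_neg_distrib, Finset.sum_add_distrib]
  congr 1
  · rw [Finset.sum_comm, ← Finset.sum_neg_distrib]
    refine Finset.sum_congr rfl fun i _ => ?_
    rw [sum_sgn_rr _ _ (by omega), neg_neg]
    rfl
  · have h : ∀ p : Fin (n + 2) → ZMod 2, sgn ((p (Fin.last (n + 1)) - 1) * rr p (n + 1)) =
        ∏ k, (fun (k : Fin (n + 2)) (q : ZMod 2) => if k = Fin.last (n + 1) then (if q = 1 then 1 else 0) else 1) k (p k) -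
        ∏ k, (fun (k : Fin (n + 2)) (q : ZMod 2) => if k = Fin.last (n + 1) then (if q = 0 then 1 else 0) else - sgn q) k (p k) := by
      intro p
      have key : ∀ p : ZMod 2, p = 0 ∨ p = 1 := by decide
      simp only [Fin.prod_univ_castSucc (n := n + 1)]
      rcases key (p (Fin.last (n + 1))) with h | h
      · have h2 : (0 - 1 : ZMod 2) * rr p (n + 1) = rr p (n + 1) := by
          rw [zero_sub, neg_one_mul, ZMod.neg_eq_self_mod_two]
        simp only [h, h2, sgn_rr p (n + 1) (by omega), Fin.prod_univ_castSucc (n := n + 1)]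
        simp [Fin.ext_iff, (Fin.is_lt _).ne]
        exact Finset.prod_congr rfl fun x _ => by rw [if_pos (by omega)]
      · simp [h, sgn, (Fin.castSucc_lt_last _).ne]
    have h1 := sum_prod_smul_prj (lastTerm n) (fun (k : Fin (n + 2)) (q : ZMod 2) => if k = Fin.last (n + 1) then (if q = 1 then 1 else 0) else 1) v
    have h2 := sum_prod_smul_prj (lastTerm n) (fun (k : Fin (n + 2)) (q : ZMod 2) => if k = Fin.last (n + 1) then (if q = 0 then 1 else 0) else - sgn q) v
    simp only [h, sub_smul, Finset.sum_sub_distrib, h1, h2]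
    have h01 : (Finset.univ : Finset (ZMod 2)) = {0, 1} := by decide
    congr 2
    · funext k
      rcases eq_or_ne k (Fin.last (n + 1)) with rfl | hk
      · simp [h01]
      · simp only [if_neg hk, Function.update_of_ne hk]
        exact sum_prj _
    · funext k
      rcases eq_or_ne k (Fin.last (n + 1)) with rfl | hk
      · simp [h01]
      · have : k.val < n + 1 := Fin.val_lt_last hk
        simp only [if_neg hk, Function.update_of_ne hk, sgUpTo, if_pos this]
        exact sum_sgn_prj _

end Words

section Cyclic

/-! ### Indices on a cycle -/

lemma succAbove_add_one {n : ℕ} (j k : Fin (n + 1)) (h : k ≠ j) :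
    j.succ.succAbove k + 1 = j.succ.succAbove (k + 1) := by
  have h1 := (Fin.ext_iff.not.mp h)
  ext
  rcases eq_or_ne k (Fin.last n) with rfl | hk
  · have : j.val < n := by have := j.2; simp at h1; omega
    rw [Fin.last_add_one, Fin.succ_succAbove_zero]
    rw [Fin.succAbove_of_le_castSucc _ _ (by rw [Fin.le_def]; simp; omega)]
    simp
  · have hk' : k.val < n := Fin.val_lt_last hk
    have e1 : (k + 1).val = k + 1 := Fin.val_add_one_of_lt (Fin.lt_last_iff_ne_last.mpr hk)
    rcases lt_or_gt_of_ne h1 with h2 | h2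
    · rw [Fin.succAbove_of_castSucc_lt _ k (by rw [Fin.lt_def]; simp; omega),
        Fin.succAbove_of_castSucc_lt _ (k + 1)
          (by rw [Fin.lt_def, Fin.val_castSucc, Fin.val_succ, e1]; omega),
        Fin.coeSucc_eq_succ]
      simp [e1]
    · rw [Fin.succAbove_of_le_castSucc _ k (by rw [Fin.le_def]; simp; omega),
        Fin.succAbove_of_le_castSucc _ (k + 1)
          (by rw [Fin.le_def, Fin.val_castSucc, Fin.val_succ, e1]; omega),
        Fin.val_add_one_of_lt (by rw [Fin.lt_def]; simp; omega)]
      simp [e1]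

lemma succAbove_self_add_one {n : ℕ} (j : Fin (n + 1)) : j.succ.succAbove j + 1 = j.succ := by
  rw [Fin.succAbove_of_castSucc_lt _ _ (Fin.castSucc_lt_succ), Fin.coeSucc_eq_succ]

lemma succ_add_one {n : ℕ} (j : Fin (n + 1)) : j.succ + 1 = j.succ.succAbove (j + 1) := by
  ext
  rcases eq_or_ne j (Fin.last n) with rfl | hk
  · rw [Fin.last_add_one, Fin.succ_succAbove_zero, Fin.succ_last, Fin.last_add_one]
  · have hk' : j.val < n := Fin.val_lt_last hk
    have e1 : (j + 1).val = j + 1 := Fin.val_add_one_of_lt (Fin.lt_last_iff_ne_last.mpr hk)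
    rw [Fin.succAbove_of_le_castSucc _ (j + 1)
        (by rw [Fin.le_def, Fin.val_castSucc, Fin.val_succ, e1]),
      Fin.val_add_one_of_lt (by rw [Fin.lt_def]; simp; omega)]
    exact congrArg (· + 1) e1.symm

end Cyclic

section Words

variable {Ω : Type*} [AddCommGroup Ω] [Module ℂ Ω] [TopologicalSpace Ω] [DGData Ω]

variable {κ : Type} [Fintype κ]

/-- The trace of a tensor of matrices, as a chain: the sum over all closed paths of indices. -/
def W (n : ℕ) : MultilinearMap ℂ (fun _ : Fin (n + 1) => Matrix κ κ Ω) (Chain Ω) :=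
  ∑ i : Fin (n + 1) → κ, (el n).compLinearMap (fun j => Matrix.entryLinearMap ℂ Ω (i j) (i (j + 1)))

lemma W_apply (n : ℕ) (V : Fin (n + 1) → Matrix κ κ Ω) :
    W n V = ∑ i : Fin (n + 1) → κ, el n (fun j => V j (i j) (i (j + 1))) := by
  simp [W]

variable (Ω) in
/-- Associativity of the product. -/
class AssocDG : Prop where
  mul_assoc : ∀ x y z : Ω, DGData.mul (DGData.mul x y) z = DGData.mul x (DGData.mul y z)

/-- The ring structure underlying an associative `DGData`. -/
abbrev dgRing [AssocDG Ω] : Ring Ω :=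
  { (inferInstance : AddCommGroup Ω) with
    mul := fun x y => DGData.mul x y
    one := DGData.one
    mul_assoc := AssocDG.mul_assoc
    one_mul := DGData.one_mul
    mul_one := DGData.mul_one
    left_distrib := fun x y z => map_add _ _ _
    right_distrib := fun x y z => by
      change DGData.mul (x + y) z = _
      rw [map_add]; rfl
    zero_mul := fun x => by
      change DGData.mul 0 x = _
      rw [map_zero]; rfl
    mul_zero := fun x => map_zero _ }

attribute [local instance] dgRing

/-- The algebra structure underlying an associative `DGData`. -/
abbrev dgAlgebra [AssocDG Ω] : Algebra ℂ Ω :=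
  Algebra.ofModule
    (fun c x y => by
      change DGData.mul (c • x) y = c • DGData.mul x y
      rw [map_smul]; rfl)
    (fun c x y => map_smul _ _ _)

attribute [local instance] dgAlgebra

variable [AssocDG Ω] [DecidableEq κ]

lemma dg_mul (x y : Ω) : DGData.mul x y = x * y := rfl

lemma dg_one : (DGData.one : Ω) = 1 := rfl

/-- `merge` for matrices. -/
def mergeM {n : ℕ} (j : Fin (n + 1)) (V : Fin (n + 2) → Matrix κ κ Ω) :
    Fin (n + 1) → Matrix κ κ Ω := fun k =>
  if k < j then V k.castSucc
  else if k = j then V j.castSucc * V j.succ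
  else V k.succ

lemma sum_el_merge (n : ℕ) (j : Fin (n + 1)) (V : Fin (n + 2) → Matrix κ κ Ω) :
    ∑ i : Fin (n + 2) → κ, el n (merge j (fun k => V k (i k) (i (k + 1)))) = W n (mergeM j V) := by
  rw [W_apply, ← (Fin.insertNthEquiv (fun _ => κ) j.succ).sum_comp, Fintype.sum_prod_type,
    Finset.sum_comm]
  refine Finset.sum_congr rfl fun i _ => ?_
  have h1 : (fun k => mergeM j V k (i k) (i (k + 1))) =
      Function.update (fun k => mergeM j V k (i k) (i (k + 1))) j
        (∑ a, V j.castSucc (i j) a * V j.succ a (i (j + 1))) := by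
    rw [eq_comm, Function.update_eq_self_iff]
    simp [mergeM, Matrix.mul_apply]
  rw [h1, MultilinearMap.map_update_sum]
  refine Finset.sum_congr rfl fun a _ => ?_
  congr 1
  have hs := succAbove_self_add_one j
  have hs2 := succ_add_one j
  have hj : j.succ.succAbove j = j.castSucc :=
    Fin.succAbove_of_castSucc_lt _ _ Fin.castSucc_lt_succ
  funext k
  simp only [merge, mergeM, Fin.insertNthEquiv_apply, Function.update_apply]
  rcases lt_trichotomy k j with h | rfl | h
  · rw [if_pos h, if_neg h.ne, if_pos h]
    have hk : j.succ.succAbove k = k.castSucc :=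
      Fin.succAbove_of_castSucc_lt _ _ ((Fin.castSucc_lt_castSucc_iff.mpr h).trans Fin.castSucc_lt_succ)
    rw [← hk, succAbove_add_one _ _ h.ne, Fin.insertNth_apply_succAbove,
      Fin.insertNth_apply_succAbove]
  · rw [if_neg (lt_irrefl _), if_pos rfl, if_pos rfl, ← hj, hs, hs2, Fin.insertNth_apply_succAbove,
      Fin.insertNth_apply_succAbove, Fin.insertNth_apply_same, hj]
    rfl
  · have hk : j.succ.succAbove k = k.succ :=
      Fin.succAbove_of_le_castSucc _ _ (Fin.succ_le_castSucc_iff.mpr h)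
    rw [if_neg h.asymm, if_neg h.ne', if_neg h.ne', if_neg h.asymm, if_neg h.ne', ← hk,
      succAbove_add_one _ _ h.ne', Fin.insertNth_apply_succAbove, Fin.insertNth_apply_succAbove]

/-- `lastTerm` for matrices. -/
def mergeLast {n : ℕ} (V : Fin (n + 2) → Matrix κ κ Ω) : Fin (n + 1) → Matrix κ κ Ω :=
  Fin.cons (V (Fin.last (n + 1)) * V 0) (fun i : Fin n => V i.succ.castSucc)

lemma sum_lastTerm (n : ℕ) (V : Fin (n + 2) → Matrix κ κ Ω) :
    ∑ i : Fin (n + 2) → κ, lastTerm n (fun k => V k (i k) (i (k + 1))) = W n (mergeLast V) := by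
  have h0 : (finRotate (n + 2)).symm 0 = Fin.last (n + 1) := by
    rw [Equiv.symm_apply_eq, finRotate_last]
  have h1 : ∀ k : Fin (n + 1), (finRotate (n + 2)).symm k.succ = k.castSucc := by
    intro k
    rw [Equiv.symm_apply_eq, finRotate_apply, Fin.coeSucc_eq_succ]
  have h2 : ∀ k, (finRotate (n + 2)).symm k + 1 = (finRotate (n + 2)).symm (k + 1) := by
    intro k
    have h := (finRotate (n + 2)).apply_symm_apply k
    rw [finRotate_apply] at h
    rw [Equiv.eq_symm_apply, finRotate_apply, h]
  have h3 : mergeLast V = mergeM 0 (fun k => V ((finRotate (n + 2)).symm k)) := by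
    funext k
    refine Fin.cases ?_ (fun k => ?_) k
    · simp only [mergeLast, mergeM, lt_irrefl, if_false, if_true, Fin.cons_zero, Fin.castSucc_zero,
        h0, h1]
    · simp only [mergeLast, mergeM, Fin.not_lt_zero, Fin.succ_ne_zero, if_false, h1, Fin.cons_succ]
  rw [h3, ← sum_el_merge,
    ← (Equiv.arrowCongr (finRotate (n + 2)).symm (Equiv.refl κ)).sum_comp]
  refine Finset.sum_congr rfl fun i _ => ?_
  rw [lastTerm, MultilinearMap.domDomCongr_apply]
  change el n (merge 0 _) = el n (merge 0 _)
  congr 2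
  funext k
  rw [h2]
  simp only [Equiv.arrowCongr_apply, Function.comp_apply, Equiv.symm_symm, Equiv.apply_symm_apply,
    Equiv.refl_apply]

/-- `sgUpTo` for matrices. -/
def sgUpToM {n : ℕ} (m : ℕ) (V : Fin n → Matrix κ κ Ω) : Fin n → Matrix κ κ Ω :=
  fun k => if k.val < m then (V k).map sg else V k

lemma sgUpTo_entries {n : ℕ} (m : ℕ) (V : Fin (n + 1) → Matrix κ κ Ω) (i : Fin (n + 1) → κ) :
    sgUpTo m (fun k => V k (i k) (i (k + 1))) = fun k => sgUpToM m V k (i k) (i (k + 1)) := by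
  funext k
  simp only [sgUpTo, sgUpToM]
  split_ifs <;> rfl

lemma update_entries {n : ℕ} (V : Fin (n + 1) → Matrix κ κ Ω) (i : Fin (n + 1) → κ)
    (j : Fin (n + 1)) (X : Matrix κ κ Ω) :
    Function.update (fun k => V k (i k) (i (k + 1))) j (X (i j) (i (j + 1))) =
      fun k => Function.update V j X k (i k) (i (k + 1)) := by
  funext k
  rcases eq_or_ne k j with rfl | h
  · simp
  · simp [h]

lemma dOp_W (n : ℕ) (V : Fin (n + 1) → Matrix κ κ Ω) :
    dOp (W n V) = ∑ m : Fin (n + 1),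
      W n (Function.update (sgUpToM m V) m ((V m).map DGData.d)) := by
  simp only [W_apply, map_sum, dOp_el, dPart_apply]
  rw [Finset.sum_comm]
  refine Finset.sum_congr rfl fun m _ => Finset.sum_congr rfl fun i _ => ?_
  rw [sgUpTo_entries, ← update_entries]
  rfl

lemma mulOp_W (n : ℕ) (V : Fin (n + 2) → Matrix κ κ Ω) :
    mulOp (W (n + 1) V) = ∑ m : Fin (n + 1), W n (mergeM m (sgUpToM (m + 1) V)) +
      (W n (mergeLast (Function.update V (Fin.last (n + 1)) ((V (Fin.last (n + 1))).map (prj 1)))) -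
      W n (mergeLast (Function.update (sgUpToM (n + 1) V) (Fin.last (n + 1))
        ((V (Fin.last (n + 1))).map (prj 0))))) := by
  rw [W_apply]
  simp only [map_sum, mulOp_el, mulPart_apply, Finset.sum_add_distrib, Finset.sum_sub_distrib]
  congr 1
  · rw [Finset.sum_comm]
    refine Finset.sum_congr rfl fun m _ => ?_
    rw [← sum_el_merge]
    exact Finset.sum_congr rfl fun i _ => by rw [sgUpTo_entries]
  · rw [← sum_lastTerm, ← sum_lastTerm]
    congr 1
    · refine Finset.sum_congr rfl fun i _ => ?_
      rw [← update_entries]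
      rfl
    · refine Finset.sum_congr rfl fun i _ => ?_
      rw [← update_entries, sgUpTo_entries]
      rfl

lemma W_cons_neg (n : ℕ) (X : Matrix κ κ Ω) (V : Fin n → Matrix κ κ Ω) :
    W n (Fin.cons (-X) V) = - W n (Fin.cons X V) := by
  rw [← MultilinearMap.curryLeft_apply, ← MultilinearMap.curryLeft_apply, map_neg]
  rfl

/-- The word `X ⋯ X Y Z ⋯ Z` with `Y` at position `m`. -/
def word {A : Type*} {n : ℕ} (m : ℕ) (X Y Z : A) : Fin n → A :=
  fun k => if k.val < m then X else if k.val = m then Y else Z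

variable (K 𝔸 : Matrix κ κ Ω)

lemma map_sg_of_const (hK : K.map DGData.par = K) : K.map sg = -K := by
  ext a b
  exact congrArg Neg.neg (congrFun (congrFun hK a) b)

lemma dOp_W_cons (hK : K.map DGData.par = K) (hd : K.map DGData.d = 0) (n : ℕ) :
    dOp (W n (Fin.cons K fun _ => 𝔸)) =
      - ∑ m : Fin n, W n (Fin.cons K (word m (𝔸.map sg) (𝔸.map DGData.d) 𝔸)) := by
  rw [dOp_W, Fin.sum_univ_succ, MultilinearMap.map_coord_zero _ 0 (by simp [hd]), zero_add,
    ← Finset.sum_neg_distrib]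
  refine Finset.sum_congr rfl fun m _ => ?_
  rw [← W_cons_neg]
  congr 1
  funext k
  refine Fin.cases ?_ (fun k => ?_) k
  · rw [Function.update_of_ne (Fin.succ_ne_zero m).symm]
    simp [sgUpToM, map_sg_of_const K hK]
  · rcases eq_or_ne k m with rfl | h
    · simp [word]
    · rw [Function.update_of_ne (by simpa using h)]
      simp [sgUpToM, word, Fin.val_eq_val, h]

lemma mulOp_W_cons (hK : K.map DGData.par = K) (n : ℕ) :
    mulOp (W (n + 1) (Fin.cons K fun _ => 𝔸)) =
      - W n (Fin.cons (K * 𝔸) fun _ => 𝔸)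
      - ∑ m : Fin n, W n (Fin.cons K (word m (𝔸.map sg) (𝔸.map sg * 𝔸) 𝔸))
      + W n (Fin.cons (𝔸.map (prj 1) * K) fun _ => 𝔸)
      + W n (Fin.cons (𝔸.map (prj 0) * K) fun _ => 𝔸.map sg) := by
  have hl : (Fin.cons K fun _ => 𝔸 : Fin (n + 2) → Matrix κ κ Ω) (Fin.last (n + 1)) = 𝔸 := rfl
  rw [mulOp_W, Fin.sum_univ_succ]
  have e1 : mergeM 0 (sgUpToM ((0 : Fin (n + 1)) + 1) (Fin.cons K fun _ => 𝔸 : Fin (n + 2) → Matrix κ κ Ω)) =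
      Fin.cons (-(K * 𝔸)) fun _ => 𝔸 := by
    funext k
    refine Fin.cases ?_ (fun k => ?_) k
    · simp [mergeM, sgUpToM, map_sg_of_const K hK]
    · simp [mergeM, sgUpToM]
  have e2 : ∀ m : Fin n, mergeM m.succ (sgUpToM (m.succ + 1) (Fin.cons K fun _ => 𝔸)) =
      Fin.cons (-K) (word m (𝔸.map sg) (𝔸.map sg * 𝔸) 𝔸) := by
    intro m
    funext k
    refine Fin.cases ?_ (fun k => ?_) k
    · simp [mergeM, sgUpToM, map_sg_of_const K hK]
    · rcases lt_trichotomy k m with h | rfl | h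
      · have h' := Fin.lt_def.mp h
        simp [mergeM, sgUpToM, word, h]
        omega
      · simp [mergeM, sgUpToM, word]
      · have h' := Fin.lt_def.mp h
        simp [mergeM, sgUpToM, word, h.asymm, h.ne', Fin.val_eq_val]
  have e3 : mergeLast (Function.update (Fin.cons K fun _ => 𝔸) (Fin.last (n + 1))
      (((Fin.cons K fun _ => 𝔸 : Fin (n + 2) → Matrix κ κ Ω) (Fin.last (n + 1))).map (prj 1))) =
      Fin.cons (𝔸.map (prj 1) * K) fun _ => 𝔸 := by
    funext k
    refine Fin.cases ?_ (fun k => ?_) k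
    · simp only [mergeLast, Fin.cons_zero, Function.update_self]
      rw [Function.update_of_ne (Fin.last_pos).ne]
      rfl
    · simp only [mergeLast, Fin.cons_succ]
      rw [Function.update_of_ne (Fin.castSucc_lt_last _).ne, ← Fin.succ_castSucc, Fin.cons_succ]
  have e4 : mergeLast (Function.update (sgUpToM (n + 1) (Fin.cons K fun _ => 𝔸)) (Fin.last (n + 1))
      (((Fin.cons K fun _ => 𝔸 : Fin (n + 2) → Matrix κ κ Ω) (Fin.last (n + 1))).map (prj 0))) =
      Fin.cons (-(𝔸.map (prj 0) * K)) fun _ => 𝔸.map sg := by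
    funext k
    refine Fin.cases ?_ (fun k => ?_) k
    · simp only [mergeLast, Fin.cons_zero, Function.update_self]
      rw [Function.update_of_ne (Fin.last_pos).ne]
      simp only [sgUpToM, Fin.val_zero, Nat.succ_pos', if_true, Fin.cons_zero, map_sg_of_const K hK,
        hl, Matrix.mul_neg]
    · simp only [mergeLast, Fin.cons_succ]
      rw [Function.update_of_ne (Fin.castSucc_lt_last _).ne, ← Fin.succ_castSucc]
      simp [sgUpToM]
  rw [e1, e3, e4, W_cons_neg, W_cons_neg]
  simp only [e2, W_cons_neg, Finset.sum_neg_distrib]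
  abel

end Words

section Kronecker

/-! ### Tensor products with constant matrices -/

variable {R : Type*} [Ring R] [Algebra ℂ R] {ι κ : Type} [Fintype ι] [Fintype κ]
  [DecidableEq ι] [DecidableEq κ]

/-- The Kronecker product of a matrix with a constant matrix. -/
def kr (P : Matrix ι ι R) (c : Matrix κ κ ℂ) : Matrix (ι × κ) (ι × κ) R :=
  fun a b => c a.2 b.2 • P a.1 b.1

lemma kr_mul (P Q : Matrix ι ι R) (c e : Matrix κ κ ℂ) : kr P c * kr Q e = kr (P * Q) (c * e) := by
  ext a b
  simp only [Matrix.mul_apply, kr, Fintype.sum_prod_type, Finset.sum_smul, Finset.smul_sum]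
  exact Finset.sum_congr rfl fun p _ => Finset.sum_congr rfl fun q _ =>
    smul_mul_smul_comm (c a.2 q) (P a.1 p) (e q b.2) (Q p b.1)

lemma kr_add_left (P Q : Matrix ι ι R) (c : Matrix κ κ ℂ) : kr (P + Q) c = kr P c + kr Q c := by
  ext a b; simp [kr]

lemma kr_neg_left (P : Matrix ι ι R) (c : Matrix κ κ ℂ) : kr (-P) c = -kr P c := by
  ext a b; simp [kr]

lemma kr_neg_right (P : Matrix ι ι R) (c : Matrix κ κ ℂ) : kr P (-c) = -kr P c := by
  ext a b; simp [kr]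

lemma kr_zero_left (c : Matrix κ κ ℂ) : kr (0 : Matrix ι ι R) c = 0 := by
  ext a b; simp [kr]

lemma kr_zero_right (P : Matrix ι ι R) : kr P (0 : Matrix κ κ ℂ) = 0 := by
  ext a b; simp [kr]

lemma kr_one_one : kr (1 : Matrix ι ι R) (1 : Matrix κ κ ℂ) = 1 := by
  ext a b
  rcases a with ⟨a, p⟩
  rcases b with ⟨b, q⟩
  rcases eq_or_ne a b with rfl | h1 <;> rcases eq_or_ne p q with rfl | h2 <;>
    simp [kr, Matrix.one_apply, *]

lemma kr_map {R' : Type*} [Ring R'] [Algebra ℂ R'] (f : R →ₗ[ℂ] R') (P : Matrix ι ι R)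
    (c : Matrix κ κ ℂ) : (kr P c).map f = kr (P.map f) c := by
  ext a b; simp [kr]

/-- The sum of all words in `a` and one letter `b`. -/
def insSum {A : Type*} [Ring A] (a b : A) (n : ℕ) : A := ∑ m : Fin n, a ^ (m : ℕ) * b * a ^ (n - 1 - m)

lemma insSum_succ {A : Type*} [Ring A] (a b : A) (n : ℕ) :
    insSum a b (n + 1) = insSum a b n * a + a ^ n * b := by
  rw [insSum, Fin.sum_univ_castSucc, insSum, Finset.sum_mul]
  congr 1
  · refine Finset.sum_congr rfl fun m _ => ?_
    rw [mul_assoc _ (a ^ _) a, ← pow_succ]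
    congr 2
    simp
    omega
  · simp

/-- Powers of `a ⊗ 1 + b ⊗ S + c ⊗ T` for anticommuting `S`, `T` of square zero. -/
lemma kr_pow {S T : Matrix κ κ ℂ} (hS : S * S = 0) (hT : T * T = 0) (hST : T * S = -(S * T))
    (a b c : Matrix ι ι R) (n : ℕ) :
    ∃ Q, (kr a 1 + kr b S + kr c T) ^ n =
      kr (a ^ n) 1 + kr (insSum a b n) S + kr (insSum a c n) T + kr Q (S * T) := by
  induction n with
  | zero => exact ⟨0, by simp [insSum, kr_zero_left, kr_one_one]⟩
  | succ n ih =>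
    obtain ⟨Q, hQ⟩ := ih
    have h1 : S * T * S = 0 := by rw [mul_assoc, hST, mul_neg, ← mul_assoc, hS, zero_mul, neg_zero]
    have h2 : S * T * T = 0 := by rw [mul_assoc, hT, mul_zero]
    refine ⟨Q * a + insSum a b n * c - insSum a c n * b, ?_⟩
    rw [pow_succ, hQ, insSum_succ, insSum_succ, sub_eq_add_neg]
    simp only [mul_add, add_mul, kr_mul, mul_one, one_mul, hS, hT, hST, h1, h2, kr_zero_right,
      kr_add_left, kr_neg_left, kr_neg_right, pow_succ]
    abel

end Kronecker

section Words

variable {Ω : Type*} [AddCommGroup Ω] [Module ℂ Ω] [TopologicalSpace Ω] [DGData Ω]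

/-- The sum of all words `X ⋯ X Y Z ⋯ Z` with `n` letters. -/
def mixW {κ : Type} [Fintype κ] (n : ℕ) (K X Y Z : Matrix κ κ Ω) : Chain Ω :=
  ∑ m : Fin n, W n (Fin.cons K (word m X Y Z))

/-- The sum of all words with one letter `Y` and all other letters `X`. -/
def insW {κ : Type} [Fintype κ] (n : ℕ) (K X Y : Matrix κ κ Ω) : Chain Ω := mixW n K X Y X

variable (Ω) in
/-- The word algebra. -/
abbrev Tw := TensorAlgebra ℂ Ω

/-- `Φ(x, v₁ ⋯ vₙ) = ⟨x ⊗ v₁ ⊗ ⋯ ⊗ vₙ⟩`. -/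
def wordChain : Ω →ₗ[ℂ] Tw Ω →ₗ[ℂ] Chain Ω :=
  (LinearMap.lcomp ℂ (Chain Ω) (TensorAlgebra.toDirectSum (R := ℂ) (M := Ω)).toLinearMap) ∘ₗ
    (DFinsupp.lsum ℂ (M := fun n => TensorPower ℂ n Ω) (N := Chain Ω)).toLinearMap ∘ₗ
    LinearMap.pi (fun n => PiTensorProduct.lift.toLinearMap ∘ₗ (el n).curryLeft)

lemma wordChain_apply (n : ℕ) (x : Ω) (v : Fin n → Ω) :
    wordChain x (List.ofFn fun k => TensorAlgebra.ι ℂ (v k)).prod = el n (Fin.cons x v) := by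
  rw [← TensorAlgebra.tprod_apply]
  change DFinsupp.lsum ℂ (M := fun n => TensorPower ℂ n Ω) (N := Chain Ω) _ (TensorAlgebra.toDirectSum _) = _
  rw [TensorAlgebra.toDirectSum_tensorPower_tprod]
  refine (DFinsupp.lsum_single (R := ℂ) (S := ℂ) (M := fun n => TensorPower ℂ n Ω) (N := Chain Ω) _ n _).trans ?_
  change PiTensorProduct.lift _ (PiTensorProduct.tprod ℂ _) = _
  rw [PiTensorProduct.lift.tprod, MultilinearMap.curryLeft_apply]

variable {κ : Type} [Fintype κ] [DecidableEq κ]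

/-- The trace pairing of a matrix with a matrix of words. -/
def pair : Matrix κ κ Ω →ₗ[ℂ] Matrix κ κ (Tw Ω) →ₗ[ℂ] Chain Ω :=
  ∑ a, ∑ b, (wordChain.compl₂ (Matrix.entryLinearMap ℂ (Tw Ω) b a)) ∘ₗ
    (Matrix.entryLinearMap ℂ Ω a b)

lemma pair_apply (X : Matrix κ κ Ω) (P : Matrix κ κ (Tw Ω)) :
    pair X P = ∑ a, ∑ b, wordChain (X a b) (P b a) := by
  simp [pair]

/-- Matrices as matrices of words. -/
def tw (X : Matrix κ κ Ω) : Matrix κ κ (Tw Ω) := X.map (TensorAlgebra.ι ℂ)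

lemma list_prod_apply {A : Type*} [Ring A] {n : ℕ} (M : Fin n → Matrix κ κ A) (b a : κ) :
    (List.ofFn M).prod b a = ∑ p : Fin (n + 1) → κ, if p 0 = b ∧ p (Fin.last n) = a then
      (List.ofFn fun k => M k (p k.castSucc) (p k.succ)).prod else 0 := by
  induction n generalizing b a with
  | zero =>
    rw [← (Equiv.funUnique (Fin 1) κ).symm.sum_comp, Finset.sum_eq_single b]
    · simp [Matrix.one_apply]
    · intro x _ hx
      simp [hx]
    · simp
  | succ n ih =>
    rw [List.ofFn_succ, List.prod_cons, Matrix.mul_apply,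
      ← (Fin.consEquiv (fun _ : Fin (n + 2) => κ)).sum_comp, Fintype.sum_prod_type]
    refine Eq.trans ?_ (Finset.sum_eq_single b ?_ ?_).symm
    · simp only [ih, Finset.mul_sum]
      rw [Finset.sum_comm]
      refine Finset.sum_congr rfl fun p _ => ?_
      rw [Finset.sum_eq_single (p 0)]
      · simp only [Fin.consEquiv_apply, Fin.cons_zero, true_and, List.ofFn_succ, List.prod_cons,
          ← Fin.succ_last, Fin.cons_succ, Fin.castSucc_zero, ← Fin.succ_castSucc, mul_ite, mul_zero]
      · intro c _ hc
        rw [if_neg (fun h => hc h.1.symm), mul_zero]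
      · simp
    · intro x _ hx
      refine Finset.sum_eq_zero fun p _ => if_neg ?_
      rintro ⟨h, -⟩
      exact hx h
    · simp

lemma W_cons_eq_pair (n : ℕ) (X : Matrix κ κ Ω) (V : Fin n → Matrix κ κ Ω) :
    W n (Fin.cons X V) = pair X (List.ofFn fun k => tw (V k)).prod := by
  have h0 : (finRotate (n + 1)).symm 0 = Fin.last n := by
    rw [Equiv.symm_apply_eq, finRotate_last]
  have h1 : ∀ k : Fin n, (finRotate (n + 1)).symm k.succ = k.castSucc := by
    intro k
    rw [Equiv.symm_apply_eq, finRotate_apply, Fin.coeSucc_eq_succ]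
  have h2 : ∀ k, (finRotate (n + 1)).symm k + 1 = (finRotate (n + 1)).symm (k + 1) := by
    intro k
    have h := (finRotate (n + 1)).apply_symm_apply k
    rw [finRotate_apply] at h
    rw [Equiv.eq_symm_apply, finRotate_apply, h]
  simp only [pair_apply, list_prod_apply, map_sum]
  have h3 : ∀ a b, (∑ p : Fin (n + 1) → κ, wordChain (X a b) (if p 0 = b ∧ p (Fin.last n) = a then
      (List.ofFn fun k => tw (V k) (p k.castSucc) (p k.succ)).prod else 0)) =
      ∑ p : Fin (n + 1) → κ, if p (Fin.last n) = a then (if p 0 = b then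
        wordChain (X a b) (List.ofFn fun k => tw (V k) (p k.castSucc) (p k.succ)).prod
          else 0) else 0 := by
    intro a b
    refine Finset.sum_congr rfl fun p _ => ?_
    split_ifs <;> simp_all
  simp only [h3]
  have h4 : ∀ a, (∑ b, ∑ p : Fin (n + 1) → κ, if p (Fin.last n) = a then (if p 0 = b then
        wordChain (X a b) (List.ofFn fun k => tw (V k) (p k.castSucc) (p k.succ)).prod
          else 0) else 0) = ∑ p : Fin (n + 1) → κ, if p (Fin.last n) = a then
        wordChain (X a (p 0)) (List.ofFn fun k => tw (V k) (p k.castSucc) (p k.succ)).prod else 0 := by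
    intro a
    rw [Finset.sum_comm]
    refine Finset.sum_congr rfl fun p _ => ?_
    split_ifs <;> simp
  simp only [h4]
  rw [Finset.sum_comm, W_apply, ← (Equiv.arrowCongr (finRotate (n + 1)) (Equiv.refl κ)).sum_comp]
  refine Finset.sum_congr rfl fun p _ => ?_
  rw [Finset.sum_ite_eq, if_pos (Finset.mem_univ _)]
  refine Eq.trans ?_ (wordChain_apply n _ (fun k => V k (p k.castSucc) (p k.succ))).symm
  congr 1
  funext k
  simp only [Equiv.arrowCongr_apply, Function.comp_apply, Equiv.refl_apply]
  refine Fin.cases ?_ (fun k => ?_) k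
  · have : (finRotate (n + 1)).symm (0 + 1) = 0 := by
      rw [← h2, h0, Fin.last_add_one]
    rw [this, h0]
    rfl
  · rw [← h2, h1, Fin.coeSucc_eq_succ]
    rfl

lemma list_prod_word {A : Type*} [Monoid A] {n : ℕ} (m : Fin n) (x y z : A) :
    (List.ofFn (word (n := n) m x y z)).prod = x ^ (m : ℕ) * y * z ^ (n - 1 - m) := by
  have h : List.ofFn (word (n := n) m x y z) =
      List.replicate m x ++ y :: List.replicate (n - 1 - m) z := by
    refine List.ext_getElem (by simp; omega) fun i h1 h2 => ?_
    simp only [List.getElem_ofFn, word, List.getElem_append, List.getElem_replicate,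
      List.length_replicate, List.getElem_cons]
    split_ifs <;> first | rfl | omega
  rw [h, List.prod_append, List.prod_cons, List.prod_replicate, List.prod_replicate, mul_assoc]

lemma tw_word {n : ℕ} (m : ℕ) (X Y Z : Matrix κ κ Ω) :
    (fun k => tw (word (n := n) m X Y Z k)) = word m (tw X) (tw Y) (tw Z) := by
  funext k
  simp only [word]
  split_ifs <;> rfl

lemma W_word {n : ℕ} (m : Fin n) (K X Y Z : Matrix κ κ Ω) :
    W n (Fin.cons K (word m X Y Z)) = pair K (tw X ^ (m : ℕ) * tw Y * tw Z ^ (n - 1 - m)) := by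
  rw [W_cons_eq_pair, tw_word, list_prod_word]

lemma W_const (n : ℕ) (K X : Matrix κ κ Ω) :
    W n (Fin.cons K fun _ => X) = pair K (tw X ^ n) := by
  rw [W_cons_eq_pair, List.ofFn_const, List.prod_replicate]

lemma insW_eq_pair (n : ℕ) (K X Y : Matrix κ κ Ω) :
    insW n K X Y = pair K (insSum (tw X) (tw Y) n) := by
  simp only [insW, mixW, W_word, insSum, map_sum]

end Words

section Block

variable {Ω : Type*} [AddCommGroup Ω] [Module ℂ Ω] [TopologicalSpace Ω] [DGData Ω]
  [AssocDG Ω] {ι κ : Type} [Fintype ι] [DecidableEq ι] [Fintype κ] [DecidableEq κ]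

attribute [local instance] dgRing dgAlgebra

lemma tw_kr (X : Matrix ι ι Ω) (c : Matrix κ κ ℂ) : tw (kr X c) = kr (tw X) c := kr_map _ _ _

lemma tw_add (X Y : Matrix ι ι Ω) : tw (X + Y) = tw X + tw Y := by ext a b; simp [tw]

lemma tw_neg (X : Matrix ι ι Ω) : tw (-X) = -tw X := by ext a b; simp [tw]

lemma pair_kr (X : Matrix ι ι Ω) (P : Matrix ι ι (Tw Ω)) (k c : Matrix κ κ ℂ) :
    pair (kr X k) (kr P c) = (k * c).trace • pair X P := by
  simp only [pair_apply, Fintype.sum_prod_type, kr, map_smul, LinearMap.smul_apply, smul_smul,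
    Matrix.trace, Matrix.diag_apply, Matrix.mul_apply, Finset.smul_sum]
  refine Finset.sum_congr rfl fun a _ => ?_
  simp only [Finset.sum_smul]
  rw [Finset.sum_comm' (t' := Finset.univ) (s' := fun _ => Finset.univ) (by simp)]
  refine Finset.sum_congr rfl fun b _ => Finset.sum_congr rfl fun p _ =>
    Finset.sum_congr rfl fun q _ => ?_
  rw [mul_comm]

lemma pair_kr_left (X : Matrix (ι × κ) (ι × κ) Ω) (P : Matrix (ι × κ) (ι × κ) (Tw Ω))
    (c : Matrix κ κ ℂ) : pair X (kr 1 c * P) = pair (X * kr 1 c) P := by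
  simp only [pair_apply, Matrix.mul_apply, map_sum, LinearMap.sum_apply]
  refine Finset.sum_congr rfl fun a _ => ?_
  rw [Finset.sum_comm]
  refine Finset.sum_congr rfl fun b _ => Finset.sum_congr rfl fun e _ => ?_
  rcases e with ⟨e, e'⟩
  rcases b with ⟨b, b'⟩
  rcases eq_or_ne e b with rfl | h
  · simp [kr]
  · simp [kr, Matrix.one_apply_ne h]

lemma pair_kr_right (X : Matrix (ι × κ) (ι × κ) Ω) (P : Matrix (ι × κ) (ι × κ) (Tw Ω))
    (c : Matrix κ κ ℂ) : pair X (P * kr 1 c) = pair (kr 1 c * X) P := by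
  simp only [pair_apply, Matrix.mul_apply, map_sum, LinearMap.sum_apply]
  have h : ∀ a e b : ι × κ, wordChain (X a b) (P b e * (kr 1 c : Matrix _ _ (Tw Ω)) e a) =
      wordChain ((kr 1 c : Matrix _ _ Ω) e a * X a b) (P b e) := by
    rintro ⟨a, a'⟩ ⟨e, e'⟩ b
    rcases eq_or_ne e a with rfl | h
    · simp [kr]
    · simp [kr, Matrix.one_apply_ne h]
  simp only [h]
  calc _ = ∑ a, ∑ e, ∑ b, wordChain ((kr 1 c : Matrix _ _ Ω) e a * X a b) (P b e) :=
        Finset.sum_congr rfl fun a _ => Finset.sum_comm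
    _ = ∑ e, ∑ a, ∑ b, wordChain ((kr 1 c : Matrix _ _ Ω) e a * X a b) (P b e) := Finset.sum_comm
    _ = _ := Finset.sum_congr rfl fun e _ => Finset.sum_comm

variable {A B C : Matrix ι ι Ω} {S T : Matrix κ κ ℂ}

/-- The operator `-(-1)^j` and the conjugation by `S` of `M = A ⊗ 1 + B ⊗ S + C ⊗ T`, for odd `A` and
even `B`, `C`. -/
lemma semiconj_left (hS : S * S = 0) (hST : T * S = -(S * T)) {R : Type*} [Ring R] [Algebra ℂ R]
    (a b c : Matrix ι ι R) :
    (kr a 1 - kr b S - kr c T) * kr 1 S = kr 1 S * (kr a 1 + kr b S + kr c T) := by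
  simp [sub_mul, mul_add, kr_mul, hS, hST, kr_zero_right, kr_neg_right]

lemma semiconj_right (hT : T * T = 0) (hST : T * S = -(S * T)) {R : Type*} [Ring R] [Algebra ℂ R]
    (a b c : Matrix ι ι R) :
    (kr a 1 - kr b S - kr c T) * kr 1 T = kr 1 T * (kr a 1 + kr b S + kr c T) := by
  simp [sub_mul, mul_add, kr_mul, hT, hST, kr_zero_right, kr_neg_right]
  abel

lemma W_zero_letter {n : ℕ} (K : Matrix ι ι Ω) (m : Fin n) (X Z : Matrix ι ι Ω) :
    W n (Fin.cons K (word m X 0 Z)) = 0 := by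
  refine MultilinearMap.map_coord_zero _ m.succ ?_
  simp [word]

lemma W_word_neg {n : ℕ} (K : Matrix ι ι Ω) (m : Fin n) (X Y Z : Matrix ι ι Ω) :
    W n (Fin.cons K (word m X (-Y) Z)) = - W n (Fin.cons K (word m X Y Z)) := by
  rw [W_word, W_word, tw_neg]
  simp

lemma W_word_add {n : ℕ} (K : Matrix ι ι Ω) (m : Fin n) (X Y Y' Z : Matrix ι ι Ω) :
    W n (Fin.cons K (word m X (Y + Y') Z)) =
      W n (Fin.cons K (word m X Y Z)) + W n (Fin.cons K (word m X Y' Z)) := by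
  rw [W_word, W_word, W_word, tw_add]
  simp [mul_add, add_mul]

/-- The Hochschild differential of closed words in `𝔸 = A ⊗ 1 + B ⊗ S + C ⊗ T`, where `A` is a flat
superconnection and `-B`, `-C` generate its variations `X`, `Y`. -/
theorem b_closed_words (hS : S * S = 0) (hT : T * T = 0) (hST : T * S = -(S * T))
    (k : Matrix κ κ ℂ) {X Y Z B' C' : Matrix ι ι Ω}
    (hA : A.map DGData.par = -A) (hB : B.map DGData.par = B) (hC : C.map DGData.par = C)
    (hdA : A.map DGData.d + A * A = 0) (hdB : B.map DGData.d + A * B - B * A = -X)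
    (hdC : C.map DGData.d + A * C - C * A = -Y) (hBC : B * C = 0) (hCB : C * B = 0) (n : ℕ) :
    dOp (W n (Fin.cons (kr 1 k) fun _ => kr A 1 + kr B S + kr C T)) +
      mulOp (W (n + 1) (Fin.cons (kr 1 k) fun _ => kr A 1 + kr B S + kr C T)) =
    insW n (kr 1 (k * S)) (kr A 1 + kr B S + kr C T) (kr X 1 + kr B' S + kr Z T) +
    insW n (kr 1 (k * T)) (kr A 1 + kr B S + kr C T) (kr Y 1 + kr Z S + kr C' T) := by
  set 𝔸 := kr A 1 + kr B S + kr C T with h𝔸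
  set N : Matrix (ι × κ) (ι × κ) Ω := kr A 1 - kr B S - kr C T with hN
  have par_map : ∀ (P : Matrix ι ι Ω) (c : Matrix κ κ ℂ),
      (kr P c).map DGData.par = kr (P.map DGData.par) c := fun P c => kr_map _ _ _
  have hA' := fun i j => congrFun (congrFun hA i) j
  have hB' := fun i j => congrFun (congrFun hB i) j
  have hC' := fun i j => congrFun (congrFun hC i) j
  simp only [Matrix.map_apply, Matrix.neg_apply] at hA' hB' hC'
  have hsg : 𝔸.map sg = N := by
    ext a b
    simp [h𝔸, hN, sg, kr, hA', hB', hC']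
    abel
  have hp1 : 𝔸.map (prj 1) = kr A 1 := by
    ext a b
    simp [h𝔸, prj, kr, hA', hB', hC']
    module
  have hp0 : 𝔸.map (prj 0) = kr B S + kr C T := by
    ext a b
    simp [h𝔸, prj, kr, hA', hB', hC']
    module
  have hk : (kr (1 : Matrix ι ι Ω) k).map DGData.par = kr 1 k := by
    rw [par_map]
    congr 1
    ext a b
    rcases eq_or_ne a b with rfl | h
    · simpa [← dg_one] using (DGData.par_one : DGData.par (DGData.one : Ω) = _)
    · simp [Matrix.one_apply_ne h]
  have hdk : (kr (1 : Matrix ι ι Ω) k).map DGData.d = 0 := by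
    rw [kr_map]
    have : (1 : Matrix ι ι Ω).map DGData.d = 0 := by
      ext a b
      rcases eq_or_ne a b with rfl | h
      · simpa [← dg_one] using (DGData.d_one : DGData.d (DGData.one : Ω) = _)
      · simp [Matrix.one_apply_ne h]
    rw [this, kr_zero_left]
  have hF : 𝔸.map DGData.d + N * 𝔸 = -(kr X S + kr Y T) := by
    have h1 : 𝔸.map DGData.d = kr (A.map DGData.d) 1 + kr (B.map DGData.d) S + kr (C.map DGData.d) T := by
      rw [← kr_map, ← kr_map, ← kr_map]
      ext a b
      simp [h𝔸]
    have h2 : N * 𝔸 = kr (A * A) 1 + kr (A * B - B * A) S + kr (A * C - C * A) T := by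
      simp only [hN, h𝔸, add_mul, neg_mul, mul_add, kr_mul, hS, hT, hST, hBC, hCB, kr_zero_left,
        kr_zero_right, one_mul, mul_one, sub_eq_add_neg, kr_add_left, kr_neg_left, kr_neg_right]
      abel
    rw [h1, h2, neg_add, ← kr_neg_left, ← kr_neg_left, ← hdB, ← hdC]
    rw [show kr (A.map DGData.d) 1 + kr (B.map DGData.d) S + kr (C.map DGData.d) T +
      (kr (A * A) 1 + kr (A * B - B * A) S + kr (A * C - C * A) T) =
      (kr (A.map DGData.d) 1 + kr (A * A) 1) + (kr (B.map DGData.d) S + kr (A * B - B * A) S) +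
        (kr (C.map DGData.d) T + kr (A * C - C * A) T) by abel, ← kr_add_left, ← kr_add_left,
      ← kr_add_left, hdA, kr_zero_left, zero_add, add_sub_assoc, add_sub_assoc]
  have hM : tw 𝔸 = kr (tw A) 1 + kr (tw B) S + kr (tw C) T := by
    rw [h𝔸, tw_add, tw_add, tw_kr, tw_kr, tw_kr]
  have hN' : tw N = kr (tw A) 1 - kr (tw B) S - kr (tw C) T := by
    rw [hN, sub_eq_add_neg, sub_eq_add_neg, tw_add, tw_add, tw_neg, tw_neg, tw_kr, tw_kr, tw_kr,
      sub_eq_add_neg, sub_eq_add_neg]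
  have hSM : ∀ m : ℕ, tw N ^ m * kr 1 S = kr 1 S * tw 𝔸 ^ m := fun m =>
    ((SemiconjBy.pow_right (x := tw 𝔸) (y := tw N) (a := kr 1 S)
      (by rw [SemiconjBy, hM, hN', semiconj_left hS hST]) m)).symm
  have hTM : ∀ m : ℕ, tw N ^ m * kr 1 T = kr 1 T * tw 𝔸 ^ m := fun m =>
    ((SemiconjBy.pow_right (x := tw 𝔸) (y := tw N) (a := kr 1 T)
      (by rw [SemiconjBy, hM, hN', semiconj_right hT hST]) m)).symm
  have hends : W n (Fin.cons (kr 1 k * 𝔸) fun _ => 𝔸) =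
      W n (Fin.cons (kr A 1 * kr 1 k) fun _ => 𝔸) +
      W n (Fin.cons ((kr B S + kr C T) * kr 1 k) fun _ => N) := by
    simp only [W_const]
    have e1 : (kr B S + kr C T) * kr 1 k = kr 1 S * kr B k + kr 1 T * kr C k := by
      simp [add_mul, kr_mul]
    have e2 : kr 1 k * 𝔸 = kr A 1 * kr 1 k + kr B k * kr 1 S + kr C k * kr 1 T := by
      simp [h𝔸, mul_add, kr_mul]
    rw [e1, e2, map_add, map_add, map_add, LinearMap.add_apply, LinearMap.add_apply,
      LinearMap.add_apply, ← pair_kr_right, ← pair_kr_right, hSM, hTM, pair_kr_left, pair_kr_left,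
      add_assoc]
  rw [dOp_W_cons _ _ hk hdk, mulOp_W_cons _ _ hk, hsg, hp1, hp0, hends, insW, insW, mixW, mixW,
    ← Finset.sum_add_distrib]
  have hterm : ∀ m : Fin n,
      W n (Fin.cons (kr 1 (k * S)) (word m 𝔸 (kr X 1 + kr B' S + kr Z T) 𝔸)) +
      W n (Fin.cons (kr 1 (k * T)) (word m 𝔸 (kr Y 1 + kr Z S + kr C' T) 𝔸)) =
      - (W n (Fin.cons (kr 1 k) (word m N (𝔸.map DGData.d) 𝔸)) +
        W n (Fin.cons (kr 1 k) (word m N (N * 𝔸) 𝔸))) := by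
    intro m
    rw [← W_word_add, hF, W_word_neg, neg_neg, W_word, W_word, W_word]
    have e1 : ∀ c : Matrix κ κ ℂ, (kr 1 (k * c) : Matrix (ι × κ) (ι × κ) Ω) = kr 1 k * kr 1 c := by
      intro c
      rw [kr_mul, one_mul]
    rw [e1, e1, ← pair_kr_left, ← pair_kr_left, ← map_add]
    congr 1
    simp only [← mul_assoc]
    rw [← hSM, ← hTM, ← add_mul, mul_assoc (tw N ^ (m : ℕ)), mul_assoc (tw N ^ (m : ℕ)), ← mul_add]
    congr 2
    simp only [tw_add, tw_kr, mul_add, kr_mul, one_mul, mul_one, hS, hT, hST, kr_zero_right,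
      kr_neg_right]
    abel
  simp only [hterm, Finset.sum_neg_distrib, Finset.sum_add_distrib]
  abel

end Block

section Chen

/-! ### The Chen relations for matrices -/

variable {Ω : Type*} [AddCommGroup Ω] [Module ℂ Ω] [TopologicalSpace Ω] [DGData Ω]
  [AssocDG Ω] {κ : Type} [Fintype κ] [DecidableEq κ] {F : Submodule ℂ Ω}

attribute [local instance] dgRing dgAlgebra

lemma W_update_sum (n : ℕ) (V : Fin (n + 1) → Matrix κ κ Ω) (j : Fin (n + 1)) (X Y : Matrix κ κ Ω) :
    W n (Function.update V j (X * Y)) = ∑ i : Fin (n + 1) → κ, ∑ e,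
      el n (Function.update (fun k => V k (i k) (i (k + 1))) j (X (i j) e * Y e (i (j + 1)))) := by
  rw [W_apply]
  refine Finset.sum_congr rfl fun i _ => ?_
  rw [← update_entries, Matrix.mul_apply, MultilinearMap.map_update_sum]

theorem W_chen_relation (n : ℕ) (V : Fin (n + 1) → Matrix κ κ Ω) (j : Fin (n + 1))
    (G : Matrix κ κ Ω) (hG : ∀ a b, G a b ∈ F) :
    W n (Function.update V j (V j * G)) + W (n + 1) (j.succ.insertNth (G.map DGData.d) V) -
      W n (Function.update V (j + 1) (G * V (j + 1))) ∈ chenSubspace F := by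
  set v : (Fin (n + 1) → κ) → κ → Fin (n + 1) → Ω := fun i e k =>
    if k = j then V j (i j) e else V k (i k) (i (k + 1)) with hv
  have h1 : W n (Function.update V j (V j * G)) = ∑ i : Fin (n + 1) → κ, ∑ e,
      el n (Function.update (v i e) j (DGData.mul (v i e j) (G e (i (j + 1))))) := by
    rw [W_update_sum]
    refine Finset.sum_congr rfl fun i _ => Finset.sum_congr rfl fun e _ => ?_
    congr 1
    funext k
    rcases eq_or_ne k j with rfl | h
    · simp [hv, dg_mul]
    · simp [h, hv]
  have h2 : W (n + 1) (j.succ.insertNth (G.map DGData.d) V) = ∑ i : Fin (n + 1) → κ, ∑ e,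
      el (n + 1) (j.succ.insertNth (DGData.d (G e (i (j + 1)))) (v i e)) := by
    rw [W_apply, ← (Fin.insertNthEquiv (fun _ => κ) j.succ).sum_comp, Fintype.sum_prod_type,
      Finset.sum_comm]
    refine Finset.sum_congr rfl fun i _ => Finset.sum_congr rfl fun e _ => ?_
    congr 1
    funext k
    simp only [Fin.insertNthEquiv_apply]
    refine Fin.succAboveCases j.succ ?_ (fun k => ?_) k
    · rw [Fin.insertNth_apply_same, Fin.insertNth_apply_same, Fin.insertNth_apply_same,
        succ_add_one, Fin.insertNth_apply_succAbove]
      rfl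
    · rw [Fin.insertNth_apply_succAbove, Fin.insertNth_apply_succAbove,
        Fin.insertNth_apply_succAbove]
      rcases eq_or_ne k j with rfl | h
      · rw [succAbove_self_add_one, Fin.insertNth_apply_same]
        simp [hv]
      · rw [succAbove_add_one _ _ h, Fin.insertNth_apply_succAbove]
        simp [hv, h]
  have h3 : W n (Function.update V (j + 1) (G * V (j + 1))) = ∑ i : Fin (n + 1) → κ, ∑ e,
      el n (Function.update (v i e) (j + 1) (DGData.mul (G e (i (j + 1))) (v i e (j + 1)))) := by
    rw [W_update_sum, ← Fintype.sum_prod_type', ← Fintype.sum_prod_type']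
    let σ : (Fin (n + 1) → κ) × κ → (Fin (n + 1) → κ) × κ :=
      fun p => (Function.update p.1 (j + 1) p.2, p.1 (j + 1))
    have hσ : Function.Involutive σ := fun p => by simp [σ]
    refine Fintype.sum_equiv hσ.toPerm _ _ fun p => ?_
    rcases p with ⟨p, c⟩
    change _ = el n (Function.update (v (Function.update p (j + 1) c) (p (j + 1))) (j + 1)
      (DGData.mul (G (p (j + 1)) (Function.update p (j + 1) c (j + 1)))
        (v (Function.update p (j + 1) c) (p (j + 1)) (j + 1))))
    congr 1
    funext k
    rcases eq_or_ne k (j + 1) with rfl | h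
    · simp only [Function.update_self, hv, dg_mul]
      congr 1
      by_cases hj : j + 1 = j
      · rw [if_pos hj, hj, hj, Function.update_self]
      · rw [if_neg hj, Function.update_of_ne (by simpa using hj)]
    · simp only [Function.update_of_ne h, hv]
      by_cases hk : k = j
      · subst hk
        rw [if_pos rfl, Function.update_of_ne h]
      · rw [if_neg hk, Function.update_of_ne (by simpa using hk)]
  rw [h1, h2, h3, ← Finset.sum_add_distrib, ← Finset.sum_sub_distrib]
  refine Submodule.sum_mem _ fun i _ => ?_
  rw [← Finset.sum_add_distrib, ← Finset.sum_sub_distrib]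
  refine Submodule.sum_mem _ fun e _ => Submodule.subset_span (Or.inr ?_)
  exact ⟨n, v i e, j, G e (i (j + 1)), hG _ _, rfl⟩

variable {K G G' 𝔸 𝔸' : Matrix κ κ Ω}

lemma gauge_step (hG : ∀ a b, G a b ∈ F) (h1 : G * G' = 1) (h2 : G' * G = 1) (hK : G * K = K * G)
    (h𝔸 : G * 𝔸 = 𝔸' * G + G.map DGData.d) (n : ℕ) :
    W n (Fin.cons K fun _ => 𝔸) - W n (Fin.cons K fun _ => 𝔸') +
      (mixW (n + 1) (K * G') 𝔸' (G.map DGData.d) 𝔸 - mixW n (K * G') 𝔸' (G.map DGData.d) 𝔸) ∈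
        chenSubspace F := by
  let V : ℕ → Fin (n + 1) → Matrix κ κ Ω := fun a =>
    Fin.cons (K * G') (fun k : Fin n => if k.val < a then 𝔸' else 𝔸)
  have key : ∑ a : Fin (n + 1), (W n (Function.update (V a) a (V a a * G)) +
      W (n + 1) (a.succ.insertNth (G.map DGData.d) (V a)) -
      W n (Function.update (V a) (a + 1) (G * V a (a + 1)))) ∈ chenSubspace F :=
    Submodule.sum_mem _ fun a _ => W_chen_relation n (V a) a G hG
  have hins : ∀ a : Fin (n + 1), (a.succ.insertNth (G.map DGData.d) (V a) : Fin (n + 2) → _) =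
      Fin.cons (K * G') (word a 𝔸' (G.map DGData.d) 𝔸) := by
    intro a
    rw [eq_comm, Fin.eq_insertNth_iff]
    refine ⟨by simp [word], ?_⟩
    funext k
    refine Fin.cases ?_ (fun k => ?_) k
    · simp [V, Fin.removeNth]
    · simp only [V, Fin.removeNth, Fin.succ_succAbove_succ, Fin.cons_succ, word]
      rcases lt_or_ge k.castSucc a with h | h
      · rw [Fin.succAbove_of_castSucc_lt _ _ h]
        have := Fin.lt_def.mp h
        simp at this
        simp [this]
      · rw [Fin.succAbove_of_le_castSucc _ _ h]
        have := Fin.le_def.mp h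
        simp at this
        rw [if_neg (by simp; omega), if_neg (by simp; omega), if_neg (by omega)]
  have hY0 : Function.update (V (0 : Fin (n + 1))) 0 (V (0 : Fin (n + 1)) 0 * G) =
      Fin.cons K fun _ => 𝔸 := by
    funext k
    refine Fin.cases ?_ (fun k => ?_) k
    · simp [V, mul_assoc, h2]
    · simp [V]
  have hZl : Function.update (V (Fin.last n)) (Fin.last n + 1) (G * V (Fin.last n) (Fin.last n + 1)) =
      Fin.cons K fun _ => 𝔸' := by
    funext k
    rw [Fin.last_add_one]
    refine Fin.cases ?_ (fun k => ?_) k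
    · simp [V, ← mul_assoc, hK]
      rw [mul_assoc, h1, mul_one]
    · simp [V]
  have hZ : ∀ a : Fin n, W n (Function.update (V a.castSucc) (a.castSucc + 1)
      (G * V a.castSucc (a.castSucc + 1))) =
      W n (Function.update (V a.succ) a.succ (V a.succ a.succ * G)) +
      W n (Fin.cons (K * G') (word a 𝔸' (G.map DGData.d) 𝔸)) := by
    intro a
    have e1 : V a.castSucc a.succ = 𝔸 := by simp [V]
    have e2 : V a.succ a.succ = 𝔸' := by simp [V]
    rw [Fin.coeSucc_eq_succ, e1, e2, h𝔸, MultilinearMap.map_update_add]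
    congr 2
    · funext k
      rcases eq_or_ne k a.succ with rfl | hk
      · simp
      · rw [Function.update_of_ne hk, Function.update_of_ne hk]
        revert hk
        refine Fin.cases ?_ (fun k => ?_) k
        · simp [V]
        · intro hk
          have : (k : ℕ) ≠ a := fun h => hk (by ext; simp [h])
          simp only [V, Fin.cons_succ, Fin.val_castSucc, Fin.val_succ]
          congr 1
          simp only [eq_iff_iff]
          omega
    · funext k
      refine Fin.cases ?_ (fun k => ?_) k
      · rw [Function.update_of_ne (Fin.succ_ne_zero a).symm]
        simp [V]
      · rcases eq_or_ne k a with rfl | hk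
        · simp [word]
        · rw [Function.update_of_ne (by simpa using hk)]
          simp [V, word, Fin.val_eq_val, hk]
  have hsum : ∑ a : Fin (n + 1), (W n (Function.update (V a) a (V a a * G)) +
      W (n + 1) (a.succ.insertNth (G.map DGData.d) (V a)) -
      W n (Function.update (V a) (a + 1) (G * V a (a + 1)))) =
      W n (Fin.cons K fun _ => 𝔸) - W n (Fin.cons K fun _ => 𝔸') +
      (mixW (n + 1) (K * G') 𝔸' (G.map DGData.d) 𝔸 - mixW n (K * G') 𝔸' (G.map DGData.d) 𝔸) := by
    rw [Finset.sum_sub_distrib, Finset.sum_add_distrib, Fin.sum_univ_succ,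
      Fin.sum_univ_castSucc (fun a : Fin (n + 1) => W n (Function.update (V a) (a + 1) _)), hY0, hZl]
    simp only [hZ, hins, Finset.sum_add_distrib, mixW]
    abel
  rwa [hsum] at key

theorem gauge_sum (hG : ∀ a b, G a b ∈ F) (h1 : G * G' = 1) (h2 : G' * G = 1) (hK : G * K = K * G)
    (h𝔸 : G * 𝔸 = 𝔸' * G + G.map DGData.d) (N : ℕ) :
    ∑ n ∈ Finset.range N, (W n (Fin.cons K fun _ => 𝔸) - W n (Fin.cons K fun _ => 𝔸')) +
      mixW N (K * G') 𝔸' (G.map DGData.d) 𝔸 ∈ chenSubspace F := by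
  induction N with
  | zero => simp [mixW]
  | succ N ih =>
    rw [Finset.sum_range_succ]
    have := add_mem ih (gauge_step hG h1 h2 hK h𝔸 N)
    convert this using 1
    abel

end Chen

section Integrals

/-! ### Integrals of curves in finite dimensional subspaces -/

variable {V W : Type*} [AddCommGroup V] [Module ℂ V] [AddCommGroup W] [Module ℂ W]

lemma eq_of_dual_eq {a b : V} (h : ∀ φ : Module.Dual ℂ V, φ a = φ b) : a = b := by
  rw [← sub_eq_zero]
  exact (Module.forall_dual_apply_eq_zero_iff ℂ _).mp fun φ => by rw [map_sub, h, sub_self]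

lemma IsIntegral01.unique {c : ℝ → V} {a b : V} (ha : IsIntegral01 c a) (hb : IsIntegral01 c b) :
    a = b :=
  eq_of_dual_eq fun φ => by rw [(ha φ).2, (hb φ).2]

lemma IsIntegral01.map {c : ℝ → V} {a : V} (ha : IsIntegral01 c a) (T : V →ₗ[ℂ] W) :
    IsIntegral01 (fun s => T (c s)) (T a) := fun φ => ha (φ ∘ₗ T)

lemma IsIntegral01.const (a : V) : IsIntegral01 (fun _ => a) a := fun φ => by
  simp [continuous_const]

lemma IsIntegral01.add {c c' : ℝ → V} {a a' : V} (h : IsIntegral01 c a) (h' : IsIntegral01 c' a') :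
    IsIntegral01 (fun s => c s + c' s) (a + a') := fun φ => by
  simp only [map_add]
  refine ⟨(h φ).1.add (h' φ).1, ?_⟩
  rw [(h φ).2, (h' φ).2, intervalIntegral.integral_add ((h φ).1.intervalIntegrable _ _)
    ((h' φ).1.intervalIntegrable _ _)]

lemma IsIntegral01.neg {c : ℝ → V} {a : V} (h : IsIntegral01 c a) :
    IsIntegral01 (fun s => -c s) (-a) := h.map (-LinearMap.id)

lemma IsIntegral01.sub {c c' : ℝ → V} {a a' : V} (h : IsIntegral01 c a) (h' : IsIntegral01 c' a') :
    IsIntegral01 (fun s => c s - c' s) (a - a') := by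
  simpa only [sub_eq_add_neg] using h.add h'.neg

lemma IsIntegral01.mem {c : ℝ → V} {a : V} (h : IsIntegral01 c a) (S : Submodule ℂ V)
    (hc : ∀ s, c s ∈ S) : a ∈ S := by
  rw [← Submodule.Quotient.mk_eq_zero]
  have h1 := h.map S.mkQ
  have h2 : (fun s => S.mkQ (c s)) = fun _ => 0 :=
    funext fun s => (Submodule.Quotient.mk_eq_zero S).mpr (hc s)
  rw [h2] at h1
  exact h1.unique (IsIntegral01.const 0)

lemma IsIntegral01.seminorm_le {c : ℝ → V} {a : V} (h : IsIntegral01 c a) (p : Seminorm ℂ V)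
    {R : ℝ} (hc : ∀ s ∈ Set.Icc (0 : ℝ) 1, p (c s) ≤ R) : p a ≤ R := by
  by_cases ha : a = 0
  · subst ha
    rw [map_zero]
    exact (apply_nonneg p _).trans (hc 0 (by simp))
  let e := LinearEquiv.toSpanNonzeroSingleton ℂ V a ha
  let f : Module.Dual ℂ (ℂ ∙ a) := (p a : ℂ) • (e.symm : (ℂ ∙ a) →ₗ[ℂ] ℂ)
  have hf : ∀ z : ℂ, f ⟨z • a, Submodule.smul_mem _ _ (Submodule.mem_span_singleton_self a)⟩ =
      p a * z := by
    intro z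
    have : e.symm ⟨z • a, Submodule.smul_mem _ _ (Submodule.mem_span_singleton_self a)⟩ = z := by
      rw [LinearEquiv.symm_apply_eq]
      rfl
    simp [f, this]
  obtain ⟨φ, h1, h2⟩ := Module.Dual.exists_extension_of_le_seminorm (ℂ ∙ a) f (p := p) (by
    rintro ⟨x, hx⟩
    obtain ⟨z, rfl⟩ := Submodule.mem_span_singleton.mp hx
    rw [hf, map_smul_eq_mul, norm_mul, Complex.norm_real, Real.norm_of_nonneg (apply_nonneg p a),
      mul_comm])
  have h3 : φ a = p a := by
    have := (h1 ⟨(1 : ℂ) • a, Submodule.smul_mem _ _ (Submodule.mem_span_singleton_self a)⟩).trans (hf 1)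
    simpa using this
  have h4 : ‖φ a‖ ≤ R * |(1 : ℝ) - 0| := by
    rw [(h φ).2]
    refine intervalIntegral.norm_integral_le_of_norm_le_const fun s hs => (h2 _).trans (hc s ?_)
    rw [Set.uIoc_of_le zero_le_one] at hs
    exact ⟨hs.1.le, hs.2⟩
  rw [h3, Complex.norm_real, Real.norm_of_nonneg (apply_nonneg p a)] at h4
  simpa using h4

lemma FinCurve.bounded {c : ℝ → V} (h : FinCurve c) (p : Seminorm ℂ V) :
    ∃ R, ∀ s ∈ Set.Icc (0 : ℝ) 1, p (c s) ≤ R := by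
  obtain ⟨ι, _, f, a, hf, hc⟩ := h
  have hcont : Continuous fun s : ℝ => ∑ k, ‖f k s‖ * p (a k) :=
    continuous_finsetSum _ fun k _ => (hf k).norm.mul continuous_const
  obtain ⟨R, hR⟩ := isCompact_Icc.bddAbove_image (f := fun s : ℝ => ∑ k, ‖f k s‖ * p (a k))
    (K := Set.Icc (0 : ℝ) 1) hcont.continuousOn
  refine ⟨R, fun s hs => ?_⟩
  refine le_trans ?_ (hR (Set.mem_image_of_mem _ hs))
  rw [hc]
  refine (Finset.le_sum_of_subadditive p (map_zero p).le (map_add_le_add p) _ _).trans ?_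
  exact Finset.sum_le_sum fun k _ => (map_smul_eq_mul p _ _).le

/-- A differentiable curve in a finite dimensional subspace, and its derivative. -/
def FinDiff (c c' : ℝ → V) : Prop :=
  ∃ (ι : Type) (_ : Fintype ι) (f f' : ι → ℝ → ℂ) (a : ι → V),
    (∀ k s, HasDerivAt (f k) (f' k s) s) ∧ (∀ k, Continuous (f' k)) ∧
    (∀ s, c s = ∑ k, f k s • a k) ∧ (∀ s, c' s = ∑ k, f' k s • a k)

lemma FinDiff.isIntegral {c c' : ℝ → V} (h : FinDiff c c') : IsIntegral01 c' (c 1 - c 0) := by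
  obtain ⟨ι, _, f, f', a, hf, hf', hc, hc'⟩ := h
  intro φ
  have h1 : (fun s => φ (c' s)) = fun s => ∑ k, f' k s * φ (a k) := by
    funext s; simp [hc']
  have h2 : Continuous fun s => ∑ k, f' k s * φ (a k) :=
    continuous_finsetSum _ fun k _ => (hf' k).mul continuous_const
  rw [h1]
  refine ⟨h2, ?_⟩
  rw [intervalIntegral.integral_eq_sub_of_hasDerivAt (f := fun s => ∑ k, f k s * φ (a k))
    (fun s _ => ?_) (h2.intervalIntegrable _ _)]
  · simp [hc]
  · exact HasDerivAt.fun_sum fun k _ => (hf k s).mul_const _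

lemma FinDiff.finCurve {c c' : ℝ → V} (h : FinDiff c c') : FinCurve c := by
  obtain ⟨ι, _, f, f', a, hf, hf', hc, hc'⟩ := h
  exact ⟨ι, inferInstance, f, a, fun k => continuous_iff_continuousAt.mpr fun s =>
    (hf k s).continuousAt, hc⟩

lemma FinDiff.quadratic (a₀ a₁ a₂ : V) :
    FinDiff (fun s => a₀ + (s : ℂ) • a₁ + ((s : ℂ) ^ 2) • a₂)
      (fun s => a₁ + (2 * (s : ℂ)) • a₂) := by
  refine ⟨Fin 3, inferInstance, ![fun _ => 1, fun s => s, fun s => (s : ℂ) ^ 2],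
    ![fun _ => 0, fun _ => 1, fun s => 2 * s], ![a₀, a₁, a₂], fun k s => ?_, fun k => ?_,
    fun s => ?_, fun s => ?_⟩
  · have h := (hasDerivAt_id s).ofReal_comp
    fin_cases k
    · exact hasDerivAt_const _ _
    · simpa using h
    · have h2 := h.fun_pow 2
      simpa using h2
  · fin_cases k
    · exact continuous_const
    · exact continuous_const
    · exact continuous_const.mul Complex.continuous_ofReal
  · simp [Fin.sum_univ_three]
  · simp [Fin.sum_univ_three]

lemma FinDiff.multilinear {n : ℕ} (T : MultilinearMap ℂ (fun _ : Fin n => V) W)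
    {c c' : ℝ → V} (h : FinDiff c c') :
    FinDiff (fun s => T (fun _ => c s))
      (fun s => ∑ j, T (Function.update (fun _ => c s) j (c' s))) := by
  classical
  obtain ⟨ι, _, f, f', a, hf, hf', hc, hc'⟩ := h
  have hcont : ∀ k, Continuous (f k) := fun k => continuous_iff_continuousAt.mpr fun s =>
    (hf k s).continuousAt
  refine ⟨Fin n → ι, inferInstance, fun r s => ∏ i, f (r i) s,
    fun r s => ∑ j, (∏ i ∈ Finset.univ.erase j, f (r i) s) • f' (r j) s,
    fun r => T (fun i => a (r i)), fun r s => ?_, fun r => ?_, fun s => ?_, fun s => ?_⟩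
  · exact HasDerivAt.fun_finsetProd fun i _ => hf (r i) s
  · exact continuous_finsetSum _ fun j _ => (continuous_finsetProd _ fun i _ => hcont (r i)).smul (hf' (r j))
  · simp only [hc]
    rw [MultilinearMap.map_sum]
    exact Finset.sum_congr rfl fun r _ => MultilinearMap.map_smul_univ _ _ _
  · simp only [Finset.sum_smul]
    rw [Finset.sum_comm]
    refine Finset.sum_congr rfl fun j _ => ?_
    have h1 : Function.update (fun _ : Fin n => c s) j (c' s) =
        fun i => ∑ k, (if i = j then f' k s else f k s) • a k := by
      funext i
      rcases eq_or_ne i j with rfl | hi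
      · simp [hc']
      · simp [hc, hi]
    rw [h1, MultilinearMap.map_sum]
    refine Finset.sum_congr rfl fun r _ => ?_
    rw [MultilinearMap.map_smul_univ]
    congr 1
    rw [← Finset.mul_prod_erase Finset.univ _ (Finset.mem_univ j), if_pos rfl, mul_comm, smul_eq_mul]
    congr 1
    exact Finset.prod_congr rfl fun i hi => if_neg (Finset.ne_of_mem_erase hi)

/-- Sums of products of continuous functions of `s` and `t` and vectors. -/
def SepCurve (c : ℝ → ℝ → V) : Prop :=
  ∃ (ι : Type) (_ : Fintype ι) (f g : ι → ℝ → ℂ) (a : ι → V),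
    (∀ k, Continuous (f k)) ∧ (∀ k, Continuous (g k)) ∧ ∀ s t, c s t = ∑ k, (f k s * g k t) • a k

/-- Iterated integrals. -/
def IsIntegral2 (c : ℝ → ℝ → V) (a : V) : Prop :=
  ∃ b b' : ℝ → V, (∀ s, IsIntegral01 (c s) (b s)) ∧ IsIntegral01 b a ∧
    (∀ t, IsIntegral01 (fun s => c s t) (b' t)) ∧ IsIntegral01 b' a

lemma isIntegral_sum {ι : Type} [Fintype ι] (f : ι → ℝ → ℂ) (a : ι → V)
    (hf : ∀ k, Continuous (f k)) :
    IsIntegral01 (fun s => ∑ k, f k s • a k) (∑ k, (∫ s in (0 : ℝ)..1, f k s) • a k) := by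
  intro φ
  have h1 : (fun s => φ (∑ k, f k s • a k)) = fun s => ∑ k, f k s * φ (a k) := by
    funext s; simp
  rw [h1]
  refine ⟨continuous_finsetSum _ fun k _ => (hf k).mul continuous_const, ?_⟩
  have h2 : ∀ k ∈ (Finset.univ : Finset ι),
      IntervalIntegrable (fun s => f k s * φ (a k)) MeasureTheory.volume 0 1 := fun k _ =>
    ((hf k).mul continuous_const).intervalIntegrable _ _
  rw [intervalIntegral.integral_finsetSum h2]
  simp [intervalIntegral.integral_mul_const]

lemma SepCurve.exists_integral {c : ℝ → ℝ → V} (h : SepCurve c) : ∃ a, IsIntegral2 c a := by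
  obtain ⟨ι, _, f, g, a, hf, hg, hc⟩ := h
  refine ⟨∑ k, (∫ s in (0 : ℝ)..1, f k s) • (∫ t in (0 : ℝ)..1, g k t) • a k,
    fun s => ∑ k, f k s • (∫ t in (0 : ℝ)..1, g k t) • a k,
    fun t => ∑ k, g k t • (∫ s in (0 : ℝ)..1, f k s) • a k, fun s => ?_, ?_, fun t => ?_, ?_⟩
  · have := isIntegral_sum g (fun k => f k s • a k) hg
    simp only [smul_comm _ (f _ s)] at this
    convert this using 2 with t
    simp only [hc, mul_smul]
  · exact isIntegral_sum f _ hf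
  · have := isIntegral_sum f (fun k => g k t • a k) hf
    simp only [smul_comm _ (g _ t)] at this
    convert this using 2 with s
    simp only [hc, mul_comm (f _ s), mul_smul]
  · have := isIntegral_sum g (fun k => (∫ s in (0 : ℝ)..1, f k s) • a k) hg
    simpa only [smul_comm (∫ t in (0 : ℝ)..1, g _ t)] using this

lemma SepCurve.multilinear {n : ℕ} (T : MultilinearMap ℂ (fun _ : Fin n => V) W)
    {c : Fin n → ℝ → ℝ → V} (h : ∀ i, SepCurve (c i)) : SepCurve (fun s t => T (fun i => c i s t)) := by
  choose ι hι f g a hf hg hc using h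
  refine ⟨(i : Fin n) → ι i, inferInstance, fun r s => ∏ i, f i (r i) s, fun r t => ∏ i, g i (r i) t,
    fun r => T (fun i => a i (r i)), fun r => continuous_finsetProd _ fun i _ => hf i (r i),
    fun r => continuous_finsetProd _ fun i _ => hg i (r i), fun s t => ?_⟩
  simp only [hc]
  rw [MultilinearMap.map_sum]
  refine Finset.sum_congr rfl fun r _ => ?_
  rw [MultilinearMap.map_smul_univ, Finset.prod_mul_distrib]

lemma SepCurve.sum {κ : Type} [Fintype κ] {c : κ → ℝ → ℝ → V} (h : ∀ k, SepCurve (c k)) :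
    SepCurve (fun s t => ∑ k, c k s t) := by
  choose ι hι f g a hf hg hc using h
  refine ⟨Σ k, ι k, inferInstance, fun k => f k.1 k.2, fun k => g k.1 k.2, fun k => a k.1 k.2,
    fun k => hf k.1 k.2, fun k => hg k.1 k.2, fun s t => ?_⟩
  rw [Fintype.sum_sigma]
  exact Finset.sum_congr rfl fun k _ => hc k s t

lemma SepCurve.smul {f g : ℝ → ℂ} (hf : Continuous f) (hg : Continuous g) (a : V) :
    SepCurve (fun s t => (f s * g t) • a) :=
  ⟨Unit, inferInstance, fun _ => f, fun _ => g, fun _ => a, fun _ => hf, fun _ => hg, by simp⟩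

lemma SepCurve.const (a : V) : SepCurve (fun _ _ => a) := by
  simpa using SepCurve.smul (f := fun _ => 1) (g := fun _ => 1) continuous_const continuous_const a

lemma SepCurve.add {c c' : ℝ → ℝ → V} (h : SepCurve c) (h' : SepCurve c') :
    SepCurve (fun s t => c s t + c' s t) := by
  have := SepCurve.sum (κ := Fin 2) (c := ![c, c']) (fun k => by fin_cases k; exacts [h, h'])
  simpa using this

lemma SepCurve.map {c : ℝ → ℝ → V} (h : SepCurve c) (T : V →ₗ[ℂ] W) :
    SepCurve (fun s t => T (c s t)) := by
  obtain ⟨ι, _, f, g, a, hf, hg, hc⟩ := h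
  exact ⟨ι, inferInstance, f, g, fun k => T (a k), hf, hg, fun s t => by simp [hc]⟩

lemma SepCurve.bounded {c : ℝ → ℝ → V} (h : SepCurve c) (p : Seminorm ℂ V) :
    ∃ R, ∀ s ∈ Set.Icc (0 : ℝ) 1, ∀ t ∈ Set.Icc (0 : ℝ) 1, p (c s t) ≤ R := by
  obtain ⟨ι, _, f, g, a, hf, hg, hc⟩ := h
  have hcont : Continuous fun z : ℝ × ℝ => ∑ k, ‖f k z.1 * g k z.2‖ * p (a k) :=
    continuous_finsetSum _ fun k _ => (((hf k).comp continuous_fst).mul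
      ((hg k).comp continuous_snd)).norm.mul continuous_const
  obtain ⟨R, hR⟩ := (isCompact_Icc.prod isCompact_Icc).bddAbove_image
    (f := fun z : ℝ × ℝ => ∑ k, ‖f k z.1 * g k z.2‖ * p (a k))
    (K := Set.Icc (0 : ℝ) 1 ×ˢ Set.Icc (0 : ℝ) 1) hcont.continuousOn
  refine ⟨R, fun s hs t ht => ?_⟩
  refine le_trans ?_ (hR (Set.mem_image_of_mem _ (Set.mk_mem_prod hs ht)))
  rw [hc]
  refine (Finset.le_sum_of_subadditive p (map_zero p).le (map_add_le_add p) _ _).trans ?_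
  exact Finset.sum_le_sum fun k _ => (map_smul_eq_mul p _ _).le

lemma IsIntegral2.map {c : ℝ → ℝ → V} {a : V} (h : IsIntegral2 c a) (T : V →ₗ[ℂ] W) :
    IsIntegral2 (fun s t => T (c s t)) (T a) := by
  obtain ⟨b, b', h1, h2, h3, h4⟩ := h
  exact ⟨fun s => T (b s), fun t => T (b' t), fun s => (h1 s).map T, h2.map T,
    fun t => (h3 t).map T, h4.map T⟩

lemma IsIntegral2.add {c c' : ℝ → ℝ → V} {a a' : V} (h : IsIntegral2 c a) (h' : IsIntegral2 c' a') :
    IsIntegral2 (fun s t => c s t + c' s t) (a + a') := by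
  obtain ⟨b, b', h1, h2, h3, h4⟩ := h
  obtain ⟨e, e', k1, k2, k3, k4⟩ := h'
  exact ⟨_, _, fun s => (h1 s).add (k1 s), h2.add k2, fun t => (h3 t).add (k3 t), h4.add k4⟩

lemma IsIntegral2.unique {c : ℝ → ℝ → V} {a a' : V} (h : IsIntegral2 c a) (h' : IsIntegral2 c a') :
    a = a' := by
  obtain ⟨b, b', h1, h2, h3, h4⟩ := h
  obtain ⟨e, e', k1, k2, k3, k4⟩ := h'
  have : b = e := funext fun s => (h1 s).unique (k1 s)
  subst this
  exact h2.unique k2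

lemma IsIntegral2.seminorm_le {c : ℝ → ℝ → V} {a : V} (h : IsIntegral2 c a) (p : Seminorm ℂ V)
    {R : ℝ} (hc : ∀ s ∈ Set.Icc (0 : ℝ) 1, ∀ t ∈ Set.Icc (0 : ℝ) 1, p (c s t) ≤ R) : p a ≤ R := by
  obtain ⟨b, b', h1, h2, h3, h4⟩ := h
  exact h2.seminorm_le p fun s hs => (h1 s).seminorm_le p (hc s hs)

lemma IsIntegral2.mem {c : ℝ → ℝ → V} {a : V} (h : IsIntegral2 c a) (S : Submodule ℂ V)
    (hc : ∀ s t, c s t ∈ S) : a ∈ S := by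
  obtain ⟨b, b', h1, h2, h3, h4⟩ := h
  exact h2.mem S fun s => (h1 s).mem S (hc s)

/-- The fundamental theorem of calculus in the first variable. -/
lemma IsIntegral2.of_deriv_left {c c' : ℝ → ℝ → V} {a : V} (h : IsIntegral2 c' a)
    (hc : ∀ t, FinDiff (fun s => c s t) (fun s => c' s t)) :
    IsIntegral01 (fun t => c 1 t - c 0 t) a := by
  obtain ⟨b, b', h1, h2, h3, h4⟩ := h
  have : b' = fun t => c 1 t - c 0 t := funext fun t => (h3 t).unique (hc t).isIntegral
  rwa [this] at h4

/-- The fundamental theorem of calculus in the second variable. -/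
lemma IsIntegral2.of_deriv_right {c c' : ℝ → ℝ → V} {a : V} (h : IsIntegral2 c' a)
    (hc : ∀ s, FinDiff (fun t => c s t) (fun t => c' s t)) :
    IsIntegral01 (fun s => c s 1 - c s 0) a := by
  obtain ⟨b, b', h1, h2, h3, h4⟩ := h
  have : b = fun s => c s 1 - c s 0 := funext fun s => (h1 s).unique (hc s).isIntegral
  rwa [this] at h2

end Integrals

section Entire

/-! ### Entire sequences of chains -/

open scoped Topology

variable {Ω : Type*} [AddCommGroup Ω] [Module ℂ Ω] [TopologicalSpace Ω] [DGData Ω]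

lemma seminorm_sum_apply {V : Type*} [AddCommGroup V] [Module ℂ V] {ι : Type*} (s : Finset ι)
    (p : ι → Seminorm ℂ V) (x : V) : (∑ i ∈ s, p i) x = ∑ i ∈ s, p i x := by
  classical
  induction s using Finset.induction_on with
  | empty => simp
  | insert a s ha ih => rw [Finset.sum_insert ha, Finset.sum_insert ha, add_apply, ih]

/-- Sequences of chains of growth `R^n / √n!` for all seminorms. -/
def Entire (c : ℕ → Chain Ω) : Prop :=
  ∀ ε : Seminorm ℂ Ω, Continuous ε → ∃ R : ℝ, ∀ n, kappa ε (c n) ≤ R ^ (n + 1) / √(n.factorial : ℝ)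

lemma summable_pow_div_sqrt (R : ℝ) : Summable fun n : ℕ => R ^ (n + 1) / √(n.factorial : ℝ) := by
  have h1 : Summable fun n : ℕ => (4 * R ^ 2) ^ n / (n.factorial : ℝ) + (1 / 4) ^ n :=
    (Real.summable_pow_div_factorial _).add (summable_geometric_of_lt_one (by norm_num) (by norm_num))
  refine Summable.of_norm_bounded (h1.mul_left |R|) fun n => ?_
  have hpos : 0 < √(n.factorial : ℝ) := Real.sqrt_pos.mpr (by positivity)
  have hsq : √(n.factorial : ℝ) ^ 2 = n.factorial := Real.sq_sqrt (by positivity)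
  rw [norm_div, norm_pow, Real.norm_eq_abs, Real.norm_of_nonneg hpos.le, pow_succ', mul_div_assoc]
  refine mul_le_mul_of_nonneg_left ?_ (abs_nonneg R)
  have e1 : |R| ^ n / √(n.factorial : ℝ) = ((2 * |R|) ^ n / √(n.factorial : ℝ)) * (1 / 2) ^ n := by
    rw [mul_pow, one_div, inv_pow]
    field_simp
  have e2 : (4 * R ^ 2) ^ n / (n.factorial : ℝ) = ((2 * |R|) ^ n / √(n.factorial : ℝ)) ^ 2 := by
    rw [div_pow, hsq, ← pow_mul, mul_comm n, pow_mul]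
    congr 2
    rw [mul_pow, sq_abs]
    norm_num
  have e3 : ((1 : ℝ) / 4) ^ n = ((1 / 2) ^ n) ^ 2 := by
    rw [← pow_mul, mul_comm n, pow_mul]; norm_num
  rw [e1, e2, e3]
  nlinarith [sq_nonneg ((2 * |R|) ^ n / √(n.factorial : ℝ) - (1 / 2) ^ n),
    sq_nonneg ((2 * |R|) ^ n / √(n.factorial : ℝ)), sq_nonneg (((1 : ℝ) / 2) ^ n)]

lemma Entire.summable_kappa {c : ℕ → Chain Ω} (h : Entire c) (ε : Seminorm ℂ Ω)
    (hε : Continuous ε) : Summable fun n => kappa ε (c n) := by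
  obtain ⟨R, hR⟩ := h ε hε
  exact Summable.of_nonneg_of_le (fun n => apply_nonneg _ _) hR (summable_pow_div_sqrt R)

lemma Entire.summable {c : ℕ → Chain Ω} (h : Entire c) : Summable fun n => incl (c n) := by
  have h1 : CauchySeq fun s : Finset ℕ => ∑ n ∈ s, c n := by
    rw [cauchySeq_finset_iff_sum_vanishing]
    intro e he
    obtain ⟨s, r, hr, hsub⟩ := (withSeminorms_chain (Ω := Ω)).mem_nhds_iff 0 e |>.mp he
    have h2 : Summable fun n => s.sup (chainSeminorms Ω) (c n) := by
      refine Summable.of_nonneg_of_le (fun n => apply_nonneg _ _) (fun n =>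
        (Seminorm.finset_sup_le_sum (chainSeminorms Ω) s) (c n)) ?_
      have : (fun n => (∑ i ∈ s, chainSeminorms Ω i) (c n)) =
          fun n => ∑ i ∈ s, chainSeminorms Ω i (c n) := by
        funext n
        exact seminorm_sum_apply _ _ _
      rw [this]
      exact summable_sum fun i _ => h.summable_kappa i.1 i.2
    obtain ⟨t, ht⟩ := summable_iff_vanishing_norm.mp h2 r hr
    refine ⟨t, fun t' ht' => hsub ?_⟩
    rw [Seminorm.mem_ball, sub_zero]
    refine lt_of_le_of_lt ?_ (ht t' ht')
    set q := s.sup (chainSeminorms Ω)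
    exact (Finset.le_sum_of_subadditive q (map_zero q).le (map_add_le_add q) _ _).trans
      (le_abs_self _)
  rw [summable_iff_cauchySeq_finset]
  have h3 := h1.map (UniformSpace.Completion.uniformContinuous_coe (Chain Ω))
  have h4 : (fun s : Finset ℕ => ∑ b ∈ s, incl (c b)) =
      fun s : Finset ℕ => ((∑ n ∈ s, c n : Chain Ω) : EChain Ω) :=
    funext fun s => (map_sum (incl (Ω := Ω)) _ _).symm
  rw [h4]
  exact h3

lemma Entire.tendsto_zero {c : ℕ → Chain Ω} (h : Entire c) :
    Filter.Tendsto (fun n => incl (c n)) Filter.atTop (𝓝 0) := h.summable.tendsto_atTop_zero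

/-- The sum of an entire sequence. -/
def esum (c : ℕ → Chain Ω) : EChain Ω := ∑' n, incl (c n)

lemma esum_add {c c' : ℕ → Chain Ω} (h : Entire c) (h' : Entire c') :
    esum (fun n => c n + c' n) = esum c + esum c' := by
  simp only [esum, map_add]
  exact h.summable.tsum_add h'.summable

lemma esum_sub {c c' : ℕ → Chain Ω} (h : Entire c) (h' : Entire c') :
    esum (fun n => c n - c' n) = esum c - esum c' := by
  simp only [esum, map_sub]
  exact h.summable.tsum_sub h'.summable

lemma tendsto_sum_incl {c : ℕ → Chain Ω} (h : Entire c) :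
    Filter.Tendsto (fun N => incl (∑ n ∈ Finset.range N, c n)) Filter.atTop (𝓝 (esum c)) := by
  simp only [map_sum]
  exact h.summable.hasSum.tendsto_sum_nat

lemma incl_mem_chenClosure {F : Submodule ℂ Ω} {x : Chain Ω} (h : x ∈ chenSubspace F) :
    incl x ∈ chenClosure F :=
  Submodule.le_topologicalClosure _ (Submodule.mem_map_of_mem h)

lemma isClosed_chenClosure (F : Submodule ℂ Ω) : IsClosed (chenClosure F : Set (EChain Ω)) :=
  Submodule.isClosed_topologicalClosure _

/-- A series lies in the closure of the Chen subspace if its partial sums do so up to a correction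
which tends to zero. -/
lemma esum_mem_chenClosure {F : Submodule ℂ Ω} {c r : ℕ → Chain Ω} (hc : Entire c) (hr : Entire r)
    (h : ∀ N, ∑ n ∈ Finset.range N, c n + r N ∈ chenSubspace F) : esum c ∈ chenClosure F := by
  have h1 := (tendsto_sum_incl hc).add hr.tendsto_zero
  rw [add_zero] at h1
  refine (isClosed_chenClosure F).mem_of_tendsto h1 (Filter.Eventually.of_forall fun N => ?_)
  rw [← map_add]
  exact incl_mem_chenClosure (h N)

section Operators

variable [PolynormableSpace ℂ Ω]

lemma hasSum_completion {c : ℕ → Chain Ω} (hc : Entire c) (T : Chain Ω →L[ℂ] Chain Ω) :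
    HasSum (fun n => incl (T (c n))) (T.completion (esum c)) := by
  have h := hc.summable.hasSum.mapL T.completion
  have h1 : (fun n => T.completion (incl (c n))) = fun n => incl (T (c n)) :=
    funext fun n => T.completion_apply_coe (c n)
  rwa [h1] at h

lemma mulOp_W_zero {κ : Type} [Fintype κ] (V : Fin 1 → Matrix κ κ Ω) : mulOp (W 0 V) = 0 := by
  simp only [W_apply, map_sum, mulOp_el]
  exact Finset.sum_eq_zero fun _ _ => rfl

/-- The operator `b + B` on the sum of an entire sequence in the kernel of `B`. -/
lemma bB_esum {c : ℕ → Chain Ω} (hc : Entire c) (hB : ∀ n, BOp (c n) = 0) (h0 : mulOp (c 0) = 0) :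
    HasSum (fun n => incl (dOp (c n) + mulOp (c (n + 1)))) (bB Ω (esum c)) := by
  have h1 := hasSum_completion hc ⟨dOp, continuous_dOp⟩
  have h2 := hasSum_completion hc ⟨mulOp, continuous_mulOp⟩
  have h3 := hasSum_completion hc
    (⟨bOp + BOp, (continuous_dOp.add continuous_mulOp).add continuous_BOp⟩ : Chain Ω →L[ℂ] Chain Ω)
  have h4 := (hasSum_nat_add_iff' (f := fun n => incl (mulOp (c n))) 1).mpr h2
  rw [Finset.sum_range_one, h0, map_zero, sub_zero] at h4
  have h5 := h1.add h4
  have h6 := h1.add h2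
  have h7 : (fun n => incl (dOp (c n)) + incl (mulOp (c n))) = fun n => incl ((bOp + BOp : Chain Ω →ₗ[ℂ] Chain Ω) (c n)) := by
    funext n
    rw [LinearMap.add_apply, hB, add_zero, bOp, LinearMap.add_apply, map_add]
  have h8 := h6.unique (h7 ▸ h3)
  simp only [map_add]
  exact h8 ▸ h5

lemma esum_mem_odd {c : ℕ → Chain Ω} (hc : Entire c) (h : ∀ n, gammaOp (c n) = -c n) :
    esum c ∈ oddChains Ω := by
  have h1 := hasSum_completion hc ⟨gammaOp, continuous_gammaOp⟩
  have h2 := hc.summable.hasSum.neg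
  simp only [← map_neg, ← h] at h2
  exact h1.unique h2

lemma esum_mem_even {c : ℕ → Chain Ω} (hc : Entire c) (h : ∀ n, gammaOp (c n) = c n) :
    esum c ∈ evenChains Ω := by
  have h1 := hasSum_completion hc ⟨gammaOp, continuous_gammaOp⟩
  have h3 : (fun n => incl (gammaOp (c n))) = fun n => incl (c n) := funext fun n => by rw [h]
  exact h1.unique (h3 ▸ hc.summable.hasSum)

lemma el_eq_zero_of_smul {n : ℕ} (v : Fin (n + 1) → Ω) (k : Fin (n + 1)) (hk : k ≠ 0) (z : ℂ)
    (h : v k = z • DGData.one) : el n v = 0 := by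
  rw [← Function.update_eq_self k v, h, MultilinearMap.map_update_smul,
    el_eq_zero _ k hk (by simp), smul_zero]

/-- The Connes operator vanishes on chains with a scalar in the slot `0`. -/
lemma BOp_el_eq_zero {n : ℕ} (v : Fin (n + 1) → Ω) (z : ℂ) (h : v 0 = z • DGData.one) :
    BOp (el n v) = 0 := by
  rw [BOp_el, rotPart, homog_apply]
  refine Finset.sum_eq_zero fun p _ => ?_
  rw [sum_apply]
  refine Finset.sum_eq_zero fun k _ => ?_
  have h1 : prj (p 0) (v 0) =
      ((1 / 2 : ℂ) * (1 + if p 0 = 0 then (1 : ℂ) else -1) * z) • (DGData.one : Ω) := by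
    rw [h]
    simp only [prj, LinearMap.smul_apply, LinearMap.add_apply, LinearMap.id_apply, map_smul,
      DGData.par_one]
    module
  rw [smul_apply, rotTerm, MultilinearMap.domDomCongr_apply, MultilinearMap.curryLeft_apply,
    el_eq_zero_of_smul _ (0 - k).succ (Fin.succ_ne_zero _) _ (by simpa using h1), smul_zero]

lemma BOp_W_eq_zero {κ : Type} [Fintype κ] {n : ℕ} (V : Fin (n + 1) → Matrix κ κ Ω)
    (z : Matrix κ κ ℂ) (h : V 0 = z.map fun c => c • DGData.one) : BOp (W n V) = 0 := by
  rw [W_apply, map_sum]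
  exact Finset.sum_eq_zero fun i _ => BOp_el_eq_zero _ (z (i 0) (i (0 + 1))) (by rw [h]; rfl)

lemma gammaOp_W {κ : Type} [Fintype κ] {n : ℕ} (V : Fin (n + 1) → Matrix κ κ Ω)
    (s : Fin (n + 1) → ℂ) (h : ∀ j, (V j).map DGData.par = s j • V j) :
    gammaOp (W n V) = ((-1) ^ n * ∏ j, s j) • W n V := by
  rw [mul_smul, ← MultilinearMap.map_smul_univ, W_apply, W_apply, map_sum, Finset.smul_sum]
  refine Finset.sum_congr rfl fun i _ => ?_
  rw [gammaOp_el, parPart, smul_apply, MultilinearMap.compLinearMap_apply]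
  congr 2
  funext j
  exact congrFun (congrFun (h j) _) _

lemma gammaOp_W_cons {κ : Type} [Fintype κ] (n : ℕ) {K X : Matrix κ κ Ω}
    (hK : K.map DGData.par = K) (hX : X.map DGData.par = -X) :
    gammaOp (W n (Fin.cons K fun _ => X)) = W n (Fin.cons K fun _ => X) := by
  rw [gammaOp_W _ (Fin.cons 1 fun _ => -1), Fin.prod_univ_succ]
  · simp [← mul_pow]
  · intro j
    refine Fin.cases ?_ (fun j => ?_) j <;> simp [hK, hX]

lemma gammaOp_insW {κ : Type} [Fintype κ] (n : ℕ) {K X Y : Matrix κ κ Ω}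
    (hK : K.map DGData.par = K) (hX : X.map DGData.par = -X) (hY : Y.map DGData.par = Y) :
    gammaOp (insW n K X Y) = -insW n K X Y := by
  rw [insW, mixW, map_sum, ← Finset.sum_neg_distrib]
  refine Finset.sum_congr rfl fun m _ => ?_
  rw [gammaOp_W _ (Fin.cons 1 fun j : Fin n => if j = m then 1 else -1), Fin.prod_univ_succ]
  · simp only [Fin.cons_zero, Fin.cons_succ, one_mul]
    have h : ∏ j : Fin n, (if j = m then (1 : ℂ) else -1) = -(-1) ^ n := by
      have h1 : ∏ j : Fin n, (if j = m then (1 : ℂ) else -1) =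
          ∏ j : Fin n, ((-1) * (if j = m then (-1 : ℂ) else 1)) :=
        Finset.prod_congr rfl fun j _ => by split_ifs <;> simp
      rw [h1, Finset.prod_mul_distrib, Finset.prod_ite_eq']
      simp
    rw [h, mul_neg, ← mul_pow]
    simp
  · intro j
    refine Fin.cases ?_ (fun j => ?_) j
    · simp [hK]
    · simp only [Fin.cons_succ, word, Fin.ext_iff]
      rcases lt_trichotomy j.val m.val with h | h | h
      · simp [h, h.ne, hX]
      · simp [h, hY]
      · simp [h.not_gt, h.ne', hX]

end Operators

section Bounds

variable {κ : Type} [Fintype κ]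

/-- The sum of the seminorms of the entries. -/
def entrySeminorm (ε : Seminorm ℂ Ω) : Seminorm ℂ (Matrix κ κ Ω) :=
  ∑ a, ∑ b, ε.comp (Matrix.entryLinearMap ℂ Ω a b)

lemma entrySeminorm_apply (ε : Seminorm ℂ Ω) (X : Matrix κ κ Ω) :
    entrySeminorm ε X = ∑ a, ∑ b, ε (X a b) := by
  simp only [entrySeminorm, seminorm_sum_apply]
  rfl

lemma le_entrySeminorm (ε : Seminorm ℂ Ω) (X : Matrix κ κ Ω) (a b : κ) :
    ε (X a b) ≤ entrySeminorm ε X := by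
  rw [entrySeminorm_apply]
  refine (Finset.single_le_sum (f := fun b => ε (X a b)) (fun _ _ => apply_nonneg _ _)
    (Finset.mem_univ b)).trans ?_
  exact Finset.single_le_sum (f := fun a => ∑ b, ε (X a b))
    (fun _ _ => Finset.sum_nonneg fun _ _ => apply_nonneg _ _) (Finset.mem_univ a)

lemma kappa_W_le (ε : Seminorm ℂ Ω) (n : ℕ) (V : Fin (n + 1) → Matrix κ κ Ω) {R : ℝ}
    (h : ∀ j, entrySeminorm ε (V j) ≤ R) :
    kappa ε (W n V) ≤ (Fintype.card κ * R) ^ (n + 1) / √(n.factorial : ℝ) := by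
  rw [W_apply]
  refine (Finset.le_sum_of_subadditive _ (map_zero _).le (map_add_le_add _) _ _).trans ?_
  refine (Finset.sum_le_card_nsmul _ _ (R ^ (n + 1) / √(n.factorial : ℝ)) fun i _ => ?_).trans_eq ?_
  · refine (kappa_el_le _ _ _).trans ?_
    gcongr
    refine (Finset.prod_le_prod (fun _ _ => apply_nonneg _ _)
      fun j _ => (le_entrySeminorm ε (V j) _ _).trans (h j)).trans_eq ?_
    simp
  · rw [Finset.card_univ, Fintype.card_pi, mul_pow, nsmul_eq_mul]
    simp
    ring

lemma kappa_mixW_le (ε : Seminorm ℂ Ω) (n : ℕ) (K X Y Z : Matrix κ κ Ω) {R : ℝ}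
    (hK : entrySeminorm ε K ≤ R) (hX : entrySeminorm ε X ≤ R) (hY : entrySeminorm ε Y ≤ R)
    (hZ : entrySeminorm ε Z ≤ R) :
    kappa ε (mixW n K X Y Z) ≤ (2 * (Fintype.card κ * R)) ^ (n + 1) / √(n.factorial : ℝ) := by
  have hR : 0 ≤ R := (apply_nonneg _ _).trans hK
  rw [mixW]
  refine (Finset.le_sum_of_subadditive _ (map_zero _).le (map_add_le_add _) _ _).trans ?_
  refine (Finset.sum_le_card_nsmul _ _ ((Fintype.card κ * R) ^ (n + 1) / √(n.factorial : ℝ))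
    fun m _ => kappa_W_le ε n _ fun j => ?_).trans ?_
  · refine Fin.cases hK (fun j => ?_) j
    simp only [Fin.cons_succ, word]
    split_ifs <;> assumption
  · rw [Finset.card_univ, Fintype.card_fin, nsmul_eq_mul, mul_pow 2, ← mul_div_assoc]
    gcongr
    exact (natCast_le_two_pow n).trans (pow_le_pow_right₀ (by norm_num) n.le_succ)

end Bounds

end Entire

section FormAlgebra

/-- A `DGData` which contains a commutative algebra of functions in degree `0`, a space of
`1`-forms, and the canonical `1`-form `ϑ` of the circle, with the relations between them which hold
for invariant forms on `M × 𝕋`. -/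
class FormDG (𝔽 : outParam Type*) [CommRing 𝔽] [Algebra ℂ 𝔽] (Ω : Type*) [AddCommGroup Ω] [Module ℂ Ω]
    [TopologicalSpace Ω] [DGData Ω] extends AssocDG Ω where
  fn : 𝔽 →ₗ[ℂ] Ω
  th : Ω
  oneForms : Submodule ℂ Ω
  fn_one : fn 1 = DGData.one
  fn_mul : ∀ f g, fn (f * g) = DGData.mul (fn f) (fn g)
  fn_comm : ∀ f x, DGData.mul (fn f) x = DGData.mul x (fn f)
  par_mul : ∀ x y : Ω, DGData.par (DGData.mul x y) = DGData.mul (DGData.par x) (DGData.par y)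
  par_fn : ∀ f, DGData.par (fn f) = fn f
  par_d : ∀ x : Ω, DGData.par (DGData.d x) = -DGData.d (DGData.par x)
  par_th : DGData.par th = -th
  th_th : DGData.mul th th = 0
  th_comm : ∀ x, DGData.mul th x = DGData.mul (DGData.par x) th
  d_th : ∀ x, DGData.d (DGData.mul th x) = x - DGData.mul th (DGData.d x)
  par_oneForm : ∀ x ∈ oneForms, DGData.par x = -x
  fn_mul_oneForm : ∀ f, ∀ x ∈ oneForms, DGData.mul (fn f) x ∈ oneForms
  d_fn_mem : ∀ f, DGData.d (fn f) ∈ oneForms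
  anticomm : ∀ x ∈ oneForms, ∀ y ∈ oneForms, DGData.mul x y = -DGData.mul y x
  d_fn_fn : ∀ f g, DGData.d (fn (f * g)) =
    DGData.mul (DGData.d (fn f)) (fn g) + DGData.mul (fn f) (DGData.d (fn g))
  d_fn_form : ∀ f, ∀ x ∈ oneForms, DGData.d (DGData.mul (fn f) x) =
    DGData.mul (DGData.d (fn f)) x + DGData.mul (fn f) (DGData.d x)
  d_form_form : ∀ x ∈ oneForms, ∀ y ∈ oneForms, DGData.d (DGData.mul x y) =
    DGData.mul (DGData.d x) y - DGData.mul x (DGData.d y)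
  d_d_fn : ∀ f, DGData.d (DGData.d (fn f)) = 0
  d_d_form : ∀ x ∈ oneForms, DGData.d (DGData.d x) = 0

variable {𝔽 : Type*} [CommRing 𝔽] [Algebra ℂ 𝔽] {Ω : Type*} [AddCommGroup Ω] [Module ℂ Ω]
  [TopologicalSpace Ω] [DGData Ω] [FormDG 𝔽 Ω] {ι : Type} [Fintype ι] [DecidableEq ι]

attribute [local instance] dgRing dgAlgebra

open FormDG

/-- Matrices of `1`-forms. -/
def IsForm (α : Matrix ι ι Ω) : Prop := ∀ i j, α i j ∈ oneForms (Ω := Ω)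

/-- The entrywise differential. -/
def dM : Matrix ι ι Ω →ₗ[ℂ] Matrix ι ι Ω := (DGData.d : Ω →ₗ[ℂ] Ω).mapMatrix

/-- The entrywise parity involution. -/
def parM : Matrix ι ι Ω →ₗ[ℂ] Matrix ι ι Ω := (DGData.par : Ω →ₗ[ℂ] Ω).mapMatrix

/-- Multiplication by `ϑ`. -/
def thM : Matrix ι ι Ω →ₗ[ℂ] Matrix ι ι Ω := (LinearMap.mulLeft ℂ (th : Ω)).mapMatrix

lemma map_d_eq (α : Matrix ι ι Ω) : α.map DGData.d = dM α := rfl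

lemma parM_mul (α β : Matrix ι ι Ω) : parM (α * β) = parM α * parM β := by
  ext i j
  change DGData.par (∑ k, α i k * β k j) = ∑ k, DGData.par (α i k) * DGData.par (β k j)
  rw [map_sum]
  exact Finset.sum_congr rfl fun k _ => par_mul _ _

lemma thM_mul (α β : Matrix ι ι Ω) : thM α * β = thM (α * β) := by
  ext i j
  change ∑ k, (th * α i k) * β k j = th * ∑ k, α i k * β k j
  rw [Finset.mul_sum]
  exact Finset.sum_congr rfl fun k _ => mul_assoc _ _ _

lemma mul_thM (α β : Matrix ι ι Ω) : parM α * thM β = thM (α * β) := by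
  ext i j
  change ∑ k, DGData.par (α i k) * (th * β k j) = th * ∑ k, α i k * β k j
  rw [Finset.mul_sum]
  refine Finset.sum_congr rfl fun k _ => ?_
  rw [← mul_assoc, ← mul_assoc]
  exact congrArg (· * β k j) (th_comm (α i k)).symm

lemma thM_thM (α : Matrix ι ι Ω) : thM (thM α) = 0 := by
  ext i j
  change th * (th * α i j) = 0
  rw [← mul_assoc]
  have h : (th : Ω) * th = 0 := th_th
  rw [h, zero_mul]

lemma parM_thM (α : Matrix ι ι Ω) : parM (thM α) = -thM (parM α) := by
  ext i j
  change DGData.par (DGData.mul th (α i j)) = -(th * DGData.par (α i j))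
  rw [par_mul, par_th, ← neg_mul]
  rfl

lemma dM_thM (α : Matrix ι ι Ω) : dM (thM α) = α - thM (dM α) := by
  ext i j
  exact d_th (α i j)

lemma parM_dM (α : Matrix ι ι Ω) : parM (dM α) = -dM (parM α) := by
  ext i j
  exact par_d (α i j)

lemma dM_one : dM (1 : Matrix ι ι Ω) = 0 := by
  ext i j
  change DGData.d ((1 : Matrix ι ι Ω) i j) = 0
  rcases eq_or_ne i j with rfl | h
  · rw [Matrix.one_apply_eq]; exact DGData.d_one
  · rw [Matrix.one_apply_ne h, map_zero]

lemma parM_one : parM (1 : Matrix ι ι Ω) = 1 := by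
  ext i j
  change DGData.par ((1 : Matrix ι ι Ω) i j) = (1 : Matrix ι ι Ω) i j
  rcases eq_or_ne i j with rfl | h
  · rw [Matrix.one_apply_eq]; exact DGData.par_one
  · rw [Matrix.one_apply_ne h, map_zero]

section OneForms

variable {α β δ : Matrix ι ι Ω}

lemma IsForm.add (hα : IsForm α) (hβ : IsForm β) : IsForm (α + β) := fun i j =>
  Submodule.add_mem _ (hα i j) (hβ i j)

lemma IsForm.sub (hα : IsForm α) (hβ : IsForm β) : IsForm (α - β) := fun i j =>
  Submodule.sub_mem _ (hα i j) (hβ i j)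

lemma IsForm.smul (hα : IsForm α) (c : ℂ) : IsForm (c • α) := fun i j =>
  Submodule.smul_mem _ c (hα i j)

lemma isForm_zero : IsForm (0 : Matrix ι ι Ω) := fun _ _ => Submodule.zero_mem _

lemma IsForm.parM (hα : IsForm α) : parM α = -α := by
  ext i j
  exact par_oneForm _ (hα i j)

lemma IsForm.dM_dM (hα : IsForm α) : dM (dM α) = 0 := by
  ext i j
  exact d_d_form _ (hα i j)

lemma IsForm.dM_mul (hα : IsForm α) (hβ : IsForm β) : dM (α * β) = dM α * β - α * dM β := by
  ext i j
  change DGData.d (∑ k, α i k * β k j) =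
    ∑ k, DGData.d (α i k) * β k j - ∑ k, α i k * DGData.d (β k j)
  rw [map_sum, ← Finset.sum_sub_distrib]
  exact Finset.sum_congr rfl fun k _ => d_form_form _ (hα i k) _ (hβ k j)

lemma IsForm.mul_thM (hα : IsForm α) (X : Matrix ι ι Ω) : α * thM X = -thM (α * X) := by
  rw [← OddChern.mul_thM, hα.parM, neg_mul, neg_neg]

/-- The curvature. -/
def curvM (α : Matrix ι ι Ω) : Matrix ι ι Ω := dM α + α * α

/-- The flat superconnection `α - ϑ R(α)`. -/
def conA (α : Matrix ι ι Ω) : Matrix ι ι Ω := α - thM (curvM α)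

/-- `-ϑ δ`. -/
def conB (δ : Matrix ι ι Ω) : Matrix ι ι Ω := -thM δ

/-- The derivative of `conA` at `α` in the direction `δ`. -/
def varA (α δ : Matrix ι ι Ω) : Matrix ι ι Ω := δ - thM (dM δ + (α * δ + δ * α))

lemma parM_curvM (hα : IsForm α) : parM (curvM α) = curvM α := by
  rw [curvM, map_add, parM_dM, parM_mul, hα.parM, map_neg, neg_neg, neg_mul_neg]

lemma parM_conA (hα : IsForm α) : parM (conA α) = -conA α := by
  rw [conA, map_sub, parM_thM, parM_curvM hα, hα.parM]
  abel

lemma parM_conB (hδ : IsForm δ) : parM (conB δ) = conB δ := by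
  rw [conB, map_neg, parM_thM, hδ.parM, map_neg, neg_neg]

lemma conB_mul_conB (hα : IsForm α) (hδ : IsForm δ) : conB α * conB δ = 0 := by
  rw [conB, conB, neg_mul_neg, thM_mul, hα.mul_thM, map_neg, thM_thM, neg_zero]

lemma dM_curvM (hα : IsForm α) : dM (curvM α) = dM α * α - α * dM α := by
  rw [curvM, map_add, hα.dM_dM, hα.dM_mul hα, zero_add]

lemma curvM_mul_thM (hα : IsForm α) (X : Matrix ι ι Ω) : curvM α * thM X = thM (curvM α * X) := by
  rw [← OddChern.mul_thM, parM_curvM hα]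

/-- Flatness of the superconnection. -/
lemma dM_conA (hα : IsForm α) : dM (conA α) + conA α * conA α = 0 := by
  have h1 : conA α * conA α = α * α + thM (α * curvM α) - thM (curvM α * α) := by
    rw [conA, sub_mul, mul_sub, mul_sub, hα.mul_thM, thM_mul, thM_mul, curvM_mul_thM hα, thM_thM]
    abel
  rw [h1, conA, map_sub, dM_thM, dM_curvM hα, curvM]
  simp only [map_add, map_sub, mul_add, add_mul, mul_assoc]
  abel

lemma dM_conB (hα : IsForm α) (hδ : IsForm δ) :
    dM (conB δ) + conA α * conB δ - conB δ * conA α = -varA α δ := by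
  have h1 : conA α * conB δ = thM (α * δ) := by
    rw [conA, conB, sub_mul, mul_neg, mul_neg, hα.mul_thM, thM_mul, curvM_mul_thM hα, thM_thM]
    abel
  have h2 : conB δ * conA α = -thM (δ * α) := by
    rw [conA, conB, neg_mul, mul_sub, thM_mul, thM_mul, hδ.mul_thM, map_neg, thM_thM]
    abel
  rw [h1, h2, conB, map_neg, dM_thM, varA]
  simp only [map_add]
  abel

lemma conA_add (α δ : Matrix ι ι Ω) (c : ℂ) : conA (α + c • δ) =
    conA α + c • varA α δ + c ^ 2 • -thM (δ * δ) := by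
  simp only [conA, curvM, varA, map_add, map_smul, mul_add, add_mul, Matrix.smul_mul,
    Matrix.mul_smul, smul_smul, pow_two, smul_sub, smul_add, smul_neg]
  abel

lemma varA_add (α δ : Matrix ι ι Ω) (c : ℂ) : varA (α + c • δ) δ =
    varA α δ + (2 * c) • -thM (δ * δ) := by
  simp only [varA, map_add, map_smul, mul_add, add_mul, Matrix.smul_mul,
    Matrix.mul_smul, smul_smul, two_mul, smul_sub, smul_add, smul_neg, add_smul]
  abel

lemma finDiff_conA (α δ : Matrix ι ι Ω) :
    FinDiff (fun s : ℝ => conA (α + (s : ℂ) • δ)) (fun s : ℝ => varA (α + (s : ℂ) • δ) δ) := by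
  simp only [conA_add, varA_add]
  exact FinDiff.quadratic _ _ _

end OneForms

end FormAlgebra

section Curves

variable {V W' : Type*} [AddCommGroup V] [Module ℂ V] [AddCommGroup W'] [Module ℂ W']

lemma FinDiff.map {c c' : ℝ → V} (h : FinDiff c c') (T : V →ₗ[ℂ] W') :
    FinDiff (fun s => T (c s)) (fun s => T (c' s)) := by
  obtain ⟨ι, _, f, f', a, hf, hf', hc, hc'⟩ := h
  exact ⟨ι, inferInstance, f, f', fun k => T (a k), hf, hf', fun s => by simp [hc],
    fun s => by simp [hc']⟩

lemma FinDiff.add {c c' e e' : ℝ → V} (h : FinDiff c c') (h' : FinDiff e e') :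
    FinDiff (fun s => c s + e s) (fun s => c' s + e' s) := by
  obtain ⟨ι, _, f, f', a, hf, hf', hc, hc'⟩ := h
  obtain ⟨κ, _, g, g', b, hg, hg', he, he'⟩ := h'
  refine ⟨ι ⊕ κ, inferInstance, Sum.elim f g, Sum.elim f' g', Sum.elim a b, ?_, ?_, fun s => ?_,
    fun s => ?_⟩
  · rintro (k | k) s
    exacts [hf k s, hg k s]
  · rintro (k | k)
    exacts [hf' k, hg' k]
  · simp [hc, he]
  · simp [hc', he']

lemma FinDiff.affine (a b : V) : FinDiff (fun s => a + (s : ℂ) • b) (fun _ => b) := by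
  simpa using FinDiff.quadratic a b 0

lemma FinDiff.const (a : V) : FinDiff (fun _ => a) (fun _ => 0) := by
  simpa using FinDiff.affine a 0

end Curves

section CurvesOfWords

variable {Ω : Type*} [AddCommGroup Ω] [Module ℂ Ω] [TopologicalSpace Ω] [DGData Ω]
  {κ : Type} [Fintype κ]

lemma word_eq_update {A : Type*} {n : ℕ} (m : Fin n) (X Y : A) :
    word m X Y X = Function.update (fun _ => X) m Y := by
  funext k
  simp only [word, Function.update_apply, Fin.ext_iff]
  rcases lt_trichotomy k.val m.val with h | h | h
  · simp [h, h.ne]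
  · simp [h]
  · simp [h.not_gt, h.ne']

lemma FinDiff.W_cons {X X' : ℝ → Matrix κ κ Ω} (h : FinDiff X X') (n : ℕ) (K : Matrix κ κ Ω) :
    FinDiff (fun s => W n (Fin.cons K fun _ => X s)) (fun s => insW n K (X s) (X' s)) := by
  have h1 := FinDiff.multilinear ((W n).curryLeft K) h
  simp only [insW, mixW, word_eq_update]
  exact h1

lemma FinCurve.mixW {X Y Z : ℝ → Matrix κ κ Ω} (hX : FinCurve X) (hY : FinCurve Y)
    (hZ : FinCurve Z) (n : ℕ) (K : Matrix κ κ Ω) :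
    FinCurve (fun s => mixW n K (X s) (Y s) (Z s)) := by
  refine FinCurve.sum (κ := Fin n) fun m => ?_
  refine FinCurve.multilinear ((W n).curryLeft K) (c := fun j s => word m (X s) (Y s) (Z s) j)
    fun j => ?_
  simp only [word]
  split_ifs <;> assumption

lemma SepCurve.W_cons {X : ℝ → ℝ → Matrix κ κ Ω} (h : SepCurve X) (n : ℕ) (K : Matrix κ κ Ω) :
    SepCurve (fun s t => W n (Fin.cons K fun _ => X s t)) :=
  SepCurve.multilinear ((W n).curryLeft K) (c := fun _ => X) fun _ => h

lemma SepCurve.insW {X Y : ℝ → ℝ → Matrix κ κ Ω} (hX : SepCurve X) (hY : SepCurve Y)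
    (n : ℕ) (K : Matrix κ κ Ω) : SepCurve (fun s t => insW n K (X s t) (Y s t)) := by
  refine SepCurve.sum (κ := Fin n) fun m => ?_
  refine SepCurve.multilinear ((W n).curryLeft K)
    (c := fun j s t => word m (X s t) (Y s t) (X s t) j) fun j => ?_
  simp only [word]
  split_ifs <;> assumption

end CurvesOfWords

section Transgression

variable {𝔽 : Type*} [CommRing 𝔽] [Algebra ℂ 𝔽] {Ω : Type*} [AddCommGroup Ω] [Module ℂ Ω]
  [TopologicalSpace Ω] [DGData Ω] [PolynormableSpace ℂ Ω] [FormDG 𝔽 Ω] {ι : Type} [Fintype ι] [DecidableEq ι]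

attribute [local instance] dgRing dgAlgebra

open FormDG

/-- The matrices `S` and `T` anticommute and have square zero, and `tr (K S T) = 1`. -/
def matS : Matrix (Fin 4) (Fin 4) ℂ := !![0, 1, 0, 0; 0, 0, 0, 0; 0, 0, 0, 1; 0, 0, 0, 0]

/-- See `matS`. -/
def matT : Matrix (Fin 4) (Fin 4) ℂ :=
  !![0, 0, 1, 0; 0, 0, 0, -1; 0, 0, 0, 0; 0, 0, 0, 0]

/-- See `matS`. -/
def matK : Matrix (Fin 4) (Fin 4) ℂ :=
  !![0, 0, 0, 0; 0, 0, 0, 0; 0, 0, 0, 0; -1, 0, 0, 0]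

/-- A matrix with `tr (K₁ S) = 1`. -/
def matK₁ : Matrix (Fin 4) (Fin 4) ℂ := -(matK * matT)

/-- The grading for which `S` and `T` are odd. -/
def matσ : Matrix (Fin 4) (Fin 4) ℂ := !![1, 0, 0, 0; 0, -1, 0, 0; 0, 0, -1, 0; 0, 0, 0, 1]

lemma matS_mul_matS : matS * matS = 0 := by
  ext i j; fin_cases i <;> fin_cases j <;> simp [matS, Matrix.mul_apply, Fin.sum_univ_succ]

lemma matT_mul_matT : matT * matT = 0 := by
  ext i j; fin_cases i <;> fin_cases j <;> simp [matT, Matrix.mul_apply, Fin.sum_univ_succ]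

lemma matT_mul_matS : matT * matS = -(matS * matT) := by
  ext i j; fin_cases i <;> fin_cases j <;> simp [matS, matT, Matrix.mul_apply, Fin.sum_univ_succ]

lemma matKS_trace : (matK * matS).trace = 0 := by
  simp [matK, matS, Matrix.trace, Fin.sum_univ_succ]

lemma matKT_trace : (matK * matT).trace = 0 := by
  simp [matK, matT, Matrix.trace, Fin.sum_univ_succ]

lemma matKST_trace : (matK * (matS * matT)).trace = 1 := by
  simp [matK, matS, matT, Matrix.trace, Fin.sum_univ_succ]

/-- The matrix `kr P c` as a linear function of `P`. -/
def krL {κ : Type} [Fintype κ] [DecidableEq κ] (c : Matrix κ κ ℂ) : Matrix ι ι Ω →ₗ[ℂ] Matrix (ι × κ) (ι × κ) Ω where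
  toFun P := kr P c
  map_add' P Q := kr_add_left P Q c
  map_smul' r P := by ext a b; exact smul_comm _ _ _

lemma W_kr {κ : Type} [Fintype κ] [DecidableEq κ] {S T : Matrix κ κ ℂ} (hS : S * S = 0)
    (hT : T * T = 0) (hST : T * S = -(S * T)) (k : Matrix κ κ ℂ) (hk : (k * (S * T)).trace = 0)
    (a b c : Matrix ι ι Ω) (n : ℕ) :
    W n (Fin.cons (kr 1 k) fun _ => kr a 1 + kr b S + kr c T) =
      k.trace • W n (Fin.cons 1 fun _ => a) + (k * S).trace • insW n 1 a b +
        (k * T).trace • insW n 1 a c := by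
  obtain ⟨Q, hQ⟩ := kr_pow hS hT hST (tw a) (tw b) (tw c) n
  rw [W_const, tw_add, tw_add, tw_kr, tw_kr, tw_kr, hQ]
  simp only [map_add, pair_kr, mul_one, hk, zero_smul, add_zero, W_const, insW_eq_pair]

/-- The words in `A` with one letter `B`, as words in `A ⊗ 1 + B ⊗ S`. -/
lemma W_matK₁ (a b : Matrix ι ι Ω) (n : ℕ) :
    W n (Fin.cons (kr 1 matK₁) fun _ => kr a 1 + kr b matS + kr 0 matT) = insW n 1 a b := by
  have h1 : matK₁.trace = 0 := by rw [matK₁, Matrix.trace_neg, matKT_trace, neg_zero]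
  have h2 : (matK₁ * matS).trace = 1 := by
    rw [matK₁, neg_mul, mul_assoc, matT_mul_matS, mul_neg, neg_neg, matKST_trace]
  have h3 : matK₁ * matT = 0 := by rw [matK₁, neg_mul, mul_assoc, matT_mul_matT, mul_zero, neg_zero]
  have h4 : matK₁ * (matS * matT) = 0 := by
    rw [← neg_eq_zero, ← mul_neg, ← matT_mul_matS, ← mul_assoc, h3, zero_mul]
  rw [W_kr matS_mul_matS matT_mul_matT matT_mul_matS _ (by rw [h4, Matrix.trace_zero]), h1, h2, h3,
    Matrix.trace_zero, zero_smul, zero_smul, one_smul, zero_add, add_zero]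

lemma W_matK₁S (a b : Matrix ι ι Ω) (n : ℕ) :
    W n (Fin.cons (kr 1 (matK₁ * matS)) fun _ => kr a 1 + kr b matS + kr 0 matT) =
      W n (Fin.cons 1 fun _ => a) := by
  have h2 : (matK₁ * matS).trace = 1 := by
    rw [matK₁, neg_mul, mul_assoc, matT_mul_matS, mul_neg, neg_neg, matKST_trace]
  have h3 : matK₁ * matS * matS = 0 := by rw [mul_assoc, matS_mul_matS, mul_zero]
  have h4 : matK₁ * matS * matT = 0 := by
    rw [mul_assoc, ← neg_eq_zero, ← mul_neg, ← matT_mul_matS, ← mul_assoc, matK₁, neg_mul, mul_assoc,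
      matT_mul_matT, mul_zero, neg_zero, zero_mul]
  rw [W_kr matS_mul_matS matT_mul_matT matT_mul_matS _ (by
    rw [← mul_assoc, h3, zero_mul, Matrix.trace_zero]), h2, h3, h4,
    Matrix.trace_zero, zero_smul, zero_smul, one_smul, add_zero, add_zero]

lemma W_matKS (a b c : Matrix ι ι Ω) (n : ℕ) :
    W n (Fin.cons (kr 1 (matK * matS)) fun _ => kr a 1 + kr b matS + kr c matT) = insW n 1 a c := by
  have h3 : matK * matS * matS = 0 := by rw [mul_assoc, matS_mul_matS, mul_zero]
  rw [W_kr matS_mul_matS matT_mul_matT matT_mul_matS _ (by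
    rw [← mul_assoc, h3, zero_mul, Matrix.trace_zero]), matKS_trace, h3, mul_assoc, matKST_trace,
    Matrix.trace_zero, zero_smul, zero_smul, one_smul, zero_add, zero_add]

lemma W_matKT (a b c : Matrix ι ι Ω) (n : ℕ) :
    W n (Fin.cons (kr 1 (matK * matT)) fun _ => kr a 1 + kr b matS + kr c matT) =
      -insW n 1 a b := by
  have h3 : matK * matT * matT = 0 := by rw [mul_assoc, matT_mul_matT, mul_zero]
  have h4 : matK * matT * (matS * matT) = 0 := by
    rw [mul_assoc, ← mul_assoc matT, matT_mul_matS, neg_mul, mul_assoc, matT_mul_matT, mul_zero,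
      neg_zero, mul_zero]
  rw [W_kr matS_mul_matS matT_mul_matT matT_mul_matS _ (by rw [h4, Matrix.trace_zero]),
    matKT_trace, h3, mul_assoc, matT_mul_matS, mul_neg, Matrix.trace_neg, matKST_trace,
    Matrix.trace_zero, zero_smul, zero_smul, neg_smul, one_smul, zero_add, add_zero]

variable {α δ : Matrix ι ι Ω}

lemma finCurve_chainCS (α δ : Matrix ι ι Ω) (n : ℕ) :
    FinCurve (fun t : ℝ => insW n 1 (conA (α + (t : ℂ) • δ)) (conB δ)) :=
  FinCurve.mixW (finDiff_conA α δ).finCurve (FinCurve.const _) (finDiff_conA α δ).finCurve n 1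

/-- The Chern-Simons chain of the segment from `α` to `α + δ`. -/
def chainCS (α δ : Matrix ι ι Ω) (n : ℕ) : Chain Ω := (finCurve_chainCS α δ n).exists_integral.choose

lemma isIntegral_chainCS (α δ : Matrix ι ι Ω) (n : ℕ) :
    IsIntegral01 (fun t : ℝ => insW n 1 (conA (α + (t : ℂ) • δ)) (conB δ)) (chainCS α δ n) :=
  (finCurve_chainCS α δ n).exists_integral.choose_spec

/-- The sum of a bounded family of words. -/
lemma entire_of_insW {κ : Type} [Fintype κ] {c : ℕ → Chain Ω} (K : Matrix κ κ Ω)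
    {X Y Z : ℝ → Matrix κ κ Ω} (hX : FinCurve X) (hY : FinCurve Y) (hZ : FinCurve Z)
    (hc : ∀ n, IsIntegral01 (fun t => mixW n K (X t) (Y t) (Z t)) (c n)) : Entire c := by
  intro ε _
  obtain ⟨R₁, h₁⟩ := hX.bounded (entrySeminorm ε)
  obtain ⟨R₂, h₂⟩ := hY.bounded (entrySeminorm ε)
  obtain ⟨R₃, h₃⟩ := hZ.bounded (entrySeminorm ε)
  set R := max (max R₁ R₂) (max R₃ (entrySeminorm ε K))
  refine ⟨2 * (Fintype.card κ * R), fun n => (hc n).seminorm_le _ fun t ht => ?_⟩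
  refine kappa_mixW_le ε n K _ _ _ ((le_max_right _ _).trans (le_max_right _ _))
    ((h₁ t ht).trans ((le_max_left _ _).trans (le_max_left _ _)))
    ((h₂ t ht).trans ((le_max_right _ _).trans (le_max_left _ _)))
    ((h₃ t ht).trans ((le_max_left _ _).trans (le_max_right _ _)))

lemma entire_chainCS (α δ : Matrix ι ι Ω) : Entire (chainCS α δ) :=
  entire_of_insW 1 (finDiff_conA α δ).finCurve (FinCurve.const _) (finDiff_conA α δ).finCurve
    (isIntegral_chainCS α δ)

lemma one_eq_map : (1 : Matrix ι ι Ω) = (1 : Matrix ι ι ℂ).map fun c => c • DGData.one := by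
  ext i j
  rcases eq_or_ne i j with rfl | h
  · simp [dg_one]
  · simp [Matrix.one_apply_ne h]

lemma BOp_insW (n : ℕ) (X Y : Matrix ι ι Ω) : BOp (insW n 1 X Y) = 0 := by
  rw [insW, mixW, map_sum]
  exact Finset.sum_eq_zero fun m _ => BOp_W_eq_zero _ 1 one_eq_map

lemma BOp_chainCS (α δ : Matrix ι ι Ω) (n : ℕ) : BOp (chainCS α δ n) = 0 :=
  (isIntegral_chainCS α δ n).mem (LinearMap.ker BOp) fun _ => BOp_insW n _ _

lemma chainCS_zero (α δ : Matrix ι ι Ω) : chainCS α δ 0 = 0 := by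
  refine (isIntegral_chainCS α δ 0).unique ?_
  simpa [insW, mixW] using IsIntegral01.const (0 : Chain Ω)

lemma gammaOp_chainCS (hα : IsForm α) (hδ : IsForm δ) (n : ℕ) :
    gammaOp (chainCS α δ n) = -chainCS α δ n := by
  have h := (isIntegral_chainCS α δ n).mem (LinearMap.ker (gammaOp + LinearMap.id)) fun t => by
    rw [LinearMap.mem_ker, LinearMap.add_apply, gammaOp_insW n parM_one
      (parM_conA (hα.add (hδ.smul _))) (parM_conB hδ)]
    exact neg_add_cancel _
  rw [LinearMap.mem_ker, LinearMap.add_apply] at h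
  exact eq_neg_of_add_eq_zero_left h

/-- The transgression formula. -/
lemma b_chainCS (hα : IsForm α) (hδ : IsForm δ) (n : ℕ) :
    dOp (chainCS α δ n) + mulOp (chainCS α δ (n + 1)) =
      W n (Fin.cons 1 fun _ => conA (α + δ)) - W n (Fin.cons 1 fun _ => conA α) := by
  have h1 := ((isIntegral_chainCS α δ n).map dOp).add ((isIntegral_chainCS α δ (n + 1)).map mulOp)
  set 𝔸 : ℝ → Matrix (ι × Fin 4) (ι × Fin 4) Ω := fun t =>
    kr (conA (α + (t : ℂ) • δ)) 1 + kr (conB δ) matS + kr 0 matT with h𝔸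
  set 𝔸' : ℝ → Matrix (ι × Fin 4) (ι × Fin 4) Ω := fun t =>
    kr (varA (α + (t : ℂ) • δ) δ) 1 + kr 0 matS + kr 0 matT with h𝔸'
  have h2 : FinDiff 𝔸 𝔸' := by
    have h := (((finDiff_conA α δ).map (krL (1 : Matrix (Fin 4) (Fin 4) ℂ))).add
      (FinDiff.const (kr (conB δ) matS))).add (FinDiff.const (kr (0 : Matrix ι ι Ω) matT))
    simpa only [h𝔸, h𝔸', kr_zero_left] using! h
  have h3 := (h2.W_cons n (kr 1 (matK₁ * matS))).isIntegral
  have h4 : (fun t : ℝ => dOp (insW n 1 (conA (α + (t : ℂ) • δ)) (conB δ)) +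
      mulOp (insW (n + 1) 1 (conA (α + (t : ℂ) • δ)) (conB δ))) =
      fun t => insW n (kr 1 (matK₁ * matS)) (𝔸 t) (𝔸' t) := by
    funext t
    have hαt : IsForm (α + (t : ℂ) • δ) := hα.add (hδ.smul _)
    have h := b_closed_words matS_mul_matS matT_mul_matT matT_mul_matS matK₁ (Z := 0) (B' := 0)
      (C' := 0) (C := 0) (Y := 0) (parM_conA hαt) (parM_conB hδ) (by ext; simp) (dM_conA hαt)
      (dM_conB hαt hδ) (by ext; simp) (by simp) (by simp) n
    rw [W_matK₁, W_matK₁] at h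
    refine h.trans ?_
    have h0 : insW n (kr 1 (matK₁ * matT)) (𝔸 t)
        (kr (0 : Matrix ι ι Ω) 1 + kr 0 matS + kr 0 matT) = 0 := by
      simp [kr_zero_left, insW, mixW, W_zero_letter]
    exact (congrArg _ h0).trans (add_zero _)
  rw [h4] at h1
  refine h1.unique ?_
  simpa [h𝔸, W_matK₁S] using h3

end Transgression

section Stokes

lemma SepCurve.mul {A : Type*} [Ring A] [Algebra ℂ A] {c c' : ℝ → ℝ → A} (h : SepCurve c)
    (h' : SepCurve c') : SepCurve (fun s t => c s t * c' s t) := by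
  have h1 := SepCurve.multilinear (MultilinearMap.mkPiAlgebraFin ℂ 2 A) (c := ![c, c'])
    (fun i => by fin_cases i; exacts [h, h'])
  simpa [MultilinearMap.mkPiAlgebraFin_apply] using h1

variable {𝔽 : Type*} [CommRing 𝔽] [Algebra ℂ 𝔽] {Ω : Type*} [AddCommGroup Ω] [Module ℂ Ω]
  [TopologicalSpace Ω] [DGData Ω] [PolynormableSpace ℂ Ω] [FormDG 𝔽 Ω] {ι : Type} [Fintype ι]
  [DecidableEq ι]

attribute [local instance] dgRing dgAlgebra

open FormDG

lemma SepCurve.neg {V : Type*} [AddCommGroup V] [Module ℂ V] {c : ℝ → ℝ → V} (h : SepCurve c) :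
    SepCurve (fun s t => -c s t) := h.map (-LinearMap.id)

lemma SepCurve.conA {α : ℝ → ℝ → Matrix ι ι Ω} (h : SepCurve α) :
    SepCurve (fun s t => conA (α s t)) := by
  simp only [OddChern.conA, curvM, sub_eq_add_neg]
  exact h.add (((h.map dM).add (h.mul h)).map thM).neg

lemma SepCurve.varA {α δ : ℝ → ℝ → Matrix ι ι Ω} (h : SepCurve α) (h' : SepCurve δ) :
    SepCurve (fun s t => varA (α s t) (δ s t)) := by
  simp only [OddChern.varA, sub_eq_add_neg]
  exact h'.add (((h'.map dM).add ((h.mul h').add (h'.mul h))).map thM).neg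

lemma SepCurve.conB {δ : ℝ → ℝ → Matrix ι ι Ω} (h : SepCurve δ) :
    SepCurve (fun s t => conB (δ s t)) := (h.map thM).neg

lemma SepCurve.kr {κ : Type} [Fintype κ] [DecidableEq κ] {α : ℝ → ℝ → Matrix ι ι Ω}
    (h : SepCurve α) (c : Matrix κ κ ℂ) : SepCurve (fun s t => kr (α s t) c) := h.map (krL c)

lemma gammaOp_W_map {κ : Type} [Fintype κ] {n : ℕ} (V : Fin (n + 1) → Matrix κ κ Ω) :
    gammaOp (W n V) = (-1 : ℂ) ^ n • W n (fun j => (V j).map DGData.par) := by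
  rw [W_apply, W_apply, map_sum, Finset.smul_sum]
  exact Finset.sum_congr rfl fun i _ => gammaOp_el n _

lemma matσ_mul_self : matσ * matσ = 1 := by
  ext i j; fin_cases i <;> fin_cases j <;> simp [matσ, Matrix.mul_apply, Fin.sum_univ_succ]
lemma matσ_mul_matS : matσ * matS = -(matS * matσ) := by
  ext i j; fin_cases i <;> fin_cases j <;> simp [matσ, matS, Matrix.mul_apply, Fin.sum_univ_succ]
lemma matσ_mul_matT : matσ * matT = -(matT * matσ) := by
  ext i j; fin_cases i <;> fin_cases j <;> simp [matσ, matT, Matrix.mul_apply, Fin.sum_univ_succ]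
lemma matσ_mul_matK : matσ * matK = matK * matσ := by
  ext i j; fin_cases i <;> fin_cases j <;> simp [matσ, matK, Matrix.mul_apply, Fin.sum_univ_succ]

lemma gammaOp_W_matK {a b c : Matrix ι ι Ω} (ha : parM a = -a) (hb : parM b = b)
    (hc : parM c = c) (n : ℕ) :
    gammaOp (W n (Fin.cons (kr 1 matK) fun _ => kr a 1 + kr b matS + kr c matT)) =
      W n (Fin.cons (kr 1 matK) fun _ => kr a 1 + kr b matS + kr c matT) := by
  have h1 : (fun j => (Fin.cons (kr 1 matK) (fun _ => kr a 1 + kr b matS + kr c matT) :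
      Fin (n + 1) → Matrix (ι × Fin 4) (ι × Fin 4) Ω) j |>.map DGData.par) =
      Fin.cons (kr 1 matK) fun _ => -(kr a 1 - kr b matS - kr c matT) := by
    have hp : ∀ (P : Matrix ι ι Ω) (e : Matrix (Fin 4) (Fin 4) ℂ),
      (kr P e).map DGData.par = kr (parM P) e := fun P e => kr_map _ _ _
    funext j
    refine Fin.cases ?_ (fun j => ?_) j
    · rw [Fin.cons_zero, Fin.cons_zero, hp, parM_one]
    · rw [Fin.cons_succ, Fin.cons_succ, Matrix.map_add _ (map_add _), Matrix.map_add _ (map_add _),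
        hp, hp, hp, ha, hb, hc, kr_neg_left]
      abel
  set M := kr (tw a) 1 + kr (tw b) matS + kr (tw c) matT with hM
  set σ : Matrix (ι × Fin 4) (ι × Fin 4) (Tw Ω) := kr 1 matσ with hσ
  have h2 : SemiconjBy σ M (kr (tw a) 1 - kr (tw b) matS - kr (tw c) matT) := by
    simp only [SemiconjBy, hσ, hM, mul_add, sub_mul, kr_mul, one_mul, mul_one, matσ_mul_matS,
      matσ_mul_matT, kr_neg_right]
    abel
  have h3 : σ * σ = 1 := by rw [hσ, kr_mul, matσ_mul_self, one_mul, kr_one_one]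
  have h4 : (kr (tw a) 1 - kr (tw b) matS - kr (tw c) matT) ^ n = σ * (M ^ n * σ) := by
    rw [← mul_assoc, (h2.pow_right n).eq, mul_assoc, h3, mul_one]
  have h5 : tw (kr a 1 - kr b matS - kr c matT) =
      kr (tw a) 1 - kr (tw b) matS - kr (tw c) matT := by
    simp only [sub_eq_add_neg, tw_add, tw_neg, tw_kr]
  rw [gammaOp_W_map, h1, W_const, tw_neg, h5, neg_pow (kr (tw a) 1 - kr (tw b) matS - kr (tw c) matT), h4]
  rw [W_const, tw_add, tw_add, tw_kr, tw_kr, tw_kr, ← hM]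
  have h6 : ((-1 : Matrix (ι × Fin 4) (ι × Fin 4) (Tw Ω)) ^ n) * (σ * (M ^ n * σ)) =
      (-1 : ℂ) ^ n • (σ * (M ^ n * σ)) := by
    rcases Nat.even_or_odd n with h | h <;> simp [h.neg_one_pow]
  rw [h6, map_smul, smul_smul, ← mul_pow, neg_one_mul, neg_neg, one_pow, one_smul, hσ,
    pair_kr_left, pair_kr_right, kr_mul, kr_mul, one_mul, one_mul, ← mul_assoc, matσ_mul_matK,
    mul_assoc, matσ_mul_self, mul_one]

variable {α δ : Matrix ι ι Ω}

/-- Stokes' theorem for the triangle with vertices `0`, `α`, `α + δ`. -/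
theorem exists_stokes (hα : IsForm α) (hδ : IsForm δ) : ∃ w : ℕ → Chain Ω, Entire w ∧
    (∀ n, BOp (w n) = 0) ∧ (∀ n, gammaOp (w n) = w n) ∧ mulOp (w 0) = 0 ∧
    ∀ n, dOp (w n) + mulOp (w (n + 1)) =
      chainCS α δ n + -(chainCS 0 (α + δ) n - chainCS 0 α n) := by
  set β : ℝ → Matrix ι ι Ω := fun t => α + (t : ℂ) • δ with hβ
  set 𝔸 : ℝ → ℝ → Matrix (ι × Fin 4) (ι × Fin 4) Ω := fun s t =>
    kr (conA ((s : ℂ) • β t)) 1 + kr (conB (β t)) matS + kr (conB ((s : ℂ) • δ)) matT with h𝔸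
  set 𝔸s : ℝ → ℝ → Matrix (ι × Fin 4) (ι × Fin 4) Ω := fun s t =>
    kr (varA ((s : ℂ) • β t) (β t)) 1 + kr 0 matS + kr (conB δ) matT with h𝔸s
  set 𝔸t : ℝ → ℝ → Matrix (ι × Fin 4) (ι × Fin 4) Ω := fun s t =>
    kr (varA ((s : ℂ) • β t) ((s : ℂ) • δ)) 1 + kr (conB δ) matS + kr 0 matT with h𝔸t
  have hβF : ∀ t, IsForm (β t) := fun t => hα.add (hδ.smul _)
  have cs : SepCurve (fun s t : ℝ => (s : ℂ) • δ) := by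
    simpa using SepCurve.smul (f := fun s : ℝ => (s : ℂ)) (g := fun _ => 1)
      Complex.continuous_ofReal continuous_const δ
  have ct : SepCurve (fun s t : ℝ => (t : ℂ) • δ) := by
    simpa using SepCurve.smul (f := fun _ => 1) (g := fun s : ℝ => (s : ℂ))
      continuous_const Complex.continuous_ofReal δ
  have cβ : SepCurve (fun s t : ℝ => β t) := (SepCurve.const α).add ct
  have csβ : SepCurve (fun s t : ℝ => (s : ℂ) • β t) := by
    have h1 := (SepCurve.smul (f := fun s : ℝ => (s : ℂ)) (g := fun _ => 1)
      Complex.continuous_ofReal continuous_const α).add (SepCurve.smul (f := fun s : ℝ => (s : ℂ))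
      (g := fun t : ℝ => (t : ℂ)) Complex.continuous_ofReal Complex.continuous_ofReal δ)
    simpa [hβ, smul_smul, -Complex.coe_smul] using h1
  have c𝔸 : SepCurve 𝔸 := (((csβ.conA).kr 1).add (cβ.conB.kr matS)).add (cs.conB.kr matT)
  have c𝔸s : SepCurve 𝔸s := (((csβ.varA cβ).kr 1).add ((SepCurve.const 0).kr matS)).add
    ((SepCurve.const _).kr matT)
  have c𝔸t : SepCurve 𝔸t := (((csβ.varA cs).kr 1).add ((SepCurve.const _).kr matS)).add
    ((SepCurve.const 0).kr matT)
  have hconB : ∀ (a b : Matrix ι ι Ω) (z : ℂ), conB (a + z • b) = conB a + z • conB b := by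
    intro a b z
    simp only [conB, map_add, map_smul, neg_add, smul_neg]
  have ds : ∀ t, FinDiff (fun s => 𝔸 s t) (fun s => 𝔸s s t) := by
    intro t
    have h1 := (finDiff_conA 0 (β t)).map (krL (1 : Matrix (Fin 4) (Fin 4) ℂ))
    have h2 := (FinDiff.affine (conB (0 : Matrix ι ι Ω)) (conB δ)).map (krL matT)
    simp only [← hconB, zero_add] at h1 h2
    have h3 := (h1.add (FinDiff.const (kr (conB (β t)) matS))).add h2
    simp only [h𝔸, h𝔸s, kr_zero_left]
    exact h3
  have dt : ∀ s, FinDiff (fun t => 𝔸 s t) (fun t => 𝔸t s t) := by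
    intro s
    have h1 := (finDiff_conA ((s : ℂ) • α) ((s : ℂ) • δ)).map (krL (1 : Matrix (Fin 4) (Fin 4) ℂ))
    have h2 := (FinDiff.affine (conB α) (conB δ)).map (krL matS)
    simp only [← hconB] at h2
    have h3 := (h1.add h2).add (FinDiff.const (kr (conB ((s : ℂ) • δ)) matT))
    have h4 : ∀ t : ℝ, (s : ℂ) • β t = (s : ℂ) • α + (t : ℂ) • (s : ℂ) • δ := fun t => by
      rw [hβ, smul_add, smul_comm (s : ℂ) (t : ℂ)]
    simp only [h𝔸, h𝔸t, kr_zero_left, h4]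
    exact h3
  choose w hw using fun n => (c𝔸.W_cons n (kr 1 matK)).exists_integral
  choose a ha using fun n => (c𝔸.insW c𝔸s n (kr 1 (matK * matS))).exists_integral
  choose a' ha' using fun n => (c𝔸.insW c𝔸t n (kr 1 (matK * matT))).exists_integral
  have hb : ∀ n, dOp (w n) + mulOp (w (n + 1)) = a n + a' n := fun n => by
    refine (((hw n).map dOp).add ((hw (n + 1)).map mulOp)).unique ?_
    have h := (ha n).add (ha' n)
    convert h using 3 with s t
    have hf : IsForm ((s : ℂ) • β t) := (hβF t).smul _
    exact b_closed_words matS_mul_matS matT_mul_matT matT_mul_matS matK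
      (parM_conA hf) (parM_conB (hβF t)) (parM_conB (hδ.smul _)) (dM_conA hf)
      (dM_conB hf (hβF t)) (dM_conB hf (hδ.smul _)) (conB_mul_conB (hβF t) (hδ.smul _))
      (conB_mul_conB (hδ.smul _) (hβF t)) n
  refine ⟨w, ?_, fun n => ?_, fun n => ?_, ?_, fun n => ?_⟩
  · intro ε _
    obtain ⟨R, hR⟩ := c𝔸.bounded (entrySeminorm ε)
    refine ⟨Fintype.card (ι × Fin 4) * max R (entrySeminorm ε (kr (1 : Matrix ι ι Ω) matK)), fun n =>
      (hw n).seminorm_le _ fun s hs t ht => kappa_W_le ε n _ fun j => ?_⟩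
    refine Fin.cases (le_max_right _ _) (fun j => ?_) j
    exact (hR s hs t ht).trans (le_max_left _ _)
  · refine (hw n).mem (LinearMap.ker BOp) fun s t => ?_
    refine BOp_W_eq_zero _ (Matrix.of fun a b => matK a.2 b.2 * (1 : Matrix ι ι ℂ) a.1 b.1) ?_
    ext a b
    change matK a.2 b.2 • (1 : Matrix ι ι Ω) a.1 b.1 = (_ * _ : ℂ) • DGData.one
    rw [one_eq_map, mul_smul]
    rfl
  · have h := (hw n).mem (LinearMap.ker (gammaOp - LinearMap.id)) fun s t => by
      rw [LinearMap.mem_ker, LinearMap.sub_apply, gammaOp_W_matK (parM_conA ((hβF t).smul _))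
        (parM_conB (hβF t)) (parM_conB (hδ.smul _))]
      exact sub_self _
    rw [LinearMap.mem_ker, LinearMap.sub_apply] at h
    exact sub_eq_zero.mp h
  · exact (hw 0).mem (LinearMap.ker mulOp) fun s t => mulOp_W_zero _
  · rw [hb]
    have h1 := (ha n).of_deriv_left fun t => (ds t).W_cons n (kr 1 (matK * matS))
    have h2 := (ha' n).of_deriv_right fun s => (dt s).W_cons n (kr 1 (matK * matT))
    simp only [h𝔸, W_matKS, W_matKT] at h1 h2
    congr 1
    · refine h1.unique ?_
      have h3 := isIntegral_chainCS α δ n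
      have h4 : ∀ X : Matrix ι ι Ω, insW n 1 X (conB (((0 : ℝ) : ℂ) • δ)) = 0 := fun X => by
        simp [conB, insW, mixW, W_zero_letter]
      simpa only [h4, sub_zero, Complex.ofReal_one, one_smul] using h3
    · refine h2.unique ?_
      have h3 := ((isIntegral_chainCS 0 (α + δ) n).sub (isIntegral_chainCS 0 α n)).neg
      simp only [hβ, zero_add, Complex.ofReal_one, Complex.ofReal_zero, one_smul, zero_smul,
        add_zero, neg_sub_neg] at h3 ⊢
      simpa only [neg_sub] using h3

end Stokes

section MaurerCartan

variable {𝔽 : Type*} [CommRing 𝔽] [Algebra ℂ 𝔽] {Ω : Type*} [AddCommGroup Ω] [Module ℂ Ω]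
  [TopologicalSpace Ω] [DGData Ω] [FormDG 𝔽 Ω] {ι : Type} [Fintype ι] [DecidableEq ι]

attribute [local instance] dgRing dgAlgebra

open FormDG

variable (Ω) in
/-- A matrix of functions as a matrix of forms. -/
def fnM (g : Matrix ι ι 𝔽) : Matrix ι ι Ω := g.map fn

lemma fnM_mul (g h : Matrix ι ι 𝔽) : fnM Ω (g * h) = fnM Ω g * fnM Ω h := by
  ext i j
  change fn (∑ k, g i k * h k j) = ∑ k, fn (g i k) * fn (h k j)
  rw [map_sum]
  exact Finset.sum_congr rfl fun k _ => fn_mul _ _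

lemma fnM_one : fnM Ω (1 : Matrix ι ι 𝔽) = 1 := by
  ext i j
  change fn ((1 : Matrix ι ι 𝔽) i j) = (1 : Matrix ι ι Ω) i j
  rcases eq_or_ne i j with rfl | h
  · rw [Matrix.one_apply_eq, Matrix.one_apply_eq]; exact fn_one
  · rw [Matrix.one_apply_ne h, Matrix.one_apply_ne h, map_zero]

lemma fn_mul_comm (f : 𝔽) (x : Ω) : fn f * x = x * fn f := fn_comm f x

lemma isForm_dM_fnM (g : Matrix ι ι 𝔽) : IsForm (dM (fnM Ω g)) := fun i j => d_fn_mem (g i j)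

lemma IsForm.fnM_mul {δ : Matrix ι ι Ω} (hδ : IsForm δ) (g : Matrix ι ι 𝔽) : IsForm (fnM Ω g * δ) :=
  fun i j => Submodule.sum_mem _ fun k _ => fn_mul_oneForm (g i k) _ (hδ k j)

lemma IsForm.mul_fnM {δ : Matrix ι ι Ω} (hδ : IsForm δ) (g : Matrix ι ι 𝔽) : IsForm (δ * fnM Ω g) :=
  fun i j => Submodule.sum_mem _ fun k _ => by
    change δ i k * fn (g k j) ∈ _
    rw [← fn_mul_comm]
    exact fn_mul_oneForm (g k j) _ (hδ i k)

lemma dM_fnM_mul (g h : Matrix ι ι 𝔽) :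
    dM (fnM Ω (g * h)) = dM (fnM Ω g) * fnM Ω h + fnM Ω g * dM (fnM Ω h) := by
  ext i j
  change DGData.d (fn (∑ k, g i k * h k j) : Ω) =
    ∑ k, DGData.d (fn (g i k) : Ω) * fn (h k j) + ∑ k, fn (g i k) * DGData.d (fn (h k j) : Ω)
  rw [map_sum, map_sum, ← Finset.sum_add_distrib]
  exact Finset.sum_congr rfl fun k _ => d_fn_fn (Ω := Ω) _ _

lemma dM_dM_fnM (g : Matrix ι ι 𝔽) : dM (dM (fnM Ω g)) = 0 := by
  ext i j
  exact d_d_fn (g i j)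

lemma IsForm.dM_fnM_mul {δ : Matrix ι ι Ω} (hδ : IsForm δ) (g : Matrix ι ι 𝔽) :
    dM (fnM Ω g * δ) = dM (fnM Ω g) * δ + fnM Ω g * dM δ := by
  ext i j
  change DGData.d (∑ k, fn (g i k) * δ k j) =
    ∑ k, DGData.d (fn (g i k)) * δ k j + ∑ k, fn (g i k) * DGData.d (δ k j)
  rw [map_sum, ← Finset.sum_add_distrib]
  exact Finset.sum_congr rfl fun k _ => d_fn_form _ _ (hδ k j)

lemma IsForm.dM_mul_fnM {δ : Matrix ι ι Ω} (hδ : IsForm δ) (g : Matrix ι ι 𝔽) :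
    dM (δ * fnM Ω g) = dM δ * fnM Ω g - δ * dM (fnM Ω g) := by
  ext i j
  change DGData.d (∑ k, δ i k * fn (g k j)) =
    ∑ k, DGData.d (δ i k) * fn (g k j) - ∑ k, δ i k * DGData.d (fn (g k j))
  rw [map_sum, ← Finset.sum_sub_distrib]
  refine Finset.sum_congr rfl fun k _ => ?_
  have h1 : DGData.d (fn (g k j) * δ i k) =
    DGData.d (fn (g k j)) * δ i k + fn (g k j) * DGData.d (δ i k) := d_fn_form _ _ (hδ i k)
  have h2 : DGData.d (fn (g k j)) * δ i k = -(δ i k * DGData.d (fn (g k j))) :=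
    anticomm _ (d_fn_mem _) _ (hδ i k)
  rw [← fn_mul_comm, h1, h2, fn_mul_comm]
  abel

lemma parM_fnM (g : Matrix ι ι 𝔽) : parM (fnM Ω g) = fnM Ω g := by
  ext i j
  exact par_fn (g i j)

lemma fnM_mul_thM (g : Matrix ι ι 𝔽) (X : Matrix ι ι Ω) : fnM Ω g * thM X = thM (fnM Ω g * X) := by
  rw [← mul_thM, parM_fnM]

variable (Ω) in
/-- The Maurer-Cartan form `g⁻¹ dg`. -/
def mcM (g : (Matrix ι ι 𝔽)ˣ) : Matrix ι ι Ω := fnM Ω (g⁻¹).1 * dM (fnM Ω g.1)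

variable (g h : (Matrix ι ι 𝔽)ˣ)

lemma isForm_mcM : IsForm (mcM Ω g) := (isForm_dM_fnM _).fnM_mul _

lemma fnM_mul_inv : fnM Ω g.1 * fnM Ω (g⁻¹).1 = 1 := by rw [← fnM_mul, Units.mul_inv, fnM_one]

lemma fnM_inv_mul : fnM Ω (g⁻¹).1 * fnM Ω g.1 = 1 := by rw [← fnM_mul, Units.inv_mul, fnM_one]

lemma fnM_mul_mcM : fnM Ω g.1 * mcM Ω g = dM (fnM Ω g.1) := by
  rw [mcM, ← mul_assoc, fnM_mul_inv, one_mul]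

lemma dM_fnM_inv : dM (fnM Ω (g⁻¹).1) = -(mcM Ω g * fnM Ω (g⁻¹).1) := by
  have h1 := dM_fnM_mul (Ω := Ω) (g⁻¹).1 g.1
  rw [Units.inv_mul, fnM_one, dM_one] at h1
  have h2 : dM (fnM Ω (g⁻¹).1) * fnM Ω g.1 = -mcM Ω g := (neg_eq_of_add_eq_zero_left h1.symm).symm
  have h3 := congrArg (· * fnM Ω (g⁻¹).1) h2
  simpa only [mul_assoc, fnM_mul_inv, mul_one, neg_mul] using h3

/-- The Maurer-Cartan equation. -/
lemma curvM_mcM : curvM (mcM Ω g) = 0 := by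
  have h1 : dM (mcM Ω g) = dM (fnM Ω (g⁻¹).1) * dM (fnM Ω g.1) := by
    rw [mcM, (isForm_dM_fnM g.1).dM_fnM_mul, dM_dM_fnM, mul_zero, add_zero]
  rw [curvM, h1, dM_fnM_inv, neg_mul, mul_assoc]
  exact neg_add_cancel _

lemma conA_mcM : conA (mcM Ω g) = mcM Ω g := by rw [conA, curvM_mcM, map_zero, sub_zero]

lemma conA_zero : conA (0 : Matrix ι ι Ω) = 0 := by simp [conA, curvM]

lemma mcM_mul_inv : mcM Ω (h * g⁻¹) = fnM Ω g.1 * (mcM Ω h - mcM Ω g) * fnM Ω (g⁻¹).1 := by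
  have h1 : fnM Ω g.1 * mcM Ω g * fnM Ω (g⁻¹).1 = -(fnM Ω g.1 * dM (fnM Ω (g⁻¹).1)) := by
    rw [dM_fnM_inv, mul_neg, neg_neg, mul_assoc]
  rw [mul_sub, sub_mul, h1, mcM, mul_inv_rev, inv_inv, Units.val_mul, Units.val_mul, dM_fnM_mul,
    fnM_mul, mul_add, sub_neg_eq_add]
  congr 1
  · rw [mcM]; simp only [mul_assoc]
  · rw [mul_assoc, ← mul_assoc (fnM Ω (h⁻¹).1), fnM_inv_mul, one_mul]

/-- Gauge transformations of the superconnections. -/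
lemma fnM_mul_conA {δ : Matrix ι ι Ω} (hδ : IsForm δ) (c : ℂ) :
    fnM Ω g.1 * conA (mcM Ω g + c • δ) =
      conA (c • (fnM Ω g.1 * δ * fnM Ω (g⁻¹).1)) * fnM Ω g.1 + dM (fnM Ω g.1) := by
  set δ' := fnM Ω g.1 * δ * fnM Ω (g⁻¹).1 with hδ'
  have hF' : IsForm δ' := (hδ.fnM_mul _).mul_fnM _
  have h1 : δ' * fnM Ω g.1 = fnM Ω g.1 * δ := by
    rw [hδ', mul_assoc, fnM_inv_mul, mul_one]
  have h2 : dM δ' * fnM Ω g.1 = fnM Ω g.1 * (dM δ + (mcM Ω g * δ + δ * mcM Ω g)) := by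
    have h3 := hF'.dM_mul_fnM g.1
    rw [h1, hδ.dM_fnM_mul, ← fnM_mul_mcM, mul_assoc, ← mul_assoc δ', h1] at h3
    rw [mul_add, mul_add, ← mul_assoc _ δ, eq_add_of_sub_eq h3.symm]
    abel
  have h4 : fnM Ω g.1 * curvM (mcM Ω g + c • δ) = curvM (c • δ') * fnM Ω g.1 := by
    have h5 : curvM (mcM Ω g + c • δ) = curvM (mcM Ω g) + (c • (dM δ + (mcM Ω g * δ + δ * mcM Ω g)) +
        c ^ 2 • (δ * δ)) := by
      simp only [curvM, map_add, map_smul, mul_add, add_mul, Matrix.smul_mul, Matrix.mul_smul,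
        smul_smul, pow_two, smul_add]
      abel
    have h6 : fnM Ω g.1 * (δ * δ) = δ' * δ' * fnM Ω g.1 := by
      rw [mul_assoc, h1, ← mul_assoc, ← mul_assoc, h1]
    rw [h5, curvM_mcM, zero_add, mul_add, Matrix.mul_smul, Matrix.mul_smul, ← h2, h6, curvM, map_smul,
      add_mul, Matrix.smul_mul, smul_mul_smul_comm, ← sq c, Matrix.smul_mul]
  rw [conA, conA, mul_sub, sub_mul, mul_add, fnM_mul_mcM, fnM_mul_thM, h4, thM_mul, Matrix.mul_smul,
    Matrix.smul_mul, h1]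
  abel

end MaurerCartan

section ChernCharacter

lemma IsIntegral01.sum {V : Type*} [AddCommGroup V] [Module ℂ V] {σ : Type*} (s : Finset σ)
    {c : σ → ℝ → V} {a : σ → V} (h : ∀ k, IsIntegral01 (c k) (a k)) :
    IsIntegral01 (fun t => ∑ k ∈ s, c k t) (∑ k ∈ s, a k) := by
  classical
  induction s using Finset.induction_on with
  | empty => simpa using IsIntegral01.const (0 : V)
  | insert k s hk ih =>
    simp only [Finset.sum_insert hk]
    exact (h k).add ih

section

variable {Ω : Type*} [AddCommGroup Ω] [Module ℂ Ω] [TopologicalSpace Ω] [DGData Ω]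

lemma Entire.add {c c' : ℕ → Chain Ω} (h : Entire c) (h' : Entire c') :
    Entire (fun n => c n + c' n) := by
  intro ε hε
  obtain ⟨R, hR⟩ := h ε hε
  obtain ⟨R', hR'⟩ := h' ε hε
  refine ⟨|R| + |R'|, fun n => (map_add_le_add _ _ _).trans ?_⟩
  refine (add_le_add (hR n) (hR' n)).trans ?_
  rw [← add_div]
  gcongr
  refine (add_le_add (le_abs_self _) (le_abs_self _)).trans ?_
  rw [abs_pow, abs_pow]
  exact pow_add_pow_le (abs_nonneg R) (abs_nonneg R') n.succ_ne_zero

lemma Entire.neg {c : ℕ → Chain Ω} (h : Entire c) : Entire (fun n => -c n) := by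
  intro ε hε
  simpa only [map_neg_eq_map] using h ε hε

lemma Entire.sub {c c' : ℕ → Chain Ω} (h : Entire c) (h' : Entire c') :
    Entire (fun n => c n - c' n) := by
  simpa only [sub_eq_add_neg] using h.add h'.neg

lemma entire_W {κ : Type} [Fintype κ] (K X : Matrix κ κ Ω) :
    Entire (fun n => W n (Fin.cons K fun _ => X)) := by
  intro ε _
  refine ⟨Fintype.card κ * max (entrySeminorm ε K) (entrySeminorm ε X), fun n =>
    kappa_W_le ε n _ fun j => ?_⟩
  refine Fin.cases (le_max_left _ _) (fun j => ?_) j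
  exact le_max_right _ _

lemma esum_neg {c : ℕ → Chain Ω} (h : Entire c) : esum (fun n => -c n) = -esum c := by
  simp only [esum, map_neg]
  exact h.summable.hasSum.neg.tsum_eq

end

variable {𝔽 : Type*} [CommRing 𝔽] [Algebra ℂ 𝔽] {Ω : Type*} [AddCommGroup Ω] [Module ℂ Ω]
  [TopologicalSpace Ω] [DGData Ω] [PolynormableSpace ℂ Ω] [FormDG 𝔽 Ω] {ι : Type} [Fintype ι]
  [DecidableEq ι]

attribute [local instance] dgRing dgAlgebra

open FormDG

variable (Ω) in
/-- The space of functions. -/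
def fnRange : Submodule ℂ Ω := LinearMap.range (fn : 𝔽 →ₗ[ℂ] Ω)

variable (Ω) in
/-- The chains which are boundaries of even chains in the Chen normalized complex. -/
def bdry : Submodule ℂ (EChain Ω) := (evenChains Ω).map (bB Ω : EChain Ω →ₗ[ℂ] EChain Ω) ⊔ chenClosure (fnRange Ω)

lemma chenClosure_le_bdry : chenClosure (fnRange Ω) ≤ bdry Ω := le_sup_right

lemma exists_of_mem_bdry {w : EChain Ω} (hw : w ∈ bdry Ω) :
    ∃ v ∈ evenChains Ω, (chenClosure (fnRange Ω)).mkQ w = bBN (fnRange Ω) v := by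
  obtain ⟨_, ⟨v, hv, rfl⟩, r, hr, rfl⟩ := Submodule.mem_sup.mp hw
  refine ⟨v, hv, ?_⟩
  have hr' : (chenClosure (fnRange Ω)).mkQ r = 0 := (Submodule.Quotient.mk_eq_zero _).mpr hr
  rw [map_add, hr', add_zero]
  rfl

lemma bB_mem_bdry {w : EChain Ω} (hw : w ∈ evenChains Ω) : bB Ω w ∈ bdry Ω :=
  le_sup_left (a := (evenChains Ω).map (bB Ω : EChain Ω →ₗ[ℂ] EChain Ω)) (Submodule.mem_map_of_mem hw)

variable (Ω) in
/-- The odd Chern character of an invertible matrix of functions. -/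
def chE (g : (Matrix ι ι 𝔽)ˣ) : EChain Ω := esum (chainCS 0 (mcM Ω g))

variable (g h : (Matrix ι ι 𝔽)ˣ)

lemma chE_mem_odd : chE Ω g ∈ oddChains Ω :=
  esum_mem_odd (entire_chainCS _ _) (gammaOp_chainCS isForm_zero (isForm_mcM g))

lemma mulOp_chainCS_zero (α δ : Matrix ι ι Ω) : mulOp (chainCS α δ 0) = 0 := by
  rw [chainCS_zero, map_zero]

theorem bB_chE_mem : bB Ω (chE Ω g) ∈ chenClosure (fnRange Ω) := by
  have h1 := bB_esum (entire_chainCS 0 (mcM Ω g)) (BOp_chainCS 0 (mcM Ω g)) (mulOp_chainCS_zero _ _)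
  simp only [b_chainCS isForm_zero (isForm_mcM g), zero_add, conA_mcM, conA_zero] at h1
  have hE := (entire_W (1 : Matrix ι ι Ω) (mcM Ω g)).sub (entire_W (1 : Matrix ι ι Ω) 0)
  rw [chE, ← h1.tsum_eq]
  refine esum_mem_chenClosure hE
    (r := fun N => mixW N (1 * fnM Ω (g⁻¹).1) 0 (dM (fnM Ω g.1)) (mcM Ω g)) ?_ fun N => ?_
  · exact entire_of_insW _ (FinCurve.const _) (FinCurve.const _) (FinCurve.const _)
      fun n => IsIntegral01.const _
  · refine gauge_sum (F := fnRange Ω) (G := fnM Ω g.1) (fun a b => ⟨_, rfl⟩) (fnM_mul_inv g) (fnM_inv_mul g) ?_ ?_ N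
    · rw [mul_one, one_mul]
    · rw [fnM_mul_mcM, zero_mul, zero_add]; rfl

theorem esum_chainCS_gauge {δ : Matrix ι ι Ω} (hδ : IsForm δ) :
    esum (chainCS (mcM Ω g) δ) - esum (chainCS 0 (fnM Ω g.1 * δ * fnM Ω (g⁻¹).1)) ∈
      chenClosure (fnRange Ω) := by
  set δ' := fnM Ω g.1 * δ * fnM Ω (g⁻¹).1 with hδ'
  set 𝔸 : ℝ → Matrix (ι × Fin 4) (ι × Fin 4) Ω := fun t =>
    kr (conA (mcM Ω g + (t : ℂ) • δ)) 1 + kr (conB δ) matS + kr 0 matT with h𝔸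
  set 𝔸' : ℝ → Matrix (ι × Fin 4) (ι × Fin 4) Ω := fun t =>
    kr (conA (0 + (t : ℂ) • δ')) 1 + kr (conB δ') matS + kr 0 matT with h𝔸'
  set G : Matrix (ι × Fin 4) (ι × Fin 4) Ω := kr (fnM Ω g.1) 1 with hG
  set G' : Matrix (ι × Fin 4) (ι × Fin 4) Ω := kr (fnM Ω (g⁻¹).1) 1 with hG'
  set K : Matrix (ι × Fin 4) (ι × Fin 4) Ω := kr 1 matK₁ with hK
  have hd : G.map DGData.d = kr (dM (fnM Ω g.1)) 1 := kr_map _ _ _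
  have h𝔸G : ∀ t, G * 𝔸 t = 𝔸' t * G + G.map DGData.d := fun t => by
    have h1 : fnM Ω g.1 * conB δ = conB δ' * fnM Ω g.1 := by
      rw [conB, conB, mul_neg, fnM_mul_thM, neg_mul, thM_mul, hδ', mul_assoc, fnM_inv_mul, mul_one]
    rw [hd]
    simp only [h𝔸, h𝔸', hG, mul_add, add_mul, kr_mul, mul_one, one_mul, h1, fnM_mul_conA g hδ,
      kr_add_left, zero_add, mul_zero, zero_mul, ← hδ']
    abel
  have c1 : FinCurve 𝔸 := by
    have := (((finDiff_conA (mcM Ω g) δ).map (krL (1 : Matrix (Fin 4) (Fin 4) ℂ))).add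
      (FinDiff.const (kr (conB δ) matS))).add (FinDiff.const (kr (0 : Matrix ι ι Ω) matT))
    exact this.finCurve
  have c2 : FinCurve 𝔸' := by
    have := (((finDiff_conA 0 δ').map (krL (1 : Matrix (Fin 4) (Fin 4) ℂ))).add
      (FinDiff.const (kr (conB δ') matS))).add (FinDiff.const (kr (0 : Matrix ι ι Ω) matT))
    exact this.finCurve
  choose r hr using fun N => (c2.mixW (FinCurve.const (G.map DGData.d)) c1 N (K * G')).exists_integral
  have hr' : Entire r := entire_of_insW _ c2 (FinCurve.const _) c1 hr
  rw [← esum_sub (entire_chainCS _ _) (entire_chainCS _ _)]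
  refine esum_mem_chenClosure ((entire_chainCS _ _).sub (entire_chainCS _ _)) hr' fun N => ?_
  have h1 := (IsIntegral01.sum (Finset.range N) fun n =>
    (isIntegral_chainCS (mcM Ω g) δ n).sub (isIntegral_chainCS 0 δ' n)).add (hr N)
  refine h1.mem _ fun t => ?_
  have h2 := gauge_sum (F := fnRange Ω) (K := K) (fun a b => ?_) ?_ ?_ ?_ (h𝔸G t) N (G' := G')
  · simpa only [h𝔸, h𝔸', hK, W_matK₁] using h2
  · exact Submodule.smul_mem _ _ ⟨_, rfl⟩
  · rw [kr_mul, fnM_mul_inv, one_mul, kr_one_one]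
  · rw [kr_mul, fnM_inv_mul, one_mul, kr_one_one]
  · rw [kr_mul, kr_mul, mul_one, one_mul, one_mul, mul_one]

theorem chE_sub_sub_mem : chE Ω h - chE Ω g - chE Ω (h * g⁻¹) ∈ bdry Ω := by
  have hδ := (isForm_mcM (Ω := Ω) h).sub (isForm_mcM g)
  obtain ⟨w, hw, hB, hγ, h0, hb⟩ := exists_stokes (isForm_mcM (Ω := Ω) g) hδ
  have h1 := bB_esum hw hB h0
  simp only [hb, add_sub_cancel] at h1
  have e1 := entire_chainCS (mcM Ω g) (mcM Ω h - mcM Ω g)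
  have e2 := entire_chainCS 0 (mcM Ω h)
  have e3 := entire_chainCS 0 (mcM Ω g)
  have h2 : bB Ω (esum w) = esum (chainCS (mcM Ω g) (mcM Ω h - mcM Ω g)) + -(chE Ω h - chE Ω g) := by
    rw [← h1.tsum_eq, chE, chE, ← esum_sub e2 e3, ← esum_neg (e2.sub e3),
      ← esum_add e1 (e2.sub e3).neg]
    rfl
  have h3 := esum_chainCS_gauge g hδ
  rw [← mcM_mul_inv] at h3
  have h4 := Submodule.sub_mem _ (chenClosure_le_bdry h3) (bB_mem_bdry (esum_mem_even hw hγ))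
  rw [h2] at h4
  convert h4 using 1
  rw [chE, chE, chE]
  abel

variable (Ω ι) in
/-- The class of the odd Chern character modulo boundaries as a homomorphism. -/
def chHom : Additive (Matrix ι ι 𝔽)ˣ →+ EChain Ω ⧸ bdry Ω :=
  AddMonoidHom.mk' (fun g => (bdry Ω).mkQ (chE Ω g.toMul)) fun a b => by
    have h := chE_sub_sub_mem (Ω := Ω) b.toMul (a.toMul * b.toMul)
    rw [mul_inv_cancel_right, sub_sub] at h
    rw [← map_add, add_comm]
    exact (Submodule.Quotient.eq _).mpr h

variable (Ω ι) in
/-- The invertible matrices whose odd Chern character is a boundary. -/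
def nullSubgroup : Subgroup (Matrix ι ι 𝔽)ˣ := AddSubgroup.toSubgroup' (chHom Ω ι).ker

lemma mem_nullSubgroup : g ∈ nullSubgroup Ω ι ↔ chE Ω g ∈ bdry Ω := by
  exact Submodule.Quotient.mk_eq_zero _

lemma chE_sub_mem_iff : chE Ω h - chE Ω g ∈ bdry Ω ↔ h * g⁻¹ ∈ nullSubgroup Ω ι := by
  rw [mem_nullSubgroup]
  have h1 := chE_sub_sub_mem (Ω := Ω) g h
  refine ⟨fun h2 => ?_, fun h2 => ?_⟩
  · simpa using Submodule.sub_mem _ h2 h1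
  · simpa using Submodule.add_mem _ h1 h2

end ChernCharacter

section Elementary

variable {𝔽 : Type*} [CommRing 𝔽] [Algebra ℂ 𝔽] {Ω : Type*} [AddCommGroup Ω] [Module ℂ Ω]
  [TopologicalSpace Ω] [DGData Ω] [PolynormableSpace ℂ Ω] [FormDG 𝔽 Ω] {ι : Type} [Fintype ι]
  [DecidableEq ι]

/-- Matrices whose entries vanish outside of `P × Pᶜ`. -/
def IsOff {R : Type*} [Zero R] (P : Set ι) (X : Matrix ι ι R) : Prop :=
  ∀ i j, ¬(i ∈ P ∧ j ∉ P) → X i j = 0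

section

variable {R : Type*} [Ring R] {P : Set ι} {X Y : Matrix ι ι R}

lemma IsOff.mul (hX : IsOff P X) (hY : IsOff P Y) : X * Y = 0 := by
  ext i j
  refine Finset.sum_eq_zero fun k _ => ?_
  change X i k * Y k j = 0
  by_cases hk : k ∈ P
  · rw [hX i k fun h => h.2 hk, zero_mul]
  · rw [hY k j fun h => hk h.1, mul_zero]

lemma IsOff.diag (hX : IsOff P X) (i : ι) : X i i = 0 := hX i i fun h => h.2 h.1

lemma IsOff.sub (hX : IsOff P X) (hY : IsOff P Y) : IsOff P (X - Y) := fun i j h => by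
  rw [Matrix.sub_apply, hX i j h, hY i j h, sub_zero]

end

attribute [local instance] dgRing dgAlgebra

open FormDG

lemma IsOff.map {R R' : Type*} [Zero R] [Zero R'] {P : Set ι} {X : Matrix ι ι R} (hX : IsOff P X)
    (f : R → R') (hf : f 0 = 0) : IsOff P (X.map f) := fun i j h => by
  rw [Matrix.map_apply, hX i j h, hf]

lemma pair_one (Q : Matrix ι ι (Tw Ω)) : pair 1 Q = ∑ a, wordChain (1 : Ω) (Q a a) := by
  rw [pair_apply]
  refine Finset.sum_congr rfl fun a _ => ?_
  rw [Finset.sum_eq_single a]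
  · rw [Matrix.one_apply_eq]
  · intro b _ hb
    rw [Matrix.one_apply_ne hb.symm, map_zero, LinearMap.zero_apply]
  · simp

lemma IsOff.insW_eq_zero {P : Set ι} {X Y : Matrix ι ι Ω} (hX : IsOff P X) (hY : IsOff P Y) (n : ℕ) :
    insW n 1 X Y = 0 := by
  have hX' : IsOff P (tw X) := hX.map _ (map_zero _)
  have hY' : IsOff P (tw Y) := hY.map _ (map_zero _)
  rw [insW, mixW]
  refine Finset.sum_eq_zero fun m _ => ?_
  rw [W_word]
  rcases Nat.eq_zero_or_pos m.val with hm | hm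
  · rcases Nat.eq_zero_or_pos (n - 1 - m) with hn | hn
    · rw [hn, hm, pow_zero, one_mul, mul_one, pair_one]
      exact Finset.sum_eq_zero fun a _ => by rw [hY'.diag, map_zero]
    · obtain ⟨q, hq⟩ := Nat.exists_eq_succ_of_ne_zero hn.ne'
      rw [hq, pow_succ', mul_assoc, ← mul_assoc (tw Y), hY'.mul hX', zero_mul, mul_zero, map_zero]
  · obtain ⟨q, hq⟩ := Nat.exists_eq_succ_of_ne_zero hm.ne'
    rw [hq, pow_succ, mul_assoc (tw X ^ q), hX'.mul hY', mul_zero, zero_mul, map_zero]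

/-- Unipotent matrices have vanishing Chern character. -/
theorem IsOff.mem_nullSubgroup {P : Set ι} (u : (Matrix ι ι 𝔽)ˣ) (h : IsOff P (u.1 - 1)) :
    u ∈ nullSubgroup Ω ι := by
  set N := u.1 - 1 with hN
  have hu : u.1 = 1 + N := by rw [hN]; abel
  have hu' : (u⁻¹).1 = 1 - N := by
    refine Units.inv_eq_of_mul_eq_one_right ?_
    have h0 : N * N = 0 := h.mul h
    calc u.1 * (1 - N) = 1 - N * N := by rw [hu]; noncomm_ring
      _ = 1 := by rw [h0, sub_zero]
  have hη : mcM Ω u = dM (fnM Ω N) := by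
    have h1 : IsOff P (fnM Ω N) := h.map _ (map_zero _)
    have h2 : IsOff P (dM (fnM Ω N)) := h1.map _ (map_zero _)
    have h3 : fnM Ω (1 - N) = 1 - fnM Ω N := by
      rw [← fnM_one]; ext i j; exact map_sub fn _ _
    have h4 : fnM Ω (1 + N) = 1 + fnM Ω N := by
      rw [← fnM_one]; ext i j; exact map_add fn _ _
    rw [mcM, hu', hu, h3, h4, map_add, dM_one, zero_add, sub_mul, h1.mul h2, one_mul, sub_zero]
  have hoff : IsOff P (mcM Ω u) := hη ▸ (h.map fn (map_zero _)).map _ (map_zero _)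
  have hB : IsOff P (conB (mcM Ω u)) := by
    intro i j hij
    have h0 := hoff.map (fun x : Ω => th * x) (mul_zero _) i j hij
    change -(th * mcM Ω u i j) = 0
    exact neg_eq_zero.mpr h0
  have hA : ∀ c : ℂ, IsOff P (conA (0 + c • mcM Ω u)) := by
    intro c
    have h1 : IsOff P (c • mcM Ω u) := hoff.map _ (smul_zero c)
    have h2 : IsOff P (thM (dM (c • mcM Ω u))) :=
      (h1.map DGData.d (map_zero _)).map (fun x : Ω => th * x) (mul_zero _)
    rw [zero_add, conA, curvM, h1.mul h1, add_zero]
    exact h1.sub h2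
  have h0 : ∀ n, chainCS 0 (mcM Ω u) n = 0 := fun n => by
    refine (isIntegral_chainCS 0 (mcM Ω u) n).unique ?_
    simp only [(hA _).insW_eq_zero hB]
    exact IsIntegral01.const 0
  rw [OddChern.mem_nullSubgroup, chE, esum]
  simp only [h0, map_zero, tsum_zero, Submodule.zero_mem]

section Scalar

variable (f : 𝔽)

/-- The sum of all insertions of `df` into a word lies in the Chen subspace. -/
lemma sum_insertNth_mem (n : ℕ) (v : Fin (n + 1) → Ω) :
    ∑ j : Fin (n + 1), el (n + 1) (j.succ.insertNth (DGData.d (fn f)) v) ∈ chenSubspace (fnRange Ω) := by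
  have h1 : ∀ j : Fin (n + 1), el n (Function.update v j (DGData.mul (v j) (fn f))) +
      el (n + 1) (j.succ.insertNth (DGData.d (fn f)) v) -
      el n (Function.update v (j + 1) (DGData.mul (fn f) (v (j + 1)))) ∈ chenSubspace (fnRange Ω) :=
    fun j => Submodule.subset_span (Or.inr ⟨n, v, j, fn f, ⟨f, rfl⟩, rfl⟩)
  have h2 := Submodule.sum_mem (chenSubspace (fnRange Ω)) fun j (_ : j ∈ Finset.univ) => h1 j
  rw [Finset.sum_sub_distrib, Finset.sum_add_distrib] at h2
  have h3 : ∑ j : Fin (n + 1), el n (Function.update v (j + 1) (DGData.mul (fn f) (v (j + 1)))) =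
      ∑ j : Fin (n + 1), el n (Function.update v j (DGData.mul (v j) (fn f))) := by
    rw [← Equiv.sum_comp (Equiv.addRight (1 : Fin (n + 1)))
      (fun j => el n (Function.update v j (DGData.mul (v j) (fn f))))]
    exact Finset.sum_congr rfl fun j _ => by rw [fn_comm]; rfl
  rwa [h3, add_sub_cancel_left] at h2

lemma insertNth_word {n : ℕ} (m : Fin n) (j : Fin (n + 1)) (z x y : Ω) :
    (j.succ.insertNth x (Fin.cons z (word m x y x) : Fin (n + 1) → Ω) : Fin (n + 2) → Ω) =
      Fin.cons z (word (if j.val ≤ m then m + 1 else m) x y x) := by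
  rw [Fin.insertNth_eq_iff]
  constructor
  · simp only [Fin.cons_succ, word]
    split_ifs <;> first | rfl | omega
  · funext k
    refine Fin.cases ?_ (fun k => ?_) k
    · simp [Fin.removeNth]
    · simp only [Fin.removeNth, Fin.succ_succAbove_succ, Fin.cons_succ, word]
      by_cases hk : k.val < j.val
      · rw [Fin.succAbove_of_castSucc_lt _ _ (Fin.lt_def.mpr hk), Fin.val_castSucc]
        split_ifs <;> first | rfl | (exfalso; omega)
      · rw [Fin.succAbove_of_le_castSucc _ _ (Fin.le_def.mpr (not_lt.mp hk)), Fin.val_succ]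
        split_ifs <;> first | rfl | (exfalso; omega)

lemma sum_insert_eq {V : Type*} [AddCommGroup V] [Module ℂ V] (w : ℕ → V) (n : ℕ) :
    ∑ m : Fin n, ∑ j : Fin (n + 1), w (if j.val ≤ m then m + 1 else m) =
      (n : ℂ) • ∑ m ∈ Finset.range (n + 1), w m := by
  have h1 : ∀ m ∈ Finset.range n, ∑ j ∈ Finset.range (n + 1), w (if j ≤ m then m + 1 else m) =
      ((m + 1 : ℕ) : ℂ) • w (m + 1) + ((n : ℂ) - m) • w m := by
    intro m hm
    have hm' := Finset.mem_range.mp hm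
    have h2 : n + 1 = (m + 1) + (n - m) := by omega
    rw [h2, Finset.sum_range_add]
    congr 1
    · rw [Finset.sum_congr rfl fun j hj => by rw [if_pos (by have := Finset.mem_range.mp hj; omega)]]
      rw [Finset.sum_const, Finset.card_range, Nat.cast_smul_eq_nsmul]
    · rw [Finset.sum_congr rfl fun j hj => by rw [if_neg (by omega)]]
      rw [Finset.sum_const, Finset.card_range, ← Nat.cast_smul_eq_nsmul ℂ, Nat.cast_sub hm'.le]
  rw [← Fin.sum_univ_eq_sum_range (fun m => w m)]
  simp only [fun m : Fin n => Fin.sum_univ_eq_sum_range (fun j => w (if j ≤ m.val then m.val + 1 else m)) (n + 1)]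
  rw [Fin.sum_univ_eq_sum_range (fun m => ∑ j ∈ Finset.range (n + 1), w (if j ≤ m then m + 1 else m)) n,
    Fin.sum_univ_eq_sum_range w (n + 1), Finset.sum_congr rfl h1, Finset.sum_add_distrib]
  have h3 : ∑ m ∈ Finset.range n, ((m + 1 : ℕ) : ℂ) • w (m + 1) =
      ∑ m ∈ Finset.range (n + 1), (m : ℂ) • w m := by
    rw [Finset.sum_range_succ']; simp
  have h4 : ∑ m ∈ Finset.range n, ((n : ℂ) - m) • w m =
      ∑ m ∈ Finset.range (n + 1), ((n : ℂ) - m) • w m := by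
    rw [Finset.sum_range_succ]; simp
  rw [h3, h4, ← Finset.sum_add_distrib, Finset.smul_sum]
  exact Finset.sum_congr rfl fun m _ => by module

lemma sum_word_mem (n : ℕ) (y : Ω) :
    ∑ m : Fin (n + 2), el (n + 2) (Fin.cons DGData.one (word m (DGData.d (fn f)) y (DGData.d (fn f)))) ∈
      chenSubspace (fnRange Ω) := by
  set x : Ω := DGData.d (fn f)
  have h1 := Submodule.sum_mem (chenSubspace (fnRange Ω)) fun m (_ : m ∈ Finset.univ) =>
    sum_insertNth_mem f (n + 1) (Fin.cons DGData.one (word (m : Fin (n + 1)) x y x) : Fin (n + 2) → Ω)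
  simp only [insertNth_word, x] at h1
  have h2 := sum_insert_eq (fun m => el (n + 2) (Fin.cons DGData.one (word m x y x))) (n + 1)
  rw [h2, ← Fin.sum_univ_eq_sum_range (fun m => el (n + 2) (Fin.cons DGData.one (word m x y x)))] at h1
  exact (Submodule.smul_mem_iff _ (by exact_mod_cast n.succ_ne_zero)).mp h1

lemma wordChain_word {n : ℕ} (m : Fin n) (z x y : Ω) :
    wordChain z (TensorAlgebra.ι ℂ x ^ m.val * TensorAlgebra.ι ℂ y * TensorAlgebra.ι ℂ x ^ (n - 1 - m)) =
      el n (Fin.cons z (word m x y x)) := by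
  rw [← wordChain_apply, ← list_prod_word]
  congr 3
  funext k
  simp only [word]
  split_ifs <;> rfl

lemma insW_diagonal (n : ℕ) (x y : ι → Ω) :
    insW n 1 (Matrix.diagonal x) (Matrix.diagonal y) =
      ∑ i, ∑ m : Fin n, el n (Fin.cons DGData.one (word m (x i) (y i) (x i))) := by
  rw [Finset.sum_comm, insW, mixW]
  refine Finset.sum_congr rfl fun m _ => ?_
  have h : ∀ x : ι → Ω, tw (Matrix.diagonal x) = Matrix.diagonal fun i => TensorAlgebra.ι ℂ (x i) := by
    intro x
    exact Matrix.diagonal_map (map_zero _)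
  rw [W_word, h, h, Matrix.diagonal_pow, Matrix.diagonal_pow, Matrix.diagonal_mul_diagonal,
    Matrix.diagonal_mul_diagonal, pair_one]
  refine Finset.sum_congr rfl fun i _ => ?_
  rw [Matrix.diagonal_apply_eq]
  exact wordChain_word m _ _ _

lemma bB_incl (z : Chain Ω) : bB Ω (incl z) = incl (dOp z + mulOp z + BOp z) :=
  ContinuousLinearMap.completion_apply_coe _ z

lemma incl_mem_even {z : Chain Ω} (h : gammaOp z = z) : incl z ∈ evenChains Ω := by
  change gammaE Ω (incl z) = incl z
  exact (ContinuousLinearMap.completion_apply_coe _ z).trans (congrArg incl h)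

lemma incl_W_one_mem (f : ι → 𝔽) :
    incl (W 1 (Fin.cons 1 fun _ => conB (dM (fnM Ω (Matrix.diagonal f))))) ∈ bdry Ω := by
  set Y := fnM Ω (Matrix.diagonal f)
  set Z := thM Y with hZ
  have hpar : parM Z = -Z := by rw [hZ, parM_thM, parM_fnM]
  set z := W 1 (Fin.cons (1 : Matrix ι ι Ω) fun _ => Z) with hz
  have hd : dOp z = -W 1 (Fin.cons 1 fun _ => Y) - W 1 (Fin.cons 1 fun _ => conB (dM Y)) := by
    rw [hz, dOp_W_cons _ _ parM_one dM_one, Fin.sum_univ_one, map_d_eq, hZ, dM_thM, sub_eq_add_neg,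
      ← conB, W_word_add, neg_add, ← sub_eq_add_neg]
    have h1 : ∀ X X' : Matrix ι ι Ω, (word ((0 : Fin 1) : ℕ) X X' (thM Y) : Fin 1 → _) = fun _ => X' := by
      intro X X'; funext k; simp [word]
    rw [h1, h1]
  have hm : mulOp z = 0 := by
    have h0 : Z.map (prj 0) = 0 := by
      ext i j
      have : DGData.par (Z i j) = -Z i j := congrFun (congrFun hpar i) j
      exact (prj_of_par (q := 1) (by simpa [sgn] using this)).trans (by simp)
    have h1 : Z.map (prj 1) = Z := by
      ext i j
      have : DGData.par (Z i j) = -Z i j := congrFun (congrFun hpar i) j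
      exact (prj_of_par (q := 1) (by simpa [sgn] using this)).trans (by simp)
    rw [hz, mulOp_W_cons _ _ parM_one, h0, h1]
    have h2 : W 0 (Fin.cons (0 * 1 : Matrix ι ι Ω) fun _ => Z.map sg) = 0 :=
      MultilinearMap.map_coord_zero _ 0 (by simp)
    rw [h2]
    simp
  have hY : W 1 (Fin.cons (1 : Matrix ι ι Ω) fun _ => Y) ∈ chenSubspace (fnRange Ω) := by
    rw [W_apply]
    exact Submodule.sum_mem _ fun i _ => Submodule.subset_span
      (Or.inl ⟨1, _, 1, one_ne_zero, ⟨_, rfl⟩, rfl⟩)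
  have hB : BOp z = 0 := BOp_W_eq_zero _ 1 one_eq_map
  have h1 := bB_mem_bdry (incl_mem_even (gammaOp_W_cons 1 parM_one hpar))
  rw [← hz, bB_incl, hd, hm, hB, add_zero, add_zero, map_sub, map_neg] at h1
  have h2 := Submodule.add_mem _ h1 (chenClosure_le_bdry (incl_mem_chenClosure hY))
  have h3 := Submodule.neg_mem _ h2
  simpa using h3

/-- Matrices with diagonal logarithmic differential of exponential type. -/
theorem mem_nullSubgroup_of_diagonal (u : (Matrix ι ι 𝔽)ˣ) (f : ι → 𝔽)
    (h : mcM Ω u = dM (fnM Ω (Matrix.diagonal f))) : u ∈ nullSubgroup Ω ι := by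
  set x : ι → Ω := fun i => DGData.d (fn (f i)) with hx
  have hη : mcM Ω u = Matrix.diagonal x := by
    rw [h, fnM, Matrix.diagonal_map (map_zero _)]
    exact Matrix.diagonal_map (map_zero _)
  have hxx : ∀ i, x i * x i = 0 := fun i => by
    have h1 : x i * x i = -(x i * x i) := anticomm _ (d_fn_mem _) _ (d_fn_mem _)
    have h2 : (2 : ℂ) • (x i * x i) = 0 := by
      rw [two_smul]; nth_rewrite 1 [h1]; exact neg_add_cancel _
    exact (smul_eq_zero.mp h2).resolve_left two_ne_zero
  have hA : ∀ c : ℂ, conA (0 + c • mcM Ω u) = c • Matrix.diagonal x := by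
    intro c
    have h1 : dM (mcM Ω u) = 0 := by rw [h, dM_dM_fnM]
    have h2 : mcM Ω u * mcM Ω u = 0 := by
      rw [hη, Matrix.diagonal_mul_diagonal]
      simp only [hxx, Matrix.diagonal_zero]
    rw [zero_add, conA, curvM, map_smul, h1, smul_mul_smul_comm, h2, smul_zero, smul_zero, add_zero,
      map_zero, sub_zero, hη]
  have hB : conB (mcM Ω u) = Matrix.diagonal fun i => -(th * x i) := by
    rw [hη, conB, thM, LinearMap.mapMatrix_apply, Matrix.diagonal_map (map_zero _)]
    exact Matrix.diagonal_neg _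
  have h2 : ∀ n, chainCS 0 (mcM Ω u) (n + 2) ∈ chenSubspace (fnRange Ω) := fun n => by
    refine (isIntegral_chainCS 0 (mcM Ω u) (n + 2)).mem _ fun t => ?_
    have h3 : (t : ℂ) • Matrix.diagonal x = Matrix.diagonal fun i => DGData.d (fn ((t : ℂ) • f i)) := by
      simp only [map_smul]
      exact (Matrix.diagonal_smul _ _).symm
    rw [hA, hB, h3, insW_diagonal]
    exact Submodule.sum_mem _ fun i _ => sum_word_mem _ n _
  have h1 : chainCS 0 (mcM Ω u) 1 = W 1 (Fin.cons 1 fun _ => conB (mcM Ω u)) := by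
    refine (isIntegral_chainCS 0 (mcM Ω u) 1).unique ?_
    have h3 : ∀ X : Matrix ι ι Ω, insW 1 1 X (conB (mcM Ω u)) =
        W 1 (Fin.cons 1 fun _ => conB (mcM Ω u)) := by
      intro X
      rw [insW, mixW, Fin.sum_univ_one]
      congr 2
      funext k
      simp [word]
    simp only [h3]
    exact IsIntegral01.const _
  rw [mem_nullSubgroup, chE, esum, (entire_chainCS 0 (mcM Ω u)).summable.tsum_eq_zero_add,
    chainCS_zero, map_zero, zero_add,
    ((summable_nat_add_iff 1).mpr (entire_chainCS 0 (mcM Ω u)).summable).tsum_eq_zero_add]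
  refine Submodule.add_mem _ ?_ (chenClosure_le_bdry ?_)
  · rw [zero_add, h1, h]
    exact incl_W_one_mem f
  · have hs := ((summable_nat_add_iff 2).mpr (entire_chainCS 0 (mcM Ω u)).summable).hasSum
    refine (isClosed_chenClosure _).mem_of_tendsto hs.tendsto_sum_nat
      (Filter.Eventually.of_forall fun N => ?_)
    exact Submodule.sum_mem _ fun n _ => incl_mem_chenClosure (h2 n)

end Scalar

end Elementary

section FormsAlgebra

variable {E : Type*} [NormedAddCommGroup E] [NormedSpace ℝ E] [FiniteDimensional ℝ E]
  {H : Type*} [TopologicalSpace H] {I : ModelWithCorners ℝ E H}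
  {M : Type*} [TopologicalSpace M] [ChartedSpace H M] [IsManifold I ∞ M]

/-- The product of the components of degrees `p` and `q`, if `p + q = m`. -/
def wedgeAt (a b : Forms I M) (m p q : ℕ) : Form I M m :=
  if h : p + q = m then wedge h (a p) (b q) else 0

lemma wedge_zero_arg_left {p q m : ℕ} (h : p + q = m) (b : Form I M q) :
    wedge h (0 : Form I M p) b = 0 := by
  simpa using wedge_smul_left h 0 (0 : Form I M p) b

lemma wedge_zero_arg_right {p q m : ℕ} (h : p + q = m) (a : Form I M p) :
    wedge h a (0 : Form I M q) = 0 := by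
  simpa using wedge_smul_right h 0 a (0 : Form I M q)

lemma wedge_sum_left {p q m : ℕ} (h : p + q = m) {ι : Type*} (s : Finset ι) (a : ι → Form I M p)
    (b : Form I M q) : wedge h (∑ i ∈ s, a i) b = ∑ i ∈ s, wedge h (a i) b := by
  classical
  induction s using Finset.induction_on with
  | empty => simp [wedge_zero_arg_left]
  | insert i s hi ih => rw [Finset.sum_insert hi, Finset.sum_insert hi, wedge_add_left, ih]

lemma wedge_sum_right {p q m : ℕ} (h : p + q = m) {ι : Type*} (s : Finset ι) (a : Form I M p)
    (b : ι → Form I M q) : wedge h a (∑ i ∈ s, b i) = ∑ i ∈ s, wedge h a (b i) := by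
  classical
  induction s using Finset.induction_on with
  | empty => simp [wedge_zero_arg_right]
  | insert i s hi ih => rw [Finset.sum_insert hi, Finset.sum_insert hi, wedge_add_right, ih]

lemma wedgeF_eq_sum_antidiagonal (a b : Forms I M) (m : ℕ) :
    wedgeF a b m = ∑ x ∈ Finset.HasAntidiagonal.antidiagonal m, wedgeAt a b m x.1 x.2 := by
  rw [Finset.Nat.sum_antidiagonal_eq_sum_range_succ (fun p q => wedgeAt a b m p q), wedgeF_apply,
    Finset.sum_range]
  refine Finset.sum_congr rfl fun p _ => ?_
  rw [wedgeAt, dif_pos (Nat.add_sub_of_le (Nat.lt_succ_iff.mp p.2))]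

/-- The product of the components of degrees `p`, `q` and `r`, if `p + q + r = m`. -/
def wedgeAt₃ (a b c : Forms I M) (m p q r : ℕ) : Form I M m :=
  if h : p + q + r = m then wedge h (wedge rfl (a p) (b q)) (c r) else 0

lemma wedgeF_assoc (a b c : Forms I M) : wedgeF (wedgeF a b) c = wedgeF a (wedgeF b c) := by
  funext m
  have hl : wedgeF (wedgeF a b) c m = ∑ x ∈ Finset.HasAntidiagonal.antidiagonal m,
      ∑ y ∈ Finset.HasAntidiagonal.antidiagonal x.1, wedgeAt₃ a b c m y.1 y.2 x.2 := by
    rw [wedgeF_eq_sum_antidiagonal]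
    refine Finset.sum_congr rfl fun x hx => ?_
    obtain ⟨s, r⟩ := x
    have h := Finset.HasAntidiagonal.mem_antidiagonal.mp hx
    rw [wedgeAt, dif_pos h, wedgeF_eq_sum_antidiagonal, wedge_sum_left]
    refine Finset.sum_congr rfl fun y hy => ?_
    obtain ⟨p, q⟩ := y
    have h' := Finset.HasAntidiagonal.mem_antidiagonal.mp hy
    dsimp only at h h' ⊢
    subst h'
    rw [wedgeAt, dif_pos rfl, wedgeAt₃, dif_pos h]
  have hr : wedgeF a (wedgeF b c) m = ∑ x ∈ Finset.HasAntidiagonal.antidiagonal m,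
      ∑ y ∈ Finset.HasAntidiagonal.antidiagonal x.2, wedgeAt₃ a b c m x.1 y.1 y.2 := by
    rw [wedgeF_eq_sum_antidiagonal]
    refine Finset.sum_congr rfl fun x hx => ?_
    obtain ⟨p, t⟩ := x
    have h := Finset.HasAntidiagonal.mem_antidiagonal.mp hx
    rw [wedgeAt, dif_pos h, wedgeF_eq_sum_antidiagonal, wedge_sum_right]
    refine Finset.sum_congr rfl fun y hy => ?_
    obtain ⟨q, r⟩ := y
    have h' := Finset.HasAntidiagonal.mem_antidiagonal.mp hy
    dsimp only at h h' ⊢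
    rw [wedgeAt, dif_pos h', wedgeAt₃, dif_pos (by omega)]
    exact (wedge_assoc rfl _ h' h _ _ _).symm
  rw [hl, hr, Finset.sum_sigma', Finset.sum_sigma']
  refine Finset.sum_nbij' (fun z => ⟨(z.2.1, z.2.2 + z.1.2), (z.2.2, z.1.2)⟩)
    (fun z => ⟨(z.1.1 + z.2.1, z.2.2), (z.1.1, z.2.1)⟩) ?_ ?_ ?_ ?_ ?_
  · rintro ⟨⟨s, r⟩, ⟨p, q⟩⟩ h
    simp only [Finset.mem_sigma, Finset.HasAntidiagonal.mem_antidiagonal] at h ⊢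
    exact ⟨by omega, trivial⟩
  · rintro ⟨⟨s, r⟩, ⟨p, q⟩⟩ h
    simp only [Finset.mem_sigma, Finset.HasAntidiagonal.mem_antidiagonal] at h ⊢
    exact ⟨by omega, trivial⟩
  · rintro ⟨⟨s, r⟩, ⟨p, q⟩⟩ h
    simp only [Finset.mem_sigma, Finset.HasAntidiagonal.mem_antidiagonal] at h ⊢
    obtain ⟨h1, rfl⟩ := h
    rfl
  · rintro ⟨⟨s, r⟩, ⟨p, q⟩⟩ h
    simp only [Finset.mem_sigma, Finset.HasAntidiagonal.mem_antidiagonal] at h ⊢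
    obtain ⟨h1, rfl⟩ := h
    rfl
  · rintro ⟨⟨s, r⟩, ⟨p, q⟩⟩ _
    rfl

lemma parF_wedgeF (a b : Forms I M) : parF (wedgeF a b) = wedgeF (parF a) (parF b) := by
  funext m
  rw [parF_apply, wedgeF_apply, wedgeF_apply, Finset.smul_sum]
  refine Finset.sum_congr rfl fun p _ => ?_
  rw [parF_apply, parF_apply, wedge_smul_left, wedge_smul_right, smul_smul, ← pow_add,
    Nat.add_sub_of_le (Nat.lt_succ_iff.mp p.2)]

lemma parF_parF (a : Forms I M) : parF (parF a) = a := by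
  funext m
  rw [parF_apply, parF_apply, smul_smul, ← mul_pow]
  simp

lemma extD_smul {k : ℕ} (c : ℂ) (a : Form I M k) : extD (c • a) = c • extD a := by
  ext Y : 1
  simp only [AlternatingMap.smul_apply, extD_apply, lieD_smulC,
    ← Finset.smul_sum, smul_comm _ c, ← smul_sub]

lemma extD_zero (k : ℕ) : extD (0 : Form I M k) = 0 := by
  simpa using extD_smul (0 : ℂ) (0 : Form I M k)

lemma parF_extDF (a : Forms I M) : parF (extDF a) = -extDF (parF a) := by
  funext m
  cases m with
  | zero => exact (smul_zero _).trans neg_zero.symm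
  | succ k =>
    change (-1 : ℂ) ^ (k + 1) • extD (a k) = -extD ((-1 : ℂ) ^ k • a k)
    rw [extD_smul, pow_succ]
    module

lemma mulT_assoc (x y z : OmegaT I M) : mulT (mulT x y) z = mulT x (mulT y z) := by
  refine Prod.ext ?_ ?_
  · simp only [mulT_fst, wedgeF_assoc]
  · simp only [mulT_fst, mulT_snd, map_add, LinearMap.add_apply, wedgeF_assoc, parF_wedgeF,
      add_assoc]

lemma parT_mulT (x y : OmegaT I M) : parT (mulT x y) = mulT (parT x) (parT y) := by
  refine Prod.ext ?_ ?_
  · exact parF_wedgeF _ _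
  · change -parF (wedgeF x.2 y.1 + wedgeF (parF x.1) y.2) =
      wedgeF (-parF x.2) (parF y.1) + wedgeF (parF (parF x.1)) (-parF y.2)
    simp only [map_add, parF_wedgeF, map_neg, LinearMap.neg_apply]
    abel

lemma parT_dT (x : OmegaT I M) : parT (dT x) = -dT (parT x) := by
  refine Prod.ext ?_ ?_
  · change parF (extDF x.1 + x.2) = -(extDF (parF x.1) + -parF x.2)
    rw [map_add, parF_extDF]
    abel
  · change -parF (-extDF x.2) = -(-extDF (-parF x.2))
    rw [map_neg, parF_extDF, map_neg]

variable (I M) in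
/-- The canonical `1`-form of the circle. -/
def thetaT : OmegaT I M := (0, ofFun I M 1)

lemma thetaT_mulT (x : OmegaT I M) : mulT (thetaT I M) x = (0, x.1) := by
  refine Prod.ext ?_ ?_
  · change wedgeF 0 x.1 = 0
    rw [map_zero, LinearMap.zero_apply]
  · change wedgeF (ofFun I M 1) x.1 + wedgeF (parF 0) x.2 = x.1
    rw [wedgeF_one_left, map_zero, map_zero, LinearMap.zero_apply, add_zero]

lemma mulT_thetaT (x : OmegaT I M) : mulT x (thetaT I M) = (0, parF x.1) := by
  refine Prod.ext ?_ ?_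
  · exact map_zero (wedgeF x.1)
  · change wedgeF x.2 0 + wedgeF (parF x.1) (ofFun I M 1) = parF x.1
    rw [wedgeF_one_right, map_zero, zero_add]

lemma dT_thetaT_mulT (x : OmegaT I M) :
    dT (mulT (thetaT I M) x) = x - mulT (thetaT I M) (dT x) := by
  rw [thetaT_mulT, thetaT_mulT]
  refine Prod.ext ?_ ?_
  · change extDF 0 + x.1 = x.1 - 0
    rw [map_zero, zero_add, sub_zero]
  · change -extDF x.1 = x.2 - (extDF x.1 + x.2)
    abel

lemma parT_thetaT : parT (thetaT I M) = -thetaT I M := by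
  refine Prod.ext ?_ ?_
  · change parF 0 = -0
    rw [map_zero, neg_zero]
  · change -parF (ofFun I M 1) = -ofFun I M 1
    rw [parF_ofFun]

/-! #### Homogeneous forms -/

/-- A form of degree `k` as an invariant form on `M × 𝕋`. -/
def homT (k : ℕ) : Form I M k →ₗ[ℂ] OmegaT I M :=
  LinearMap.inl ℂ _ _ ∘ₗ LinearMap.single ℂ (fun k => Form I M k) k

lemma dT_homT {k : ℕ} (a : Form I M k) : dT (homT k a) = homT (k + 1) (extD a) := by
  refine Prod.ext ?_ ?_
  · change extDF (Pi.single k a) + 0 = Pi.single (k + 1) (extD a)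
    rw [add_zero]
    funext m
    cases m with
    | zero => exact (Pi.single_eq_of_ne (by omega) _).symm
    | succ n =>
      change extD (Pi.single (M := fun k => Form I M k) k a n) = _
      rcases eq_or_ne n k with rfl | h
      · rw [Pi.single_eq_same, Pi.single_eq_same]
      · rw [Pi.single_eq_of_ne h, Pi.single_eq_of_ne (by omega), extD_zero]
  · change -extDF 0 = 0
    rw [map_zero, neg_zero]

lemma parT_homT {k : ℕ} (a : Form I M k) : parT (homT k a) = (-1 : ℂ) ^ k • homT k a := by
  refine Prod.ext ?_ ?_
  · funext m
    change (-1 : ℂ) ^ m • Pi.single (M := fun k => Form I M k) k a m =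
      (-1 : ℂ) ^ k • Pi.single (M := fun k => Form I M k) k a m
    rcases eq_or_ne m k with rfl | h
    · rfl
    · rw [Pi.single_eq_of_ne h, smul_zero, smul_zero]
  · change -parF 0 = (-1 : ℂ) ^ k • 0
    rw [map_zero, neg_zero, smul_zero]

lemma homT_mulT {p q m : ℕ} (h : p + q = m) (a : Form I M p) (b : Form I M q) :
    mulT (homT p a) (homT q b) = homT m (wedge h a b) := by
  refine Prod.ext ?_ ?_
  · change wedgeF (Pi.single p a) (Pi.single q b) = Pi.single m (wedge h a b)
    funext n
    rw [wedgeF_eq_sum_antidiagonal]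
    have hz : ∀ x : ℕ × ℕ, x ≠ (p, q) → wedgeAt (Pi.single p a) (Pi.single q b) n x.1 x.2 = 0 := by
      rintro ⟨p', q'⟩ hx
      rw [wedgeAt]
      split_ifs with h'
      · by_cases hp : p' = p
        · have hq : q' ≠ q := fun e => hx (by rw [hp, e])
          rw [Pi.single_eq_of_ne hq, wedge_zero_arg_right]
        · rw [Pi.single_eq_of_ne hp, wedge_zero_arg_left]
      · rfl
    subst h
    rcases eq_or_ne n (p + q) with rfl | hn
    · rw [Finset.sum_eq_single (p, q) (fun x _ hx => hz x hx)
        (fun hx => absurd (Finset.HasAntidiagonal.mem_antidiagonal.mpr rfl) hx), wedgeAt, dif_pos rfl,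
        Pi.single_eq_same, Pi.single_eq_same, Pi.single_eq_same]
    · rw [Pi.single_eq_of_ne hn]
      refine Finset.sum_eq_zero fun x hx => hz x ?_
      rintro rfl
      exact hn (Finset.HasAntidiagonal.mem_antidiagonal.mp hx).symm
  · change wedgeF 0 _ + wedgeF _ 0 = 0
    rw [map_zero, map_zero, LinearMap.zero_apply, add_zero]

/-- A function as a form of degree zero. -/
abbrev fun0 (f : CFun I M) : Form I M 0 :=
  AlternatingMap.constOfIsEmpty (RFun I M) (VField I M) (Fin 0) f

lemma funT_eq_homT (f : CFun I M) : funT I M f = homT 0 (fun0 f) := rfl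

/-- The product of a function and a form. -/
abbrev fmul {k : ℕ} (f : CFun I M) (a : Form I M k) : Form I M k := wedge (zero_add k) (fun0 f) a

lemma fmul_apply {k : ℕ} (f : CFun I M) (a : Form I M k) (Y : Fin k → VField I M) :
    fmul f a Y = f * a Y := wedge_zero_left _ _ _ _

lemma funT_mulT_homT {k : ℕ} (f : CFun I M) (a : Form I M k) :
    mulT (funT I M f) (homT k a) = homT k (fmul f a) := homT_mulT _ _ _

lemma extD_fun0_apply (f : CFun I M) (Y : Fin 1 → VField I M) :
    extD (fun0 f) Y = lieD (Y 0) f := extD_zero_form _ _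

lemma extD_extD_fun0 (f : CFun I M) : extD (extD (fun0 f)) = 0 := by
  ext Y : 1
  rw [extD_one_form]
  simp only [extD_fun0_apply, Matrix.cons_val_zero, lieD_bracket]
  rw [AlternatingMap.zero_apply]
  module

lemma extD_fmul (f : CFun I M) (a : Form I M 1) :
    extD (fmul f a) = wedge (m := 2) rfl (extD (fun0 f)) a + fmul f (extD a) := by
  ext Y : 1
  rw [AlternatingMap.add_apply, wedge_one_one]
  simp only [fmul_apply, extD_one_form, extD_fun0_apply, lieD_mul, Matrix.cons_val_zero]
  ext x
  simp
  ring

lemma fmul_fmul {k : ℕ} (f g : CFun I M) (a : Form I M k) : fmul f (fmul g a) = fmul (f * g) a := by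
  ext Y : 1
  simp only [fmul_apply, mul_assoc]

lemma fmul_one {k : ℕ} (a : Form I M k) : fmul 1 a = a := by
  ext Y : 1
  rw [fmul_apply, one_mul]

variable (I M) in
/-- The `1`-forms `α` for which `f α` is annihilated by `d ∘ d` for all functions `f`. -/
def exactness : Submodule ℂ (Form I M 1) where
  carrier := {a | ∀ f : CFun I M, extD (extD (fmul f a)) = 0}
  zero_mem' := fun f => by
    rw [fmul, wedge_zero_arg_right, extD_zero, extD_zero]
  add_mem' := by
    intro a b ha hb f
    have h : ∀ (k : ℕ) (x y : Form I M k), extD (x + y) = extD x + extD y := by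
      intro k x y
      ext Y : 1
      simp only [AlternatingMap.add_apply, extD_apply, map_add, Finset.sum_add_distrib, smul_sub,
        smul_add, Finset.sum_sub_distrib]
      abel
    rw [fmul, wedge_add_right, h, h, ha f, hb f, add_zero]
  smul_mem' := by
    intro c a ha f
    rw [fmul, wedge_smul_right, extD_smul, extD_smul, ha f, smul_zero]

lemma extD_fun0_mem (f : CFun I M) : extD (fun0 f) ∈ exactness I M := by
  intro g
  have h0 : fmul g (extD (extD (fun0 f))) = 0 := by
    rw [extD_extD_fun0, fmul, wedge_zero_arg_right]
  rw [extD_fmul, h0, add_zero, extD_wedge_one_one, extD_extD_fun0, extD_extD_fun0,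
    wedge_zero_arg_left, wedge_zero_arg_right, sub_zero]

lemma funT_comm (f : CFun I M) (x : OmegaT I M) : mulT (funT I M f) x = mulT x (funT I M f) := by
  refine Prod.ext ?_ ?_
  · rw [mulT_fst, mulT_fst, funT_fst]
    funext m; ext Y : 1
    rw [wedgeF_ofFun_left, wedgeF_ofFun_right, mul_comm]
  · rw [mulT_snd, mulT_snd, funT_fst, funT_snd, map_zero, map_zero, LinearMap.zero_apply, zero_add,
      add_zero, parF_ofFun]
    funext m; ext Y : 1
    rw [wedgeF_ofFun_left, wedgeF_ofFun_right, mul_comm]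

instance : FormDG (CFun I M) (OmegaT I M) where
  mul_assoc := mulT_assoc
  fn := funT I M
  th := thetaT I M
  oneForms := (exactness I M).map (homT 1)
  fn_one := rfl
  fn_mul f g := by
    change funT I M (f * g) = mulT (funT I M f) (funT I M g)
    rw [funT_eq_homT g, funT_mulT_homT, funT_eq_homT]
    congr 1
    ext Y : 1
    rw [fmul_apply]
    rfl
  fn_comm := funT_comm
  par_mul := parT_mulT
  par_fn := parT_funT
  par_d := parT_dT
  par_th := parT_thetaT
  th_th := (thetaT_mulT _)
  th_comm x := by
    change mulT (thetaT I M) x = mulT (parT x) (thetaT I M)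
    rw [thetaT_mulT, mulT_thetaT]
    exact Prod.ext rfl (parF_parF _).symm
  d_th := dT_thetaT_mulT
  par_oneForm := by
    rintro _ ⟨a, -, rfl⟩
    refine (parT_homT a).trans ?_
    module
  fn_mul_oneForm := by
    rintro f _ ⟨a, ha, rfl⟩
    refine ⟨fmul f a, fun g => ?_, (funT_mulT_homT f a).symm⟩
    rw [fmul_fmul]
    exact ha _
  d_fn_mem f := ⟨extD (fun0 f), extD_fun0_mem f, (dT_homT _).symm⟩
  anticomm := by
    rintro _ ⟨a, -, rfl⟩ _ ⟨b, -, rfl⟩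
    change mulT _ _ = -mulT _ _
    rw [homT_mulT (m := 2) rfl, homT_mulT (m := 2) rfl, ← map_neg]
    congr 1
    ext Y : 1
    rw [AlternatingMap.neg_apply, wedge_one_one, wedge_one_one]
    ring
  d_fn_fn f g := by
    change dT _ = mulT (dT _) _ + mulT _ (dT _)
    rw [← funT_comm, funT_eq_homT (f * g), funT_eq_homT f, funT_eq_homT g, dT_homT, dT_homT,
      dT_homT, ← funT_eq_homT f, ← funT_eq_homT g, funT_mulT_homT, funT_mulT_homT, ← map_add]
    congr 1
    ext Y : 1
    rw [AlternatingMap.add_apply]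
    simp only [fmul_apply, extD_fun0_apply, lieD_mul]
    ring
  d_fn_form := by
    rintro f _ ⟨a, -, rfl⟩
    change dT (mulT _ _) = mulT (dT _) _ + mulT _ (dT _)
    rw [funT_mulT_homT, dT_homT, dT_homT, funT_mulT_homT, funT_eq_homT, dT_homT,
      homT_mulT (m := 2) rfl, extD_fmul, map_add]
  d_form_form := by
    rintro _ ⟨a, -, rfl⟩ _ ⟨b, -, rfl⟩
    change dT (mulT _ _) = mulT (dT _) _ - mulT _ (dT _)
    rw [homT_mulT (m := 2) rfl, dT_homT, dT_homT, dT_homT, homT_mulT (m := 3) rfl,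
      homT_mulT (m := 3) rfl, extD_wedge_one_one, map_sub]
  d_d_fn f := by
    change dT (dT (homT 0 (fun0 f))) = 0
    rw [dT_homT, dT_homT, extD_extD_fun0, map_zero]
  d_d_form := by
    rintro _ ⟨a, ha, rfl⟩
    change dT (dT (homT 1 a)) = 0
    rw [dT_homT, dT_homT]
    have h := ha 1
    rw [fmul_one] at h
    rw [h, map_zero]

end FormsAlgebra

section Elimination

variable {E : Type*} [NormedAddCommGroup E] [NormedSpace ℝ E] [FiniteDimensional ℝ E]
  {H : Type*} [TopologicalSpace H] {I : ModelWithCorners ℝ E H}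
  {M : Type*} [TopologicalSpace M] [ChartedSpace H M] [IsManifold I ∞ M] [CompactSpace M]
  {ι : Type} [Fintype ι] [DecidableEq ι]

attribute [local instance] dgRing dgAlgebra

/-- The composition of a smooth function with a function which is smooth on its range. -/
def compC (φ : ℂ → ℂ) (f : CFun I M) (h : ∀ x, ContDiffAt ℝ ∞ φ (f x)) : CFun I M :=
  ⟨fun x => φ (f x), fun x => (h x).comp_contMDiffAt (f.contMDiff x)⟩

lemma lieD_compC (φ : ℂ → ℂ) (f : CFun I M) (h : ∀ x, ContDiffAt ℝ ∞ φ (f x)) (X : VField I M)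
    (x : M) {φ' : ℂ} (hφ : HasDerivAt φ φ' (f x)) :
    lieD X (compC φ f h) x = φ' * lieD X f x := by
  have hf : MDifferentiableAt I 𝓘(ℝ, ℂ) f x := f.contMDiff.mdifferentiable (by simp) x
  have h1 := ((hφ.hasFDerivAt.restrictScalars ℝ).hasMFDerivAt.comp x hf.hasMFDerivAt).mfderiv
  refine (congrArg (fun L => L (X x)) h1).trans ?_
  exact mul_comm (lieD X f x) φ'

/-- A matrix of functions which is close to the identity matrix. -/
def NearOne (h : Matrix ι ι (CFun I M)) : Prop :=
  ∀ x i, ∑ j, ‖h i j x - (1 : Matrix ι ι ℂ) i j‖ < 1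

lemma NearOne.diag {h : Matrix ι ι (CFun I M)} (hh : NearOne h) (x : M) (i : ι) :
    ‖h i i x - 1‖ < 1 := by
  refine lt_of_le_of_lt ?_ (hh x i)
  have := Finset.single_le_sum (f := fun j => ‖h i j x - (1 : Matrix ι ι ℂ) i j‖)
    (fun j _ => norm_nonneg _) (Finset.mem_univ i)
  simpa using this

lemma mem_slitPlane_of_norm_sub_one_lt {z : ℂ} (hz : ‖z - 1‖ < 1) : z ∈ Complex.slitPlane := by
  refine Or.inl ?_
  have h := (abs_lt.mp ((Complex.abs_re_le_norm _).trans_lt hz)).1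
  simp at h
  exact h

lemma NearOne.diag_mem_slitPlane {h : Matrix ι ι (CFun I M)} (hh : NearOne h) (x : M) (i : ι) :
    h i i x ∈ Complex.slitPlane := mem_slitPlane_of_norm_sub_one_lt (hh.diag x i)

lemma NearOne.exists_inv {h : Matrix ι ι (CFun I M)} (hh : NearOne h) (i : ι) :
    ∃ q : CFun I M, q * h i i = 1 := by
  have h0 : ∀ x, h i i x ≠ 0 := fun x => Complex.slitPlane_ne_zero (hh.diag_mem_slitPlane x i)
  refine ⟨compC Inv.inv (h i i) fun x => contDiffAt_inv ℝ (h0 x), ?_⟩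
  ext x
  exact inv_mul_cancel₀ (h0 x)

lemma NearOne.mem_nullSubgroup_of_diagonal (u : (Matrix ι ι (CFun I M))ˣ) (hu : NearOne u.1)
    (h : ∀ i j, i ≠ j → u.1 i j = 0) : u ∈ nullSubgroup (OmegaT I M) ι := by
  have hs : ∀ i x, u.1 i i x ∈ Complex.slitPlane := fun i x => hu.diag_mem_slitPlane x i
  have hc : ∀ i x, ContDiffAt ℝ ∞ Complex.log (u.1 i i x) := fun i x =>
    (Complex.contDiffAt_log (hs i x)).restrict_scalars ℝ
  have hd : u.1 = Matrix.diagonal fun i => u.1 i i := by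
    ext1 i j
    rcases eq_or_ne i j with rfl | hij
    · rw [Matrix.diagonal_apply_eq]
    · rw [Matrix.diagonal_apply_ne _ hij, h i j hij]
  choose q hq using fun i => hu.exists_inv i
  have hi : u⁻¹.1 = Matrix.diagonal q := by
    have h1 : Matrix.diagonal q * u.1 = 1 := by
      rw [hd, Matrix.diagonal_mul_diagonal]
      simp only [hq]
      exact Matrix.diagonal_one
    calc u⁻¹.1 = (Matrix.diagonal q * u.1) * u⁻¹.1 := by rw [h1, one_mul]
      _ = Matrix.diagonal q := by rw [mul_assoc, ← Units.val_mul, mul_inv_cancel, Units.val_one,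
        mul_one]
  refine OddChern.mem_nullSubgroup_of_diagonal u (fun i => compC Complex.log (u.1 i i) (hc i)) ?_
  rw [mcM, hi, congrArg (fnM (OmegaT I M)) hd, fnM, fnM, fnM, Matrix.diagonal_map (map_zero _), Matrix.diagonal_map (map_zero _),
    Matrix.diagonal_map (map_zero _), dM, LinearMap.mapMatrix_apply, LinearMap.mapMatrix_apply,
    Matrix.diagonal_map (map_zero _), Matrix.diagonal_map (map_zero _),
    Matrix.diagonal_mul_diagonal]
  congr 1
  funext i
  change mulT (funT I M (q i)) (dT (funT I M (u.1 i i))) =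
    dT (funT I M (compC Complex.log (u.1 i i) (hc i)))
  rw [funT_eq_homT (u.1 i i), dT_homT, funT_mulT_homT, funT_eq_homT, dT_homT]
  congr 1
  ext Y x
  rw [fmul_apply, extD_fun0_apply, extD_fun0_apply,
    lieD_compC _ _ _ _ _ (Complex.hasDerivAt_log (hs i x))]
  have h1 : q i x * u.1 i i x = 1 := congrArg (fun f : CFun I M => f x) (hq i)
  rw [← eq_inv_of_mul_eq_one_left h1]
  rfl

/-- The unit `1 + X` for `X² = 0`. -/
def sqZeroUnit {R : Type*} [Ring R] (X : R) (h : X * X = 0) : Rˣ where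
  val := 1 + X
  inv := 1 - X
  val_inv := by rw [add_mul, mul_sub, mul_sub, h]; simp
  inv_val := by rw [sub_mul, mul_add, mul_add, h]; simp

lemma sum_schur_lt {ι : Type*} [Fintype ι] [DecidableEq ι] {a : Matrix ι ι ℂ}
    (ha : ∀ i, ∑ j, ‖a i j - (1 : Matrix ι ι ℂ) i j‖ < 1) (p : ι) {q : ℂ} (hq : q * a p p = 1)
    {i : ι} (hi : i ≠ p) :
    ∑ j ∈ Finset.univ.erase p, ‖a i j - a i p * q * a p j - (1 : Matrix ι ι ℂ) i j‖ < 1 := by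
  have h1 : ‖a i p‖ + ∑ j ∈ Finset.univ.erase p, ‖a i j - (1 : Matrix ι ι ℂ) i j‖ < 1 := by
    have := ha i
    rw [← Finset.add_sum_erase _ _ (Finset.mem_univ p), Matrix.one_apply_ne hi, sub_zero] at this
    exact this
  have h2 : ‖a p p - 1‖ + ∑ j ∈ Finset.univ.erase p, ‖a p j‖ < 1 := by
    have := ha p
    rw [← Finset.add_sum_erase _ _ (Finset.mem_univ p), Matrix.one_apply_eq] at this
    refine lt_of_le_of_lt (le_of_eq ?_) this
    congr 1
    refine Finset.sum_congr rfl fun j hj => ?_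
    rw [Matrix.one_apply_ne (Finset.ne_of_mem_erase hj).symm, sub_zero]
  have h3 : 1 - ‖a p p - 1‖ ≤ ‖a p p‖ := by
    have := norm_sub_norm_le (1 : ℂ) (1 - a p p)
    rw [sub_sub_cancel, norm_one, norm_sub_rev] at this
    exact this
  have h4 : ‖q‖ * ∑ j ∈ Finset.univ.erase p, ‖a p j‖ ≤ 1 := by
    have h5 : ‖q‖ * ‖a p p‖ = 1 := by rw [← norm_mul, hq, norm_one]
    calc ‖q‖ * ∑ j ∈ Finset.univ.erase p, ‖a p j‖ ≤ ‖q‖ * ‖a p p‖ :=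
          mul_le_mul_of_nonneg_left (by linarith) (norm_nonneg _)
      _ = 1 := h5
  calc ∑ j ∈ Finset.univ.erase p, ‖a i j - a i p * q * a p j - (1 : Matrix ι ι ℂ) i j‖
      ≤ ∑ j ∈ Finset.univ.erase p,
          (‖a i j - (1 : Matrix ι ι ℂ) i j‖ + ‖a i p‖ * (‖q‖ * ‖a p j‖)) := by
        refine Finset.sum_le_sum fun j _ => ?_
        rw [← norm_mul, ← norm_mul, sub_right_comm, ← mul_assoc]
        exact norm_sub_le _ _
    _ = ∑ j ∈ Finset.univ.erase p, ‖a i j - (1 : Matrix ι ι ℂ) i j‖ +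
          ‖a i p‖ * (‖q‖ * ∑ j ∈ Finset.univ.erase p, ‖a p j‖) := by
        rw [Finset.sum_add_distrib, Finset.mul_sum, Finset.mul_sum]
    _ ≤ ∑ j ∈ Finset.univ.erase p, ‖a i j - (1 : Matrix ι ι ℂ) i j‖ + ‖a i p‖ * 1 := by
        gcongr
    _ < 1 := by linarith

/-- Gaussian elimination. -/
theorem NearOne.mem_nullSubgroup (u : (Matrix ι ι (CFun I M))ˣ) (hu : NearOne u.1) :
    u ∈ nullSubgroup (OmegaT I M) ι := by
  suffices H : ∀ (s : Finset ι) (u : (Matrix ι ι (CFun I M))ˣ), NearOne u.1 →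
      (∀ i j, i ≠ j → (i ∉ s ∨ j ∉ s) → u.1 i j = 0) → u ∈ nullSubgroup (OmegaT I M) ι from
    H Finset.univ u hu fun i j _ h => by simp at h
  intro s
  induction s using Finset.induction_on with
  | empty =>
    intro u hu h
    exact hu.mem_nullSubgroup_of_diagonal u fun i j hij => h i j hij (Or.inl (by simp))
  | insert p s hp ih =>
    intro u hu h
    obtain ⟨q, hq⟩ := hu.exists_inv p
    set a := u.1 with ha
    let V : Matrix ι ι (CFun I M) := fun i j => if i ≠ p ∧ j = p then -(a i p * q) else 0
    let Z : Matrix ι ι (CFun I M) := fun i j => if i = p ∧ j ≠ p then -(q * a p j) else 0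
    have hV : IsOff {p}ᶜ V := fun i j hij => if_neg fun h => hij (by simpa using h)
    have hZ : IsOff {p} Z := fun i j hij => if_neg fun h => hij (by simpa using h)
    let v := sqZeroUnit V (hV.mul hV)
    let z := sqZeroUnit Z (hZ.mul hZ)
    have hv : v ∈ nullSubgroup (OmegaT I M) ι := IsOff.mem_nullSubgroup (P := {p}ᶜ) v (by
      rw [show v.1 - 1 = V from add_sub_cancel_left _ _]; exact hV)
    have hz : z ∈ nullSubgroup (OmegaT I M) ι := IsOff.mem_nullSubgroup (P := {p}) z (by
      rw [show z.1 - 1 = Z from add_sub_cancel_left _ _]; exact hZ)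
    have hVa : ∀ (b : Matrix ι ι (CFun I M)) i j, (V * b) i j = V i p * b p j := fun b i j =>
      Finset.sum_eq_single p (fun k _ hk => by
        change V i k * b k j = 0
        rw [show V i k = 0 from if_neg fun h => hk h.2, zero_mul]) (by simp)
    have haZ : ∀ (b : Matrix ι ι (CFun I M)) i j, (b * Z) i j = b i p * Z p j := fun b i j =>
      Finset.sum_eq_single p (fun k _ hk => by
        change b i k * Z k j = 0
        rw [show Z k j = 0 from if_neg fun h => hk h.1, mul_zero]) (by simp)
    have hVp : V p p = 0 := if_neg fun h => h.1 rfl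
    have hZp : Z p p = 0 := if_neg fun h => h.2 rfl
    have hVi : ∀ i, i ≠ p → V i p = -(a i p * q) := fun i hi => if_pos ⟨hi, rfl⟩
    have hZj : ∀ j, j ≠ p → Z p j = -(q * a p j) := fun j hj => if_pos ⟨rfl, hj⟩
    have hq' : a p p * q = 1 := by rw [mul_comm, hq]
    set w := v * u * z with hw
    have hwv : w.1 = (1 + V) * a * (1 + Z) := rfl
    have hwij : ∀ i j, w.1 i j = a i j + V i p * a p j + (a i p + V i p * a p p) * Z p j := by
      intro i j
      rw [hwv, mul_add, mul_one, Matrix.add_apply, haZ, add_mul, one_mul, Matrix.add_apply,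
        Matrix.add_apply, hVa, hVa]
    have hcol : ∀ i, i ≠ p → a i p + V i p * a p p = 0 := by
      intro i hi
      rw [hVi i hi, neg_mul, mul_assoc, hq, mul_one, add_neg_cancel]
    have hpp : w.1 p p = a p p := by
      rw [hwij, hVp, hZp]; ring
    have hpj : ∀ j, j ≠ p → w.1 p j = 0 := by
      intro j hj
      rw [hwij, hVp, hZj j hj]
      linear_combination (-a p j) * hq
    have hip : ∀ i, i ≠ p → w.1 i p = 0 := by
      intro i hi
      rw [hwij, hcol i hi, zero_mul, add_zero]
    have hij : ∀ i j, i ≠ p → w.1 i j = a i j - a i p * q * a p j := by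
      intro i j hi
      rw [hwij, hcol i hi, zero_mul, add_zero, hVi i hi]
      ring
    have hwN : w ∈ nullSubgroup (OmegaT I M) ι := by
      refine ih w ?_ ?_
      · intro x i
        rw [← Finset.add_sum_erase _ _ (Finset.mem_univ p)]
        rcases eq_or_ne i p with rfl | hi
        · rw [Finset.sum_eq_zero, add_zero, hpp, Matrix.one_apply_eq]
          · exact hu.diag x i
          · intro j hj
            have hj := Finset.ne_of_mem_erase hj
            rw [hpj j hj, Matrix.one_apply_ne hj.symm]
            simp
        · rw [hip i hi, Matrix.one_apply_ne hi]
          have h1 := sum_schur_lt (a := fun i j => a i j x) (hu x) p (q := q x)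
            (congrArg (fun f : CFun I M => f x) hq) hi
          have h2 : ‖(0 : CFun I M) x - 0‖ = 0 := by simp
          rw [h2, zero_add]
          refine lt_of_le_of_lt (le_of_eq ?_) h1
          refine Finset.sum_congr rfl fun j _ => ?_
          rw [hij i j hi]
          rfl
      · intro i j hne hs
        rcases eq_or_ne i p with rfl | hi
        · exact hpj j hne.symm
        rcases eq_or_ne j p with rfl | hj
        · exact hip i hi
        rw [hij i j hi]
        rcases hs with hs | hs
        · rw [h i j hne (Or.inl (by simp [hi, hs])), h i p hi (Or.inl (by simp [hi, hs]))]
          simp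
        · rw [h i j hne (Or.inr (by simp [hj, hs])), h p j hj.symm (Or.inr (by simp [hj, hs]))]
          simp
    have hfin : u = v⁻¹ * w * z⁻¹ := by rw [hw]; group
    rw [hfin]
    exact mul_mem (mul_mem (inv_mem hv) hwN) (inv_mem hz)

end Elimination

section BlockDiagonal

variable {ι κ τ : Type} [Fintype ι] [DecidableEq ι] [Fintype κ] [DecidableEq κ] [Fintype τ]
  [DecidableEq τ]

/-- Block diagonal matrices. -/
def blockDiag {R : Type*} [Zero R] (e : ι ⊕ κ ≃ τ) (X : Matrix ι ι R) (Y : Matrix κ κ R) :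
    Matrix τ τ R := (Matrix.fromBlocks X 0 0 Y).reindex e e

section

variable (e : ι ⊕ κ ≃ τ)

lemma blockDiag_map {R R' : Type*} [Zero R] [Zero R'] (f : R → R') (hf : f 0 = 0) (X : Matrix ι ι R)
    (Y : Matrix κ κ R) : (blockDiag e X Y).map f = blockDiag e (X.map f) (Y.map f) := by
  have h0 : ∀ {α β : Type}, (0 : Matrix α β R).map f = 0 := by
    intro α β
    ext i j
    exact hf
  rw [blockDiag, blockDiag, Matrix.reindex_apply, Matrix.reindex_apply, ← Matrix.submatrix_map,
    Matrix.fromBlocks_map, h0, h0]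

variable {R : Type*} [Ring R]

lemma blockDiag_mul (X X' : Matrix ι ι R) (Y Y' : Matrix κ κ R) :
    blockDiag e X Y * blockDiag e X' Y' = blockDiag e (X * X') (Y * Y') := by
  simp only [blockDiag, Matrix.reindex_apply, Matrix.submatrix_mul_equiv, Matrix.fromBlocks_multiply,
    Matrix.mul_zero, Matrix.zero_mul, add_zero, zero_add]

lemma blockDiag_one : blockDiag e (1 : Matrix ι ι R) (1 : Matrix κ κ R) = 1 := by
  simp only [blockDiag, Matrix.reindex_apply, Matrix.fromBlocks_one, Matrix.submatrix_one_equiv]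

lemma blockDiag_pow (X : Matrix ι ι R) (Y : Matrix κ κ R) (n : ℕ) :
    blockDiag e X Y ^ n = blockDiag e (X ^ n) (Y ^ n) := by
  induction n with
  | zero => simp only [pow_zero, blockDiag_one]
  | succ n ih => simp only [pow_succ, ih, blockDiag_mul]

lemma blockDiag_add (X X' : Matrix ι ι R) (Y Y' : Matrix κ κ R) :
    blockDiag e X Y + blockDiag e X' Y' = blockDiag e (X + X') (Y + Y') := by
  ext a b
  obtain ⟨a, rfl⟩ := e.surjective a
  obtain ⟨b, rfl⟩ := e.surjective b
  rcases a with a | a <;> rcases b with b | b <;> simp [blockDiag]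

lemma blockDiag_neg (X : Matrix ι ι R) (Y : Matrix κ κ R) :
    -blockDiag e X Y = blockDiag e (-X) (-Y) := (blockDiag_map e (fun x => -x) neg_zero X Y)

end

variable {𝔽 : Type*} [CommRing 𝔽] [Algebra ℂ 𝔽] {Ω : Type*} [AddCommGroup Ω] [Module ℂ Ω]
  [TopologicalSpace Ω] [DGData Ω] [PolynormableSpace ℂ Ω] [FormDG 𝔽 Ω] (e : ι ⊕ κ ≃ τ)

attribute [local instance] dgRing dgAlgebra

open FormDG

lemma pair_one_blockDiag (P : Matrix ι ι (Tw Ω)) (Q : Matrix κ κ (Tw Ω)) :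
    pair 1 (blockDiag e P Q) = pair 1 P + pair 1 Q := by
  rw [pair_one, pair_one, pair_one, ← e.sum_comp, Fintype.sum_sum_type]
  simp [blockDiag]

lemma insW_blockDiag (n : ℕ) (X X' : Matrix ι ι Ω) (Y Y' : Matrix κ κ Ω) :
    insW n 1 (blockDiag e X Y) (blockDiag e X' Y') = insW n 1 X X' + insW n 1 Y Y' := by
  simp only [insW, mixW, W_word]
  rw [← Finset.sum_add_distrib]
  refine Finset.sum_congr rfl fun m _ => ?_
  rw [tw, tw, blockDiag_map e _ (map_zero _), blockDiag_map e _ (map_zero _), blockDiag_pow,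
    blockDiag_pow, blockDiag_mul, blockDiag_mul, pair_one_blockDiag]
  rfl

lemma conA_blockDiag (α : Matrix ι ι Ω) (β : Matrix κ κ Ω) :
    conA (blockDiag e α β) = blockDiag e (conA α) (conA β) := by
  simp only [conA, curvM, sub_eq_add_neg]
  rw [dM, LinearMap.mapMatrix_apply, blockDiag_map e _ (map_zero _), blockDiag_mul, blockDiag_add,
    thM, LinearMap.mapMatrix_apply, blockDiag_map e _ (map_zero _), blockDiag_neg, blockDiag_add]
  rfl

lemma conB_blockDiag (α : Matrix ι ι Ω) (β : Matrix κ κ Ω) :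
    conB (blockDiag e α β) = blockDiag e (conB α) (conB β) := by
  simp only [conB]
  rw [thM, LinearMap.mapMatrix_apply, blockDiag_map e _ (map_zero _), blockDiag_neg]
  rfl

lemma chainCS_blockDiag (α : Matrix ι ι Ω) (β : Matrix κ κ Ω) (n : ℕ) :
    chainCS 0 (blockDiag e α β) n = chainCS 0 α n + chainCS 0 β n := by
  refine (isIntegral_chainCS _ _ n).unique ?_
  have h := (isIntegral_chainCS 0 α n).add (isIntegral_chainCS 0 β n)
  refine (congrArg (IsIntegral01 · _) ?_).mp h
  funext t
  have ht : (t : ℂ) • blockDiag e α β = blockDiag e ((t : ℂ) • α) ((t : ℂ) • β) :=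
    blockDiag_map e (fun x => (t : ℂ) • x) (smul_zero _) α β
  rw [zero_add, zero_add, zero_add, ht, conA_blockDiag, conB_blockDiag, insW_blockDiag]

lemma mcM_blockDiag (g : (Matrix ι ι 𝔽)ˣ) (h : (Matrix κ κ 𝔽)ˣ) (u : (Matrix τ τ 𝔽)ˣ)
    (hu : u.1 = blockDiag e g.1 h.1) : mcM Ω u = blockDiag e (mcM Ω g) (mcM Ω h) := by
  have hi : u⁻¹.1 = blockDiag e g⁻¹.1 h⁻¹.1 := by
    have h1 : blockDiag e g⁻¹.1 h⁻¹.1 * u.1 = 1 := by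
      rw [hu, blockDiag_mul, ← Units.val_mul, ← Units.val_mul, inv_mul_cancel, inv_mul_cancel,
        Units.val_one, Units.val_one, blockDiag_one]
    calc u⁻¹.1 = (blockDiag e g⁻¹.1 h⁻¹.1 * u.1) * u⁻¹.1 := by rw [h1, one_mul]
      _ = blockDiag e g⁻¹.1 h⁻¹.1 := by rw [mul_assoc, ← Units.val_mul, mul_inv_cancel,
        Units.val_one, mul_one]
  rw [mcM, hi, hu, fnM, fnM, dM, LinearMap.mapMatrix_apply, blockDiag_map e _ (map_zero _),
    blockDiag_map e _ (map_zero _), blockDiag_map e _ (map_zero _), blockDiag_mul]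
  rfl

lemma chE_blockDiag (g : (Matrix ι ι 𝔽)ˣ) (h : (Matrix κ κ 𝔽)ˣ)
    (u : (Matrix τ τ 𝔽)ˣ) (hu : u.1 = blockDiag e g.1 h.1) : chE Ω u = chE Ω g + chE Ω h := by
  rw [chE, chE, chE, ← esum_add (entire_chainCS _ _) (entire_chainCS _ _), mcM_blockDiag e g h u hu]
  congr 1
  funext n
  exact chainCS_blockDiag e _ _ n

end BlockDiagonal

section Unitary

variable {E : Type*} [NormedAddCommGroup E] [NormedSpace ℝ E] [FiniteDimensional ℝ E]
  {H : Type*} [TopologicalSpace H] {I : ModelWithCorners ℝ E H}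
  {M : Type*} [TopologicalSpace M] [ChartedSpace H M]

lemma sum_cfun_apply {ι : Type*} (s : Finset ι) (f : ι → CFun I M) (x : M) :
    (∑ k ∈ s, f k) x = ∑ k ∈ s, f k x := map_sum (ContMDiffMap.evalRingHom x) f s

lemma SmoothU.entry_mul {l : ℕ} (g : SmoothU I M l) :
    g.entry * (Matrix.of fun i j => conjC (g.entry j i)) = 1 := by
  ext i j x
  have h := congrArg (fun A : Matrix (Fin l) (Fin l) ℂ => A i j)
    (Matrix.mem_unitaryGroup_iff.mp (g.unitary x))
  have h1 : (∑ k, g.entry i k * conjC (g.entry j k)) x =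
      ∑ k, g.entry i k x * (starRingEnd ℂ) (g.entry j k x) := sum_cfun_apply _ _ x
  have h2 : (1 : Matrix (Fin l) (Fin l) (CFun I M)) i j x = (1 : Matrix (Fin l) (Fin l) ℂ) i j := by
    rcases eq_or_ne i j with rfl | hij
    · rw [Matrix.one_apply_eq, Matrix.one_apply_eq]; rfl
    · rw [Matrix.one_apply_ne hij, Matrix.one_apply_ne hij]; rfl
  rw [h2]
  exact h1.trans h

/-- A unitary matrix of functions as an invertible matrix of functions. -/
def SmoothU.unit {l : ℕ} (g : SmoothU I M l) : (Matrix (Fin l) (Fin l) (CFun I M))ˣ where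
  val := g.entry
  inv := Matrix.of fun i j => conjC (g.entry j i)
  val_inv := g.entry_mul
  inv_val := mul_eq_one_comm.mp g.entry_mul

lemma SmoothU.ext_of_eval {l : ℕ} {g h : SmoothU I M l} (e : ∀ x, g.eval x = h.eval x) : g = h := by
  obtain ⟨a, _⟩ := g
  obtain ⟨b, _⟩ := h
  obtain rfl : a = b := by
    ext i j x
    exact congrArg (fun A : Matrix (Fin l) (Fin l) ℂ => A i j) (e x)
  rfl

/-- The restriction of a map on `M × [0, 1]` to `M × {t}`. -/
def SmoothU.slice {l : ℕ} (G : SmoothU (I.prod (𝓡∂ 1)) (M × unitInterval) l) (t : unitInterval) :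
    SmoothU I M l where
  entry i j := ⟨fun x => G.entry i j (x, t),
    (G.entry i j).contMDiff.comp (contMDiff_id.prodMk contMDiff_const)⟩
  unitary x := G.unitary (x, t)

variable [IsManifold I ∞ M] [CompactSpace M]

lemma SmoothU.eventually_nearOne {l : ℕ} (G : SmoothU (I.prod (𝓡∂ 1)) (M × unitInterval) l)
    (t₀ : unitInterval) :
    ∀ᶠ t in nhds t₀, NearOne ((G.slice t).unit * (G.slice t₀).unit⁻¹).1 := by
  let F : unitInterval → M → Fin l → ℝ := fun t x i =>
    ∑ j, ‖∑ k, G.entry i k (x, t) * (starRingEnd ℂ) (G.entry j k (x, t₀)) -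
      (1 : Matrix (Fin l) (Fin l) ℂ) i j‖
  have hc : ∀ i, Continuous fun z : unitInterval × M => F z.1 z.2 i := by
    intro i
    have h1 : ∀ i k, Continuous fun z : unitInterval × M => G.entry i k (z.2, z.1) := fun i k =>
      (G.entry i k).contMDiff.continuous.comp (by fun_prop)
    have h2 : ∀ i k, Continuous fun z : unitInterval × M =>
        (starRingEnd ℂ) (G.entry i k (z.2, t₀)) := fun i k =>
      Complex.continuous_conj.comp ((G.entry i k).contMDiff.continuous.comp (by fun_prop))
    refine continuous_finsetSum _ fun j _ => ((continuous_finsetSum _ fun k _ =>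
      (h1 i k).mul (h2 j k)).sub continuous_const).norm
  have h0 : ∀ x i, F t₀ x i = 0 := by
    intro x i
    refine Finset.sum_eq_zero fun j _ => ?_
    have h := congrArg (fun A : Matrix (Fin l) (Fin l) ℂ => A i j)
      (Matrix.mem_unitaryGroup_iff.mp (G.unitary (x, t₀)))
    have h' : ∑ k, G.entry i k (x, t₀) * (starRingEnd ℂ) (G.entry j k (x, t₀)) =
      (1 : Matrix (Fin l) (Fin l) ℂ) i j := h
    rw [h', sub_self, norm_zero]
  have h1 : ∀ᶠ t in nhds t₀, ∀ x ∈ (Set.univ : Set M), ∀ i, F t x i < 1 := by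
    refine isCompact_univ.eventually_forall_of_forall_eventually fun x _ => ?_
    refine Filter.eventually_all.mpr fun i => ?_
    refine (hc i).continuousAt.eventually_lt continuousAt_const ?_
    change F t₀ x i < 1
    rw [h0]
    exact one_pos
  filter_upwards [h1] with t ht x i
  refine lt_of_le_of_lt (le_of_eq ?_) (ht x (Set.mem_univ x) i)
  refine Finset.sum_congr rfl fun j _ => ?_
  congr 2
  exact sum_cfun_apply Finset.univ
    (fun k => (G.slice t).entry i k * conjC ((G.slice t₀).entry j k)) x

theorem SmoothU.Homotopic.chE_sub_mem {l : ℕ} {g₀ g₁ : SmoothU I M l} (h : g₀.Homotopic g₁) :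
    chE (OmegaT I M) g₁.unit - chE (OmegaT I M) g₀.unit ∈ bdry (OmegaT I M) := by
  obtain ⟨G, hG⟩ := h
  obtain rfl : G.slice 0 = g₀ := SmoothU.ext_of_eval fun x => (hG x).1
  obtain rfl : G.slice 1 = g₁ := SmoothU.ext_of_eval fun x => (hG x).2
  set N := nullSubgroup (OmegaT I M) (Fin l)
  have hl : IsLocallyConstant fun t : unitInterval =>
      (G.slice t).unit * (G.slice 0).unit⁻¹ ∈ N := by
    refine (IsLocallyConstant.iff_eventually_eq _).mpr fun t₀ => ?_
    filter_upwards [G.eventually_nearOne t₀] with t ht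
    have h1 := ht.mem_nullSubgroup
    have h2 : (G.slice t).unit * (G.slice 0).unit⁻¹ =
        ((G.slice t).unit * (G.slice t₀).unit⁻¹) * ((G.slice t₀).unit * (G.slice 0).unit⁻¹) := by
      group
    rw [h2]
    exact propext (N.mul_mem_cancel_left h1)
  have h0 := hl.apply_eq_of_preconnectedSpace 1 0
  rw [chE_sub_mem_iff]
  refine h0.mpr ?_
  rw [mul_inv_cancel]
  exact one_mem _

end Unitary

section OddChernCharacter

variable {E : Type*} [NormedAddCommGroup E] [NormedSpace ℝ E] [FiniteDimensional ℝ E]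
  {H : Type*} [TopologicalSpace H] {I : ModelWithCorners ℝ E H}
  {M : Type*} [TopologicalSpace M] [ChartedSpace H M] [IsManifold I ∞ M]

attribute [local instance] dgRing dgAlgebra

lemma SmoothU.mcM_unit {l : ℕ} (g : SmoothU I M l) (i j : Fin l) :
    mcM (OmegaT I M) g.unit i j = (g.mc i j, 0) := by
  have h : ∀ f f' : CFun I M, mulT (funT I M f) (dT (funT I M f')) =
      (wedgeF (ofFun I M f) (extDF (ofFun I M f')), 0) := by
    intro f f'
    refine Prod.ext ?_ ?_
    · change wedgeF (ofFun I M f) (extDF (ofFun I M f') + 0) = _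
      rw [add_zero]
    · change wedgeF 0 _ + wedgeF _ (-extDF 0) = 0
      rw [map_zero, map_zero, neg_zero, map_zero, LinearMap.zero_apply, add_zero]
  change ∑ k, mulT (funT I M (conjC (g.entry k i))) (dT (funT I M (g.entry k j))) = _
  simp only [h]
  refine Prod.ext ?_ ?_
  · rw [Prod.fst_sum]
    rfl
  · rw [Prod.snd_sum]
    exact Finset.sum_const_zero

lemma SmoothU.calA_eq {l : ℕ} (g : SmoothU I M l) (s : ℝ) :
    g.calA s = conA (0 + (s : ℂ) • mcM (OmegaT I M) g.unit) := by
  have hα : ∀ i j, ((s : ℂ) • mcM (OmegaT I M) g.unit) i j = ((s : ℂ) • g.mc i j, 0) := by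
    intro i j
    rw [Matrix.smul_apply, g.mcM_unit, Prod.smul_mk, smul_zero]
  rw [zero_add]
  ext1 i j
  set α := (s : ℂ) • mcM (OmegaT I M) g.unit with hα'
  change g.calA s i j = α i j - mulT (thetaT I M) (dT (α i j) + ∑ k, mulT (α i k) (α k j))
  rw [thetaT_mulT]
  refine Prod.ext ?_ ?_
  · change (s : ℂ) • g.mc i j = (α i j).1 - 0
    rw [hα, sub_zero]
  · change -((s : ℂ) • extDF (g.mc i j) + ∑ k, wedgeF ((s : ℂ) • g.mc i k) ((s : ℂ) • g.mc k j)) =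
      (α i j).2 - ((extDF (α i j).1 + (α i j).2) + (∑ k, mulT (α i k) (α k j)).1)
    rw [Prod.fst_sum]
    simp only [hα, mulT_fst, map_smul]
    rw [add_zero, zero_sub]

lemma SmoothU.calB_eq {l : ℕ} (g : SmoothU I M l) :
    g.calB = conB (mcM (OmegaT I M) g.unit) := by
  ext1 i j
  change g.calB i j = -mulT (thetaT I M) (mcM (OmegaT I M) g.unit i j)
  rw [thetaT_mulT, g.mcM_unit]
  exact Prod.ext neg_zero.symm rfl

lemma single_trN {Ω : Type*} [AddCommGroup Ω] [Module ℂ Ω] [TopologicalSpace Ω] [DGData Ω] {l n : ℕ}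
    (V : Fin (n + 1) → Matrix (Fin l) (Fin l) Ω) : single Ω n (trN V) = W n V := by
  rw [trN, map_sum, W_apply]
  rfl

lemma SmoothU.single_integrand {l : ℕ} (g : SmoothU I M l) (n : ℕ) (s : ℝ) :
    single (OmegaT I M) n (g.integrand n s) =
      insW n 1 (conA (0 + (s : ℂ) • mcM (OmegaT I M) g.unit)) (conB (mcM (OmegaT I M) g.unit)) := by
  rw [SmoothU.integrand, map_sum, insW, mixW]
  refine Finset.sum_congr rfl fun k _ => ?_
  rw [single_trN, SmoothU.factors, ← g.calA_eq, ← g.calB_eq]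
  congr 2
  funext j
  rw [word]
  rcases lt_trichotomy j.val k.val with h | h | h
  · rw [if_pos h, if_neg fun e => h.ne (congrArg _ e)]
  · rw [if_neg h.not_lt, if_pos h, if_pos (Fin.ext h)]
  · rw [if_neg h.le.not_gt, if_neg h.ne', if_neg fun e => h.ne' (congrArg _ e)]

variable [CompactSpace M]

lemma SmoothU.single_chN {l : ℕ} (g : SmoothU I M l) (n : ℕ) :
    single (OmegaT I M) n (g.chN n) = chainCS 0 (mcM (OmegaT I M) g.unit) n := by
  refine ((g.isIntegral_chN n).map (single (OmegaT I M) n)).unique ?_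
  simp only [g.single_integrand]
  exact isIntegral_chainCS _ _ n

lemma SmoothU.chTerm_eq {l : ℕ} (g : SmoothU I M l) :
    g.chTerm = fun n => incl (chainCS 0 (mcM (OmegaT I M) g.unit) n) :=
  funext fun n => congrArg incl (g.single_chN n)

lemma SmoothU.summable_chTerm {l : ℕ} (g : SmoothU I M l) : Summable g.chTerm := by
  rw [g.chTerm_eq]
  exact (entire_chainCS _ _).summable

lemma SmoothU.ch_eq {l : ℕ} (g : SmoothU I M l) : g.ch = chE (OmegaT I M) g.unit := by
  rw [SmoothU.ch, g.chTerm_eq]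
  rfl

lemma SmoothU.ch_mem_odd {l : ℕ} (g : SmoothU I M l) : g.ch ∈ oddChains (OmegaT I M) := by
  rw [g.ch_eq]
  exact chE_mem_odd _

lemma SmoothU.bBN_ch {l : ℕ} (g : SmoothU I M l) : bBN (smoothFun I M) g.ch = 0 := by
  rw [g.ch_eq]
  exact (Submodule.Quotient.mk_eq_zero _).mpr (bB_chE_mem _)

lemma SmoothU.ch_directSum {l m : ℕ} (g : SmoothU I M l) (h : SmoothU I M m) :
    (g.directSum h).ch = g.ch + h.ch := by
  rw [g.ch_eq, h.ch_eq, SmoothU.ch_eq]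
  exact chE_blockDiag finSumFinEquiv g.unit h.unit _ rfl

lemma SmoothU.ch_one (l : ℕ) : (SmoothU.one I M l).ch ∈ bdry (OmegaT I M) := by
  rw [SmoothU.ch_eq, ← mem_nullSubgroup]
  rw [show (SmoothU.one I M l).unit = 1 from Units.ext rfl]
  exact one_mem _

lemma fnRange_omegaT : fnRange (OmegaT I M) = smoothFun I M := rfl

lemma exists_of_mem_bdry_omegaT {w : EChain (OmegaT I M)} (hw : w ∈ bdry (OmegaT I M)) :
    ∃ v ∈ evenChains (OmegaT I M),
      (chenClosure (smoothFun I M)).mkQ w = bBN (smoothFun I M) v := by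
  rw [← fnRange_omegaT]
  exact exists_of_mem_bdry hw

lemma SmoothU.Homotopic.exists_boundary {l : ℕ} {g₀ g₁ : SmoothU I M l} (h : g₀.Homotopic g₁) :
    ∃ w ∈ evenChains (OmegaT I M),
      (chenClosure (smoothFun I M)).mkQ (g₁.ch - g₀.ch) = bBN (smoothFun I M) w := by
  rw [g₀.ch_eq, g₁.ch_eq]
  exact exists_of_mem_bdry_omegaT h.chE_sub_mem

/-- The odd Chern character as an odd cycle of the Chen normalized complex. -/
def SmoothU.chCycle {l : ℕ} (g : SmoothU I M l) : oddCycles (smoothFun I M) :=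
  ⟨(chenClosure (smoothFun I M)).mkQ g.ch, g.ch, ⟨g.ch_mem_odd, g.bBN_ch⟩, rfl⟩

/-- The class of the odd Chern character. -/
def SmoothU.chClass {l : ℕ} (g : SmoothU I M l) : HNOdd (smoothFun I M) :=
  Submodule.Quotient.mk g.chCycle

lemma SmoothU.chClass_directSum {l m : ℕ} (g : SmoothU I M l) (h : SmoothU I M m) :
    (g.directSum h).chClass = g.chClass + h.chClass := by
  have e : (g.directSum h).chCycle = g.chCycle + h.chCycle := by
    refine Subtype.ext ?_
    change (chenClosure (smoothFun I M)).mkQ _ =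
      (chenClosure (smoothFun I M)).mkQ _ + (chenClosure (smoothFun I M)).mkQ _
    rw [← map_add, g.ch_directSum h]
  rw [SmoothU.chClass, e]
  rfl

lemma SmoothU.Homotopic.chClass_eq {l : ℕ} {g₀ g₁ : SmoothU I M l} (h : g₀.Homotopic g₁) :
    g₁.chClass = g₀.chClass := by
  refine (Submodule.Quotient.eq _).mpr ?_
  obtain ⟨w, hw, e⟩ := h.exists_boundary
  refine ⟨w, hw, ?_⟩
  rw [← e, map_sub]
  rfl

lemma SmoothU.chClass_one (l : ℕ) : (SmoothU.one I M l).chClass = 0 := by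
  refine (Submodule.Quotient.mk_eq_zero _).mpr ?_
  obtain ⟨w, hw, e⟩ := exists_of_mem_bdry_omegaT (SmoothU.ch_one (I := I) (M := M) l)
  exact ⟨w, hw, e.symm⟩

variable (I M) in
/-- The odd Chern character on the free group generated by the smooth maps to unitary groups. -/
def chFree : FreeAbelianGroup (Σ l, SmoothU I M l) →+ HNOdd (smoothFun I M) :=
  FreeAbelianGroup.lift fun g => g.2.chClass

lemma chFree_of {l : ℕ} (g : SmoothU I M l) : chFree I M (.of ⟨l, g⟩) = g.chClass :=
  FreeAbelianGroup.lift_apply_of _ _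

lemma map_sub_eq_zero_of_eq {A B : Type*} [AddCommGroup A] [AddCommGroup B] (f : A →+ B) {a b : A}
    (h : f a = f b) : f (a - b) = 0 := by
  rw [map_sub, h, sub_self]

lemma kRel_subset_ker : AddSubgroup.closure (kRel I M) ≤ (chFree I M).ker := by
  refine (AddSubgroup.closure_le _).mpr ?_
  rintro z ((⟨l, m, g, h, rfl⟩ | ⟨l, g₀, g₁, h, rfl⟩) | ⟨l, rfl⟩)
  · rw [sub_sub]
    refine map_sub_eq_zero_of_eq _ ?_
    refine (chFree_of _).trans ((g.chClass_directSum h).trans ?_)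
    exact ((map_add (chFree I M) _ _).trans (congrArg₂ _ (chFree_of g) (chFree_of h))).symm
  · exact map_sub_eq_zero_of_eq _ ((chFree_of _).trans (h.chClass_eq.trans (chFree_of _).symm))
  · exact (chFree_of _).trans (SmoothU.chClass_one l)

variable (I M) in
/-- The odd Chern character on `K⁻¹(M)`. -/
def chK : KMinusOne I M →+ HNOdd (smoothFun I M) :=
  QuotientAddGroup.lift _ (chFree I M) kRel_subset_ker

lemma chK_kClass {l : ℕ} (g : SmoothU I M l) : chK I M g.kClass = g.chClass :=
  (QuotientAddGroup.lift_mk _ _ _).trans (chFree_of g)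

end OddChernCharacter

end OddChern

end

theorem theorem1 {E : Type*} [NormedAddCommGroup E] [NormedSpace ℝ E] [FiniteDimensional ℝ E]
    {H : Type*} [TopologicalSpace H] (I : ModelWithCorners ℝ E H)
    (M : Type*) [TopologicalSpace M] [ChartedSpace H M] [IsManifold I ∞ M]
    [T2Space M] [CompactSpace M] :
    (∀ (l : ℕ) (g : SmoothU I M l),
      Summable g.chTerm ∧
      g.ch ∈ oddChains (OmegaT I M) ∧
      bBN (smoothFun I M) g.ch = 0) ∧
    (∀ (l m : ℕ) (g : SmoothU I M l) (h : SmoothU I M m), (g.directSum h).ch = g.ch + h.ch) ∧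
    (∀ (l : ℕ) (g₀ g₁ : SmoothU I M l), g₀.Homotopic g₁ →
      ∃ w ∈ evenChains (OmegaT I M),
        (chenClosure (smoothFun I M)).mkQ (g₁.ch - g₀.ch) = bBN (smoothFun I M) w) ∧
    ∃ Φ : KMinusOne I M →+ HNOdd (smoothFun I M),
      ∀ (l : ℕ) (g : SmoothU I M l),
        ∃ hg : (chenClosure (smoothFun I M)).mkQ g.ch ∈ oddCycles (smoothFun I M),
          Φ g.kClass = Submodule.Quotient.mk ⟨(chenClosure (smoothFun I M)).mkQ g.ch, hg⟩ :=
  ⟨fun _ g => ⟨g.summable_chTerm, g.ch_mem_odd, g.bBN_ch⟩, fun _ _ g h => g.ch_directSum h,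
    fun _ _ _ h => h.exists_boundary,
    chK I M, fun _ g => ⟨g.chCycle.2, chK_kClass g⟩⟩
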